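/- **Setting.** Consider the following phase-encoding decoy-state BB84 protocol with $N=M N_{\mathrm{block}}$ double pulses, sent in $N_{\mathrm{block}}\ge 1$ blocks of $M$. *Source.* For each pulse $i$, Alice chooses an intensity label $\omega\in\{S,D,V\}$, a basis $\alpha\in\{Z,X\}$ and a bit $a$ with probabilities $p_\omega,p_\alpha,p_a=\frac12$, records $(\omega,\alpha,a)$ in a register $A_i^{\rm CR}$, and emits, averaged over uniform $\delta\in[0,2\pi)$, the two-mode coherent state $|e^{\mathrm i(\delta+\theta_{a,\alpha})}\sqrt{\mu_\omega/2}\rangle\otimes|e^{\mathrm i\delta}\sqrt{\mu_\omega/2}\rangle$, where $\theta_{0,Z}=0$, $\theta_{1,Z}=\pi$, $\theta_{0,X}=\frac\pi2$, $\theta_{1,X}=\frac{3\pi}2$. *Bob.* For each pulse Bob receives two bosonic systems (over an arbitrary set of optical modes), chooses $\beta\in\{Z,X\}$ with probability $p_\beta$ and measures with the interferometer: $50\%$ loss on each system, phase shift $\theta_\beta$ on the first ($\theta_Z=\frac\pi2$, $\theta_X=\pi$), the beam splitter $e^{\mathrm i\frac\pi4\sum_k(a^\dagger_{1,k}a_{2,k}+a_{1,k}a^\dagger_{2,k})}$,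 and two identical threshold detectors with efficiency $\eta_{\det}$ and dark count probability $p_{\rm dark}$. The outcome is the bit of the detector that clicks, a uniformly random bit if both click, and "No click" if neither does. *Eve and announcements.* Eve, with an arbitrary memory $E$ and arbitrary CPTP maps, turns Alice's $N$ signals into Bob's inputs block by block. After each block Bob announces for each pulse $\beta$, whether he has a click, and his outcome if $\beta=X$; then Alice announces, if there was a click and $\alpha=\beta$, also $\omega,\alpha$ and, if $\alpha=X$, her bit. Eve's next map may depend on this, and Eve acts once more after the announcements on the last block. *Key generation.* The bits of the $N_{\rm sift}$ pulses with a click and $\alpha=\beta=Z$ form the sifted keys, stored with their length in $A_{\rm sift}$, $B_{\rm sift}$; all other data are discarded. The final length is $N_{\rm sift}-N_{\rm PA}-N_{\rm EC}-N_{\rm verify}$, where $N_{\rm PA}$ is a given function of the numbers, for each $\omega$, of sifted pulses and of $X$-basis bit errors, $N_{\rm EC}$ is a given function of $N_{\rm sift}$ and $N_{\rm verify}$ is a constant; if it is not positive, the protocol is aborted. Otherwise Alice announces the syndrome $\vec k_A\mathcal C_{\rm synd}$ and Bob adds to his key an error string that is a given function of the syndrome; with a uniform public seed, both compute hash values $\vec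 k\,\mathcal C_{\rm verify}$, Alice announces hers, Bob announces whether they agree, and the protocol is aborted if they do not; with a uniform public seed, both replace their key $\vec k$ by $\vec k\,\mathcal C_{\rm PA}$. The binary matrices (depending on the lengths and, for the last two, on the seed) have linearly independent columns. An abort replaces both keys by the empty key of length $0$. Finally Eve applies an arbitrary CPTP map to $E$ and the public registers (syndrome, final length, abort flag, hash seed and value, result of the comparison, privacy amplification seed). The resulting state of $A_{\rm sift}B_{\rm sift}E$ is $\hat\rho_{\rm PA}$. Let $\hat E_n$ project $A_{\rm sift}$ onto key length $n$, $\Pr_{\rm PA}(n)=\operatorname{tr}(\hat E_n\hat\rho_{\rm PA})$, $$\hat\rho^{AE}_{{\rm PA}|n}=\frac{\operatorname{tr}_{B_{\rm sift}}(\hat E_n\hat\rho_{\rm PA})}{\Pr_{\rm PA}(n)},\qquad \hat\rho_{\rm ideal}=\sum_n\Big(2^{-n}\sum_{\vec k\in\{0,1\}^n}|n,\vec k\rangle\langle n,\vec k|_{A_{\rm sift}}\otimes|n,\vec k\rangle\langle n,\vec k|_{B_{\rm sift}}\Big)\otimes\operatorname{tr}_{A_{\rm sift}B_{\rm sift}}(\hat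 E_n\hat\rho_{\rm PA}),$$ and $\hat\rho^{AE}_{{\rm ideal}|n}=\operatorname{tr}_{B_{\rm sift}}(\hat E_n\hat\rho_{\rm ideal})/\Pr_{\rm PA}(n)$. **Virtual protocol.** With the same maps of Eve and the same announcements, change the following. 1. The source of each pulse is the pure state $\sum_{\omega,\alpha,a}\sqrt{p_ap_\omega p_\alpha}\,|\omega,\alpha,a\rangle_{A^{\rm CR}}\sum_{n\ge0}\sqrt{e^{-\mu_\omega}\mu_\omega^n/n!}\,|n\rangle_R|\psi_{n,\theta_{a,\alpha}}\rangle$, where $|\psi_{n,\theta}\rangle=\sum_{k=0}^n\sqrt{2^{-n}\binom nk}\,e^{\mathrm i\theta(n-k)}|n-k\rangle|k\rangle$. 2. Bob first applies a *squashing map* $\mathcal S$ to each pulse. This is a CPTP map to $\mathbb C^2\oplus\mathbb C|{\rm Noclick}\rangle$ such that, for every input state $\hat\rho$, $\mathcal S(\hat\rho)$ has no coherence between $\mathbb C^2$ and $|{\rm Noclick}\rangle$ and, for each $\beta$ with $p_\beta\neq0$, Bob's outcomes have probabilities $\langle{\rm Noclick}|\mathcal S(\hat\rho)|{\rm Noclick}\rangle$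 for "No click" and $\operatorname{tr}\big(\frac{I_2+(-1)^b\sigma_\beta}2\mathcal S(\hat\rho)\big)$ for $b\in\{0,1\}$. Here $I_2$, $\sigma_\beta$ are the identity and the Pauli operator of the qubit. He then tests for $|{\rm Noclick}\rangle$; if there is a click, for $\beta=X$ he measures the qubit in the $X$ basis and stores the outcome, and for $\beta=Z$ he keeps the qubit unmeasured. 3. Sifting moves the sifted qubits coherently to $A_{\rm sift}$, $B_{\rm sift}$. Let $\tilde{\mathcal C}_{\rm synd}$, $\tilde{\mathcal C}_{\rm verify}$, $\tilde{\mathcal C}_{\rm PA}$ be any invertible square completions of the above matrices, which form their first, first and last columns, respectively, and let $U(\tilde{\mathcal C})|\vec z\rangle=|\vec z\,\tilde{\mathcal C}\rangle$. Error correction: Alice applies $U(\tilde{\mathcal C}_{\rm synd})$, measures the first $N_{\rm EC}$ qubits in the $Z$ basis, announces the result as the syndrome, and applies $U(\tilde{\mathcal C}_{\rm synd})^\dagger$; Bob applies the corresponding bit flips. Verification: both apply $U(\tilde{\mathcal C}_{\rm verify})$, measure the first $N_{\rm verify}$ qubits in the $Z$ basis (the hash values, announced and compared as before) and apply $U(\tilde{\mathcal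 C}_{\rm verify})^\dagger$. Privacy amplification to length $n$: both apply $U(\tilde{\mathcal C}_{\rm PA})$; Alice measures her first $N_{\rm sift}-n$ qubits and Bob all of his qubits in the $X$ basis; Alice applies to $A_{\rm sift}$ a tensor product of Pauli $Z$ and identity operators that is any given function of these outcomes, the lengths and the seed; her first $N_{\rm sift}-n$ qubits, $B_{\rm sift}$ and the $X$ outcomes are traced out. Aborts are as before. 4. After Eve's final map, all systems $R$ are traced out. The resulting state of $A_{\rm sift}E$ is $\hat\rho_{\rm PA,vir}$. Let $\hat\rho^{\rm PA,vir}_{|n}=\hat E_n\hat\rho_{\rm PA,vir}\hat E_n/\Pr_{\rm PA}(n)$, let $\mathcal E^Z_{A_{\rm sift}}(\hat\rho)=\sum_{n,\vec a}|n,\vec a\rangle\langle n,\vec a|\hat\rho|n,\vec a\rangle\langle n,\vec a|$ be the $Z$-basis measurement of $A_{\rm sift}$, and let $$\hat\rho^{\rm ideal,vir}_{|n}=|n,+^n\rangle\langle n,+^n|_{A_{\rm sift}}\otimes\operatorname{tr}_{A_{\rm sift}}\hat\rho^{AE}_{{\rm PA}|n},\qquad|n,+^n\rangle=2^{-n/2}\sum_{\vec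 k\in\{0,1\}^n}|n,\vec k\rangle .$$ **Proposition.** A squashing map for Bob's measurement exists. For every such map, every strategy of Eve, all choices above, and every key length $n\in\{0,\dots,N\}$ (where conditional states of a length of probability $0$ are read as $0$), $$\mathcal E^Z_{A_{\rm sift}}\big(\hat\rho^{\rm PA,vir}_{|n}\big)=\hat\rho^{AE}_{{\rm PA}|n}\qquad\text{and}\qquad\mathcal E^Z_{A_{\rm sift}}\big(\hat\rho^{\rm ideal,vir}_{|n}\big)=\hat\rho^{AE}_{{\rm ideal}|n}.$$ -/

import Mathlib

open scoped Classical ComplexConjugate ComplexOrder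

universe u v w

noncomputable section

namespace QKD

/-! ### Systems, operators and channels

A system is given by the set `ι` of labels of an orthonormal basis; its Hilbert space is `ℓ²(ι)`.
Composite systems are products of label sets.  An operator is given by its matrix elements
`⟨x| ρ |y⟩ = ρ x y`, also when the label set is infinite (infinite sums are `tsum`s). -/

abbrev Op (ι : Type*) := Matrix ι ι ℂ

/-- `|x⟩⟨y|` -/
def ketBra {κ ι : Type*} (x : κ) (y : ι) : Matrix κ ι ℂ :=
  fun a b => if a = x ∧ b = y then 1 else 0

/-- Density operators: positive semidefinite, trace one. -/
def IsState {ι : Type*} (ρ : Op ι) : Prop :=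
  ρ.PosSemidef ∧ HasSum (fun i => ρ i i) 1

/-- `∑ₖ Kₖ ρ Kₖ†` -/
def krausMap {e κ ι : Type*} (K : e → Matrix κ ι ℂ) (ρ : Op ι) : Op κ :=
  fun x y => ∑' k, ∑' a, ∑' b, K k x a * ρ a b * conj (K k y b)

/-- `∑ₖ (Kₖ ⊗ 1) ρ (Kₖ ⊗ 1)†`, with identity on the spectator system `σ`. -/
def act {e κ ι σ : Type*} (K : e → Matrix κ ι ℂ) (ρ : Op (ι × σ)) : Op (κ × σ) :=
  fun x y => ∑' k, ∑' a, ∑' b, K k x.1 a * ρ (a, x.2) (b, y.2) * conj (K k y.1 b)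

/-- `act` between composite systems `I` and `O` in which the subsystem acted on is singled out by
the rearrangements of tensor factors `inp` and `out`. -/
def actOn {e κ ι σ I O : Type*} (K : e → Matrix κ ι ℂ) (inp : ι × σ → I) (out : O → κ × σ)
    (ρ : Op I) : Op O :=
  (act K (ρ.submatrix inp inp)).submatrix out out

/-- `∑ₖ Kₖ† E Kₖ`, the adjoint (Heisenberg picture) of `krausMap`. -/
def heis {e κ ι : Type*} (K : e → Matrix κ ι ℂ) (E : Op κ) : Op ι :=
  fun a b => ∑' k, ∑' x, ∑' y, conj (K k x a) * E x y * K k y b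

/-- Product of operators. -/
def mulOp {ι : Type*} (A B : Op ι) : Op ι := fun a b => ∑' c, A a c * B c b

/-- `tr (E ρ)` -/
def trMul {ι : Type*} (E ρ : Op ι) : ℂ := ∑' a, ∑' b, E a b * ρ b a

/-- `A ⊗ B` -/
def tens {κ ι κ' ι' : Type*} (A : Matrix κ ι ℂ) (B : Matrix κ' ι' ℂ) :
    Matrix (κ × κ') (ι × ι') ℂ :=
  fun x y => A x.1 y.1 * B x.2 y.2

/-- A CPTP map from `ℓ²(ι)` to `ℓ²(κ)` in Kraus form; `∑ₖ Kₖ† Kₖ = 1` is expressed by matrix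
elements. -/
structure Channel (ι : Type v) (κ : Type w) where
  Env : Type u
  K : Env → Matrix κ ι ℂ
  complete : ∀ a b : ι,
    HasSum (fun p : Env × κ => conj (K p.1 p.2 a) * K p.1 p.2 b) (if a = b then 1 else 0)

/-! ### Labels of the classical registers -/

/-- The intensity labels `S`, `D`, `V`. -/
inductive Intensity
  | S
  | D
  | V
deriving DecidableEq

instance : Fintype Intensity :=
  ⟨{Intensity.S, Intensity.D, Intensity.V}, by intro x; cases x <;> simp⟩

/-- The bases `Z`, `X`. -/
inductive Basis
  | Z
  | X
deriving DecidableEq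

instance : Fintype Basis := ⟨{Basis.Z, Basis.X}, by intro x; cases x <;> simp⟩

abbrev Bit := ZMod 2

/-- `A_i^CR`: intensity, basis, bit. -/
abbrev ACR := Intensity × Basis × Bit

/-- `B_i^CR`: basis and outcome, where `none` is `Noclick`. -/
abbrev BCR := Basis × Option Bit

/-- Bob's announcement on one pulse: basis, click (`true`) or not, outcome or null. -/
abbrev BobAnn := Basis × Bool × Option Bit

/-- Alice's announcement on one pulse: intensity, basis, bit, or nulls. -/
abbrev AliceAnn := Option Intensity × Option Basis × Option Bit

/-- Number of double pulses, in `L + 1` blocks of `M` double pulses. -/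
abbrev numPulses (L M : ℕ) : ℕ := (L + 1) * M

/-- Bit strings of a length between `0` and `N`, together with their length. -/
abbrev Key (N : ℕ) := Σ n : Fin (N + 1), (Fin n.val → Bit)

/-- `|0, null⟩` -/
def nullKey (N : ℕ) : Key N := ⟨0, fun _ => 0⟩

/-- The first `l` entries. -/
def firstBits {n : ℕ} (l : ℕ) (a : Fin n → Bit) : Fin l → Bit :=
  fun k => if h : k.val < n then a ⟨k.val, h⟩ else 0

/-- The last `m` entries. -/
def lastBits {n : ℕ} (m : ℕ) (a : Fin n → Bit) : Fin m → Bit :=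
  fun k => if h : n - m + k.val < n then a ⟨n - m + k.val, h⟩ else 0

/-- `(-1)^(z·x)` -/
def signOf {n : ℕ} (z x : Fin n → Bit) : ℂ := (-1) ^ (z ⬝ᵥ x).val

/-! ### The data of the actual protocol -/

/-- All constants and classical functions fixed before the actual protocol starts. -/
structure Params (L M : ℕ) where
  /-- intensity probabilities -/
  pInt : Intensity → ℝ
  pInt_nonneg : ∀ ω, 0 ≤ pInt ω
  pInt_sum : ∑ ω, pInt ω = 1
  /-- intensities of the double pulses -/
  mu : Intensity → ℝ
  mu_nonneg : ∀ ω, 0 ≤ mu ω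
  /-- Alice's basis probabilities -/
  pA : Basis → ℝ
  pA_nonneg : ∀ α, 0 ≤ pA α
  pA_sum : ∑ α, pA α = 1
  /-- Bob's basis probabilities -/
  pB : Basis → ℝ
  pB_nonneg : ∀ β, 0 ≤ pB β
  pB_sum : ∑ β, pB β = 1
  /-- dark count probability -/
  pDark : ℝ
  pDark_mem : pDark ∈ Set.Icc (0 : ℝ) 1
  /-- detection efficiency -/
  etaDet : ℝ
  etaDet_mem : etaDet ∈ Set.Icc (0 : ℝ) 1
  /-- `N_PA` as a function of the observed numbers `(N_ω^sift)_ω` and `(N_{ω,X}^Error)_ω` -/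
  NPA : (Intensity → ℕ) → (Intensity → ℕ) → ℕ
  /-- syndrome length for a sifted key of length `n` -/
  NEC : ℕ → ℕ
  /-- parity check matrices -/
  Csynd : ∀ n, Matrix (Fin n) (Fin (NEC n)) Bit
  Csynd_indep : ∀ n, NEC n ≤ n → n ≤ numPulses L M →
    LinearIndependent Bit (fun (k : Fin (NEC n)) (i : Fin n) => Csynd n i k)
  /-- error vector found by Bob from a syndrome -/
  fEC : ∀ n, (Fin (NEC n) → Bit) → (Fin n → Bit)
  /-- length of the hash value in error verification -/
  Nverify : ℕ
  /-- length of the random seed in error verification -/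
  hVerify : ℕ
  /-- hash functions of error verification -/
  Cverify : ∀ n, (Fin hVerify → Bit) → Matrix (Fin n) (Fin Nverify) Bit
  Cverify_surj : ∀ n r, Nverify ≤ n → n ≤ numPulses L M →
    Function.Surjective (fun k : Fin n → Bit => Matrix.vecMul k (Cverify n r))
  /-- length of the random seed in privacy amplification -/
  hPA : ℕ
  /-- hash functions of privacy amplification, from `n` to `m` bits -/
  CPA : ∀ n m : ℕ, (Fin hPA → Bit) → Matrix (Fin n) (Fin m) Bit
  CPA_surj : ∀ n m r, m ≤ n → n ≤ numPulses L M →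
    Function.Surjective (fun k : Fin n → Bit => Matrix.vecMul k (CPA n m r))

/-! ### Alice's source -/

/-- The relative phases `θ_{a,α}`. -/
def theta (a : Bit) : Basis → ℝ
  | Basis.Z => if a = 0 then 0 else Real.pi
  | Basis.X => if a = 0 then Real.pi / 2 else 3 * Real.pi / 2

/-- Photon number amplitudes of the coherent state `|e^{iφ} √μ⟩`. -/
def coherentAmp (μ φ : ℝ) (k : ℕ) : ℂ :=
  (Real.exp (-μ / 2) : ℂ) * (Complex.exp (Complex.I * φ) * (Real.sqrt μ : ℂ)) ^ k /
    (Real.sqrt (k.factorial : ℝ) : ℂ)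

/-- The phase randomized double pulse `ρ(θ, μ)` on two modes labelled by photon numbers. -/
def pulseState (θ μ : ℝ) : Op (ℕ × ℕ) := fun s t =>
  (1 / (2 * Real.pi) : ℂ) * ∫ δ in (0 : ℝ)..(2 * Real.pi),
    (coherentAmp (μ / 2) (δ + θ) s.1 * coherentAmp (μ / 2) δ s.2) *
      conj (coherentAmp (μ / 2) (δ + θ) t.1 * coherentAmp (μ / 2) δ t.2)

/-- `∑ₙ Nₙ ρ(θ, μ) Nₙ`, with `Nₙ` the projection to `n` photons in the double pulse. -/
def pulseStateByNumber (θ μ : ℝ) : Op (ℕ × ℕ) := fun s t =>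
  ∑' n : ℕ, if s.1 + s.2 = n ∧ t.1 + t.2 = n then pulseState θ μ s t else 0

section Source

variable {L M : ℕ} (P : Params L M)

/-- `p_a p_ω p_α` with `p_a = 1/2`. -/
def probACR (c : ACR) : ℝ := (1 / 2) * P.pInt c.1 * P.pA c.2.1

/-- State of `A_i^CR A_i^sig`. -/
def source1 : Op (ACR × (ℕ × ℕ)) := fun x y =>
  if x.1 = y.1 then
    (probACR P x.1 : ℂ) * pulseStateByNumber (theta x.1.2.2 x.1.2.1) (P.mu x.1.1) x.2 y.2
  else 0

/-- The Poisson probabilities `p^CS_{μ,n}`. -/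
def poissonCS (μ : ℝ) (n : ℕ) : ℝ := μ ^ n / n.factorial * Real.exp (-μ)

/-- The superposition `|ψ_{n,θ}⟩` of the `n`-photon states of a double pulse. -/
def psiAmp (n : ℕ) (θ : ℝ) (s : ℕ × ℕ) : ℂ :=
  if s.1 + s.2 = n then
    (Real.sqrt (1 / 2 ^ n * (n.choose s.2 : ℝ)) : ℂ) * Complex.exp (Complex.I * θ * s.1)
  else 0

/-- Amplitudes of `|Ψ_in,vir⟩` on `A_i^CR`, `R_i`, `A_i^sig`. -/
def sourceVirAmp (c : ACR) (n : ℕ) (s : ℕ × ℕ) : ℂ :=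
  (Real.sqrt (probACR P c) : ℂ) * (Real.sqrt (poissonCS (P.mu c.1) n) : ℂ) *
    psiAmp n (theta c.2.2 c.2.1) s

end Source

/-! ### Bob's measurement -/

/-- Basis labels of the bosonic Fock space over the optical modes `𝒦`. -/
abbrev Fock (𝒦 : Type u) := 𝒦 →₀ ℕ

/-- Labels of `B_i^sig = B_i^sig1 B_i^sig2`. -/
abbrev BSig (𝒦 : Type u) := Fock 𝒦 × Fock 𝒦

/-- `a†_J a_L + a_J a†_L` for one mode on the space of `n` photons in total; the label `j` stands
for `|j⟩_J |n - j⟩_L`. -/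
def hop (n : ℕ) : Matrix (Fin (n + 1)) (Fin (n + 1)) ℂ := fun x j =>
  if x.val = j.val + 1 then (Real.sqrt ((j.val + 1 : ℝ) * (n - j.val : ℝ)) : ℂ)
  else if j.val = x.val + 1 then (Real.sqrt ((j.val : ℝ) * (n - j.val + 1 : ℝ)) : ℂ)
  else 0

/-- `exp (iθ (a†_J a_L + a_J a†_L))` on the space of `n` photons. -/
def beamSplitter1 (θ : ℝ) (n : ℕ) : Matrix (Fin (n + 1)) (Fin (n + 1)) ℂ :=
  NormedSpace.exp ((Complex.I * θ) • hop n)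

section Optics

variable {𝒦 : Type u}

/-- The beam splitter `exp (iθ ∑ₖ (a†_{J,k} a_{L,k} + a_{J,k} a†_{L,k}))`: the product over the
modes, each of which conserves its total photon number in `J` and `L`. -/
def beamSplitter (θ : ℝ) : Op (Fock 𝒦 × Fock 𝒦) := fun x y =>
  if x.1 + x.2 = y.1 + y.2 then
    ∏ k ∈ (y.1 + y.2).support,
      beamSplitter1 θ ((y.1 + y.2) k) (Fin.ofNat _ (x.1 k)) (Fin.ofNat _ (y.1 k))
  else 0

/-- The phase shifter `exp (iθ ∑ₖ a†ₖ aₖ)`. -/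
def phaseShifter (θ : ℝ) : Op (Fock 𝒦) := fun x y =>
  if x = y then Complex.exp (Complex.I * θ * ((x.sum fun _ m => m : ℕ) : ℂ)) else 0

/-- Kraus operators of the channel with transmittance `η`: a beam splitter with a vacuum
environment, which is traced out. -/
def lossKraus (η : ℝ) (r : Fock 𝒦) : Op (Fock 𝒦) := fun x y =>
  beamSplitter (Real.arccos (Real.sqrt η)) (x, r) (y, 0)

/-- Threshold detector with dark counts, click element. -/
def detector1Click (p : ℝ) : Op (Fock 𝒦) := 1 - ((1 - p : ℝ) : ℂ) • ketBra 0 0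

/-- Threshold detector with dark counts and detection efficiency, click element. -/
def detectorClick (p η : ℝ) : Op (Fock 𝒦) := heis (lossKraus η) (detector1Click p)

/-- Bob's phase modulation. -/
def thetaBob : Basis → ℝ
  | Basis.Z => Real.pi / 2
  | Basis.X => Real.pi

variable {L M : ℕ} (P : Params L M)

/-- `E^Click_{β, D^d}`: 50% loss at the first beam splitter, phase shift on the long arm,
interference at the second beam splitter, click of the detector `D^d`. -/
def clickOp (β : Basis) (d : Bit) : Op (BSig 𝒦) :=
  heis (fun r : Fock 𝒦 × Fock 𝒦 => tens (lossKraus (1 / 2) r.1) (lossKraus (1 / 2) r.2))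
    (heis (fun _ : Unit => tens (phaseShifter (thetaBob β)) 1)
      (heis (fun _ : Unit => beamSplitter (Real.pi / 4))
        (if d = 0 then tens (detectorClick P.pDark P.etaDet) 1
          else tens 1 (detectorClick P.pDark P.etaDet))))

/-- `E^Noclick_{β, D^d}` -/
def noclickOp (β : Basis) (d : Bit) : Op (BSig 𝒦) := 1 - clickOp P β d

/-- The POVM `E^meas_b` of Bob's measurement in the basis `β`. -/
def measPOVM (β : Basis) : Option Bit → Op (BSig 𝒦)
  | some b => mulOp (clickOp P β b) (noclickOp P β (b + 1)) +
      (1 / 2 : ℂ) • mulOp (clickOp P β 0) (clickOp P β 1)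
  | none => mulOp (noclickOp P β 0) (noclickOp P β 1)

/-- Bob's measurement `ℰ_i^B` of one pulse. -/
def bobMeas (ρ : Op (BSig 𝒦)) : Op BCR :=
  ∑ β : Basis, ∑ b : Option Bit,
    ((P.pB β : ℂ) * trMul (measPOVM P β b) ρ) • ketBra (β, b) (β, b)

/-- Bob's measurement `⨂ᵢ ℰ_i^B` of one block, with spectator system `σ`. -/
def bobBlock (σ : Type u) (ρ : Op ((Fin M → BSig 𝒦) × σ)) : Op ((Fin M → BCR) × σ) :=
  fun x y =>
    if x.1 = y.1 then
      ∑' a : Fin M → BSig 𝒦, ∑' b : Fin M → BSig 𝒦,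
        (∏ m, (P.pB (x.1 m).1 : ℂ) * measPOVM P (x.1 m).1 (x.1 m).2 (a m) (b m)) *
          ρ (b, x.2) (a, y.2)
    else 0

/-! ### Squashing map and Bob's virtual measurement -/

/-- The identity on the qubit, zero on `Noclick`. -/
def id2 : Op (Option Bit) := fun x y => if x = y ∧ x ≠ none then 1 else 0

/-- The Pauli operators of the qubit, zero on `Noclick`. -/
def pauli : Basis → Op (Option Bit)
  | Basis.Z => ketBra (some 0) (some 0) - ketBra (some 1) (some 1)
  | Basis.X => ketBra (some 0) (some 1) + ketBra (some 1) (some 0)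

/-- `(I₂ + (-1)^b σ_β) / 2` -/
def pauliProj (β : Basis) (b : Bit) : Op (Option Bit) :=
  (1 / 2 : ℂ) • (id2 + ((-1 : ℂ) ^ b.val) • pauli β)

/-- `S` is a squashing map for Bob's measurement: a CPTP map whose output has no coherence between
the qubit and `Noclick`, and whose output, tested for `Noclick` and otherwise measured in the Pauli
basis `β`, reproduces Bob's measurement on every state. -/
def IsSquashing (S : Channel.{u} (BSig 𝒦) (Option Bit)) : Prop :=
  ∀ ρ : Op (BSig 𝒦), IsState ρ →
    (∀ b : Bit, krausMap S.K ρ (some b) none = 0 ∧ krausMap S.K ρ none (some b) = 0) ∧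
    bobMeas P ρ =
      (∑ β : Basis, ((P.pB β : ℂ) *
          Matrix.trace (ketBra none none * krausMap S.K ρ)) • ketBra (β, none) (β, none)) +
      ∑ b : Bit, ∑ β : Basis, ((P.pB β : ℂ) *
          Matrix.trace (pauliProj β b * krausMap S.K ρ)) • ketBra (β, some b) (β, some b)

/-- Labels of the branches of Bob's virtual measurement after squashing. -/
inductive VirBranch
  | noclick (β : Basis)
  | clickX (b : Bit)
  | clickZ

/-- Kraus operators of Bob's virtual measurement after squashing.  No click: both bases.  Click,
`X` basis: the bit is measured in the `X` basis and the outcome is stored.  Click, `Z` basis: the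
qubit is kept unmeasured. -/
def virBranchKraus : VirBranch → Matrix BCR (Option Bit) ℂ
  | VirBranch.noclick β => (Real.sqrt (P.pB β) : ℂ) • ketBra (β, none) none
  | VirBranch.clickX b => (Real.sqrt (P.pB Basis.X) : ℂ) •
      ∑ c : Bit, (((-1 : ℂ) ^ (b * c).val) / (Real.sqrt 2 : ℂ)) •
        ketBra (Basis.X, some b) (some c)
  | VirBranch.clickZ => (Real.sqrt (P.pB Basis.Z) : ℂ) •
      ∑ c : Bit, ketBra (Basis.Z, some c) (some c)

/-- Kraus operators of `ℰ_i^{B,vir}`. -/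
def bobVirKraus (S : Channel.{u} (BSig 𝒦) (Option Bit)) (k : VirBranch × S.Env) :
    Matrix BCR (BSig 𝒦) ℂ :=
  virBranchKraus P k.1 * S.K k.2

/-- Bob's virtual measurement `⨂ᵢ ℰ_i^{B,vir}` of one block, with spectator system `σ`. -/
def bobVirBlock (S : Channel.{u} (BSig 𝒦) (Option Bit)) (σ : Type u)
    (ρ : Op ((Fin M → BSig 𝒦) × σ)) : Op ((Fin M → BCR) × σ) :=
  act (fun (k : Fin M → VirBranch × S.Env) x a => ∏ m, bobVirKraus P S (k m) (x m) (a m)) ρ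

end Optics

/-! ### Announcements -/

/-- Bob's announcement. -/
def bobAnn : BCR → BobAnn
  | (β, none) => (β, false, none)
  | (Basis.X, some b) => (Basis.X, true, some b)
  | (Basis.Z, some _) => (Basis.Z, true, none)

/-- Alice's announcement, given Bob's: nothing unless Bob clicked in her basis; otherwise intensity
and basis, and in the `X` basis also the bit. -/
def aliceAnn (c : ACR) (t : BobAnn) : AliceAnn :=
  if t.2.1 = true ∧ c.2.1 = t.1 then
    (some c.1, some c.2.1, if c.2.1 = Basis.X then some c.2.2 else none)
  else (none, none, none)

/-- Registers `B_CR`, `C^{A_B}`, `C^{B_A}` of one block. -/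
abbrev Rec (M : ℕ) := Fin M → BCR × BobAnn × AliceAnn

/-- Registers `C^{E_B}`, `C^{E_A}` of one block. -/
abbrev EveAnn (M : ℕ) := Fin M → BobAnn × AliceAnn

/-- The systems outside Eve's hands after `j` blocks: `A_CR`, `R`, and the records of the blocks. -/
abbrev Rest (L M : ℕ) (R : Type) (j : ℕ) :=
  (Fin (numPulses L M) → ACR) × R × (Fin j → Rec M)

/-- `ℰ^{B,public}` of a block copies Bob's announcements to Alice and to Eve. -/
def bobPublicKraus (M : ℕ) (_ : Unit) :
    Matrix (Fin M → BCR × BobAnn × BobAnn) (Fin M → BCR) ℂ :=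
  fun x y => if ∀ m, x m = (y m, bobAnn (y m), bobAnn (y m)) then 1 else 0

/-- `ℰ^{A,public}` of the block `j` copies Alice's announcements to Bob and to Eve. -/
def alicePublicKraus (L M : ℕ) (j : Fin (L + 1)) (_ : Unit) :
    Matrix ((Fin (numPulses L M) → ACR) × (Fin M → BobAnn × AliceAnn × AliceAnn))
      ((Fin (numPulses L M) → ACR) × (Fin M → BobAnn)) ℂ :=
  fun x y =>
    if x.1 = y.1 ∧ ∀ m, x.2 m =
        (y.2 m, aliceAnn (y.1 (finProdFinEquiv (j, m))) (y.2 m),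
          aliceAnn (y.1 (finProdFinEquiv (j, m))) (y.2 m))
    then 1 else 0

section Communication

variable {L M : ℕ} {ε : Type u} {R : Type}

/-- Bob's and then Alice's announcements on the block number `j` (counted from `0`). -/
def announce (j : ℕ) (ρ : Op ((Fin M → BCR) × (ε × Rest L M R j))) :
    Op ((ε × EveAnn M) × Rest L M R (j + 1)) :=
  actOn (σ := (Fin M → BCR × BobAnn) × ε × R × (Fin j → Rec M))
    (alicePublicKraus L M (Fin.ofNat (L + 1) j))
    (fun p => (fun m => ((p.2.1 m).1, p.1.2 m, (p.2.1 m).2),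
      (p.2.2.1, (p.1.1, p.2.2.2.1, p.2.2.2.2))))
    (fun q => ((q.2.1, fun m => ((q.2.2.2 (Fin.last j) m).2.1, (q.2.2.2 (Fin.last j) m).2.2,
        (q.1.2 m).2)),
      (fun m => ((q.2.2.2 (Fin.last j) m).1, (q.1.2 m).1), q.1.1, q.2.2.1, Fin.init q.2.2.2)))
    (act (bobPublicKraus M) ρ)

end Communication

/-! ### Public registers of key generation and Eve -/

section Registers

variable {L M : ℕ} (P : Params L M)

/-- `C_EC`: the syndrome, or null. -/
abbrev CEC := Option (Σ n : Fin (numPulses L M + 1), (Fin (P.NEC n.val) → Bit))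

/-- `C_A^Hash`: seed and hash value, or null. -/
abbrev CHash := Option ((Fin P.hVerify → Bit) × (Fin P.Nverify → Bit))

/-- `C_PA`: the seed of privacy amplification. -/
abbrev CPASeed := Fin P.hPA → Bit

/-- `C_EC`, `C_Key^Length`, `C_Judge^Length`, `C_A^Hash`, `C_B^HashResult`, `C_PA`. -/
abbrev Pub :=
  CEC P × Fin (numPulses L M + 1) × Bool × CHash P × Option Bool × CPASeed P

/-- A strategy of Eve with memory system `E = ℓ²(ε)`. -/
structure Eve (𝒦 ε : Type u) where
  /-- outputs the first block; any initial state of `E` is part of this channel -/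
  first : Channel.{u} (Fin (numPulses L M) → ℕ × ℕ) ((Fin M → BSig 𝒦) × ε)
  /-- `next j` outputs the block number `j + 1`, counted from `0` -/
  next : ℕ → Channel.{u} (ε × EveAnn M) ((Fin M → BSig 𝒦) × ε)
  /-- after the announcements on the last block -/
  last : Channel.{u} (ε × EveAnn M) ε
  /-- at the end of the protocol -/
  final : Channel.{u} (ε × Pub P) ε

end Registers

section QuantumCommunication

variable {L M : ℕ} {P : Params L M} {𝒦 ε : Type u} (E : Eve P 𝒦 ε) {R : Type}

/-- The state after Eve has output the block number `j` (counted from `0`), for a source state and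
a block measurement of Bob. -/
def beforeBlock
    (bob : ∀ σ : Type u, Op ((Fin M → BSig 𝒦) × σ) → Op ((Fin M → BCR) × σ))
    (source : Op ((Fin (numPulses L M) → ℕ × ℕ) × Rest L M R 0)) :
    ∀ j : ℕ, Op (((Fin M → BSig 𝒦) × ε) × Rest L M R j)
  | 0 => act E.first.K source
  | j + 1 => act (E.next j).K (announce j (bob (ε × Rest L M R j)
      ((beforeBlock bob source j).submatrix
        (fun p : (Fin M → BSig 𝒦) × (ε × Rest L M R j) => ((p.1, p.2.1), p.2.2))
        (fun p : (Fin M → BSig 𝒦) × (ε × Rest L M R j) => ((p.1, p.2.1), p.2.2)))))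

/-- The state at the end of quantum communication and information exchange. -/
def afterQC
    (bob : ∀ σ : Type u, Op ((Fin M → BSig 𝒦) × σ) → Op ((Fin M → BCR) × σ))
    (source : Op ((Fin (numPulses L M) → ℕ × ℕ) × Rest L M R 0)) :
    Op (ε × Rest L M R (L + 1)) :=
  act E.last.K (announce L (bob (ε × Rest L M R L)
    ((beforeBlock E bob source L).submatrix
      (fun p : (Fin M → BSig 𝒦) × (ε × Rest L M R L) => ((p.1, p.2.1), p.2.2))
      (fun p : (Fin M → BSig 𝒦) × (ε × Rest L M R L) => ((p.1, p.2.1), p.2.2)))))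

variable (P)

/-- `ρ_in = ⨂ᵢ ρ_{in,i}` on all `A_i^sig`, `A_i^CR`. -/
def source : Op ((Fin (numPulses L M) → ℕ × ℕ) × Rest L M Unit 0) := fun x y =>
  ∏ i, source1 P (x.2.1 i, x.1 i) (y.2.1 i, y.1 i)

/-- `⨂ᵢ |Ψ_in,vir⟩⟨Ψ_in,vir|` on all `A_i^sig`, `A_i^CR`, `R_i`. -/
def sourceVir :
    Op ((Fin (numPulses L M) → ℕ × ℕ) × Rest L M (Fin (numPulses L M) → ℕ) 0) := fun x y =>
  ∏ i, sourceVirAmp P (x.2.1 i) (x.2.2.1 i) (x.1 i) *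
    conj (sourceVirAmp P (y.2.1 i) (y.2.2.1 i) (y.1 i))

variable {P}

/-- `ρ_QC` -/
def rhoQC : Op (ε × Rest L M Unit (L + 1)) := afterQC E (bobBlock P) (source P)

/-- `ρ_QC,vir` -/
def rhoQCVir (S : Channel.{u} (BSig 𝒦) (Option Bit)) :
    Op (ε × Rest L M (Fin (numPulses L M) → ℕ) (L + 1)) :=
  afterQC E (bobVirBlock P S) (sourceVir P)

end QuantumCommunication

/-! ### Sifting (common to both protocols) -/

section Sift

variable {L M : ℕ}

/-- The data in `A_CR`, `B_CR`, `C_{A_B}`, `C_{B_A}`. -/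
abbrev Data (L M : ℕ) := (Fin (numPulses L M) → ACR) × (Fin (L + 1) → Rec M)

/-- The record of pulse `i`. -/
def recAt (d : Data L M) (i : Fin (numPulses L M)) : BCR × BobAnn × AliceAnn :=
  d.2 (finProdFinEquiv.symm i).1 (finProdFinEquiv.symm i).2

/-- The announcement registers agree with `A_CR` and `B_CR`. -/
def Consistent (d : Data L M) : Prop :=
  ∀ i, (recAt d i).2.1 = bobAnn (recAt d i).1 ∧
    (recAt d i).2.2 = aliceAnn (d.1 i) (recAt d i).2.1

/-- Pulses sent and detected in the `Z` basis. -/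
def siftSet (d : Data L M) : Finset (Fin (numPulses L M)) :=
  Finset.univ.filter fun i =>
    (d.1 i).2.1 = Basis.Z ∧ (recAt d i).1.1 = Basis.Z ∧ (recAt d i).1.2 ≠ none

/-- `N_ω^sift` -/
def numSift (d : Data L M) (ω : Intensity) : ℕ :=
  ((siftSet d).filter fun i => (d.1 i).1 = ω).card

/-- `N_{ω,X}^Error` -/
def numErrX (d : Data L M) (ω : Intensity) : ℕ :=
  (Finset.univ.filter fun i : Fin (numPulses L M) =>
    (d.1 i).1 = ω ∧ (d.1 i).2.1 = Basis.X ∧ (recAt d i).1.1 = Basis.X ∧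
      (recAt d i).1.2 ≠ none ∧ (recAt d i).1.2 ≠ some (d.1 i).2.2).card

lemma siftSet_card_lt (d : Data L M) : (siftSet d).card < numPulses L M + 1 := by
  have h := Finset.card_le_univ (siftSet d)
  rw [Fintype.card_fin] at h
  exact Nat.lt_succ_of_le h

/-- The key formed by the bits at the sifted pulses, in increasing order of the pulses. -/
def siftedKey (d : Data L M) (bit : Fin (numPulses L M) → Bit) : Key (numPulses L M) :=
  ⟨⟨(siftSet d).card, siftSet_card_lt d⟩, fun t => bit ((siftSet d).orderEmbOfFin rfl t)⟩

variable (P : Params L M)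

/-- The secret key length `N_sift - N_PA - N_EC - N_verify`, or `0` if this is not positive. -/
def finalLength (d : Data L M) : Fin (numPulses L M + 1) :=
  ⟨(siftSet d).card - (P.NPA (numSift d) (numErrX d) + P.NEC (siftSet d).card + P.Nverify),
    lt_of_le_of_lt (Nat.sub_le _ _) (siftSet_card_lt d)⟩

/-- Output of sifting: `A_sift`, `B_sift`, `C_Key^Length`, `C_Judge^Length`. -/
def siftOut (d : Data L M) :
    Key (numPulses L M) × Key (numPulses L M) × Fin (numPulses L M + 1) × Bool :=
  if Consistent d then
    (siftedKey d fun i => (d.1 i).2.2, siftedKey d fun i => ((recAt d i).1.2).getD 0,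
      finalLength P d, decide (0 < (finalLength P d).val))
  else (nullKey _, nullKey _, 0, false)

/-- The data without the sifted bits (these are set to `0`), which are moved to `A_sift` and
`B_sift`.  All other data are discarded. -/
def eraseSifted (d : Data L M) : Data L M :=
  if Consistent d then
    (fun i => if i ∈ siftSet d then ((d.1 i).1, (d.1 i).2.1, 0) else d.1 i,
      fun j m => if finProdFinEquiv (j, m) ∈ siftSet d then
          (((d.2 j m).1.1, some 0), (d.2 j m).2) else d.2 j m)
  else d

/-- Kraus operators of `ℰ^sift`, one for each value of the discarded data: the sum over the values
of the sifted bits is inside the Kraus operator. -/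
def siftKraus (k : Data L M) :
    Matrix (Key (numPulses L M) × Key (numPulses L M) × Fin (numPulses L M + 1) × Bool)
      (Data L M) ℂ :=
  fun o d => if k = eraseSifted d ∧ o = siftOut P d then 1 else 0

variable {ε : Type u} {R : Type}

/-- `ℰ^sift` -/
def sift (ρ : Op (ε × Rest L M R (L + 1))) :
    Op ((Key (numPulses L M) × Key (numPulses L M) × Fin (numPulses L M + 1) × Bool) × (R × ε)) :=
  actOn (σ := R × ε) (siftKraus P) (fun p => (p.2.2, (p.1.1, p.2.1, p.1.2))) id ρ

end Sift

/-! ### Actual key generation -/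

section Actual

variable {L M : ℕ} (P : Params L M)

/-- `C_Judge^Length`-controlled bit error correction; `true` stands for a positive key length. -/
def ecKraus (k : Σ n : Fin (numPulses L M + 1), (Fin n.val → Bit) × (Fin n.val → Bit)) :
    Matrix (Key (numPulses L M) × Key (numPulses L M) × Bool × CEC P)
      (Key (numPulses L M) × Key (numPulses L M) × Bool) ℂ :=
  ketBra
      (⟨k.1, k.2.1⟩, ⟨k.1, k.2.2 + P.fEC k.1.val (Matrix.vecMul k.2.1 (P.Csynd k.1.val))⟩, true,
        some ⟨k.1, Matrix.vecMul k.2.1 (P.Csynd k.1.val)⟩)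
      (⟨k.1, k.2.1⟩, ⟨k.1, k.2.2⟩, true) +
    ketBra (nullKey _, nullKey _, false, none) (⟨k.1, k.2.1⟩, ⟨k.1, k.2.2⟩, false)

/-- Error verification with seed `k.1`.  The hash value in `B_Hash` is a function of the Kraus
index, so tracing `B_Hash` out amounts to omitting it. -/
def verifyKraus (k : (Fin P.hVerify → Bit) ×
      (Σ n : Fin (numPulses L M + 1), (Fin n.val → Bit) × (Fin n.val → Bit))) :
    Matrix (Key (numPulses L M) × Key (numPulses L M) × Bool × CHash P × Option Bool)
      (Key (numPulses L M) × Key (numPulses L M) × Bool) ℂ :=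
  let hA := Matrix.vecMul k.2.2.1 (P.Cverify k.2.1.val k.1)
  let hB := Matrix.vecMul k.2.2.2 (P.Cverify k.2.1.val k.1)
  (Real.sqrt (1 / 2 ^ P.hVerify) : ℂ) •
    (ketBra
        (⟨k.2.1, k.2.2.1⟩, ⟨k.2.1, k.2.2.2⟩, decide (hA = hB), some (k.1, hA),
          some (decide (hA = hB)))
        (⟨k.2.1, k.2.2.1⟩, ⟨k.2.1, k.2.2.2⟩, true) +
      ketBra (nullKey _, nullKey _, false, none, none)
        (⟨k.2.1, k.2.2.1⟩, ⟨k.2.1, k.2.2.2⟩, false))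

/-- Privacy amplification with seed `k.1` and final length `k.2.2`. -/
def paKraus (k : (Fin P.hPA → Bit) ×
      (Σ n : Fin (numPulses L M + 1), (Fin n.val → Bit) × (Fin n.val → Bit)) ×
        Fin (numPulses L M + 1)) :
    Matrix (Key (numPulses L M) × Key (numPulses L M) × Fin (numPulses L M + 1) × Bool ×
        CPASeed P)
      (Key (numPulses L M) × Key (numPulses L M) × Fin (numPulses L M + 1) × Bool) ℂ :=
  let n := k.2.1.1
  let m := k.2.2
  (Real.sqrt (1 / 2 ^ P.hPA) : ℂ) •
    (ketBra
        (⟨m, Matrix.vecMul k.2.1.2.1 (P.CPA n.val m.val k.1)⟩,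
          ⟨m, Matrix.vecMul k.2.1.2.2 (P.CPA n.val m.val k.1)⟩, m, true, k.1)
        (⟨n, k.2.1.2.1⟩, ⟨n, k.2.1.2.2⟩, m, true) +
      ketBra (nullKey _, nullKey _, m, false, k.1) (⟨n, k.2.1.2.1⟩, ⟨n, k.2.1.2.2⟩, m, false))

variable {P} {𝒦 ε : Type u} (E : Eve P 𝒦 ε)

/-- The actual final state `ρ_PA` of `A_sift B_sift E`: sifting, error correction, verification,
privacy amplification and Eve's final operation. -/
def rhoPA : Op (Key (numPulses L M) × Key (numPulses L M) × ε) :=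
  let ρ₁ := sift P (rhoQC E)
  let ρ₂ : Op ((Key (numPulses L M) × Key (numPulses L M) × Bool) ×
      (CEC P × Fin (numPulses L M + 1) × Unit × ε)) :=
    actOn (σ := Fin (numPulses L M + 1) × Unit × ε) (ecKraus P)
      (fun p => ((p.1.1, p.1.2.1, p.2.1, p.1.2.2), p.2.2))
      (fun q => ((q.1.1, q.1.2.1, q.1.2.2, q.2.1), q.2.2)) ρ₁
  let ρ₃ : Op ((Key (numPulses L M) × Key (numPulses L M) × Fin (numPulses L M + 1) × Bool) ×
      (CEC P × CHash P × Option Bool × Unit × ε)) :=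
    actOn (σ := CEC P × Fin (numPulses L M + 1) × Unit × ε) (verifyKraus P) id
      (fun q => ((q.1.1, q.1.2.1, q.1.2.2.2, q.2.2.1, q.2.2.2.1),
        (q.2.1, q.1.2.2.1, q.2.2.2.2))) ρ₂
  let ρ₄ := act (paKraus P) ρ₃
  actOn (σ := Key (numPulses L M) × Key (numPulses L M)) E.final.K
    (fun p => ((p.2.1, p.2.2, p.1.2.2.1, p.1.2.2.2.1, p.1.2.2.2.2.2.2),
      (p.1.2.1, p.1.2.2.2.2.1, p.1.2.2.2.2.2.1, (), p.1.1)))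
    (fun q => (q.2.2, (q.1, q.2.1))) ρ₄

end Actual

/-! ### Virtual key generation -/

section Virtual

/-- Choices made in the virtual protocol: invertible completions of the binary matrices of the
actual protocol, and the Pauli-`Z` string applied in the phase correction. -/
structure VirParams {L M : ℕ} (P : Params L M) where
  tCsynd : ∀ n, Matrix (Fin n) (Fin n) Bit
  tCsynd_unit : ∀ n, P.NEC n ≤ n → n ≤ numPulses L M → IsUnit (tCsynd n)
  /-- the first columns are those of the parity check matrix -/
  tCsynd_cols : ∀ n, P.NEC n ≤ n → n ≤ numPulses L M →
    ∀ (i l : Fin n) (k : Fin (P.NEC n)), l.val = k.val → tCsynd n i l = P.Csynd n i k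
  tCverify : ∀ n, (Fin P.hVerify → Bit) → Matrix (Fin n) (Fin n) Bit
  tCverify_unit : ∀ n r, P.Nverify ≤ n → n ≤ numPulses L M → IsUnit (tCverify n r)
  /-- the first columns are those of the hash function -/
  tCverify_cols : ∀ n r, P.Nverify ≤ n → n ≤ numPulses L M →
    ∀ (i l : Fin n) (k : Fin P.Nverify), l.val = k.val → tCverify n r i l = P.Cverify n r i k
  tCPA : ∀ n _m : ℕ, (Fin P.hPA → Bit) → Matrix (Fin n) (Fin n) Bit
  tCPA_unit : ∀ n m r, m ≤ n → n ≤ numPulses L M → IsUnit (tCPA n m r)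
  /-- the last columns are those of the hash function -/
  tCPA_cols : ∀ n m r, m ≤ n → n ≤ numPulses L M →
    ∀ (i l : Fin n) (k : Fin m), l.val = n - m + k.val → tCPA n m r i l = P.CPA n m r i k
  /-- the Pauli-`Z` string, given `n`, `m`, the seed and the `X` outcomes of Alice and Bob -/
  zString : ∀ n m : ℕ, (Fin P.hPA → Bit) → (Fin (n - m) → Bit) → (Fin n → Bit) → (Fin n → Bit)

/-- The operator `∑ₙ ∑_z |n, z Cₙ⟩⟨n, z|`. -/
def linU (N : ℕ) (C : ∀ n, Matrix (Fin n) (Fin n) Bit) : Op (Key N) :=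
  ∑ k : Key N, ketBra (⟨k.1, Matrix.vecMul k.2 (C k.1.val)⟩ : Key N) k

/-- The `X`-basis ket `|n, (x)_X⟩`. -/
def xKet {N : ℕ} (n : Fin (N + 1)) (x : Fin n.val → Bit) (k : Key N) : ℂ :=
  ∑ z : Fin n.val → Bit,
    if k = ⟨n, z⟩ then signOf z x / (Real.sqrt (2 ^ n.val) : ℂ) else 0

/-- Projection to the `X`-basis ket. -/
def xProj {N : ℕ} (n : Fin (N + 1)) (x : Fin n.val → Bit) : Op (Key N) :=
  fun k l => xKet n x k * conj (xKet n x l)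

/-- Projection to length `n` with first bits equal to `s` in the `Z` basis. -/
def zFirst {N l : ℕ} (n : Fin (N + 1)) (s : Fin l → Bit) : Op (Key N) :=
  ∑ a : Fin n.val → Bit,
    if firstBits l a = s then ketBra (⟨n, a⟩ : Key N) ⟨n, a⟩ else 0

variable {L M : ℕ} {P : Params L M} (V : VirParams P)

/-- Alice's part of error correction, on `A_sift C_Judge`: measure the first qubits after
`U_synd`, undo `U_synd`; or reset if the key length is not positive. -/
def ecAVirKraus :
    ((Σ n : Fin (numPulses L M + 1), (Fin (P.NEC n.val) → Bit)) ⊕ Key (numPulses L M)) →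
      Matrix (Key (numPulses L M) × Bool × CEC P) (Key (numPulses L M) × Bool) ℂ
  | Sum.inl s => fun x y =>
      if x.2.1 = true ∧ y.2 = true ∧ x.2.2 = some s then
        ((linU _ V.tCsynd).conjTranspose * zFirst s.1 s.2 * linU _ V.tCsynd :
          Op (Key (numPulses L M))) x.1 y.1
      else 0
  | Sum.inr k => ketBra (nullKey _, false, none) (k, false)

variable (P) in
/-- Bob's part of error correction, on `B_sift C_Judge C_EC`: bit flips determined by the
syndrome; or reset if the key length is not positive. -/
def ecBVirKraus :
    ((Σ n : Fin (numPulses L M + 1), (Fin (P.NEC n.val) → Bit)) ⊕ Key (numPulses L M)) →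
      Matrix (Key (numPulses L M) × Bool × CEC P) (Key (numPulses L M) × Bool × CEC P) ℂ
  | Sum.inl s => ∑ z : Fin s.1.val → Bit,
      ketBra (⟨s.1, z + P.fEC s.1.val s.2⟩, true, some s) (⟨s.1, z⟩, true, some s)
  | Sum.inr k => ketBra (nullKey _, false, none) (k, false, none)

/-- Labels of the branches of virtual error verification. -/
inductive VerifyBranch (P : Params L M)
  | pass (n : Fin (numPulses L M + 1)) (h : Fin P.Nverify → Bit)
  | fail (n : Fin (numPulses L M + 1)) (a b : Fin n.val → Bit)
  | aborted

/-- `U_verify` on `A_sift B_sift`. -/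
def verifyU (r : Fin P.hVerify → Bit) : Op (Key (numPulses L M) × Key (numPulses L M)) :=
  tens (linU _ fun n => V.tCverify n r) (linU _ fun n => V.tCverify n r)

/-- The operator on `A_sift B_sift` between `U_verify` and its adjoint: both parties measure their
first qubits in the `Z` basis; equal results keep the state, different results discard the keys. -/
def verifyVirMid : VerifyBranch P → Op (Key (numPulses L M) × Key (numPulses L M))
  | VerifyBranch.pass n h => tens (zFirst n h) (zFirst n h)
  | VerifyBranch.fail n a b =>
      if firstBits P.Nverify a ≠ firstBits P.Nverify b then
        ketBra (nullKey _, nullKey _) (⟨n, a⟩, ⟨n, b⟩) else 0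
  | VerifyBranch.aborted => ketBra (nullKey _, nullKey _) (nullKey _, nullKey _)

/-- Registers `C_Judge` (before and after), `C_A^Hash`, `C_B^HashResult` in each branch. -/
def verifyVirReg (r : Fin P.hVerify → Bit) :
    VerifyBranch P → Bool × Bool × CHash P × Option Bool
  | VerifyBranch.pass _ h => (true, true, some (r, h), some true)
  | VerifyBranch.fail _ a _ => (true, false, some (r, firstBits P.Nverify a), some false)
  | VerifyBranch.aborted => (false, false, none, none)

/-- Virtual error verification `U† K U` with seed `k.1`. -/
def verifyVirKraus (k : (Fin P.hVerify → Bit) × VerifyBranch P) :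
    Matrix (Key (numPulses L M) × Key (numPulses L M) × Bool × CHash P × Option Bool)
      (Key (numPulses L M) × Key (numPulses L M) × Bool) ℂ :=
  fun x y =>
    if (y.2.2, x.2.2) = verifyVirReg k.1 k.2 then
      (Real.sqrt (1 / 2 ^ P.hVerify) : ℂ) *
        ((verifyU V k.1).conjTranspose * verifyVirMid k.2 * verifyU V k.1)
          (x.1, x.2.1) (y.1, y.2.1)
    else 0

/-- `A_sift`, `B_sift`, `C_Key^Length`, with `C_Judge^Length = 1`. -/
abbrev PASys (L M : ℕ) :=
  Key (numPulses L M) × Key (numPulses L M) × Fin (numPulses L M + 1)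

/-- First step of virtual privacy amplification: `U_PA ⊗ U_PA`. -/
def paVir1 (r : Fin P.hPA → Bit) : Op (PASys L M) := fun x y =>
  if x.2.2 = y.2.2 then
    linU _ (fun n => V.tCPA n x.2.2.val r) x.1 y.1 *
      linU _ (fun n => V.tCPA n x.2.2.val r) x.2.1 y.2.1
  else 0

/-- Second step: `X`-basis outcomes `xA` of Alice's first `n - m` qubits and `xB` of all of Bob's
qubits, for sifted key length `n` and final length `m`. -/
def paVir2 (n m : Fin (numPulses L M + 1)) (xA : Fin (n.val - m.val) → Bit)
    (xB : Fin n.val → Bit) : Op (PASys L M) := fun x y =>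
  if x.2.2 = m ∧ y.2.2 = m then
    (∑ a : Fin n.val → Bit, if firstBits (n.val - m.val) a = xA then xProj n a x.1 y.1 else 0) *
      xProj n xB x.2.1 y.2.1
  else 0

/-- Third step: the Pauli-`Z` string on `A_sift` determined by the outcomes. -/
def paVir3 (n m : Fin (numPulses L M + 1)) (r : Fin P.hPA → Bit)
    (xA : Fin (n.val - m.val) → Bit) (xB : Fin n.val → Bit) : Op (PASys L M) := fun x y =>
  if x.2 = y.2 then
    ∑ z : Fin n.val → Bit, signOf (V.zString n.val m.val r xA xB) z *
      ketBra (⟨n, z⟩ : Key (numPulses L M)) (⟨n, z⟩ : Key (numPulses L M)) x.1 y.1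
  else 0

/-- Fourth step: the first `n - m` qubits of `A_sift` (index `c`) and `B_sift` (index `b`) are
traced out. -/
def paVir4 (n m : Fin (numPulses L M + 1)) (c : Fin (n.val - m.val) → Bit)
    (b : Key (numPulses L M)) :
    Matrix (Key (numPulses L M) × Fin (numPulses L M + 1)) (PASys L M) ℂ :=
  ∑ a : Fin n.val → Bit,
    if firstBits (n.val - m.val) a = c then
      ketBra (⟨m, lastBits m.val a⟩, m) (⟨n, a⟩, b, m)
    else 0

/-- Labels of the branches of virtual privacy amplification, including the indices of the systems
traced out. -/
inductive PABranch (L M : ℕ)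
  | positive (n m : Fin (numPulses L M + 1)) (le : m ≤ n) (xA : Fin (n.val - m.val) → Bit)
      (xB : Fin n.val → Bit) (c : Fin (n.val - m.val) → Bit) (b : Key (numPulses L M))
  | aborted (b : Key (numPulses L M))

/-- Virtual privacy amplification with seed `k.1`; the output is `A_sift`, `C_Key^Length`,
`C_Judge^Length`, `C_PA`. -/
def paVirKraus (k : (Fin P.hPA → Bit) × PABranch L M) :
    Matrix (Key (numPulses L M) × Fin (numPulses L M + 1) × Bool × CPASeed P)
      (Key (numPulses L M) × Key (numPulses L M) × Fin (numPulses L M + 1) × Bool) ℂ :=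
  fun x y =>
    if x.2.2.2 = k.1 then
      (Real.sqrt (1 / 2 ^ P.hPA) : ℂ) *
        match k.2 with
        | PABranch.positive n m _ xA xB c b =>
          if x.2.2.1 = true ∧ y.2.2.2 = true then
            (paVir4 n m c b * paVir3 V n m k.1 xA xB * paVir2 n m xA xB * paVir1 V k.1)
              (x.1, x.2.1) (y.1, y.2.1, y.2.2.1)
          else 0
        | PABranch.aborted b =>
          if x.1 = y.1 ∧ y.2.1 = b ∧ x.2.1 = y.2.2.1 ∧ x.2.2.1 = false ∧ y.2.2.2 = false
          then 1 else 0
    else 0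

variable {𝒦 ε : Type u} (E : Eve P 𝒦 ε) (S : Channel.{u} (BSig 𝒦) (Option Bit))

/-- The final state `ρ_PA,vir` of `A_sift E` in the virtual protocol, before Alice's final `Z`
measurement: sifting, virtual error correction (Alice, then Bob), verification and privacy
amplification, Eve's final operation, and the trace over `R_1 … R_N`. -/
def rhoPAVir : Op (Key (numPulses L M) × ε) :=
  let ρ₁ := sift P (rhoQCVir E S)
  let ρ₂ : Op ((Key (numPulses L M) × Bool × CEC P) ×
      (Key (numPulses L M) × Fin (numPulses L M + 1) × (Fin (numPulses L M) → ℕ) × ε)) :=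
    actOn (σ := Key (numPulses L M) × Fin (numPulses L M + 1) × (Fin (numPulses L M) → ℕ) × ε)
      (ecAVirKraus V)
      (fun p => ((p.1.1, p.2.1, p.2.2.1, p.1.2), p.2.2.2)) id ρ₁
  let ρ₂' : Op ((Key (numPulses L M) × Key (numPulses L M) × Bool) ×
      (CEC P × Fin (numPulses L M + 1) × (Fin (numPulses L M) → ℕ) × ε)) :=
    actOn (σ := Key (numPulses L M) × Fin (numPulses L M + 1) × (Fin (numPulses L M) → ℕ) × ε)
      (ecBVirKraus P)
      (fun p => ((p.2.1, p.1.2.1, p.1.2.2), (p.1.1, p.2.2)))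
      (fun q => ((q.1.2.1, q.1.2.2, q.2.1), (q.1.1, q.2.2))) ρ₂
  let ρ₃ : Op ((Key (numPulses L M) × Key (numPulses L M) × Fin (numPulses L M + 1) × Bool) ×
      (CEC P × CHash P × Option Bool × (Fin (numPulses L M) → ℕ) × ε)) :=
    actOn (σ := CEC P × Fin (numPulses L M + 1) × (Fin (numPulses L M) → ℕ) × ε)
      (verifyVirKraus V) id
      (fun q => ((q.1.1, q.1.2.1, q.1.2.2.2, q.2.2.1, q.2.2.2.1),
        (q.2.1, q.1.2.2.1, q.2.2.2.2))) ρ₂'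
  let ρ₄ := act (paVirKraus V) ρ₃
  let ρ₅ : Op (Key (numPulses L M) × ε × (Fin (numPulses L M) → ℕ)) :=
    actOn (σ := Key (numPulses L M) × (Fin (numPulses L M) → ℕ)) E.final.K
      (fun p => ((p.2.1, p.1.2.2.1, p.1.2.2.2.1, p.1.2.2.2.2.2.2),
        (p.1.2.1, p.1.2.2.2.2.1, p.1.2.2.2.2.2.1, p.2.2, p.1.1)))
      (fun q => (q.2.1, (q.1, q.2.2))) ρ₄
  fun x y => ∑' r, ρ₅ (x.1, x.2, r) (y.1, y.2, r)

end Virtual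

/-! ### Conditional and ideal states -/

section Final

variable {N : ℕ} {ε : Type u}

/-- `Pr_PA(n) = tr (E_n ρ_PA)`, where `E_n` projects `A_sift` to length `n`. -/
def prPA (ρ : Op (Key N × Key N × ε)) (n : Fin (N + 1)) : ℂ :=
  ∑ a : Key N, ∑ b : Key N, ∑' e : ε, if a.1 = n then ρ (a, b, e) (a, b, e) else 0

/-- `tr_{B_sift} (E_n ρ) / p` -/
def condAE (ρ : Op (Key N × Key N × ε)) (n : Fin (N + 1)) (p : ℂ) : Op (Key N × ε) :=
  fun x y => (if x.1.1 = n then ∑ b : Key N, ρ (x.1, b, x.2) (y.1, b, y.2) else 0) / p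

/-- `E_n ρ E_n / p` -/
def condA (ρ : Op (Key N × ε)) (n : Fin (N + 1)) (p : ℂ) : Op (Key N × ε) :=
  fun x y => (if x.1.1 = n ∧ y.1.1 = n then ρ x y else 0) / p

/-- `ρ_ideal = ∑ₙ tr_{AB} (E_n ρ) ⊗ 2⁻ⁿ ∑_a |n,a⟩⟨n,a| ⊗ |n,a⟩⟨n,a|` -/
def idealize (ρ : Op (Key N × Key N × ε)) : Op (Key N × Key N × ε) := fun x y =>
  ∑ n : Fin (N + 1),
    (∑ a : Key N, ∑ b : Key N, if a.1 = n then ρ (a, b, x.2.2) (a, b, y.2.2) else 0) *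
      ((1 / 2 ^ n.val : ℂ) * ∑ a : Fin n.val → Bit,
        ketBra (⟨n, a⟩ : Key N) (⟨n, a⟩ : Key N) x.1 y.1 *
          ketBra (⟨n, a⟩ : Key N) (⟨n, a⟩ : Key N) x.2.1 y.2.1)

/-- The `Z`-basis measurement `ℰ^Z` of `A_sift`. -/
def measureZ (ρ : Op (Key N × ε)) : Op (Key N × ε) :=
  act (fun k : Key N => ketBra k k) ρ

/-- `|n, +ⁿ⟩ = 2^{-n/2} ∑_k |n, k⟩` -/
def plusKet (n : Fin (N + 1)) (k : Key N) : ℂ :=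
  (1 / (Real.sqrt (2 ^ n.val) : ℂ)) * ∑ a : Fin n.val → Bit, if k = ⟨n, a⟩ then 1 else 0

/-- `|n,+ⁿ⟩⟨n,+ⁿ| ⊗ tr_{A_sift} ρ` -/
def idealVir (ρ : Op (Key N × ε)) (n : Fin (N + 1)) : Op (Key N × ε) := fun x y =>
  (plusKet n x.1 * conj (plusKet n y.1)) * ∑ a : Key N, ρ (a, x.2) (a, y.2)

end Final

end QKD

end

/-!
The proof has two independent parts.

**Equality of the states.** States are handled through Gram decompositions `ρ(x, y) = ∑ⱼ vⱼ(x)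
conj vⱼ(y)` with square-summable `v` (`IsState.traceClass`), which survive Kraus families, partial
traces and dephasing, and which turn all interchanges of infinite sums into Cauchy–Schwarz
estimates.

* The squashing condition holds for all states, hence by polarization for the matrix elements of
  the effects (`outcomeEffect_eq`): `∑ₑ Kₑ(x)† Kₑ(x)` for Bob's virtual Kraus operators is his
  effect for the outcome `x`. A diagonal entry of an output depends on the Kraus operators only
  through this operator (`act_diag_eq`), so Bob's measurement is the virtual one followed by a
  dephasing of the classical labels (`bobBlock_dephase`). The source is likewise the dephased
  virtual source with `R` traced out (`source_eq_dephase`). Announcements only read classical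
  labels, and Eve's maps do not touch them; by induction over the blocks the same relation holds
  after the quantum communication (`rhoQC_eq_dephase`).
* Every virtual step of error correction and verification maps `Z` basis labels to `Z` basis
  labels and tells the environment a function of the label (`ActsAs`). It therefore acts on the
  diagonal entries as the classical protocol does (`ActsAs.act_diag`, `ecState_dephase`,
  `verifyVirState_collapse`). In privacy amplification the sum over the `X` outcomes and the
  corrections by Pauli `Z` operators leave only the diagonal entries (`tsum_paVirKraus`). Hence
  the diagonal entries of the two final states agree (`sum_rhoPA`), which is the first equality
  (`measureZ_condA`); the second one is a computation with `|+ⁿ⟩` (`measureZ_idealVir`).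

**Existence of a squashing map.** Passive linear optics is functorial: beam splitters, phase
shifters and the attenuations `c ^ (number of photons)` are second quantizations `secondQuant g`
of `2 × 2` matrices `g`, the second quantization of a product of matrices is the product of the
operators (`mulOp_secondQuant`, `beamSplitter_eq`), and photon loss acts on them affinely in `g`
(`heis_sigLoss_secondQuant`). This yields closed forms of Bob's effects (`measPOVM_none`,
`measPOVM_some`): a part that depends on the number of photons only, and the pullback under a loss
of the effects `clickEffect` of lossless detectors without dark counts.

Let `m` be the total occupation numbers of the optical modes, with `n > 0` photons. On the sector
`m` the second quantization of a rank-one projector has rank one (`secondQuant_vecMulVec`), so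
that `clickEffect` is `½ (1 ± (|z₀⟩⟨z₀| - |z₁⟩⟨z₁|))` in the `Z` basis and `½ (1 ± (|x₀⟩⟨x₀| -
|x₁⟩⟨x₁|))` in the `X` basis, for two orthonormal pairs whose mutual overlaps are `2^(-n/2)`, up
to a sign `(-1)^n` of one of them. A completely positive map to the qubit with these effects is
the same as a positive block matrix `½ [[1 + Z, G], [G†, 1 - Z]]` with `(G + G†) / 2 = X`: the
antihermitian part of `G`, that is, the effect of the third Pauli operator, is free, and
`exists_clickForm_nonneg` gives a choice that makes the form a sum of squares. The map for all
sectors after the loss, supplemented by random bits for dark counts and by `Noclick`, is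
`squashMap`.
-/

noncomputable section

namespace QKD

/-! ### Square-summable families and bounded Kraus families -/

lemma summable_mul_of_sq {α : Type*} {f g : α → ℂ} (hf : Summable fun a => ‖f a‖ ^ 2)
    (hg : Summable fun a => ‖g a‖ ^ 2) : Summable fun a => f a * g a := by
  refine Summable.of_norm_bounded (hf.add hg) fun a => ?_
  rw [norm_mul]
  nlinarith [sq_nonneg (‖f a‖ - ‖g a‖), sq_nonneg (‖f a‖), sq_nonneg (‖g a‖)]

lemma norm_tsum_mul_sq_le {α : Type*} {f g : α → ℂ} (hf : Summable fun a => ‖f a‖ ^ 2)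
    (hg : Summable fun a => ‖g a‖ ^ 2) :
    ‖∑' a, f a * g a‖ ^ 2 ≤ (∑' a, ‖f a‖ ^ 2) * ∑' a, ‖g a‖ ^ 2 := by
  have hlim : Filter.Tendsto (fun s : Finset α => ‖∑ a ∈ s, f a * g a‖ ^ 2)
      Filter.atTop (nhds (‖∑' a, f a * g a‖ ^ 2)) :=
    ((summable_mul_of_sq hf hg).hasSum.norm).pow 2
  refine le_of_tendsto' hlim fun s => ?_
  have h1 : ‖∑ a ∈ s, f a * g a‖ ≤ ∑ a ∈ s, ‖f a‖ * ‖g a‖ :=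
    (norm_sum_le _ _).trans (Finset.sum_le_sum fun _ _ => (norm_mul _ _).le)
  calc ‖∑ a ∈ s, f a * g a‖ ^ 2 ≤ (∑ a ∈ s, ‖f a‖ * ‖g a‖) ^ 2 := by gcongr
    _ ≤ (∑ a ∈ s, ‖f a‖ ^ 2) * ∑ a ∈ s, ‖g a‖ ^ 2 := Finset.sum_mul_sq_le_sq_mul_sq _ _ _
    _ ≤ _ := by
      gcongr
      · exact hf.sum_le_tsum s fun _ _ => by positivity
      · exact hg.sum_le_tsum s fun _ _ => by positivity

lemma summable_conj_sq {α : Type*} {f : α → ℂ} (hf : Summable fun a => ‖f a‖ ^ 2) :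
    Summable fun a => ‖conj (f a)‖ ^ 2 := by
  simpa using hf

lemma summable_sq_mul_prod {α β : Type*} {f : α → ℂ} {g : β → ℂ}
    (hf : Summable fun a => ‖f a‖ ^ 2) (hg : Summable fun a => ‖g a‖ ^ 2) :
    Summable fun p : α × β => ‖f p.1 * g p.2‖ ^ 2 := by
  have := Summable.mul_of_nonneg hf hg (fun _ => by positivity) (fun _ => by positivity)
  simpa [mul_pow] using this

/-- A family of Kraus operators is bounded if `∑ₖ ‖Kₖ v‖² ≤ C ‖v‖²`.  Finite partial sums and
finitely supported `v` suffice, which avoids any assumption of summability. -/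
def Bdd {e κ ι : Type*} (K : e → Matrix κ ι ℂ) : Prop :=
  ∃ C : ℝ, 0 ≤ C ∧ ∀ (F : Finset (e × κ)) (s : Finset ι) (v : ι → ℂ),
    ∑ p ∈ F, ‖∑ a ∈ s, K p.1 p.2 a * v a‖ ^ 2 ≤ C * ∑ a ∈ s, ‖v a‖ ^ 2

section Bdd

variable {e κ ι : Type*} {K : e → Matrix κ ι ℂ}

lemma Bdd.summable_row (hK : Bdd K) (k : e) (x : κ) : Summable fun a => ‖K k x a‖ ^ 2 := by
  obtain ⟨C, hC, h⟩ := hK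
  refine summable_of_sum_le (fun _ => by positivity) (c := C) fun s => ?_
  have h1 := h {(k, x)} s (fun a => conj (K k x a))
  have h2 : ∑ a ∈ s, K k x a * conj (K k x a) = ((∑ a ∈ s, ‖K k x a‖ ^ 2 : ℝ) : ℂ) := by
    push_cast
    exact Finset.sum_congr rfl fun a _ => by rw [Complex.mul_conj']
  have h3 : 0 ≤ ∑ a ∈ s, ‖K k x a‖ ^ 2 := Finset.sum_nonneg fun _ _ => by positivity
  simp only [Finset.sum_singleton, RCLike.norm_conj] at h1
  rw [h2, Complex.norm_real, Real.norm_eq_abs, sq_abs] at h1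
  by_contra hlt
  push Not at hlt
  nlinarith

lemma Bdd.summable_mul (hK : Bdd K) {v : ι → ℂ} (hv : Summable fun a => ‖v a‖ ^ 2) (k : e)
    (x : κ) : Summable fun a => K k x a * v a :=
  summable_mul_of_sq (hK.summable_row k x) hv

/-- The bound on finite sums extends to square-summable vectors. -/
lemma Bdd.exists_bound (hK : Bdd K) : ∃ C : ℝ, 0 ≤ C ∧ ∀ v : ι → ℂ,
    (Summable fun a => ‖v a‖ ^ 2) →
      (Summable fun p : e × κ => ‖∑' a, K p.1 p.2 a * v a‖ ^ 2) ∧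
      ∑' p : e × κ, ‖∑' a, K p.1 p.2 a * v a‖ ^ 2 ≤ C * ∑' a, ‖v a‖ ^ 2 := by
  obtain ⟨C, hC, h⟩ := id hK
  refine ⟨C, hC, fun v hv => ?_⟩
  have key : ∀ F : Finset (e × κ),
      ∑ p ∈ F, ‖∑' a, K p.1 p.2 a * v a‖ ^ 2 ≤ C * ∑' a, ‖v a‖ ^ 2 := by
    intro F
    have ht : Filter.Tendsto (fun s : Finset ι => ∑ p ∈ F, ‖∑ a ∈ s, K p.1 p.2 a * v a‖ ^ 2)
        Filter.atTop (nhds (∑ p ∈ F, ‖∑' a, K p.1 p.2 a * v a‖ ^ 2)) :=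
      tendsto_finsetSum _ fun p _ => ((hK.summable_mul hv p.1 p.2).hasSum.norm).pow 2
    refine le_of_tendsto' ht fun s => (h F s v).trans ?_
    exact mul_le_mul_of_nonneg_left (hv.sum_le_tsum s fun _ _ => by positivity) hC
  have hs := summable_of_sum_le (fun p : e × κ => by positivity) key
  exact ⟨hs, hs.tsum_le_of_sum_le key⟩

lemma Bdd.summable_image (hK : Bdd K) {v : ι → ℂ} (hv : Summable fun a => ‖v a‖ ^ 2) :
    Summable fun p : e × κ => ‖∑' a, K p.1 p.2 a * v a‖ ^ 2 := by
  obtain ⟨C, -, h⟩ := hK.exists_bound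
  exact (h v hv).1

lemma bdd_of_complete
    (h : ∀ a b : ι, HasSum (fun p : e × κ => conj (K p.1 p.2 a) * K p.1 p.2 b)
      (if a = b then 1 else 0)) : Bdd K := by
  refine ⟨1, zero_le_one, fun F s v => ?_⟩
  have h1 : HasSum (fun p : e × κ => ((‖∑ a ∈ s, K p.1 p.2 a * v a‖ ^ 2 : ℝ) : ℂ))
      ((∑ a ∈ s, ‖v a‖ ^ 2 : ℝ) : ℂ) := by
    have h2 : HasSum (fun p : e × κ => ∑ a ∈ s, ∑ b ∈ s,
        conj (v a) * v b * (conj (K p.1 p.2 a) * K p.1 p.2 b))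
        (∑ a ∈ s, ∑ b ∈ s, conj (v a) * v b * (if a = b then 1 else 0)) :=
      hasSum_sum fun a _ => hasSum_sum fun b _ => (h a b).mul_left _
    convert h2 using 1
    · funext p
      push_cast
      rw [← Complex.conj_mul', map_sum, Finset.sum_mul_sum]
      refine Finset.sum_congr rfl fun a _ => Finset.sum_congr rfl fun b _ => ?_
      rw [map_mul]; ring
    · push_cast
      refine Finset.sum_congr rfl fun a ha => ?_
      simp [ha, Complex.conj_mul']
  have h3 := Complex.hasSum_ofReal.mp h1
  rw [one_mul]
  exact sum_le_hasSum F (fun _ _ => by positivity) h3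

lemma bdd_of_finite [Finite e] [Finite κ] [Finite ι] (K : e → Matrix κ ι ℂ) : Bdd K := by
  have := Fintype.ofFinite e
  have := Fintype.ofFinite κ
  have := Fintype.ofFinite ι
  refine ⟨∑ p : e × κ, ∑ a, ‖K p.1 p.2 a‖ ^ 2, by positivity, fun F s v => ?_⟩
  rw [Finset.sum_mul]
  refine (Finset.sum_le_sum fun p _ => ?_).trans
    (Finset.sum_le_sum_of_subset_of_nonneg (Finset.subset_univ F) fun _ _ _ => by positivity)
  have h1 : ‖∑ a ∈ s, K p.1 p.2 a * v a‖ ≤ ∑ a ∈ s, ‖K p.1 p.2 a‖ * ‖v a‖ :=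
    (norm_sum_le _ _).trans (Finset.sum_le_sum fun _ _ => (norm_mul _ _).le)
  calc ‖∑ a ∈ s, K p.1 p.2 a * v a‖ ^ 2 ≤ (∑ a ∈ s, ‖K p.1 p.2 a‖ * ‖v a‖) ^ 2 := by gcongr
    _ ≤ (∑ a ∈ s, ‖K p.1 p.2 a‖ ^ 2) * ∑ a ∈ s, ‖v a‖ ^ 2 := Finset.sum_mul_sq_le_sq_mul_sq _ _ _
    _ ≤ _ := by
      gcongr
      exact Finset.subset_univ s

lemma Channel.bdd {ι : Type v} {κ : Type w} (S : Channel.{u} ι κ) : Bdd S.K :=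
  bdd_of_complete S.complete

end Bdd

/-! ### Trace-class operators through Gram decompositions -/

/-- `ρ = ∑ⱼ |vⱼ⟩⟨vⱼ|` with `∑ⱼ ‖vⱼ‖² < ∞`. -/
def IsGram {J ι : Type*} (v : J → ι → ℂ) (ρ : Op ι) : Prop :=
  (Summable fun p : J × ι => ‖v p.1 p.2‖ ^ 2) ∧ ∀ x y, ρ x y = ∑' j, v j x * conj (v j y)

/-- Positive trace-class operators, in the form of an ensemble of unnormalized pure states. -/
def TraceClass {ι : Type*} (ρ : Op ι) : Prop := ∃ (J : Type u) (v : J → ι → ℂ), IsGram v ρ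

section Gram

variable {J e κ ι σ : Type*}

lemma IsGram.summable_vec {v : J → ι → ℂ} {ρ : Op ι} (h : IsGram v ρ) (j : J) :
    Summable fun x => ‖v j x‖ ^ 2 :=
  h.1.comp_injective (i := fun x => (j, x)) fun _ _ hab => (Prod.ext_iff.mp hab).2

lemma IsGram.summable_entry {v : J → ι → ℂ} {ρ : Op ι} (h : IsGram v ρ) (x : ι) :
    Summable fun j => ‖v j x‖ ^ 2 :=
  h.1.comp_injective (i := fun j => (j, x)) fun _ _ hab => (Prod.ext_iff.mp hab).1

lemma IsGram.summable_slice {v : J → ι × σ → ℂ} {ρ : Op (ι × σ)} (h : IsGram v ρ) (s : σ) :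
    Summable fun p : J × ι => ‖v p.1 (p.2, s)‖ ^ 2 :=
  h.1.comp_injective (i := fun p : J × ι => (p.1, (p.2, s))) fun p q hab => by
    simp only [Prod.mk.injEq] at hab
    exact Prod.ext hab.1 hab.2.1

/-- The sandwich `K ρ K†` of a cross-Gram operator, entry by entry. -/
lemma tsum_sandwich {v w : J → ι → ℂ} (hv : Summable fun p : J × ι => ‖v p.1 p.2‖ ^ 2)
    (hw : Summable fun p : J × ι => ‖w p.1 p.2‖ ^ 2) {r t : ι → ℂ}
    (hr : Summable fun a => ‖r a‖ ^ 2) (ht : Summable fun a => ‖t a‖ ^ 2) :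
    ∑' a, ∑' b, r a * (∑' j, v j a * conj (w j b)) * conj (t b) =
      ∑' j, (∑' a, r a * v j a) * conj (∑' b, t b * w j b) := by
  have hv1 : ∀ a, Summable fun j => ‖v j a‖ ^ 2 := fun a =>
    hv.comp_injective (i := fun j => (j, a)) fun _ _ hab => (Prod.ext_iff.mp hab).1
  have hw1 : ∀ a, Summable fun j => ‖w j a‖ ^ 2 := fun a =>
    hw.comp_injective (i := fun j => (j, a)) fun _ _ hab => (Prod.ext_iff.mp hab).1
  have hw2 : ∀ j, Summable fun b => ‖w j b‖ ^ 2 := fun j =>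
    hw.comp_injective (i := fun b => (j, b)) fun _ _ hab => (Prod.ext_iff.mp hab).2
  -- the `b`-sum and the `j`-sum commute for fixed `a`
  have h1 : ∀ a, ∑' b, r a * (∑' j, v j a * conj (w j b)) * conj (t b) =
      ∑' j, r a * v j a * conj (∑' b, t b * w j b) := by
    intro a
    have hs : Summable (Function.uncurry fun (b : ι) (j : J) =>
        r a * v j a * conj (t b * w j b)) := by
      have e0 : Summable fun j => ‖r a * v j a‖ ^ 2 := by
        simpa [mul_pow] using (hv1 a).mul_left (‖r a‖ ^ 2)
      have e1 := summable_sq_mul_prod e0 (summable_conj_sq ht)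
      have e2 := summable_mul_of_sq e1 (summable_conj_sq hw)
      refine ((Equiv.prodComm ι J).summable_iff.mpr e2).congr fun p => ?_
      simp only [Function.comp_apply, Equiv.prodComm_apply, Prod.fst_swap, Prod.snd_swap,
        Function.uncurry, map_mul, mul_assoc]
    have e3 : ∀ j, r a * v j a * conj (∑' b, t b * w j b) =
        ∑' b, r a * v j a * conj (t b * w j b) := fun j => by
      rw [tsum_mul_left, Complex.conj_tsum]
    simp_rw [e3]
    have e4 := hs.tsum_comm
    rw [e4]
    refine tsum_congr fun b => ?_
    rw [mul_assoc, ← tsum_mul_right, ← tsum_mul_left]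
    refine tsum_congr fun j => ?_
    rw [map_mul]; ring
  simp_rw [h1]
  have hβ : Summable fun j => ‖∑' b, t b * w j b‖ ^ 2 := by
    have e1 : ∀ j, ‖∑' b, t b * w j b‖ ^ 2 ≤ (∑' b, ‖t b‖ ^ 2) * ∑' b, ‖w j b‖ ^ 2 := by
      intro j
      exact norm_tsum_mul_sq_le ht (hw2 j)
    refine Summable.of_nonneg_of_le (fun _ => by positivity) e1 ?_
    exact (((summable_prod_of_nonneg fun _ => by positivity).mp hw).2).mul_left _
  have hs2 : Summable (Function.uncurry fun (a : ι) (j : J) =>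
      r a * v j a * conj (∑' b, t b * w j b)) := by
    have e1 := summable_sq_mul_prod hr (summable_conj_sq hβ)
    have e2 : Summable fun p : ι × J => ‖v p.2 p.1‖ ^ 2 :=
      (Equiv.prodComm ι J).summable_iff.mpr hv
    refine (summable_mul_of_sq e1 e2).congr fun p => ?_
    simp only [Function.uncurry]; ring
  rw [← hs2.tsum_comm]
  refine tsum_congr fun j => ?_
  rw [tsum_mul_right]

end Gram

section Gram

variable {J e κ ι σ : Type*} {K : e → Matrix κ ι ℂ}

lemma IsGram.summable_act {v : J → ι × σ → ℂ} {ρ : Op (ι × σ)} (h : IsGram v ρ) (hK : Bdd K) :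
    Summable fun p : (e × J) × (κ × σ) =>
      ‖∑' a, K p.1.1 p.2.1 a * v p.1.2 (a, p.2.2)‖ ^ 2 := by
  have hv : ∀ j s, Summable fun a => ‖v j (a, s)‖ ^ 2 := fun j s =>
    (h.summable_vec j).comp_injective (i := fun a => (a, s)) fun _ _ hab => (Prod.ext_iff.mp hab).1
  obtain ⟨C, -, hC⟩ := hK.exists_bound
  have h2 : Summable fun p : (J × σ) × ι => ‖v p.1.1 (p.2, p.1.2)‖ ^ 2 :=
    h.1.comp_injective (i := fun p : (J × σ) × ι => (p.1.1, (p.2, p.1.2))) fun p q hab => by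
      simp only [Prod.mk.injEq] at hab
      exact Prod.ext (Prod.ext hab.1 hab.2.2) hab.2.1
  have h3 := ((summable_prod_of_nonneg fun _ => by positivity).mp h2).2
  have h4 := h3.mul_left C
  have h5 : Summable fun p : J × σ =>
      ∑' q : e × κ, ‖∑' a, K q.1 q.2 a * v p.1 (a, p.2)‖ ^ 2 :=
    Summable.of_nonneg_of_le (fun p => tsum_nonneg fun _ => by positivity)
      (fun p => (hC _ (hv p.1 p.2)).2) h4
  have h1 : Summable fun q : (J × σ) × (e × κ) =>
      ‖∑' a, K q.2.1 q.2.2 a * v q.1.1 (a, q.1.2)‖ ^ 2 :=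
    (summable_prod_of_nonneg fun _ => by positivity).mpr
      ⟨fun p => (hC _ (hv p.1 p.2)).1, h5⟩
  exact h1.comp_injective
    (i := fun p : (e × J) × (κ × σ) => ((p.1.2, p.2.2), (p.1.1, p.2.1))) fun p q hab => by
      simp only [Prod.mk.injEq] at hab
      exact Prod.ext (Prod.ext hab.2.1 hab.1.1) (Prod.ext hab.2.2 hab.1.2)

/-- Kraus operators act on the vectors of a Gram decomposition. -/
lemma IsGram.act {v : J → ι × σ → ℂ} {ρ : Op (ι × σ)} (h : IsGram v ρ) (hK : Bdd K) :
    IsGram (fun (p : e × J) (x : κ × σ) => ∑' a, K p.1 x.1 a * v p.2 (a, x.2)) (act K ρ) := by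
  have hsum := h.summable_act hK
  refine ⟨hsum, fun x y => ?_⟩
  have hent : ∀ x : κ × σ, Summable fun p : e × J =>
      ‖∑' a, K p.1 x.1 a * v p.2 (a, x.2)‖ ^ 2 := fun x =>
    hsum.comp_injective (i := fun p => (p, x)) fun _ _ hab => (Prod.ext_iff.mp hab).1
  have hs := summable_mul_of_sq (hent x) (summable_conj_sq (hent y))
  have h0 : QKD.act K ρ x y = ∑' k, ∑' a, ∑' b, K k x.1 a *
      (∑' j, v j (a, x.2) * conj (v j (b, y.2))) * conj (K k y.1 b) :=
    tsum_congr fun k => tsum_congr fun a => tsum_congr fun b => by rw [h.2]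
  have h1 : ∀ k, ∑' a, ∑' b, K k x.1 a *
      (∑' j, v j (a, x.2) * conj (v j (b, y.2))) * conj (K k y.1 b) =
        ∑' j, (∑' a, K k x.1 a * v j (a, x.2)) * conj (∑' b, K k y.1 b * v j (b, y.2)) :=
    fun k => tsum_sandwich (v := fun j a => v j (a, x.2)) (w := fun j a => v j (a, y.2))
      (r := K k x.1) (t := K k y.1) (h.summable_slice x.2) (h.summable_slice y.2)
      (hK.summable_row k x.1) (hK.summable_row k y.1)
  rw [h0]
  simp_rw [h1]
  exact hs.tsum_prod.symm

end Gram

section TraceClass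

variable {e : Type u} {κ ι σ I O : Type*} {K : e → Matrix κ ι ℂ}

lemma TraceClass.act {e : Type v} {K : e → Matrix κ ι ℂ} {ρ : Op (ι × σ)}
    (h : TraceClass.{max u v} ρ) (hK : Bdd K) : TraceClass.{max u v} (act K ρ) := by
  obtain ⟨J, v, hv⟩ := h
  exact ⟨_, _, hv.act hK⟩

lemma TraceClass.submatrix {X Y : Type*} {ρ : Op X} (h : TraceClass.{u} ρ) {f : Y → X}
    (hf : Function.Injective f) : TraceClass.{u} (ρ.submatrix f f) := by
  obtain ⟨J, v, hv⟩ := h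
  refine ⟨J, fun j y => v j (f y), ?_, fun x y => hv.2 _ _⟩
  exact hv.1.comp_injective (i := fun p : J × Y => (p.1, f p.2)) fun p q hab => by
    simp only [Prod.mk.injEq] at hab
    exact Prod.ext hab.1 (hf hab.2)

lemma TraceClass.actOn {e : Type v} {K : e → Matrix κ ι ℂ} {inp : ι × σ → I} {out : O → κ × σ}
    {ρ : Op I} (h : TraceClass.{max u v} ρ) (hK : Bdd K) (hi : Function.Injective inp)
    (ho : Function.Injective out) : TraceClass.{max u v} (actOn K inp out ρ) :=
  ((h.submatrix hi).act hK).submatrix ho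

end TraceClass

/-! ### Tracing out a spectator -/

/-- `ρ'` is the reduced operator of `ρ` when the system labelled by `r` is traced out. -/
def TrRel {X X' R : Type*} (f : X' → R → X) (ρ : Op X) (ρ' : Op X') : Prop :=
  ∀ x y, ρ' x y = ∑' r, ρ (f x r) (f y r)

section TrRel

variable {e κ ι σ σ' I O I' O' X X' R : Type*} {K : e → Matrix κ ι ℂ}

lemma IsGram.trace {J : Type*} {v : J → X → ℂ} {ρ : Op X} (h : IsGram v ρ) {f : X' → R → X}
    (hf : Function.Injective fun p : X' × R => f p.1 p.2) {ρ' : Op X'} (hρ : TrRel f ρ ρ') :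
    IsGram (fun (p : J × R) x => v p.1 (f x p.2)) ρ' := by
  have hs : Summable fun p : (J × R) × X' => ‖v p.1.1 (f p.2 p.1.2)‖ ^ 2 :=
    h.1.comp_injective (i := fun p : (J × R) × X' => (p.1.1, f p.2 p.1.2)) fun p q hab => by
      simp only [Prod.mk.injEq] at hab
      have := @hf (p.2, p.1.2) (q.2, q.1.2) hab.2
      simp only [Prod.mk.injEq] at this
      exact Prod.ext (Prod.ext hab.1 this.2) this.1
  refine ⟨hs, fun x y => ?_⟩
  have hent : ∀ x : X', Summable fun p : J × R => ‖v p.1 (f x p.2)‖ ^ 2 := fun x =>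
    hs.comp_injective (i := fun p => (p, x)) fun _ _ hab => (Prod.ext_iff.mp hab).1
  have h2 := summable_mul_of_sq (hent x) (summable_conj_sq (hent y))
  have h3 : Summable (Function.uncurry fun (j : J) (r : R) =>
      v j (f x r) * conj (v j (f y r))) := h2
  rw [hρ x y, h2.tsum_prod]
  simp only [h.2]
  exact h3.tsum_comm

lemma TraceClass.trace {X X' : Type*} {R : Type v} {ρ : Op X} (h : TraceClass.{max u v} ρ)
    {f : X' → R → X} (hf : Function.Injective fun p : X' × R => f p.1 p.2) {ρ' : Op X'}
    (hρ : TrRel f ρ ρ') : TraceClass.{max u v} ρ' := by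
  obtain ⟨J, v, hv⟩ := h
  exact ⟨_, _, hv.trace hf hρ⟩

lemma TrRel.act {g : σ' → R → σ} (hg : Function.Injective fun p : σ' × R => g p.1 p.2)
    {ρ : Op (ι × σ)} {ρ' : Op (ι × σ')} (hρ : TraceClass.{u} ρ) (hK : Bdd K)
    (h : TrRel (fun x r => (x.1, g x.2 r)) ρ ρ') :
    TrRel (fun x r => (x.1, g x.2 r)) (act K ρ) (act K ρ') := by
  obtain ⟨J, v, hv⟩ := hρ
  have hinj : ∀ α : Type _, Function.Injective fun p : (α × σ') × R => (p.1.1, g p.1.2 p.2) := by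
    intro α p q hpq
    simp only [Prod.mk.injEq] at hpq
    have := @hg (p.1.2, p.2) (q.1.2, q.2) hpq.2
    simp only [Prod.mk.injEq] at this
    exact Prod.ext (Prod.ext hpq.1 this.1) this.2
  have h1 := (hv.trace (hinj ι) h).act hK
  intro x y
  have h2 := (hv.act hK).trace (X' := κ × σ') (f := fun x r => (x.1, g x.2 r))
    (fun p q hpq => by
      simp only [Prod.mk.injEq] at hpq
      have := @hg (p.1.2, p.2) (q.1.2, q.2) hpq.2
      simp only [Prod.mk.injEq] at this
      exact Prod.ext (Prod.ext hpq.1 this.1) this.2) (fun _ _ => rfl)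
  exact (h1.2 x y).trans (((Equiv.prodAssoc e J R).tsum_eq _).symm.trans (h2.2 x y).symm)

lemma TrRel.actOn {g : σ' → R → σ} (hg : Function.Injective fun p : σ' × R => g p.1 p.2)
    {inp : ι × σ → I} {out : O → κ × σ} {inp' : ι × σ' → I'} {out' : O' → κ × σ'}
    {fI : I' → R → I} {fO : O' → R → O} {ρ : Op I} {ρ' : Op I'} (hρ : TraceClass.{u} ρ)
    (hK : Bdd K) (h : TrRel fI ρ ρ') (hi : Function.Injective inp)
    (hinp : ∀ a s r, inp (a, g s r) = fI (inp' (a, s)) r)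
    (hout : ∀ o r, out (fO o r) = ((out' o).1, g (out' o).2 r)) :
    TrRel fO (actOn K inp out ρ) (actOn K inp' out' ρ') := by
  have h1 : TrRel (fun x r => (x.1, g x.2 r)) (ρ.submatrix inp inp) (ρ'.submatrix inp' inp') := by
    intro x y
    simp only [Matrix.submatrix_apply]
    rw [h]
    exact tsum_congr fun r => by rw [hinp, hinp]
  intro x y
  have h2 := h1.act hg (hρ.submatrix hi) hK (out' x) (out' y)
  simp only [QKD.actOn, Matrix.submatrix_apply]
  rw [h2]
  exact tsum_congr fun r => by rw [hout, hout]

end TrRel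

/-! ### Dephasing of classical labels -/

/-- The matrix elements of `ρ` between labels that agree in `lab`. -/
def dephase {X C : Type*} (lab : X → C) (ρ : Op X) : Op X :=
  fun x y => if lab x = lab y then ρ x y else 0

section Dephase

variable {e κ ι σ X C : Type*} {K : e → Matrix κ ι ℂ}

lemma act_dephase (lab : σ → C) (ρ : Op (ι × σ)) :
    act K (dephase (fun x => lab x.2) ρ) = dephase (fun x => lab x.2) (act K ρ) := by
  funext x y
  by_cases h : lab x.2 = lab y.2 <;> simp [act, dephase, h]

lemma TraceClass.dephase {X : Type*} {C : Type v} {ρ : Op X} (h : TraceClass.{max u v} ρ)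
    (lab : X → C) : TraceClass.{max u v} (dephase lab ρ) := by
  obtain ⟨J, v, hv⟩ := h
  refine ⟨J × C, fun p x => if lab x = p.2 then v p.1 x else 0, ?_, fun x y => ?_⟩
  · have hinj : Function.Injective fun p : J × X => ((p.1, lab p.2), p.2) := fun p q hpq => by
      simp only [Prod.mk.injEq] at hpq
      exact Prod.ext hpq.1.1 hpq.2
    refine (hinj.summable_iff fun q hq => ?_).mp (hv.1.congr fun p => by simp)
    have : lab q.2 ≠ q.1.2 := fun hc => hq ⟨(q.1.1, q.2), by simp [hc]⟩
    simp [this]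
  · have hinj : Function.Injective fun j : J => (j, lab x) := fun p q hpq => by
      simpa using hpq
    rw [← hinj.tsum_eq]
    · by_cases hxy : lab x = lab y
      · simp [QKD.dephase, hxy, hv.2]
      · simp [QKD.dephase, hxy, Ne.symm hxy]
    · intro q hq
      by_contra hn
      have : lab x ≠ q.2 := fun hc => hn ⟨q.1, by simp [hc]⟩
      simp [this] at hq

/-- Nonzero entries of the output of a Kraus family come from nonzero entries of its input. -/
lemma exists_of_act_ne_zero {ρ : Op (ι × σ)} {x y : κ × σ} (h : act K ρ x y ≠ 0) :
    ∃ k a b, K k x.1 a ≠ 0 ∧ K k y.1 b ≠ 0 ∧ ρ (a, x.2) (b, y.2) ≠ 0 := by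
  by_contra hn
  push Not at hn
  refine h ?_
  have h0 : ∀ k a b, K k x.1 a * ρ (a, x.2) (b, y.2) * conj (K k y.1 b) = 0 := by
    intro k a b
    by_cases h1 : K k x.1 a = 0
    · rw [h1, zero_mul, zero_mul]
    by_cases h2 : K k y.1 b = 0
    · rw [h2, map_zero, mul_zero]
    · rw [hn k a b h1 h2, mul_zero, zero_mul]
  have h1 : act K ρ x y = ∑' _ : e, ∑' _ : ι, ∑' _ : ι, (0 : ℂ) :=
    tsum_congr fun k => tsum_congr fun a => tsum_congr fun b => h0 k a b
  rw [h1]; simp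

end Dephase

/-! ### Bounded operators on `ℓ²` -/

/-- The Hilbert space `ℓ²(ι)`. -/
abbrev L2 (ι : Type*) := lp (fun _ : ι => ℂ) 2

section L2

variable {e ι : Type*}

/-- A square-summable family as a vector of `ℓ²`. -/
def toL2 (f : ι → ℂ) (hf : Summable fun a => ‖f a‖ ^ 2) : L2 ι :=
  ⟨f, memℓp_gen (by simpa using hf)⟩

lemma toL2_apply (f : ι → ℂ) (hf : Summable fun a => ‖f a‖ ^ 2) (a : ι) : toL2 f hf a = f a := rfl

lemma l2_summable (f : L2 ι) : Summable fun a => ‖f a‖ ^ 2 := by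
  have := (lp.memℓp f).summable (by simp)
  simpa using this

lemma l2_norm_sq (f : L2 ι) : ‖f‖ ^ 2 = ∑' a, ‖f a‖ ^ 2 := by
  have := lp.norm_rpow_eq_tsum (p := 2) (by simp) f
  simpa using this

lemma l2_inner_eq (f g : L2 ι) : inner ℂ f g = ∑' a, conj (f a) * g a := by
  rw [lp.inner_eq_tsum]
  exact tsum_congr fun a => by rw [RCLike.inner_apply, mul_comm]

/-- The basis vector of the label `a`. -/
def ket (a : ι) : L2 ι := lp.single 2 a (1 : ℂ)

lemma inner_ket (a : ι) (f : L2 ι) : inner ℂ (ket a) f = f a := by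
  rw [ket, lp.inner_single_left]; simp

lemma l2_hasSum (f : L2 ι) : HasSum (fun a => f a • ket a) f := by
  have := lp.hasSum_single (p := 2) (by simp) f
  convert this using 2 with a
  rw [ket, ← lp.single_smul, smul_eq_mul, mul_one]

lemma ket_apply (a b : ι) : ket a b = if b = a then (1 : ℂ) else 0 := by
  rw [ket, lp.single_apply]
  by_cases h : b = a
  · subst h; simp
  · simp [h]

/-- The operator of a bounded matrix. -/
def Bdd.toCLM {A : Matrix e ι ℂ} (hA : Bdd fun _ : Unit => A) : L2 ι →L[ℂ] L2 e :=
  LinearMap.mkContinuousOfExistsBound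
    { toFun := fun v => toL2 (fun k => ∑' a, A k a * v a)
        ((hA.summable_image (l2_summable v)).comp_injective (i := fun k => ((), k))
          fun _ _ h => (Prod.ext_iff.mp h).2)
      map_add' := fun v w => by
        ext k
        simp only [toL2_apply, lp.coeFn_add, Pi.add_apply, mul_add]
        exact (hA.summable_mul (l2_summable v) () k).tsum_add (hA.summable_mul (l2_summable w) () k)
      map_smul' := fun c v => by
        ext k
        simp only [toL2_apply, lp.coeFn_smul, Pi.smul_apply, smul_eq_mul, RingHom.id_apply]
        rw [← tsum_mul_left]
        exact tsum_congr fun a => by ring }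
    (by
      obtain ⟨C, hC, h⟩ := hA.exists_bound
      refine ⟨Real.sqrt C, fun v => ?_⟩
      refine le_of_sq_le_sq ?_ (by positivity)
      rw [mul_pow, Real.sq_sqrt hC, l2_norm_sq, l2_norm_sq]
      have h1 := (h v (l2_summable v)).2
      rw [← (Equiv.punitProd e : Unit × e ≃ e).symm.tsum_eq] at h1
      exact h1)

lemma Bdd.toCLM_apply {A : Matrix e ι ℂ} (hA : Bdd fun _ : Unit => A) (v : L2 ι) (k : e) :
    hA.toCLM v k = ∑' a, A k a * v a := rfl

lemma Bdd.toCLM_ket {A : Matrix e ι ℂ} (hA : Bdd fun _ : Unit => A) (a : ι) (k : e) :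
    hA.toCLM (ket a) k = A k a := by
  rw [Bdd.toCLM_apply, tsum_eq_single a]
  · simp [ket_apply]
  · intro b hb; simp [ket_apply, hb]

lemma clm_apply_eq (B : L2 ι →L[ℂ] L2 e) (v : L2 ι) (k : e) :
    HasSum (fun a => B (ket a) k * v a) (B v k) := by
  have h1 := ((innerSL ℂ (ket k)).comp B).hasSum (l2_hasSum v)
  simpa [inner_ket, mul_comm] using h1

lemma bdd_of_clm (B : L2 ι →L[ℂ] L2 e) : Bdd (fun _ : Unit => fun k a => B (ket a) k) := by
  refine ⟨‖B‖ ^ 2, by positivity, fun F s v => ?_⟩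
  set z : L2 ι := ∑ a ∈ s, v a • ket a with hz
  have h1 : ∀ k, ∑ a ∈ s, B (ket a) k * v a = B z k := by
    intro k
    rw [hz, map_sum, lp.coeFn_sum, Finset.sum_apply]
    exact Finset.sum_congr rfl fun a _ => by simp [mul_comm]
  have h2 : ‖z‖ ^ 2 = ∑ a ∈ s, ‖v a‖ ^ 2 := by
    have hza : ∀ a, z a = if a ∈ s then v a else 0 := by
      intro a
      rw [hz, lp.coeFn_sum, Finset.sum_apply]
      simp [ket_apply]
    rw [l2_norm_sq, tsum_eq_sum (s := s)]
    · exact Finset.sum_congr rfl fun a ha => by rw [hza, if_pos ha]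
    · intro a ha; simp [hza, ha]
  simp only [h1]
  rw [← h2, ← mul_pow]
  have h3 : ∑ p ∈ F, ‖B z p.2‖ ^ 2 ≤ ‖B z‖ ^ 2 := by
    rw [l2_norm_sq, ← (Equiv.punitProd e : Unit × e ≃ e).tsum_eq]
    exact (((Equiv.punitProd e : Unit × e ≃ e).summable_iff.mpr (l2_summable (B z)))).sum_le_tsum F
      fun _ _ => by positivity
  exact h3.trans (by gcongr; exact B.le_opNorm z)

end L2

section Dual

variable {J e κ ι σ : Type*} {K : e → Matrix κ ι ℂ}

/-- Interchange of two sums of which only the products are square-summable. -/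
lemma tsum_half {v : J → ι → ℂ} (hv : Summable fun p : J × ι => ‖v p.1 p.2‖ ^ 2) {c : J → ℂ}
    (hc : Summable fun j => ‖c j‖ ^ 2) {r : ι → ℂ} (hr : Summable fun a => ‖r a‖ ^ 2) :
    ∑' b, r b * (∑' j, v j b * conj (c j)) = ∑' j, (∑' b, r b * v j b) * conj (c j) := by
  have hs2 : Summable (Function.uncurry fun (a : ι) (j : J) => r a * (v j a * conj (c j))) := by
    have e1 := summable_sq_mul_prod hr (summable_conj_sq hc)
    have e2 : Summable fun p : ι × J => ‖v p.2 p.1‖ ^ 2 :=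
      (Equiv.prodComm ι J).summable_iff.mpr hv
    refine (summable_mul_of_sq e1 e2).congr fun p => ?_
    simp only [Function.uncurry]; ring
  simp_rw [← tsum_mul_left, ← tsum_mul_right]
  rw [← hs2.tsum_comm]
  exact tsum_congr fun j => tsum_congr fun b => by ring

lemma Bdd.output (hK : Bdd K) (x : κ) : Bdd (fun _ : Unit => fun k a => K k x a) := by
  obtain ⟨C, hC, h⟩ := hK
  refine ⟨C, hC, fun F s v => ?_⟩
  have hinj : Function.Injective fun p : Unit × e => (p.2, x) := fun p q hpq => by
    simp only [Prod.mk.injEq, and_true] at hpq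
    exact Prod.ext rfl hpq
  have := h (F.map ⟨_, hinj⟩) s v
  simpa using this

/-- Diagonal output entries of a bounded Kraus family in the Heisenberg picture. -/
lemma act_diag_eq {ρ : Op (ι × σ)} (hρ : TraceClass.{u} ρ) (hK : Bdd K) (x : κ) {W : Op ι}
    (hW : ∀ a b, W a b = ∑' k, conj (K k x a) * K k x b) (s t : σ) :
    act K ρ (x, s) (x, t) = ∑' a, ∑' b, W a b * ρ (b, s) (a, t) := by
  obtain ⟨J, v, hv⟩ := hρ
  have hA := hK.output x
  set T := hA.toCLM with hT
  set B : L2 ι →L[ℂ] L2 ι := (ContinuousLinearMap.adjoint T).comp T with hB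
  have hBW : ∀ a b, B (ket b) a = W a b := by
    intro a b
    rw [← inner_ket, hB, ContinuousLinearMap.comp_apply, ContinuousLinearMap.adjoint_inner_right,
      l2_inner_eq, hW]
    exact tsum_congr fun k =>
      congrArg₂ (fun p q => conj p * q) (hA.toCLM_ket a k) (hA.toCLM_ket b k)
  have hWb : Bdd (fun _ : Unit => W) := by
    have := bdd_of_clm B
    simpa only [hBW] using this
  have hvs : ∀ j s, Summable fun a => ‖v j (a, s)‖ ^ 2 := fun j s =>
    (hv.summable_vec j).comp_injective (i := fun a => (a, s)) fun _ _ hab => (Prod.ext_iff.mp hab).1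
  have hsum := hv.summable_act hK
  have hent : ∀ s : σ, Summable fun p : e × J =>
      ‖∑' a, K p.1 x a * v p.2 (a, s)‖ ^ 2 := fun s =>
    hsum.comp_injective (i := fun p => (p, (x, s))) fun _ _ hab => (Prod.ext_iff.mp hab).1
  have hs := summable_mul_of_sq (hent s) (summable_conj_sq (hent t))
  have hcomm : Summable (Function.uncurry fun (k : e) (j : J) =>
    (∑' a, K k x a * v j (a, s)) * conj (∑' a, K k x a * v j (a, t))) := hs
  have h1 : act K ρ (x, s) (x, t) =
      ∑' j, ∑' k, (∑' a, K k x a * v j (a, s)) * conj (∑' a, K k x a * v j (a, t)) := by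
    rw [(hv.act hK).2, hs.tsum_prod]
    exact hcomm.tsum_comm.symm
  have h2 : ∀ j, ∑' k, (∑' a, K k x a * v j (a, s)) * conj (∑' a, K k x a * v j (a, t)) =
      ∑' a, (∑' b, W a b * v j (b, s)) * conj (v j (a, t)) := by
    intro j
    have e1 : inner ℂ (T (toL2 _ (hvs j t))) (T (toL2 _ (hvs j s))) =
        inner ℂ (toL2 _ (hvs j t)) (B (toL2 _ (hvs j s))) := by
      rw [hB, ContinuousLinearMap.comp_apply, ContinuousLinearMap.adjoint_inner_right]
    rw [l2_inner_eq, l2_inner_eq] at e1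
    refine Eq.trans (tsum_congr fun k => ?_) (e1.trans (tsum_congr fun a => ?_))
    · rw [mul_comm]; rfl
    · rw [mul_comm, ← (clm_apply_eq B _ a).tsum_eq]
      simp only [hBW, toL2_apply]
  have h3 : ∀ a, ∑' b, W a b * ρ (b, s) (a, t) =
      ∑' j, (∑' b, W a b * v j (b, s)) * conj (v j (a, t)) := by
    intro a
    simp only [hv.2]
    exact tsum_half (v := fun j a => v j (a, s)) (hv.summable_slice s)
      (hv.summable_entry (a, t)) (hWb.summable_row () a)
  have h4 : Summable (Function.uncurry fun (a : ι) (j : J) =>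
      (∑' b, W a b * v j (b, s)) * conj (v j (a, t))) := by
    have e1 := hv.summable_act hWb
    have e2 : Summable fun p : ι × J => ‖∑' b, W p.1 b * v p.2 (b, s)‖ ^ 2 :=
      e1.comp_injective (i := fun p : ι × J => (((), p.2), (p.1, s))) fun p q hpq => by
        simp only [Prod.mk.injEq, true_and, and_true] at hpq
        exact Prod.ext hpq.2 hpq.1
    have e3 : Summable fun p : ι × J => ‖v p.2 (p.1, t)‖ ^ 2 :=
      (Equiv.prodComm ι J).summable_iff.mpr (hv.summable_slice t)
    exact summable_mul_of_sq e2 (summable_conj_sq e3)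
  rw [h1]
  simp_rw [h2, h3]
  exact h4.tsum_comm

end Dual

/-! ### States have Gram decompositions -/

section Sqrt

variable {ι : Type u}

lemma norm_sq_le_of_posSemidef {ρ : Op ι} (h : ρ.PosSemidef) (a b : ι) :
    ‖ρ a b‖ ^ 2 ≤ (ρ a a).re * (ρ b b).re := by
  have h1 := (h.submatrix (fun i : Fin 2 => if i = 0 then a else b)).det_nonneg
  rw [Matrix.det_fin_two] at h1
  simp only [Matrix.submatrix_apply, if_true, one_ne_zero, if_false] at h1
  have ha := (Complex.nonneg_iff.mp (h.diag_nonneg (i := a))).2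
  have hb := (Complex.nonneg_iff.mp (h.diag_nonneg (i := b))).2
  have hba : ρ b a = conj (ρ a b) := (h.1.apply b a).symm
  rw [hba, Complex.mul_conj] at h1
  have h2 := (Complex.nonneg_iff.mp h1).1
  simp only [Complex.sub_re, Complex.mul_re, ← ha, ← hb, Complex.ofReal_re] at h2
  rw [← Complex.normSq_eq_norm_sq]
  linarith

/-- A state is a bounded matrix, by the Cauchy–Schwarz inequality for positive matrices. -/
lemma IsState.bdd {ρ : Op ι} (h : IsState ρ) : Bdd (fun _ : Unit => ρ) := by
  have hd : HasSum (fun i => (ρ i i).re) 1 := by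
    have := Complex.hasSum_re h.2
    simpa using this
  have hd0 : ∀ i, 0 ≤ (ρ i i).re := fun i => (Complex.nonneg_iff.mp (h.1.diag_nonneg (i := i))).1
  refine ⟨1, zero_le_one, fun F s v => ?_⟩
  have h1 : ∀ x, ‖∑ a ∈ s, ρ x a * v a‖ ^ 2 ≤ (ρ x x).re * ∑ a ∈ s, ‖v a‖ ^ 2 := by
    intro x
    calc ‖∑ a ∈ s, ρ x a * v a‖ ^ 2 ≤ (∑ a ∈ s, ‖ρ x a‖ * ‖v a‖) ^ 2 := by
          gcongr
          exact (norm_sum_le _ _).trans (Finset.sum_le_sum fun _ _ => (norm_mul _ _).le)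
      _ ≤ (∑ a ∈ s, ‖ρ x a‖ ^ 2) * ∑ a ∈ s, ‖v a‖ ^ 2 := Finset.sum_mul_sq_le_sq_mul_sq _ _ _
      _ ≤ (∑ a ∈ s, (ρ x x).re * (ρ a a).re) * ∑ a ∈ s, ‖v a‖ ^ 2 := by
          gcongr with a
          exact norm_sq_le_of_posSemidef h.1 x a
      _ ≤ _ := by
          rw [← Finset.mul_sum]
          have := sum_le_hasSum s (fun i _ => hd0 i) hd
          have h2 : (ρ x x).re * ∑ a ∈ s, (ρ a a).re ≤ (ρ x x).re * 1 :=
            mul_le_mul_of_nonneg_left this (hd0 x)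
          rw [mul_one] at h2
          gcongr
  calc _ ≤ ∑ p ∈ F, (ρ p.2 p.2).re * ∑ a ∈ s, ‖v a‖ ^ 2 := Finset.sum_le_sum fun p _ => h1 p.2
    _ ≤ _ := by
      rw [← Finset.sum_mul]
      have h2 : HasSum (fun p : Unit × ι => (ρ p.2 p.2).re) 1 :=
        ((Equiv.punitProd ι : Unit × ι ≃ ι).hasSum_iff).mpr hd
      have := sum_le_hasSum F (fun i _ => hd0 i.2) h2
      gcongr

/-- The operator of a state is positive; finitely supported vectors are dense. -/
lemma IsState.isPositive {ρ : Op ι} (h : IsState ρ) : h.bdd.toCLM.IsPositive := by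
  set B := h.bdd.toCLM with hB
  have key : ∀ v : L2 ι, (0 : ℂ) ≤ inner ℂ v (B v) := by
    intro v
    have ht : Filter.Tendsto (fun s : Finset ι => ∑ a ∈ s, v a • ket a) Filter.atTop (nhds v) :=
      l2_hasSum v
    have ht2 := ht.inner (𝕜 := ℂ) ((B.continuous.tendsto v).comp ht)
    refine ge_of_tendsto' ht2 fun s => ?_
    have h1 := h.1.2 (Finsupp.onFinset s (fun a => if a ∈ s then v a else 0) (by
      intro a ha; by_contra hn; simp [hn] at ha))
    rw [Finsupp.onFinset_sum _ (by simp)] at h1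
    have h2 : ∀ a ∈ s, ((Finsupp.onFinset s (fun a => if a ∈ s then v a else 0) (by
        intro a ha; by_contra hn; simp [hn] at ha)).sum fun j xj =>
          star (if a ∈ s then v a else 0) * ρ a j * xj) = ∑ b ∈ s, conj (v a) * ρ a b * v b := by
      intro a ha
      rw [Finsupp.onFinset_sum _ (by simp)]
      exact Finset.sum_congr rfl fun b hb => by simp [ha, hb]
    rw [Finset.sum_congr rfl h2] at h1
    convert h1 using 1
    simp only [Function.comp_apply, map_sum, sum_inner, inner_sum, map_smul, inner_smul_left,
      inner_smul_right, inner_ket]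
    simp only [Finset.mul_sum]
    rw [Finset.sum_comm]
    refine Finset.sum_congr rfl fun a _ => Finset.sum_congr rfl fun b _ => ?_
    have h3 : B (ket b) a = ρ a b := h.bdd.toCLM_ket b a
    rw [h3]; ring
  rw [ContinuousLinearMap.isPositive_iff_complex]
  intro v
  have h1 := Complex.nonneg_iff.mp (key v)
  have h2 : inner ℂ (B v) v = inner ℂ v (B v) := by
    rw [← inner_conj_symm]
    exact Complex.conj_eq_iff_im.mpr h1.2.symm
  rw [h2]
  exact ⟨Complex.ext rfl (by simpa using h1.2), h1.1⟩

lemma exists_selfAdjoint_mul_self_eq {H : Type*} [NormedAddCommGroup H] [InnerProductSpace ℂ H]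
    [CompleteSpace H] {B : H →L[ℂ] H} (hB : B.IsPositive) :
    ∃ S : H →L[ℂ] H, IsSelfAdjoint S ∧ S * S = B := by
  have hpos : 0 ≤ B := (ContinuousLinearMap.nonneg_iff_isPositive B).mpr hB
  exact ⟨CFC.sqrt B, ((ContinuousLinearMap.nonneg_iff_isPositive _).mp
    (CFC.sqrt_nonneg B)).isSelfAdjoint, CFC.sqrt_mul_sqrt_self B hpos⟩

/-- The rows of the square root of a density operator form a Gram decomposition of it. -/
lemma IsState.traceClass {ρ : Op ι} (h : IsState ρ) : TraceClass.{u} ρ := by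
  obtain ⟨S, hSa, hSS⟩ := exists_selfAdjoint_mul_self_eq h.isPositive
  have hent : ∀ x y, ρ x y = inner ℂ (S (ket x)) (S (ket y)) := by
    intro x y
    have h1 : ρ x y = inner ℂ (ket x) ((S * S) (ket y)) := by
      rw [hSS, inner_ket]; exact (h.bdd.toCLM_ket y x).symm
    rw [h1, mul_apply_eq_comp, ← ContinuousLinearMap.adjoint_inner_left,
      hSa.adjoint_eq]
  have hre : HasSum (fun i => (ρ i i).re) 1 := by
    have := Complex.hasSum_re h.2
    simpa using this
  refine ⟨ι, fun j x => conj (S (ket x) j), ?_, fun x y => ?_⟩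
  · have h2 : Summable fun p : ι × ι => ‖S (ket p.1) p.2‖ ^ 2 := by
      refine (summable_prod_of_nonneg fun _ => sq_nonneg _).mpr
        ⟨fun x => l2_summable (S (ket x)), ?_⟩
      refine hre.summable.congr fun x => ?_
      refine Eq.trans ?_ (l2_norm_sq (S (ket x)))
      rw [hent, inner_self_eq_norm_sq_to_K, ← Complex.ofReal_re (‖S (ket x)‖ ^ 2)]
      push_cast
      rfl
    refine ((Equiv.prodComm ι ι).summable_iff.mpr h2).congr fun p => ?_
    rw [RCLike.norm_conj]
    rfl
  · rw [hent, l2_inner_eq]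
    exact tsum_congr fun j => by rw [Complex.conj_conj]

end Sqrt

/-! ### Sums over products -/

lemma hasSum_prod_fintype {α β : Type*} [Fintype β] {f : α × β → ℂ} {g : β → ℂ}
    (h : ∀ x, HasSum (fun k => f (k, x)) (g x)) : HasSum f (∑ x, g x) := by
  have h1 : ∀ x0, HasSum (fun p : α × β => if p.2 = x0 then f p else 0) (g x0) := by
    intro x0
    have hinj : Function.Injective fun k : α => (k, x0) := fun p q hpq => by simpa using hpq
    refine (hinj.hasSum_iff fun p hp => ?_).mp (by simpa [Function.comp_def] using h x0)
    rw [if_neg]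
    rintro rfl
    exact hp ⟨p.1, rfl⟩
  have h2 := hasSum_sum (s := Finset.univ) fun x0 _ => h1 x0
  simpa using h2

lemma hasSum_mul_prod {α β : Type*} {f : α → ℂ} {g : β → ℂ} {s t : ℂ} (hf : HasSum f s)
    (hg : HasSum g t) : HasSum (fun p : α × β => f p.1 * g p.2) (s * t) :=
  hf.mul hg (summable_mul_of_summable_norm hf.summable.norm hg.summable.norm)

lemma hasSum_pi_prod {α : Type*} {n : ℕ} : ∀ {f : Fin n → α → ℂ} {s : Fin n → ℂ},
    (∀ m, HasSum (f m) (s m)) → HasSum (fun e : Fin n → α => ∏ m, f m (e m)) (∏ m, s m) := by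
  induction n with
  | zero =>
    intro f s _
    simp only [Finset.univ_eq_empty, Finset.prod_empty]
    exact hasSum_unique (fun _ : Fin 0 → α => (1 : ℂ))
  | succ n ih =>
    intro f s h
    have h1 : HasSum (fun e : Fin n → α => ∏ m, f m.succ (e m)) (∏ m : Fin n, s m.succ) :=
      ih fun m : Fin n => h m.succ
    have h2 := hasSum_mul_prod (h 0) h1
    rw [Fin.prod_univ_succ, ← (Fin.consEquiv fun _ : Fin (n + 1) => α).hasSum_iff]
    convert h2 using 1
    funext p
    simp [Fin.prod_univ_succ, Fin.consEquiv]

lemma Bdd.summable_col {e κ ι : Type*} {K : e → Matrix κ ι ℂ} (hK : Bdd K) (a : ι) :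
    Summable fun p : e × κ => ‖K p.1 p.2 a‖ ^ 2 := by
  have h0 : Summable fun b : ι => ‖(if b = a then (1 : ℂ) else 0)‖ ^ 2 :=
    summable_of_ne_finset_zero (s := {a}) fun b hb => by simp at hb; simp [hb]
  refine (hK.summable_image h0).congr fun p => ?_
  rw [tsum_eq_single a]
  · simp
  · intro b hb; simp [hb]

lemma Bdd.summable_col_entry {e κ ι : Type*} {K : e → Matrix κ ι ℂ} (hK : Bdd K) (x : κ) (a : ι) :
    Summable fun k => ‖K k x a‖ ^ 2 :=
  (hK.summable_col a).comp_injective (i := fun k => (k, x)) fun p q hpq => by simpa using hpq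

/-! ### Pure states with finite support -/

section Pure

variable {ι : Type*}

lemma isState_pure {w : ι → ℂ} {s : Finset ι} (hs : ∀ a, a ∉ s → w a = 0)
    (hw : ∑ a ∈ s, ‖w a‖ ^ 2 = 1) : IsState (fun x y => w x * conj (w y)) := by
  refine ⟨⟨?_, fun x => ?_⟩, ?_⟩
  · ext a b
    simp only [Matrix.conjTranspose, Matrix.transpose, Matrix.map, Matrix.of_apply, star_mul']
    simp [mul_comm]
  · have : (x.sum fun i xi => x.sum fun j xj => star xi * (w i * conj (w j)) * xj) =
        star (x.sum fun j xj => conj (w j) * xj) * (x.sum fun j xj => conj (w j) * xj) := by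
      simp only [Finsupp.sum, star_sum, Finset.sum_mul_sum]
      refine Finset.sum_congr rfl fun i _ => Finset.sum_congr rfl fun j _ => ?_
      simp; ring
    rw [this]
    exact star_mul_self_nonneg _
  · have h1 : HasSum (fun i => w i * conj (w i)) (∑ a ∈ s, w a * conj (w a)) :=
      hasSum_sum_of_ne_finset_zero fun b hb => by simp [hs b hb]
    convert h1
    rw [← Complex.ofReal_one, ← hw]
    push_cast
    exact Finset.sum_congr rfl fun a _ => by rw [Complex.mul_conj']

/-- A matrix is determined by the expectation values in the pure states of finite support. -/
lemma eq_zero_of_form {D : Op ι}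
    (h : ∀ (s : Finset ι) (w : ι → ℂ), (∀ a, a ∉ s → w a = 0) → ∑ a ∈ s, ‖w a‖ ^ 2 = 1 →
      ∑ a ∈ s, ∑ b ∈ s, D a b * (w b * conj (w a)) = 0) : D = 0 := by
  have hd : ∀ a, D a a = 0 := fun a => by
    have := h {a} (fun b => if b = a then 1 else 0) (by simp) (by simp)
    simpa using this
  ext a b
  by_cases hab : a = b
  · subst hab; exact hd a
  have h2 : ∀ z : ℂ, ‖z‖ = 1 → D a b * z + D b a * conj z = 0 := by
    intro z hz
    have h3 := h {a, b} (fun c => if c = a then (Real.sqrt (1 / 2) : ℂ) else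
      if c = b then (Real.sqrt (1 / 2) : ℂ) * z else 0) (by
        intro c hc; simp only [Finset.mem_insert, Finset.mem_singleton, not_or] at hc
        simp [hc.1, hc.2]) (by
        rw [Finset.sum_pair hab]
        simp only [if_true, if_neg (Ne.symm hab), norm_mul, hz, mul_one, Complex.norm_real,
          Real.norm_eq_abs, sq_abs]
        rw [Real.sq_sqrt (by norm_num)]; norm_num)
    simp only [Finset.sum_pair hab, if_true, if_neg (Ne.symm hab), hd, zero_mul, zero_add,
      add_zero, map_mul, Complex.conj_ofReal] at h3
    have h4 : (Real.sqrt (1 / 2) : ℂ) * (Real.sqrt (1 / 2) : ℂ) = 1 / 2 := by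
      rw [← Complex.ofReal_mul, Real.mul_self_sqrt (by norm_num)]; norm_num
    have h5 : (1 / 2 : ℂ) * (D a b * z + D b a * conj z) = 0 := by
      rw [← h4]; linear_combination h3
    simpa using h5
  have e1 := h2 1 (by simp)
  have e2 := h2 Complex.I (by simp)
  simp only [map_one, mul_one, Complex.conj_I] at e1 e2
  have e3 : Complex.I * (D a b + D a b) = 0 := by linear_combination e2 + Complex.I * e1
  have e4 := (mul_eq_zero.mp e3).resolve_left Complex.I_ne_zero
  simpa using (add_self_eq_zero.mp e4)

end Pure

/-! ### The squashing condition in the Heisenberg picture -/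

section Squash

variable {𝒦 : Type u} {L M : ℕ} (P : Params L M)

/-- The branch of Bob's virtual measurement that yields a given content of `B^CR`. -/
def branchOf : BCR → VirBranch
  | (β, none) => VirBranch.noclick β
  | (Basis.X, some b) => VirBranch.clickX b
  | (Basis.Z, some _) => VirBranch.clickZ

lemma virBranchKraus_eq_zero {br : VirBranch} {x : BCR} (h : br ≠ branchOf x) (o : Option Bit) :
    virBranchKraus P br x o = 0 := by
  obtain ⟨β, b⟩ := x
  cases br with
  | noclick β' =>
    simp only [virBranchKraus, Matrix.smul_apply, ketBra, Prod.mk.injEq, smul_eq_mul, mul_ite,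
      mul_one, mul_zero, ite_eq_right_iff]
    rintro ⟨⟨rfl, rfl⟩, -⟩
    exact absurd rfl h
  | clickX b' =>
    simp only [virBranchKraus, Matrix.smul_apply, Matrix.sum_apply, ketBra, smul_eq_mul]
    rw [Finset.sum_eq_zero, mul_zero]
    intro c _
    rw [if_neg, mul_zero]
    simp only [Prod.mk.injEq]
    rintro ⟨⟨rfl, rfl⟩, -⟩
    exact absurd rfl h
  | clickZ =>
    simp only [virBranchKraus, Matrix.smul_apply, Matrix.sum_apply, ketBra, smul_eq_mul]
    rw [Finset.sum_eq_zero, mul_zero]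
    intro c _
    rw [if_neg]
    simp only [Prod.mk.injEq]
    rintro ⟨⟨rfl, rfl⟩, -⟩
    exact absurd rfl h

/-- The projector tested for the outcome `x`. -/
def outcomeProj : BCR → Op (Option Bit)
  | (_, none) => ketBra none none
  | (β, some b) => pauliProj β b

lemma bit_cases (b : Bit) : b = 0 ∨ b = 1 := by
  revert b; decide

lemma bit_val_one : (1 : Bit).val = 1 := rfl

lemma sum_bit {A : Type*} [AddCommMonoid A] (f : Bit → A) : ∑ b, f b = f 0 + f 1 :=
  Fin.sum_univ_two f

lemma conj_sqrt_mul_sqrt {p : ℝ} (hp : 0 ≤ p) :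
    conj (Real.sqrt p : ℂ) * (Real.sqrt p : ℂ) = p := by
  rw [Complex.conj_ofReal, ← Complex.ofReal_mul, Real.mul_self_sqrt hp]

lemma neg_one_pow_bit_mul (b c : Bit) :
    (-1 : ℂ) ^ (b * c).val = if b = 1 ∧ c = 1 then -1 else 1 := by
  rcases bit_cases b with rfl | rfl <;> rcases bit_cases c with rfl | rfl <;> simp [bit_val_one]

lemma virBranchKraus_branchOf (x : BCR) (o : Option Bit) :
    virBranchKraus P (branchOf x) x o = (Real.sqrt (P.pB x.1) : ℂ) *
      match x, o with
      | (_, none), none => 1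
      | (Basis.X, some b), some c => (if b = 1 ∧ c = 1 then -1 else 1) / (Real.sqrt 2 : ℂ)
      | (Basis.Z, some b), some c => if b = c then 1 else 0
      | _, _ => 0 := by
  obtain ⟨β, _ | b⟩ := x
  · cases o <;> simp [branchOf, virBranchKraus, ketBra]
  · cases β
    · cases o <;> simp [branchOf, virBranchKraus, ketBra, Matrix.sum_apply, ite_and, eq_comm]
    · cases o <;> simp [branchOf, virBranchKraus, ketBra, Matrix.sum_apply, neg_one_pow_bit_mul]

/-- Each outcome of Bob's virtual measurement is a rank-one test of the squashed system. -/
lemma outcomeProj_eq (x : BCR) (o o' : Option Bit) :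
    (P.pB x.1 : ℂ) * outcomeProj x o o' =
      conj (virBranchKraus P (branchOf x) x o) * virBranchKraus P (branchOf x) x o' := by
  rw [virBranchKraus_branchOf, virBranchKraus_branchOf, map_mul, mul_mul_mul_comm,
    conj_sqrt_mul_sqrt (P.pB_nonneg _)]
  congr 1
  have h2 : conj (Real.sqrt 2 : ℂ) * (Real.sqrt 2 : ℂ) = 2 := by
    simpa using conj_sqrt_mul_sqrt (p := 2) (by norm_num)
  have h2' : (Real.sqrt 2 : ℂ) * (Real.sqrt 2 : ℂ) = 2 := by simpa using h2
  have h4 : (Real.sqrt 2 : ℂ)⁻¹ * (Real.sqrt 2 : ℂ)⁻¹ = 1 / 2 := by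
    rw [← mul_inv, h2']; norm_num
  have h3 : ∀ u v : ℂ, u / (Real.sqrt 2 : ℂ) * (v / (Real.sqrt 2 : ℂ)) = u * v / 2 := fun u v => by
    rw [div_mul_div_comm, h2']
  obtain ⟨β, _ | b⟩ := x
  · cases o <;> cases o' <;> simp [outcomeProj, ketBra]
  · cases β <;> rcases bit_cases b with rfl | rfl <;> rcases o with _ | o <;>
      rcases o' with _ | o' <;>
      (try rcases bit_cases o with rfl | rfl) <;> (try rcases bit_cases o' with rfl | rfl) <;>
      simp [outcomeProj, pauliProj, pauli, id2, ketBra, h4, bit_val_one, div_eq_mul_inv] <;>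
      norm_num [h4]

lemma sum_outcomeProj (o o' : Option Bit) :
    ∑ x : BCR, (P.pB x.1 : ℂ) * outcomeProj x o o' = if o = o' then 1 else 0 := by
  have h1 : (P.pB Basis.Z : ℂ) + P.pB Basis.X = 1 := by
    have h := P.pB_sum
    have h0 : (Finset.univ : Finset Basis) = {Basis.Z, Basis.X} := rfl
    rw [h0, Finset.sum_pair (by decide)] at h
    exact_mod_cast h
  have h2 : ∀ β, ∑ b : Option Bit, outcomeProj (β, b) o o' = if o = o' then 1 else 0 := by
    intro β
    rw [Fintype.sum_option, sum_bit]
    have h3 : pauliProj β 0 o o' + pauliProj β 1 o o' = id2 o o' := by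
      simp only [pauliProj, Matrix.smul_apply, Matrix.add_apply, smul_eq_mul, bit_val_one,
        ZMod.val_zero, pow_zero, pow_one]
      ring
    simp only [outcomeProj]
    rw [h3]
    rcases o with _ | o <;> rcases o' with _ | o' <;> simp [ketBra, id2]
  rw [Fintype.sum_prod_type]
  simp only [← Finset.mul_sum, h2]
  rw [← Finset.sum_mul]
  have h0 : (Finset.univ : Finset Basis) = {Basis.Z, Basis.X} := rfl
  rw [h0, Finset.sum_pair (by decide), h1, one_mul]

end Squash

section Pure

variable {e κ ι : Type*} {K : e → Matrix κ ι ℂ}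

lemma Bdd.summable_cross (hK : Bdd K) (o o' : κ) (a b : ι) :
    Summable fun k => K k o a * conj (K k o' b) :=
  summable_mul_of_sq (hK.summable_col_entry o a) (summable_conj_sq (hK.summable_col_entry o' b))

lemma krausMap_pure (hK : Bdd K) {w : ι → ℂ} {s : Finset ι} (hs : ∀ a, a ∉ s → w a = 0)
    (o o' : κ) : krausMap K (fun x y => w x * conj (w y)) o o' =
      ∑ a ∈ s, ∑ b ∈ s, (∑' k, K k o a * conj (K k o' b)) * (w a * conj (w b)) := by
  have h1 : ∀ k, ∑' a, ∑' b, K k o a * (w a * conj (w b)) * conj (K k o' b) =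
      ∑ a ∈ s, ∑ b ∈ s, K k o a * conj (K k o' b) * (w a * conj (w b)) := by
    intro k
    rw [tsum_eq_sum (s := s)]
    · refine Finset.sum_congr rfl fun a _ => ?_
      rw [tsum_eq_sum (s := s)]
      · exact Finset.sum_congr rfl fun b _ => by ring
      · intro b hb; simp [hs b hb]
    · intro a ha; simp [hs a ha]
  unfold krausMap
  simp_rw [h1]
  rw [Summable.tsum_finsetSum]
  · refine Finset.sum_congr rfl fun a _ => ?_
    rw [Summable.tsum_finsetSum]
    · exact Finset.sum_congr rfl fun b _ => tsum_mul_right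
    · exact fun b _ => (hK.summable_cross o o' a b).mul_right _
  · exact fun a _ => summable_sum fun b _ => (hK.summable_cross o o' a b).mul_right _

lemma trMul_pure {E : Op ι} {w : ι → ℂ} {s : Finset ι} (hs : ∀ a, a ∉ s → w a = 0) :
    trMul E (fun x y => w x * conj (w y)) =
      ∑ a ∈ s, ∑ b ∈ s, E a b * (w b * conj (w a)) := by
  unfold trMul
  rw [tsum_eq_sum (s := s)]
  · refine Finset.sum_congr rfl fun a _ => ?_
    rw [tsum_eq_sum (s := s)]
    intro b hb; simp [hs b hb]
  · intro a ha; simp [hs a ha]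

end Pure

lemma sum_comm4 {α β : Type*} [Fintype β] (s : Finset α) (F : α → α → β → β → ℂ) :
    ∑ a ∈ s, ∑ b ∈ s, ∑ o, ∑ o', F a b o o' = ∑ o, ∑ o', ∑ b ∈ s, ∑ a ∈ s, F a b o o' := by
  have h1 : ∀ a, ∑ b ∈ s, ∑ o, ∑ o', F a b o o' = ∑ o, ∑ o', ∑ b ∈ s, F a b o o' := fun a => by
    rw [Finset.sum_comm]
    exact Finset.sum_congr rfl fun o _ => Finset.sum_comm
  simp_rw [h1]
  rw [Finset.sum_comm]
  refine Finset.sum_congr rfl fun o _ => ?_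
  rw [Finset.sum_comm]
  exact Finset.sum_congr rfl fun o' _ => Finset.sum_comm

section Squash

variable {𝒦 : Type u} {L M : ℕ} {P : Params L M} {S : Channel.{u} (BSig 𝒦) (Option Bit)}

lemma sum_ketBra_diag {C : Type*} [Fintype C] (c : C → ℂ) (x : C) :
    (∑ y, c y • ketBra y y) x x = c x := by
  rw [Matrix.sum_apply, Finset.sum_eq_single x]
  · simp [ketBra]
  · intro y _ hy; simp [ketBra, Ne.symm hy]
  · simp

lemma bobMeas_apply (ρ : Op (BSig 𝒦)) (x : BCR) :
    bobMeas P ρ x x = (P.pB x.1 : ℂ) * trMul (measPOVM P x.1 x.2) ρ := by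
  have h := sum_ketBra_diag (fun x : BCR => (P.pB x.1 : ℂ) * trMul (measPOVM P x.1 x.2) ρ) x
  rw [Fintype.sum_prod_type] at h
  exact h

lemma squash_sum_eq (τ : Op (Option Bit)) :
    (∑ β : Basis, ((P.pB β : ℂ) * Matrix.trace (ketBra none none * τ)) •
        ketBra (β, (none : Option Bit)) (β, none)) +
      ∑ b : Bit, ∑ β : Basis, ((P.pB β : ℂ) * Matrix.trace (pauliProj β b * τ)) •
        ketBra (β, some b) (β, some b) =
      ∑ x : BCR, ((P.pB x.1 : ℂ) * Matrix.trace (outcomeProj x * τ)) • ketBra x x := by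
  rw [Fintype.sum_prod_type_right, Fintype.sum_option]
  rfl

/-- The squashing condition on one outcome. -/
lemma squash_condition (hS : IsSquashing P S) {ρ : Op (BSig 𝒦)} (hρ : IsState ρ) (x : BCR) :
    (P.pB x.1 : ℂ) * trMul (measPOVM P x.1 x.2) ρ =
      (P.pB x.1 : ℂ) * Matrix.trace (outcomeProj x * krausMap S.K ρ) := by
  have h := (hS ρ hρ).2
  rw [squash_sum_eq] at h
  have h2 := congrFun (congrFun h x) x
  rwa [bobMeas_apply, sum_ketBra_diag] at h2

/-- The Kraus operator of Bob's virtual measurement that yields `x`, as a functional. -/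
def outcomeRow (P : Params L M) (S : Channel.{u} (BSig 𝒦) (Option Bit)) (x : BCR) (e : S.Env)
    (a : BSig 𝒦) : ℂ :=
  ∑ o, virBranchKraus P (branchOf x) x o * S.K e o a

lemma bobVirKraus_apply (k : VirBranch × S.Env) (x : BCR) (a : BSig 𝒦) :
    bobVirKraus P S k x a = if k.1 = branchOf x then outcomeRow P S x k.2 a else 0 := by
  unfold bobVirKraus outcomeRow
  rw [Matrix.mul_apply]
  split_ifs with h
  · rw [h]
  · exact Finset.sum_eq_zero fun o _ => by rw [virBranchKraus_eq_zero P h, zero_mul]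

/-- The effect of the outcome `x` through the Kraus operators of the squashing map. -/
def outcomeEffect (P : Params L M) (S : Channel.{u} (BSig 𝒦) (Option Bit)) (x : BCR)
    (a b : BSig 𝒦) : ℂ :=
  ∑ o, ∑ o', (P.pB x.1 : ℂ) * outcomeProj x o o' * ∑' e, S.K e o' b * conj (S.K e o a)

lemma hasSum_outcomeRow (x : BCR) (a b : BSig 𝒦) :
    HasSum (fun e => conj (outcomeRow P S x e a) * outcomeRow P S x e b)
      (outcomeEffect P S x a b) := by
  have h : HasSum (fun e => ∑ o, ∑ o', (P.pB x.1 : ℂ) * outcomeProj x o o' *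
      (S.K e o' b * conj (S.K e o a))) (outcomeEffect P S x a b) :=
    hasSum_sum fun o _ => hasSum_sum fun o' _ =>
      (S.bdd.summable_cross o' o b a).hasSum.mul_left _
  convert h using 1
  funext e
  simp only [outcomeRow, map_sum, Finset.sum_mul_sum]
  refine Finset.sum_congr rfl fun o _ => Finset.sum_congr rfl fun o' _ => ?_
  rw [outcomeProj_eq, map_mul]; ring

/-- A squashing map reproduces the matrix elements of Bob's effects: a form that vanishes on all
pure states with finite support is zero. -/
lemma outcomeEffect_eq (hS : IsSquashing P S) (x : BCR) (a b : BSig 𝒦) :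
    (P.pB x.1 : ℂ) * measPOVM P x.1 x.2 a b = outcomeEffect P S x a b := by
  have key : (fun a b => (P.pB x.1 : ℂ) * measPOVM P x.1 x.2 a b - outcomeEffect P S x a b :
      Op (BSig 𝒦)) = 0 := by
    refine eq_zero_of_form fun s w hs hw => ?_
    have h := squash_condition hS (isState_pure hs hw) x
    rw [trMul_pure hs, Matrix.trace] at h
    simp only [Matrix.diag, Matrix.mul_apply, krausMap_pure S.bdd hs] at h
    have h2 : ∑ a ∈ s, ∑ b ∈ s, outcomeEffect P S x a b * (w b * conj (w a)) =
        (P.pB x.1 : ℂ) * ∑ o, ∑ o', outcomeProj x o o' *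
          ∑ a ∈ s, ∑ b ∈ s, (∑' k, S.K k o' a * conj (S.K k o b)) * (w a * conj (w b)) := by
      simp only [outcomeEffect, Finset.mul_sum, Finset.sum_mul]
      rw [sum_comm4]
      refine Finset.sum_congr rfl fun o _ => Finset.sum_congr rfl fun o' _ =>
        Finset.sum_congr rfl fun b _ => Finset.sum_congr rfl fun a _ => ?_
      ring
    simp only [sub_mul, Finset.sum_sub_distrib]
    rw [h2, ← h]
    simp only [Finset.mul_sum, mul_assoc, sub_self]
  exact sub_eq_zero.mp (congrFun (congrFun key a) b)

lemma hasSum_bobVirKraus (x : BCR) (a b : BSig 𝒦) :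
    HasSum (fun k => conj (bobVirKraus P S k x a) * bobVirKraus P S k x b)
      (outcomeEffect P S x a b) := by
  have hinj : Function.Injective fun e : S.Env => (branchOf x, e) := fun p q hpq => by
    simpa using hpq
  refine (hinj.hasSum_iff fun k hk => ?_).mp ?_
  · have : k.1 ≠ branchOf x := fun h => hk ⟨k.2, by rw [← h]⟩
    simp [bobVirKraus_apply, this]
  · convert hasSum_outcomeRow x a b using 2 with e
    simp [bobVirKraus_apply]

lemma bobVirKraus_complete (a b : BSig 𝒦) :
    HasSum (fun p : (VirBranch × S.Env) × BCR =>
      conj (bobVirKraus P S p.1 p.2 a) * bobVirKraus P S p.1 p.2 b) (if a = b then 1 else 0) := by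
  have h := hasSum_prod_fintype (f := fun p : (VirBranch × S.Env) × BCR =>
    conj (bobVirKraus P S p.1 p.2 a) * bobVirKraus P S p.1 p.2 b)
    fun x => hasSum_bobVirKraus x a b
  convert h using 1
  have h1 := hasSum_prod_fintype (f := fun p : S.Env × Option Bit =>
    conj (S.K p.1 p.2 a) * S.K p.1 p.2 b) fun o =>
      ((S.bdd.summable_cross o o b a).congr fun k => mul_comm _ _).hasSum
  refine (Eq.trans (by congr) ((S.complete a b).unique h1)).trans ?_
  simp only [outcomeEffect]
  rw [Finset.sum_comm]
  have h2 : ∀ o, ∑ x : BCR, ∑ o', (P.pB x.1 : ℂ) * outcomeProj x o o' *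
      ∑' e, S.K e o' b * conj (S.K e o a) =
        ∑ o', (if o = o' then 1 else 0) * ∑' e, S.K e o' b * conj (S.K e o a) := fun o => by
    rw [Finset.sum_comm]
    exact Finset.sum_congr rfl fun o' _ => by rw [← Finset.sum_mul, sum_outcomeProj]
  simp_rw [h2]
  simp only [ite_mul, one_mul, zero_mul, Finset.sum_ite_eq, Finset.mem_univ, if_true]
  exact Finset.sum_congr rfl fun o _ => tsum_congr fun k => mul_comm _ _

/-- The Kraus family of Bob's virtual measurement of a block. -/
abbrev blockKraus (P : Params L M) (S : Channel.{u} (BSig 𝒦) (Option Bit)) :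
    (Fin M → VirBranch × S.Env) → Matrix (Fin M → BCR) (Fin M → BSig 𝒦) ℂ :=
  fun k x a => ∏ m, bobVirKraus P S (k m) (x m) (a m)

lemma bdd_blockKraus : Bdd (blockKraus P S) := by
  refine bdd_of_complete fun a b => ?_
  have h := hasSum_pi_prod (n := M) fun m => bobVirKraus_complete (P := P) (S := S) (a m) (b m)
  rw [← (Equiv.arrowProdEquivProdArrow (Fin M) (fun _ => VirBranch × S.Env)
    (fun _ => BCR)).symm.hasSum_iff] at h
  convert h using 1
  · funext p
    simp [blockKraus, Equiv.arrowProdEquivProdArrow, Finset.prod_mul_distrib, map_prod]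
  · by_cases hab : a = b
    · subst hab; simp
    · rw [if_neg hab]
      obtain ⟨m, hm⟩ := Function.ne_iff.mp hab
      exact (Finset.prod_eq_zero (Finset.mem_univ m) (by simp [hm])).symm

/-- The actual block measurement is the dephased virtual one. -/
lemma bobBlock_dephase (hS : IsSquashing P S) {σ : Type u} {C : Type*} (lab : σ → C)
    {ρ : Op ((Fin M → BSig 𝒦) × σ)} (hρ : TraceClass.{u} ρ) :
    bobBlock P σ (dephase (fun x => lab x.2) ρ) =
      dephase (fun x => (x.1, lab x.2)) (bobVirBlock P S σ ρ) := by
  funext x y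
  obtain ⟨x, s⟩ := x
  obtain ⟨y, t⟩ := y
  by_cases hxy : x = y
  swap
  · simp [bobBlock, dephase, hxy]
  subst hxy
  by_cases hst : lab s = lab t
  swap
  · simp [bobBlock, dephase, hst]
  simp only [bobBlock, dephase, hst, if_true, bobVirBlock]
  refine (act_diag_eq hρ (bdd_blockKraus (P := P) (S := S)) x (fun a b => ?_) s t).symm
  simp_rw [outcomeEffect_eq hS (x _)]
  have h := hasSum_pi_prod (n := M) fun m => hasSum_bobVirKraus (P := P) (S := S) (x m) (a m) (b m)
  rw [← h.tsum_eq]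
  exact tsum_congr fun k => by rw [map_prod, Finset.prod_mul_distrib]

end Squash

/-! ### The source -/

section Source

variable {L M : ℕ} (P : Params L M)

lemma sqrt_factor {n : ℕ} (s : ℕ × ℕ) (h : s.1 + s.2 = n) :
    Real.sqrt (1 / 2 ^ n * (n.choose s.2 : ℝ)) =
      Real.sqrt (n.factorial / 2 ^ n) / (Real.sqrt s.1.factorial * Real.sqrt s.2.factorial) := by
  subst h
  rw [← Real.sqrt_mul (by positivity), ← Real.sqrt_div (by positivity)]
  congr 1
  have h1 := Nat.add_choose_mul_factorial_mul_factorial s.1 s.2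
  have h2 : ((s.1 + s.2).choose s.2 : ℝ) * s.1.factorial * s.2.factorial =
      ((s.1 + s.2).factorial : ℝ) := by exact_mod_cast h1
  rw [← h2]
  field_simp

lemma sourceVirAmp_of_ne {c : ACR} {n : ℕ} {s : ℕ × ℕ} (h : s.1 + s.2 ≠ n) :
    sourceVirAmp P c n s = 0 := by
  simp [sourceVirAmp, psiAmp, h]

/-- The common value of the matrix elements of the two sources. -/
lemma sourceVirAmp_mul_conj (c : ACR) {n : ℕ} {s t : ℕ × ℕ} (hs : s.1 + s.2 = n)
    (ht : t.1 + t.2 = n) :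
    sourceVirAmp P c n s * conj (sourceVirAmp P c n t) =
      (probACR P c : ℂ) * ((Real.exp (-P.mu c.1) * (P.mu c.1 / 2) ^ n /
        ((Real.sqrt s.1.factorial * Real.sqrt s.2.factorial) *
          (Real.sqrt t.1.factorial * Real.sqrt t.2.factorial)) : ℝ) *
        (Complex.exp (Complex.I * theta c.2.2 c.2.1) ^ s.1 *
          conj (Complex.exp (Complex.I * theta c.2.2 c.2.1)) ^ t.1)) := by
  have hp : 0 ≤ probACR P c := by
    unfold probACR
    have := P.pInt_nonneg c.1
    have := P.pA_nonneg c.2.1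
    positivity
  have hq : 0 ≤ poissonCS (P.mu c.1) n := by
    unfold poissonCS
    have := P.mu_nonneg c.1
    positivity
  have h1 := conj_sqrt_mul_sqrt hp
  have h2 := conj_sqrt_mul_sqrt hq
  have h3 := conj_sqrt_mul_sqrt (p := (n.factorial / 2 ^ n : ℝ)) (by positivity)
  rw [Complex.conj_ofReal] at h1 h2 h3
  simp only [sourceVirAmp, psiAmp, hs, ht, if_true, sqrt_factor s hs, sqrt_factor t ht]
  have e1 : ∀ k : ℕ, Complex.exp (Complex.I * theta c.2.2 c.2.1 * k) =
      Complex.exp (Complex.I * theta c.2.2 c.2.1) ^ k := fun k => by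
    rw [← Complex.exp_nat_mul]; ring_nf
  rw [e1, e1]
  simp only [map_mul, map_div₀, map_pow, Complex.conj_ofReal, Complex.ofReal_div,
    Complex.ofReal_mul]
  have h4 : (poissonCS (P.mu c.1) n : ℂ) * ((n.factorial / 2 ^ n : ℝ) : ℂ) =
      (Real.exp (-P.mu c.1) : ℂ) * ((P.mu c.1 / 2) ^ n : ℝ) := by
    rw [← Complex.ofReal_mul, ← Complex.ofReal_mul]
    congr 1
    unfold poissonCS
    have : (n.factorial : ℝ) ≠ 0 := by positivity
    rw [div_pow]
    field_simp
  rw [← h4, ← h1, ← h2, ← h3]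
  ring

lemma pulseState_eq (θ μ : ℝ) (hμ : 0 ≤ μ) {n : ℕ} {s t : ℕ × ℕ} (hs : s.1 + s.2 = n)
    (ht : t.1 + t.2 = n) :
    pulseState θ μ s t = ((Real.exp (-μ) * (μ / 2) ^ n /
        ((Real.sqrt s.1.factorial * Real.sqrt s.2.factorial) *
          (Real.sqrt t.1.factorial * Real.sqrt t.2.factorial)) : ℝ) *
        (Complex.exp (Complex.I * θ) ^ s.1 * conj (Complex.exp (Complex.I * θ)) ^ t.1)) := by
  unfold pulseState
  set c : ℂ := ((Real.exp (-μ) * (μ / 2) ^ n /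
        ((Real.sqrt s.1.factorial * Real.sqrt s.2.factorial) *
          (Real.sqrt t.1.factorial * Real.sqrt t.2.factorial)) : ℝ) *
        (Complex.exp (Complex.I * θ) ^ s.1 * conj (Complex.exp (Complex.I * θ)) ^ t.1)) with hc
  have h : ∀ δ : ℝ, (coherentAmp (μ / 2) (δ + θ) s.1 * coherentAmp (μ / 2) δ s.2) *
      conj (coherentAmp (μ / 2) (δ + θ) t.1 * coherentAmp (μ / 2) δ t.2) = c := by
    intro δ
    simp only [coherentAmp]
    rw [show Complex.exp (Complex.I * ((δ + θ : ℝ) : ℂ)) =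
      Complex.exp (Complex.I * δ) * Complex.exp (Complex.I * θ) by
        rw [← Complex.exp_add]; push_cast; ring_nf]
    set z := Complex.exp (Complex.I * δ) with hz
    set q := Complex.exp (Complex.I * θ)
    have hzz : z * conj z = 1 := by
      rw [hz, Complex.mul_conj, Complex.normSq_eq_norm_sq, mul_comm,
        Complex.norm_exp_ofReal_mul_I]; simp
    have hr : (Real.sqrt (μ / 2) : ℂ) * (Real.sqrt (μ / 2) : ℂ) = ((μ / 2 : ℝ) : ℂ) := by
      rw [← Complex.ofReal_mul, Real.mul_self_sqrt (by positivity)]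
    have hE : (Real.exp (-(μ / 2) / 2) : ℂ) * Real.exp (-(μ / 2) / 2) *
        (Real.exp (-(μ / 2) / 2) * Real.exp (-(μ / 2) / 2)) = (Real.exp (-μ) : ℂ) := by
      simp only [← Complex.ofReal_mul, ← Real.exp_add]
      congr 2; ring
    have hn : z ^ (s.1 + s.2) * conj z ^ (t.1 + t.2) *
        ((Real.sqrt (μ / 2) : ℂ) ^ (s.1 + s.2) * (Real.sqrt (μ / 2) : ℂ) ^ (t.1 + t.2)) =
          ((μ / 2 : ℝ) : ℂ) ^ n := by
      rw [hs, ht, ← mul_pow, hzz, one_pow, one_mul, ← mul_pow, hr]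
    rw [hc]
    simp only [map_mul, map_div₀, map_pow, Complex.conj_ofReal, Complex.ofReal_mul,
      Complex.ofReal_div, Complex.ofReal_pow]
    rw [← hE]
    have hn' := hn
    simp only [Complex.ofReal_div] at hn'
    rw [← hn']
    have f1 : (Real.sqrt s.1.factorial : ℂ) ≠ 0 := by
      rw [Complex.ofReal_ne_zero]; positivity
    have f2 : (Real.sqrt s.2.factorial : ℂ) ≠ 0 := by
      rw [Complex.ofReal_ne_zero]; positivity
    have f3 : (Real.sqrt t.1.factorial : ℂ) ≠ 0 := by
      rw [Complex.ofReal_ne_zero]; positivity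
    have f4 : (Real.sqrt t.2.factorial : ℂ) ≠ 0 := by
      rw [Complex.ofReal_ne_zero]; positivity
    field_simp
    ring
  simp_rw [h]
  rw [intervalIntegral.integral_const, sub_zero]
  have hpi : (Real.pi : ℂ) ≠ 0 := by exact_mod_cast Real.pi_ne_zero
  simp only [Complex.real_smul, Complex.ofReal_mul, Complex.ofReal_ofNat]
  field_simp

/-- Tracing out the photon number of the virtual source leaves the phase-randomized pulse. -/
lemma hasSum_sourceVirAmp (c : ACR) (s t : ℕ × ℕ) :
    HasSum (fun n => sourceVirAmp P c n s * conj (sourceVirAmp P c n t))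
      (source1 P (c, s) (c, t)) := by
  have h0 : HasSum (fun n => sourceVirAmp P c n s * conj (sourceVirAmp P c n t))
      (sourceVirAmp P c (s.1 + s.2) s * conj (sourceVirAmp P c (s.1 + s.2) t)) :=
    hasSum_single _ fun n hn => by rw [sourceVirAmp_of_ne P (Ne.symm hn), zero_mul]
  convert h0 using 1
  simp only [source1, if_true, pulseStateByNumber]
  rw [tsum_eq_single (s.1 + s.2) (fun n hn => if_neg fun h => hn h.1.symm)]
  by_cases ht : t.1 + t.2 = s.1 + s.2
  · rw [if_pos ⟨rfl, ht⟩, pulseState_eq _ _ (P.mu_nonneg _) rfl ht,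
      sourceVirAmp_mul_conj P c rfl ht]
  · rw [if_neg fun h => ht h.2, sourceVirAmp_of_ne P ht, map_zero, mul_zero, mul_zero]

lemma summable_sourceVirAmp :
    Summable fun q : (ℕ × ℕ) × ACR × ℕ => ‖sourceVirAmp P q.2.1 q.2.2 q.1‖ ^ 2 := by
  have hinj : Function.Injective fun p : (ℕ × ℕ) × ACR => (p.1, p.2, p.1.1 + p.1.2) := by
    intro p q h
    simp only [Prod.mk.injEq] at h
    exact Prod.ext h.1 h.2.1
  refine (hinj.summable_iff fun q hq => ?_).mp ?_
  · have : q.1.1 + q.1.2 ≠ q.2.2 := fun h => hq ⟨(q.1, q.2.1), by simp [h]⟩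
    simp [sourceVirAmp_of_ne P this]
  · have h1 : ∀ c : ACR, Summable fun s : ℕ × ℕ => ‖sourceVirAmp P c (s.1 + s.2) s‖ ^ 2 := by
      intro c
      have hμ : 0 ≤ P.mu c.1 / 2 := by have := P.mu_nonneg c.1; positivity
      have h2 := (Summable.mul_of_nonneg (Real.summable_pow_div_factorial (P.mu c.1 / 2))
        (Real.summable_pow_div_factorial (P.mu c.1 / 2)) (fun _ => by positivity)
        (fun _ => by positivity)).mul_left (probACR P c * Real.exp (-P.mu c.1))
      refine h2.congr fun s => ?_
      have h3 := sourceVirAmp_mul_conj P c (n := s.1 + s.2) (s := s) (t := s) rfl rfl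
      have h4 : ∀ z : ℂ, z ^ s.1 * conj z ^ s.1 = ((‖z‖ ^ 2 : ℝ) : ℂ) ^ s.1 := fun z => by
        rw [← mul_pow, Complex.mul_conj']; push_cast; rfl
      rw [Complex.mul_conj', h4, mul_comm Complex.I, Complex.norm_exp_ofReal_mul_I] at h3
      have h5 : ‖sourceVirAmp P c (s.1 + s.2) s‖ ^ 2 = probACR P c * (Real.exp (-P.mu c.1) *
          (P.mu c.1 / 2) ^ (s.1 + s.2) / ((Real.sqrt s.1.factorial * Real.sqrt s.2.factorial) *
          (Real.sqrt s.1.factorial * Real.sqrt s.2.factorial))) := by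
        have h6 := h3
        simp only [one_pow, Complex.ofReal_one, mul_one] at h6
        exact_mod_cast h6
      rw [h5]
      have e1 : Real.sqrt s.1.factorial * Real.sqrt s.1.factorial = s.1.factorial :=
        Real.mul_self_sqrt (by positivity)
      have e2 : Real.sqrt s.2.factorial * Real.sqrt s.2.factorial = s.2.factorial :=
        Real.mul_self_sqrt (by positivity)
      have e3 : Real.sqrt s.1.factorial * Real.sqrt s.2.factorial *
          (Real.sqrt s.1.factorial * Real.sqrt s.2.factorial) =
          (s.1.factorial : ℝ) * s.2.factorial := by
        rw [mul_mul_mul_comm, e1, e2]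
      rw [e3, pow_add]
      field_simp
    have h2 := hasSum_prod_fintype (f := fun p : (ℕ × ℕ) × ACR =>
      ((‖sourceVirAmp P p.2 (p.1.1 + p.1.2) p.1‖ ^ 2 : ℝ) : ℂ))
      fun c => (Complex.hasSum_ofReal.mpr (h1 c).hasSum)
    exact Complex.summable_ofReal.mp h2.summable

end Source

/-! ### Quantum communication -/

section QC

variable {L M : ℕ} {P : Params L M} {𝒦 ε : Type u} {R : Type}

/-- Inserts the label of the system `R`. -/
def withR {A : Type*} {j : ℕ} (x : A × Rest L M Unit j) (r : R) : A × Rest L M R j :=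
  (x.1, (x.2.1, r, x.2.2.2))

/-- The classical registers outside Eve's hands. -/
def restLab {j : ℕ} (x : Rest L M R j) : (Fin (numPulses L M) → ACR) × (Fin j → Rec M) :=
  (x.1, x.2.2)

/-- The virtual source with the systems `R` traced out. -/
def sourceTr (P : Params L M) : Op ((Fin (numPulses L M) → ℕ × ℕ) × Rest L M Unit 0) :=
  fun x y => ∑' r, sourceVir P (withR x r) (withR y r)

lemma traceClass_sourceVir : TraceClass.{u} (sourceVir P) := by
  refine ⟨PUnit.{u + 1}, fun _ x => ∏ i, sourceVirAmp P (x.2.1 i) (x.2.2.1 i) (x.1 i), ?_, ?_⟩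
  · have h1 : HasSum (fun q : (ℕ × ℕ) × ACR × ℕ => ((‖sourceVirAmp P q.2.1 q.2.2 q.1‖ ^ 2 : ℝ) : ℂ))
        _ := Complex.hasSum_ofReal.mpr (summable_sourceVirAmp P).hasSum
    have h2 := (hasSum_pi_prod (n := numPulses L M) fun _ => h1).summable
    have hinj : Function.Injective
        fun p : PUnit.{u + 1} × ((Fin (numPulses L M) → ℕ × ℕ) ×
          Rest L M (Fin (numPulses L M) → ℕ) 0) =>
          fun i => (p.2.1 i, p.2.2.1 i, p.2.2.2.1 i) := by
      intro p q h
      have h' := fun i => congrFun h i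
      simp only [Prod.mk.injEq] at h'
      refine Prod.ext rfl (Prod.ext (funext fun i => (h' i).1)
        (Prod.ext (funext fun i => (h' i).2.1) (Prod.ext (funext fun i => (h' i).2.2) ?_)))
      exact Subsingleton.elim _ _
    have h3 := h2.comp_injective hinj
    refine Complex.summable_ofReal.mp (h3.congr fun p => ?_)
    simp [Finset.prod_pow]
  · intro x y
    rw [tsum_fintype, Fintype.sum_unique]
    simp only [sourceVir, map_prod, Finset.prod_mul_distrib]

/-- The actual source is the virtual one with `R` traced out and the records dephased: the uniform
phase average is a Poissonian mixture of photon numbers. -/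
lemma source_eq_dephase : source P = dephase (fun x => restLab x.2) (sourceTr P) := by
  funext x y
  by_cases h : x.2.1 = y.2.1
  · have hl : restLab x.2 = restLab y.2 := Prod.ext h (Subsingleton.elim _ _)
    simp only [dephase, hl, if_true, sourceTr, sourceVir, withR, source, h]
    rw [(hasSum_pi_prod fun i => hasSum_sourceVirAmp P (y.2.1 i) (x.1 i) (y.1 i)).tsum_eq]
  · have hl : restLab x.2 ≠ restLab y.2 := fun hc => h (Prod.ext_iff.mp hc).1
    simp only [dephase, hl, if_false, source]
    obtain ⟨i, hi⟩ := Function.ne_iff.mp h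
    exact Finset.prod_eq_zero (Finset.mem_univ i) (by simp [source1, hi])

/-! ### Announcements -/

/-- The announcement registers agree with the data. -/
def AnnOK {j : ℕ} (X : (ε × EveAnn M) × Rest L M R (j + 1)) : Prop :=
  ∀ m, (X.2.2.2 (Fin.last j) m).2.1 = bobAnn (X.2.2.2 (Fin.last j) m).1 ∧
    (X.1.2 m).1 = bobAnn (X.2.2.2 (Fin.last j) m).1 ∧
    (X.2.2.2 (Fin.last j) m).2.2 =
      aliceAnn (X.2.1 (finProdFinEquiv (Fin.ofNat (L + 1) j, m)))
        (bobAnn (X.2.2.2 (Fin.last j) m).1) ∧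
    (X.1.2 m).2 = aliceAnn (X.2.1 (finProdFinEquiv (Fin.ofNat (L + 1) j, m)))
        (bobAnn (X.2.2.2 (Fin.last j) m).1)

/-- The registers before the announcements on a block. -/
def annPre {j : ℕ} (X : (ε × EveAnn M) × Rest L M R (j + 1)) :
    (Fin M → BCR) × (ε × Rest L M R j) :=
  (fun m => (X.2.2.2 (Fin.last j) m).1, (X.1.1, (X.2.1, X.2.2.1, Fin.init X.2.2.2)))

lemma ite_eq_ite_of_iff {A : Type*} {p q : Prop} {_ : Decidable p} {_ : Decidable q} (h : p ↔ q)
    (a b : A) : (if p then a else b) = if q then a else b :=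
  if_congr h rfl rfl

/-- A single Kraus operator that is a partial classical map with left inverse `G`. -/
lemma act_unit_copy {κ ι σ : Type*} {p : κ → Prop} {G : κ → ι} {K : Unit → Matrix κ ι ℂ}
    (hK : ∀ x a, K () x a = if p x ∧ a = G x then 1 else 0) (ρ : Op (ι × σ)) (x y : κ × σ) :
    act K ρ x y = if p x.1 ∧ p y.1 then ρ (G x.1, x.2) (G y.1, y.2) else 0 := by
  unfold act
  rw [tsum_fintype, Fintype.sum_unique, tsum_eq_single (G x.1), tsum_eq_single (G y.1)]
  · have h : default = () := rfl
    rw [h, hK, hK]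
    by_cases hx : p x.1 <;> by_cases hy : p y.1 <;> simp [hx, hy]
  · intro b hb
    have h : default = () := rfl
    simp [h, hK y.1 b, hb]
  · intro a ha
    have h : default = () := rfl
    simp [h, hK x.1 a, ha]

lemma announce_apply (j : ℕ) (ρ : Op ((Fin M → BCR) × (ε × Rest L M R j)))
    (X Y : (ε × EveAnn M) × Rest L M R (j + 1)) :
    announce j ρ X Y = if AnnOK X ∧ AnnOK Y then ρ (annPre X) (annPre Y) else 0 := by
  unfold announce actOn
  have hA := act_unit_copy (σ := (Fin M → BCR × BobAnn) × ε × R × (Fin j → Rec M))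
    (K := alicePublicKraus L M (Fin.ofNat (L + 1) j))
    (p := fun x => ∀ m, (x.2 m).2.1 =
      aliceAnn (x.1 (finProdFinEquiv (Fin.ofNat (L + 1) j, m))) (x.2 m).1 ∧
        (x.2 m).2.2 = aliceAnn (x.1 (finProdFinEquiv (Fin.ofNat (L + 1) j, m))) (x.2 m).1)
    (G := fun x => (x.1, fun m => (x.2 m).1)) (by
      intro x a
      unfold alicePublicKraus
      congr 1
      apply propext
      constructor
      · rintro ⟨h1, h2⟩
        refine ⟨fun m => ?_, Prod.ext h1.symm (funext fun m => ?_)⟩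
        · rw [h2 m, h1]; exact ⟨rfl, rfl⟩
        · change a.2 m = (x.2 m).1
          rw [h2 m]
      · rintro ⟨h1, rfl⟩
        exact ⟨rfl, fun m => Prod.ext rfl (Prod.ext (h1 m).1 (h1 m).2)⟩)
  have hB := act_unit_copy (σ := ε × Rest L M R j) (K := bobPublicKraus M)
    (p := fun x => ∀ m, (x m).2.1 = bobAnn (x m).1 ∧ (x m).2.2 = bobAnn (x m).1)
    (G := fun x => fun m => (x m).1) (by
      intro x a
      unfold bobPublicKraus
      congr 1
      apply propext
      constructor
      · intro h
        refine ⟨fun m => ?_, funext fun m => ?_⟩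
        · rw [h m]; exact ⟨rfl, rfl⟩
        · rw [h m]
      · rintro ⟨h1, rfl⟩ m
        exact Prod.ext rfl (Prod.ext (h1 m).1 (h1 m).2)) ρ
  simp only [Matrix.submatrix_apply, hA, hB]
  rw [← ite_and]
  refine ite_eq_ite_of_iff ?_ _ _
  unfold AnnOK
  constructor
  · rintro ⟨⟨h1, h2⟩, h3, h4⟩
    refine ⟨fun m => ⟨(h3 m).1, (h3 m).2, ?_, ?_⟩, fun m => ⟨(h4 m).1, (h4 m).2, ?_, ?_⟩⟩
    · rw [(h1 m).1, (h3 m).1]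
    · rw [(h1 m).2, (h3 m).1]
    · rw [(h2 m).1, (h4 m).1]
    · rw [(h2 m).2, (h4 m).1]
  · rintro ⟨h1, h2⟩
    refine ⟨⟨fun m => ?_, fun m => ?_⟩, fun m => ⟨(h1 m).1, (h1 m).2.1⟩,
      fun m => ⟨(h2 m).1, (h2 m).2.1⟩⟩
    · simp only [(h1 m).1]; exact (h1 m).2.2
    · simp only [(h2 m).1]; exact (h2 m).2.2

/-- Announcements are functions of classical labels, so that they commute with dephasing; they also
copy the labels of the block to the public record. -/
lemma announce_dephase (j : ℕ) (ρ : Op ((Fin M → BCR) × (ε × Rest L M Unit j))) :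
    announce j (dephase (fun x => (x.1, restLab x.2.2)) ρ) =
      dephase (fun x => restLab x.2) (announce j ρ) := by
  funext X Y
  rw [announce_apply]
  by_cases h : AnnOK X ∧ AnnOK Y
  swap
  · simp only [dephase, announce_apply, if_neg h, ite_self]
  simp only [dephase, announce_apply, if_pos h]
  refine ite_eq_ite_of_iff ?_ _ _
  constructor
  · intro h1
    simp only [annPre, restLab, Prod.mk.injEq] at h1
    obtain ⟨h2, h3, h4⟩ := h1
    refine Prod.ext h3 ?_
    simp only [restLab]
    rw [← Fin.snoc_init_self X.2.2.2, ← Fin.snoc_init_self Y.2.2.2, h4]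
    congr 1
    funext m
    have e := congrFun h2 m
    refine Prod.ext e (Prod.ext ?_ ?_)
    · rw [(h.1 m).1, (h.2 m).1, e]
    · rw [(h.1 m).2.2.1, (h.2 m).2.2.1, e, h3]
  · intro h1
    simp only [restLab, Prod.mk.injEq] at h1
    simp only [annPre, restLab, h1.1, h1.2]

lemma announce_trRel (j : ℕ) {ρ : Op ((Fin M → BCR) × (ε × Rest L M R j))}
    {ρ' : Op ((Fin M → BCR) × (ε × Rest L M Unit j))}
    (h : TrRel (fun x r => (x.1, withR x.2 r)) ρ ρ') :
    TrRel withR (announce j ρ) (announce j ρ') := by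
  intro X Y
  rw [announce_apply, h]
  simp only [announce_apply]
  by_cases hc : AnnOK X ∧ AnnOK Y
  · rw [if_pos hc]
    exact tsum_congr fun r => (if_pos hc).symm
  · rw [if_neg hc]
    exact ((tsum_congr fun r => if_neg hc).trans tsum_zero).symm

lemma traceClass_announce (j : ℕ) {ρ : Op ((Fin M → BCR) × (ε × Rest L M R j))}
    (h : TraceClass.{u} ρ) : TraceClass.{u} (announce j ρ) := by
  unfold announce
  refine TraceClass.actOn.{u, 0} (TraceClass.act.{u, 0} h (bdd_of_finite _)) (bdd_of_finite _)
    ?_ ?_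
  · refine Function.LeftInverse.injective (g := fun q =>
      ((q.2.2.1, fun m => (q.1 m).2.1),
        (fun m => ((q.1 m).1, (q.1 m).2.2), q.2.1, q.2.2.2.1, q.2.2.2.2))) fun _ => rfl
  · refine Function.LeftInverse.injective (g := fun q =>
      ((q.2.2.1, fun m => ((q.2.1 m).2, (q.1.2 m).2.2)),
        (q.1.1, q.2.2.2.1, Fin.snoc q.2.2.2.2
          fun m => ((q.2.1 m).1, (q.1.2 m).1, (q.1.2 m).2.1)))) fun q => ?_
    refine Prod.ext rfl (Prod.ext rfl (Prod.ext rfl ?_))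
    exact Fin.snoc_init_self q.2.2.2

end QC

section QC

variable {L M : ℕ} {P : Params L M} {𝒦 ε : Type u} {R : Type}

/-- Bob's measurement of a block and the announcements on it. -/
def measureAnnounce (bob : ∀ σ : Type u, Op ((Fin M → BSig 𝒦) × σ) → Op ((Fin M → BCR) × σ))
    (j : ℕ) (ρ : Op (((Fin M → BSig 𝒦) × ε) × Rest L M R j)) :
    Op ((ε × EveAnn M) × Rest L M R (j + 1)) :=
  announce j (bob (ε × Rest L M R j) (ρ.submatrix
    (fun p : (Fin M → BSig 𝒦) × (ε × Rest L M R j) => ((p.1, p.2.1), p.2.2))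
    (fun p : (Fin M → BSig 𝒦) × (ε × Rest L M R j) => ((p.1, p.2.1), p.2.2))))

lemma withR_injective {A : Type*} {j : ℕ} :
    Function.Injective fun p : (A × Rest L M Unit j) × R => withR p.1 p.2 := by
  rintro ⟨⟨a, b, c, d⟩, r⟩ ⟨⟨a', b', c', d'⟩, r'⟩ h
  simp only [withR, Prod.mk.injEq] at h
  obtain ⟨rfl, rfl, rfl, rfl⟩ := h
  rfl

lemma restR_injective {j : ℕ} : Function.Injective fun p : Rest L M Unit j × R =>
    ((p.1.1, p.2, p.1.2.2) : Rest L M R j) := by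
  rintro ⟨⟨b, c, d⟩, r⟩ ⟨⟨b', c', d'⟩, r'⟩ h
  simp only [Prod.mk.injEq] at h
  obtain ⟨rfl, rfl, rfl⟩ := h
  rfl

variable {S : Channel.{u} (BSig 𝒦) (Option Bit)}

lemma assoc_injective {A B C : Type*} :
    Function.Injective fun p : A × (B × C) => ((p.1, p.2.1), p.2.2) :=
  Function.LeftInverse.injective (g := fun q => (q.1.1, q.1.2, q.2)) fun _ => rfl

lemma traceClass_measureAnnounce (j : ℕ) {ρ : Op (((Fin M → BSig 𝒦) × ε) × Rest L M R j)}
    (h : TraceClass.{u} ρ) : TraceClass.{u} (measureAnnounce (bobVirBlock P S) j ρ) := by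
  have h1 := h.submatrix (assoc_injective (A := Fin M → BSig 𝒦) (B := ε) (C := Rest L M R j))
  have h2 := TraceClass.act.{u, u} h1 (bdd_blockKraus (P := P) (S := S))
  exact traceClass_announce j h2

lemma trRel_measureAnnounce (j : ℕ) {ρ : Op (((Fin M → BSig 𝒦) × ε) × Rest L M R j)}
    {ρ' : Op (((Fin M → BSig 𝒦) × ε) × Rest L M Unit j)} (hρ : TraceClass.{u} ρ)
    (h : TrRel withR ρ ρ') :
    TrRel withR (measureAnnounce (bobVirBlock P S) j ρ)
      (measureAnnounce (bobVirBlock P S) j ρ') := by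
  refine announce_trRel j ?_
  have h1 := hρ.submatrix (assoc_injective (A := Fin M → BSig 𝒦) (B := ε) (C := Rest L M R j))
  have e := TrRel.act (g := fun (x : ε × Rest L M Unit j) (r : R) => withR x r) withR_injective h1
    (bdd_blockKraus (P := P) (S := S)) (ρ' := ρ'.submatrix
    (fun p : (Fin M → BSig 𝒦) × (ε × Rest L M Unit j) => ((p.1, p.2.1), p.2.2))
    (fun p : (Fin M → BSig 𝒦) × (ε × Rest L M Unit j) => ((p.1, p.2.1), p.2.2)))
    (fun x y => h _ _)
  exact e

/-- One block: the actual measurement is the virtual one with dephased records. -/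
lemma measureAnnounce_dephase (hS : IsSquashing P S) (j : ℕ)
    {ρ : Op (((Fin M → BSig 𝒦) × ε) × Rest L M Unit j)} (hρ : TraceClass.{u} ρ) :
    measureAnnounce (bobBlock P) j (dephase (fun x => restLab x.2) ρ) =
      dephase (fun x => restLab x.2) (measureAnnounce (bobVirBlock P S) j ρ) := by
  have h1 := hρ.submatrix
    (assoc_injective (A := Fin M → BSig 𝒦) (B := ε) (C := Rest L M Unit j))
  have e := bobBlock_dephase hS (fun x : ε × Rest L M Unit j => restLab x.2) h1
  unfold measureAnnounce
  rw [← announce_dephase, ← e]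
  rfl

variable (E : Eve P 𝒦 ε)

lemma trRel_channel {ι κ : Type*} (C : Channel.{u} ι κ) {j : ℕ} {ρ : Op (ι × Rest L M R j)}
    {ρ' : Op (ι × Rest L M Unit j)} (hρ : TraceClass.{u} ρ) (h : TrRel withR ρ ρ') :
    TrRel withR (act C.K ρ) (act C.K ρ') := by
  have e := TrRel.act (g := fun (x : Rest L M Unit j) (r : R) => (x.1, r, x.2.2)) restR_injective
    hρ C.bdd h
  exact e

variable {src : Op ((Fin (numPulses L M) → ℕ × ℕ) × Rest L M R 0)}
  {src' : Op ((Fin (numPulses L M) → ℕ × ℕ) × Rest L M Unit 0)}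

lemma traceClass_beforeBlock (h : TraceClass.{u} src) (j : ℕ) :
    TraceClass.{u} (beforeBlock E (bobVirBlock P S) src j) := by
  induction j with
  | zero => exact TraceClass.act.{u, u} h E.first.bdd
  | succ j ih =>
    exact TraceClass.act.{u, u} (traceClass_measureAnnounce j ih) (E.next j).bdd

lemma traceClass_afterQC (h : TraceClass.{u} src) :
    TraceClass.{u} (afterQC E (bobVirBlock P S) src) :=
  TraceClass.act.{u, u} (traceClass_measureAnnounce L (traceClass_beforeBlock E h L)) E.last.bdd

lemma trRel_beforeBlock (h : TraceClass.{u} src) (h' : TrRel withR src src') (j : ℕ) :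
    TrRel withR (beforeBlock E (bobVirBlock P S) src j)
      (beforeBlock E (bobVirBlock P S) src' j) := by
  induction j with
  | zero => exact trRel_channel E.first h h'
  | succ j ih =>
    have hj := traceClass_beforeBlock (S := S) E h j
    exact trRel_channel (E.next j) (traceClass_measureAnnounce j hj)
      (trRel_measureAnnounce j hj ih)

lemma trRel_afterQC (h : TraceClass.{u} src) (h' : TrRel withR src src') :
    TrRel withR (afterQC E (bobVirBlock P S) src) (afterQC E (bobVirBlock P S) src') := by
  have hj := traceClass_beforeBlock (S := S) E h L
  exact trRel_channel E.last (traceClass_measureAnnounce L hj)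
      (trRel_measureAnnounce L hj (trRel_beforeBlock E h h' L))

/-- Eve's maps do not act on the classical records, so the relation between the two protocols
propagates from block to block. -/
lemma beforeBlock_dephase (hS : IsSquashing P S) (h : TraceClass.{u} src') (j : ℕ) :
    beforeBlock E (bobBlock P) (dephase (fun x => restLab x.2) src') j =
      dephase (fun x => restLab x.2) (beforeBlock E (bobVirBlock P S) src' j) := by
  induction j with
  | zero => exact act_dephase restLab src'
  | succ j ih =>
    have e1 := measureAnnounce_dephase hS j (traceClass_beforeBlock (S := S) E h j)
    have e2 := act_dephase (K := (E.next j).K) restLab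
      (measureAnnounce (bobVirBlock P S) j (beforeBlock E (bobVirBlock P S) src' j))
    rw [← e1, ← ih] at e2
    exact e2

lemma afterQC_dephase (hS : IsSquashing P S) (h : TraceClass.{u} src') :
    afterQC E (bobBlock P) (dephase (fun x => restLab x.2) src') =
      dephase (fun x => restLab x.2) (afterQC E (bobVirBlock P S) src') := by
  have e1 := measureAnnounce_dephase hS L (traceClass_beforeBlock (S := S) E h L)
  have e2 := act_dephase (K := E.last.K) restLab
    (measureAnnounce (bobVirBlock P S) L (beforeBlock E (bobVirBlock P S) src' L))
  rw [← e1, ← beforeBlock_dephase E hS h] at e2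
  exact e2

/-- The virtual state after quantum communication with the systems `R` traced out. -/
def rhoQCTr (S : Channel.{u} (BSig 𝒦) (Option Bit)) : Op (ε × Rest L M Unit (L + 1)) :=
  afterQC E (bobVirBlock P S) (sourceTr P)

lemma traceClass_sourceTr : TraceClass.{u} (sourceTr P) :=
  TraceClass.trace.{u, 0} traceClass_sourceVir (f := withR) withR_injective fun _ _ => rfl

lemma traceClass_rhoQCVir : TraceClass.{u} (rhoQCVir E S) :=
  traceClass_afterQC E traceClass_sourceVir

lemma traceClass_rhoQCTr : TraceClass.{u} (rhoQCTr E S) :=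
  traceClass_afterQC E traceClass_sourceTr

lemma trRel_rhoQC : TrRel withR (rhoQCVir E S) (rhoQCTr E S) :=
  trRel_afterQC E traceClass_sourceVir fun _ _ => rfl

/-- The actual state is the virtual one with all classical records dephased. -/
lemma rhoQC_eq_dephase (hS : IsSquashing P S) :
    rhoQC E = dephase (fun x => restLab x.2) (rhoQCTr E S) := by
  unfold rhoQC rhoQCTr
  rw [source_eq_dephase]
  exact afterQC_dephase E hS traceClass_sourceTr

end QC

/-! ### Tracing out `R` in virtual key generation -/

section KeyGen

variable {L M : ℕ} {P : Params L M}

instance : Finite (VerifyBranch P) := by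
  refine Finite.of_surjective
    (α := (Fin (numPulses L M + 1) × (Fin P.Nverify → Bit)) ⊕
      (Σ n : Fin (numPulses L M + 1), (Fin n.val → Bit) × (Fin n.val → Bit)) ⊕ Unit)
    (fun x => match x with
      | Sum.inl p => VerifyBranch.pass p.1 p.2
      | Sum.inr (Sum.inl p) => VerifyBranch.fail p.1 p.2.1 p.2.2
      | Sum.inr (Sum.inr _) => VerifyBranch.aborted) fun x => ?_
  cases x with
  | pass n h => exact ⟨Sum.inl (n, h), rfl⟩
  | fail n a b => exact ⟨Sum.inr (Sum.inl ⟨n, a, b⟩), rfl⟩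
  | aborted => exact ⟨Sum.inr (Sum.inr ()), rfl⟩

instance : Finite (PABranch L M) := by
  refine Finite.of_surjective
    (α := (Σ p : {p : Fin (numPulses L M + 1) × Fin (numPulses L M + 1) // p.2 ≤ p.1},
        (Fin (p.1.1.val - p.1.2.val) → Bit) × (Fin p.1.1.val → Bit) ×
          (Fin (p.1.1.val - p.1.2.val) → Bit) × Key (numPulses L M)) ⊕ Key (numPulses L M))
    (fun x => match x with
      | Sum.inl p => PABranch.positive p.1.1.1 p.1.1.2 p.1.2 p.2.1 p.2.2.1 p.2.2.2.1 p.2.2.2.2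
      | Sum.inr b => PABranch.aborted b) fun x => ?_
  cases x with
  | positive n m le xA xB c b => exact ⟨Sum.inl ⟨⟨(n, m), le⟩, xA, xB, c, b⟩, rfl⟩
  | aborted b => exact ⟨Sum.inr b, rfl⟩

variable {ε : Type u} {R : Type} (V : VirParams P)

/-- Virtual error correction. -/
def ecVirState
    (ρ : Op ((Key (numPulses L M) × Key (numPulses L M) × Fin (numPulses L M + 1) × Bool) ×
      (R × ε))) :
    Op ((Key (numPulses L M) × Key (numPulses L M) × Bool) ×
      (CEC P × Fin (numPulses L M + 1) × R × ε)) :=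
  actOn (σ := Key (numPulses L M) × Fin (numPulses L M + 1) × R × ε) (ecBVirKraus P)
    (fun p => ((p.2.1, p.1.2.1, p.1.2.2), (p.1.1, p.2.2)))
    (fun q => ((q.1.2.1, q.1.2.2, q.2.1), (q.1.1, q.2.2)))
    (actOn (O := (Key (numPulses L M) × Bool × CEC P) ×
        (Key (numPulses L M) × Fin (numPulses L M + 1) × R × ε))
      (σ := Key (numPulses L M) × Fin (numPulses L M + 1) × R × ε) (ecAVirKraus V)
      (fun p => ((p.1.1, p.2.1, p.2.2.1, p.1.2), p.2.2.2)) id ρ)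

/-- Virtual error verification. -/
def verifyVirState
    (ρ : Op ((Key (numPulses L M) × Key (numPulses L M) × Bool) ×
      (CEC P × Fin (numPulses L M + 1) × R × ε))) :
    Op ((Key (numPulses L M) × Key (numPulses L M) × Fin (numPulses L M + 1) × Bool) ×
      (CEC P × CHash P × Option Bool × R × ε)) :=
  actOn (σ := CEC P × Fin (numPulses L M + 1) × R × ε) (verifyVirKraus V) id
    (fun q => ((q.1.1, q.1.2.1, q.1.2.2.2, q.2.2.1, q.2.2.2.1),
      (q.2.1, q.1.2.2.1, q.2.2.2.2))) ρ

/-- Eve's final operation in the virtual protocol. -/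
def finalVirState (C : Channel.{u} (ε × Pub P) ε)
    (ρ : Op ((Key (numPulses L M) × Fin (numPulses L M + 1) × Bool × CPASeed P) ×
      (CEC P × CHash P × Option Bool × R × ε))) :
    Op (Key (numPulses L M) × ε × R) :=
  actOn (σ := Key (numPulses L M) × R) C.K
    (fun p => ((p.2.1, p.1.2.2.1, p.1.2.2.2.1, p.1.2.2.2.2.2.2),
      (p.1.2.1, p.1.2.2.2.2.1, p.1.2.2.2.2.2.1, p.2.2, p.1.1)))
    (fun q => (q.2.1, (q.1, q.2.2))) ρ

section Trace

lemma trRel_sift {ρ : Op (ε × Rest L M R (L + 1))} {ρ' : Op (ε × Rest L M Unit (L + 1))}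
    (hρ : TraceClass.{u} ρ) (h : TrRel withR ρ ρ') :
    TrRel (fun x r => (x.1, (r, x.2.2))) (sift P ρ) (sift P ρ') := by
  have e := TrRel.actOn (K := siftKraus P) (g := fun (x : Unit × ε) (r : R) => (r, x.2))
    (by rintro ⟨⟨_, a⟩, b⟩ ⟨⟨_, a'⟩, b'⟩ h; simpa [and_comm] using h)
    (inp := fun p => (p.2.2, (p.1.1, p.2.1, p.1.2))) (out := id)
    (inp' := fun p => (p.2.2, (p.1.1, p.2.1, p.1.2))) (out' := id)
    (fI := withR) (fO := fun x r => (x.1, (r, x.2.2))) hρ (bdd_of_finite _) h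
    (Function.LeftInverse.injective (g := fun q => ((q.2.1, q.2.2.2), (q.2.2.1, q.1)))
      fun _ => rfl) (fun _ _ _ => rfl) (fun _ _ => rfl)
  exact e

lemma traceClass_sift {ρ : Op (ε × Rest L M R (L + 1))} (hρ : TraceClass.{u} ρ) :
    TraceClass.{u} (sift P ρ) :=
  TraceClass.actOn.{u, 0} hρ (bdd_of_finite _)
    (Function.LeftInverse.injective (g := fun q => ((q.2.1, q.2.2.2), (q.2.2.1, q.1)))
      fun _ => rfl) Function.injective_id

lemma reorder_ecA_injective : Function.Injective
    (fun p : (Key (numPulses L M) × Bool) × (Key (numPulses L M) × Fin (numPulses L M + 1) × R × ε)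
      => ((p.1.1, p.2.1, p.2.2.1, p.1.2), p.2.2.2)) :=
  Function.LeftInverse.injective
    (g := fun q => ((q.1.1, q.1.2.2.2), (q.1.2.1, q.1.2.2.1, q.2))) fun _ => rfl

lemma reorder_ecB_injective {C : Type*} : Function.Injective
    (fun p : (Key (numPulses L M) × Bool × C) ×
      (Key (numPulses L M) × Fin (numPulses L M + 1) × R × ε) =>
      ((p.2.1, p.1.2.1, p.1.2.2), (p.1.1, p.2.2))) :=
  Function.LeftInverse.injective
    (g := fun q => ((q.2.1, q.1.2.1, q.1.2.2), (q.1.1, q.2.2))) fun _ => rfl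

lemma spectator_injective {A B : Type*} : Function.Injective
    fun p : (A × B × Unit × ε) × R => (p.1.1, p.1.2.1, p.2, p.1.2.2.2) := by
  rintro ⟨⟨a, b, c, d⟩, r⟩ ⟨⟨a', b', c', d'⟩, r'⟩ h
  simp only [Prod.mk.injEq] at h
  obtain ⟨rfl, rfl, rfl, rfl⟩ := h
  rfl

lemma traceClass_ecVirState
    {ρ : Op ((Key (numPulses L M) × Key (numPulses L M) × Fin (numPulses L M + 1) × Bool) ×
      (R × ε))} (hρ : TraceClass.{u} ρ) : TraceClass.{u} (ecVirState V ρ) := by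
  have h1 := TraceClass.actOn.{u, 0}
    (O := (Key (numPulses L M) × Bool × CEC P) ×
        (Key (numPulses L M) × Fin (numPulses L M + 1) × R × ε))
    hρ (bdd_of_finite (ecAVirKraus V)) reorder_ecA_injective Function.injective_id
  exact TraceClass.actOn.{u, 0} h1 (bdd_of_finite (ecBVirKraus P)) reorder_ecB_injective
    (Function.LeftInverse.injective
      (g := fun q => ((q.2.1, q.1.1, q.1.2.1), (q.1.2.2, q.2.2))) fun _ => rfl)

lemma trRel_ecVirState
    {ρ : Op ((Key (numPulses L M) × Key (numPulses L M) × Fin (numPulses L M + 1) × Bool) ×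
      (R × ε))}
    {ρ' : Op ((Key (numPulses L M) × Key (numPulses L M) × Fin (numPulses L M + 1) × Bool) ×
      (Unit × ε))}
    (hρ : TraceClass.{u} ρ) (h : TrRel (fun x r => (x.1, (r, x.2.2))) ρ ρ') :
    TrRel (fun x r => (x.1, (x.2.1, x.2.2.1, r, x.2.2.2.2))) (ecVirState V ρ)
      (ecVirState V ρ') := by
  have h1 := TraceClass.actOn.{u, 0}
    (O := (Key (numPulses L M) × Bool × CEC P) ×
        (Key (numPulses L M) × Fin (numPulses L M + 1) × R × ε))
    hρ (bdd_of_finite (ecAVirKraus V)) reorder_ecA_injective Function.injective_id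
  have e1 := TrRel.actOn (K := ecAVirKraus V)
    (g := fun (x : Key (numPulses L M) × Fin (numPulses L M + 1) × Unit × ε) (r : R) =>
      (x.1, x.2.1, r, x.2.2.2)) spectator_injective
    (inp := fun p => ((p.1.1, p.2.1, p.2.2.1, p.1.2), p.2.2.2)) (out := id)
    (inp' := fun p => ((p.1.1, p.2.1, p.2.2.1, p.1.2), p.2.2.2)) (out' := id)
    (fO := fun x r => (x.1, (x.2.1, x.2.2.1, r, x.2.2.2.2))) hρ (bdd_of_finite _) h
    reorder_ecA_injective (fun _ _ _ => rfl) (fun _ _ => rfl)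
  have e2 := TrRel.actOn (O := (Key (numPulses L M) × Key (numPulses L M) × Bool) ×
      (CEC P × Fin (numPulses L M + 1) × R × ε))
    (O' := (Key (numPulses L M) × Key (numPulses L M) × Bool) ×
      (CEC P × Fin (numPulses L M + 1) × Unit × ε))
    (K := ecBVirKraus P)
    (g := fun (x : Key (numPulses L M) × Fin (numPulses L M + 1) × Unit × ε) (r : R) =>
      (x.1, x.2.1, r, x.2.2.2)) spectator_injective
    (inp := fun p => ((p.2.1, p.1.2.1, p.1.2.2), (p.1.1, p.2.2)))
    (out := fun q => ((q.1.2.1, q.1.2.2, q.2.1), (q.1.1, q.2.2)))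
    (inp' := fun p => ((p.2.1, p.1.2.1, p.1.2.2), (p.1.1, p.2.2)))
    (out' := fun q => ((q.1.2.1, q.1.2.2, q.2.1), (q.1.1, q.2.2)))
    (fO := fun x r => (x.1, (x.2.1, x.2.2.1, r, x.2.2.2.2))) h1 (bdd_of_finite _) e1
    reorder_ecB_injective (fun _ _ _ => rfl) (fun _ _ => rfl)
  exact e2

lemma traceClass_verifyVirState
    {ρ : Op ((Key (numPulses L M) × Key (numPulses L M) × Bool) ×
      (CEC P × Fin (numPulses L M + 1) × R × ε))}
    (hρ : TraceClass.{u} ρ) : TraceClass.{u} (verifyVirState V ρ) :=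
  TraceClass.actOn.{u, 0} hρ (bdd_of_finite (verifyVirKraus V)) Function.injective_id
    (Function.LeftInverse.injective
      (g := fun q => ((q.1.1, q.1.2.1, q.2.2.1, q.1.2.2.1),
        (q.2.1, q.1.2.2.2.1, q.1.2.2.2.2, q.2.2.2))) fun _ => rfl)

lemma trRel_verifyVirState
    {ρ : Op ((Key (numPulses L M) × Key (numPulses L M) × Bool) ×
      (CEC P × Fin (numPulses L M + 1) × R × ε))}
    {ρ' : Op ((Key (numPulses L M) × Key (numPulses L M) × Bool) ×
      (CEC P × Fin (numPulses L M + 1) × Unit × ε))} (hρ : TraceClass.{u} ρ)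
    (h : TrRel (fun x r => (x.1, (x.2.1, x.2.2.1, r, x.2.2.2.2))) ρ ρ') :
    TrRel (fun x r => (x.1, (x.2.1, x.2.2.1, x.2.2.2.1, r, x.2.2.2.2.2))) (verifyVirState V ρ)
      (verifyVirState V ρ') := by
  have e := TrRel.actOn (O := (Key (numPulses L M) × Key (numPulses L M) ×
      Fin (numPulses L M + 1) × Bool) × (CEC P × CHash P × Option Bool × R × ε))
    (O' := (Key (numPulses L M) × Key (numPulses L M) × Fin (numPulses L M + 1) × Bool) ×
      (CEC P × CHash P × Option Bool × Unit × ε))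
    (K := verifyVirKraus V)
    (g := fun (x : CEC P × Fin (numPulses L M + 1) × Unit × ε) (r : R) =>
      (x.1, x.2.1, r, x.2.2.2)) spectator_injective
    (inp := id) (inp' := id)
    (out := fun q => ((q.1.1, q.1.2.1, q.1.2.2.2, q.2.2.1, q.2.2.2.1),
      (q.2.1, q.1.2.2.1, q.2.2.2.2)))
    (out' := fun q => ((q.1.1, q.1.2.1, q.1.2.2.2, q.2.2.1, q.2.2.2.1),
      (q.2.1, q.1.2.2.1, q.2.2.2.2)))
    (fO := fun x r => (x.1, (x.2.1, x.2.2.1, x.2.2.2.1, r, x.2.2.2.2.2))) hρ (bdd_of_finite _) h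
    Function.injective_id (fun _ _ _ => rfl) (fun _ _ => rfl)
  exact e

lemma traceClass_paVirState
    {ρ : Op ((Key (numPulses L M) × Key (numPulses L M) × Fin (numPulses L M + 1) × Bool) ×
      (CEC P × CHash P × Option Bool × R × ε))} (hρ : TraceClass.{u} ρ) :
    TraceClass.{u} (act (paVirKraus V) ρ) :=
  TraceClass.act.{u, 0} hρ (bdd_of_finite (paVirKraus V))

lemma trRel_paVirState
    {ρ : Op ((Key (numPulses L M) × Key (numPulses L M) × Fin (numPulses L M + 1) × Bool) ×
      (CEC P × CHash P × Option Bool × R × ε))}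
    {ρ' : Op ((Key (numPulses L M) × Key (numPulses L M) × Fin (numPulses L M + 1) × Bool) ×
      (CEC P × CHash P × Option Bool × Unit × ε))} (hρ : TraceClass.{u} ρ)
    (h : TrRel (fun x r => (x.1, (x.2.1, x.2.2.1, x.2.2.2.1, r, x.2.2.2.2.2))) ρ ρ') :
    TrRel (fun x r => (x.1, (x.2.1, x.2.2.1, x.2.2.2.1, r, x.2.2.2.2.2)))
      (act (paVirKraus V) ρ) (act (paVirKraus V) ρ') := by
  have e := TrRel.act (K := paVirKraus V)
    (g := fun (x : CEC P × CHash P × Option Bool × Unit × ε) (r : R) =>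
      (x.1, x.2.1, x.2.2.1, r, x.2.2.2.2))
    (by
      rintro ⟨⟨a, b, b₂, c, d⟩, r⟩ ⟨⟨a', b', b₂', c', d'⟩, r'⟩ h
      simp only [Prod.mk.injEq] at h
      obtain ⟨rfl, rfl, rfl, rfl, rfl⟩ := h
      rfl) hρ (bdd_of_finite _) h
  exact e

lemma trRel_finalVirState (C : Channel.{u} (ε × Pub P) ε)
    {ρ : Op ((Key (numPulses L M) × Fin (numPulses L M + 1) × Bool × CPASeed P) ×
      (CEC P × CHash P × Option Bool × R × ε))}
    {ρ' : Op ((Key (numPulses L M) × Fin (numPulses L M + 1) × Bool × CPASeed P) ×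
      (CEC P × CHash P × Option Bool × Unit × ε))} (hρ : TraceClass.{u} ρ)
    (h : TrRel (fun x r => (x.1, (x.2.1, x.2.2.1, x.2.2.2.1, r, x.2.2.2.2.2))) ρ ρ') :
    TrRel (fun x r => (x.1, x.2.1, r)) (finalVirState C ρ) (finalVirState C ρ') := by
  have e := TrRel.actOn (O := Key (numPulses L M) × ε × R)
    (O' := Key (numPulses L M) × ε × Unit)
    (K := C.K)
    (g := fun (x : Key (numPulses L M) × Unit) (r : R) => (x.1, r))
    (by rintro ⟨⟨a, _⟩, b⟩ ⟨⟨a', _⟩, b'⟩ h; simpa using h)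
    (inp := fun p => ((p.2.1, p.1.2.2.1, p.1.2.2.2.1, p.1.2.2.2.2.2.2),
      (p.1.2.1, p.1.2.2.2.2.1, p.1.2.2.2.2.2.1, p.2.2, p.1.1)))
    (out := fun q => (q.2.1, (q.1, q.2.2)))
    (inp' := fun p => ((p.2.1, p.1.2.2.1, p.1.2.2.2.1, p.1.2.2.2.2.2.2),
      (p.1.2.1, p.1.2.2.2.2.1, p.1.2.2.2.2.2.1, p.2.2, p.1.1)))
    (out' := fun q => (q.2.1, (q.1, q.2.2)))
    (fO := fun x r => (x.1, x.2.1, r)) hρ C.bdd h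
    (Function.LeftInverse.injective (g := fun q =>
      ((q.2.2.2.2.2, (q.2.1, q.1.2.1, q.1.2.2.1, q.2.2.1, q.2.2.2.1, q.1.2.2.2)),
        (q.1.1, q.2.2.2.2.1))) fun _ => rfl) (fun _ _ _ => rfl) (fun _ _ => rfl)
  exact e

end Trace

variable {𝒦 : Type u} (E : Eve P 𝒦 ε) (S : Channel.{u} (BSig 𝒦) (Option Bit))

/-- The virtual final state, with the systems `R` traced out already at the source. -/
lemma rhoPAVir_eq (x y : Key (numPulses L M) × ε) :
    rhoPAVir V E S x y =
      finalVirState E.final (act (paVirKraus V) (verifyVirState V (ecVirState V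
        (sift P (rhoQCTr E S))))) (x.1, x.2, ()) (y.1, y.2, ()) := by
  have t0 := traceClass_rhoQCVir E (S := S)
  have t1 := traceClass_sift (P := P) t0
  have t2 := traceClass_ecVirState V t1
  have t3 := traceClass_verifyVirState V t2
  have h1 := trRel_sift (P := P) t0 (trRel_rhoQC E)
  have h2 := trRel_ecVirState V t1 h1
  have h3 := trRel_verifyVirState V t2 h2
  have h4 := trRel_paVirState V t3 h3
  have h5 := trRel_finalVirState E.final (traceClass_paVirState V t3) h4
  exact (h5 (x.1, x.2, ()) (y.1, y.2, ())).symm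

end KeyGen

/-! ### Kraus families that act as classical maps -/

section Branch

variable {e κ ι σ : Type*} {K : e → Matrix κ ι ℂ}

/-- On finite systems a Kraus family acts through `∑ₖ Kₖ(x, a) conj Kₖ(y, b)` alone. -/
lemma act_eq_sum [Finite e] [Fintype ι] (ρ : Op (ι × σ)) (x y : κ × σ) :
    act K ρ x y = ∑ a, ∑ b, (∑' k, K k x.1 a * conj (K k y.1 b)) * ρ (a, x.2) (b, y.2) := by
  have := Fintype.ofFinite e
  unfold act
  simp only [tsum_fintype, Finset.sum_mul]
  rw [Finset.sum_comm]
  refine Finset.sum_congr rfl fun a _ => ?_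
  rw [Finset.sum_comm]
  exact Finset.sum_congr rfl fun b _ => Finset.sum_congr rfl fun k _ => by ring

/-- On the labels in `good`, the Kraus family `K` maps the label `a` to the label `T a` with
amplitude `c`, and the Kraus index tells the value `br a` to the environment. -/
structure ActsAs (K : e → Matrix κ ι ℂ) (good : ι → Prop) (br : ι → e) (T : ι → κ) (c : ℂ) :
    Prop where
  apply : ∀ k z a, good a → K k z a = if br a = k ∧ T a = z then c else 0
  inj : ∀ a b, good a → good b → br a = br b → T a = T b → a = b

variable {good : ι → Prop} {br : ι → e} {T : ι → κ} {c : ℂ}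

/-- Support properties of the output follow from those of the input. -/
lemma ActsAs.exists_of_ne_zero (h : ActsAs K good br T c) {ρ : Op (ι × σ)}
    (hρ : ∀ x y, ρ x y ≠ 0 → good x.1 ∧ good y.1) {x y : κ × σ} (hxy : act K ρ x y ≠ 0) :
    ∃ a b, good a ∧ good b ∧ br a = br b ∧ T a = x.1 ∧ T b = y.1 ∧ ρ (a, x.2) (b, y.2) ≠ 0 := by
  obtain ⟨k, a, b, h1, h2, h3⟩ := exists_of_act_ne_zero hxy
  obtain ⟨ha, hb⟩ := hρ _ _ h3
  rw [h.apply _ _ _ ha] at h1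
  rw [h.apply _ _ _ hb] at h2
  have h1' := (ite_ne_right_iff.mp h1).1
  have h2' := (ite_ne_right_iff.mp h2).1
  exact ⟨a, b, ha, hb, h1'.1.trans h2'.1.symm, h1'.2, h2'.2, h3⟩

/-- A label-preserving Kraus family acts on diagonal entries as a classical map. -/
lemma ActsAs.act_diag [Finite e] [Fintype ι] (h : ActsAs K good br T c) {ρ : Op (ι × σ)}
    (hρ : ∀ x y, ρ x y ≠ 0 → good x.1 ∧ good y.1) (z : κ) (s t : σ) :
    act K ρ (z, s) (z, t) = ∑ a, if T a = z then c * conj c * ρ (a, s) (a, t) else 0 := by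
  rw [act_eq_sum]
  refine Finset.sum_congr rfl fun a _ => ?_
  by_cases ha : good a
  swap
  · have h0 : ∀ b, ρ (a, s) (b, t) = 0 := fun b => by
      by_contra hn
      exact ha (hρ _ _ hn).1
    simp [h0]
  rw [Finset.sum_eq_single a]
  · simp only [h.apply _ _ _ ha]
    by_cases hz : T a = z
    · rw [tsum_eq_single (br a)]
      · simp [hz]
      · intro k hk; simp [hk.symm]
    · simp [hz]
  · intro b _ hb
    by_cases h0 : ρ (a, s) (b, t) = 0
    · simp [h0]
    have hgb := (hρ _ _ h0).2
    have h1 : ∀ k, K k z a * conj (K k z b) = 0 := by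
      intro k
      rw [h.apply _ _ _ ha, h.apply _ _ _ hgb]
      by_cases h2 : br a = k ∧ T a = z
      · by_cases h3 : br b = k ∧ T b = z
        · exact absurd (h.inj a b ha hgb (h2.1.trans h3.1.symm) (h2.2.trans h3.2.symm)).symm hb
        · simp [h3]
      · simp [h2]
    simp [h1]
  · simp

end Branch

/-! ### Linear maps of key labels -/

section LinU

variable {N : ℕ}

/-- The map of labels underlying `linU`. -/
def linKey (C : ∀ n, Matrix (Fin n) (Fin n) Bit) (k : Key N) : Key N :=
  ⟨k.1, Matrix.vecMul k.2 (C k.1.val)⟩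

lemma linU_apply (C : ∀ n, Matrix (Fin n) (Fin n) Bit) (x y : Key N) :
    linU N C x y = if x = linKey C y then 1 else 0 := by
  unfold linU
  rw [Matrix.sum_apply, Finset.sum_eq_single y]
  · simp only [ketBra, linKey, and_true]
    congr
  · intro b _ hb; simp [ketBra, Ne.symm hb]
  · simp

lemma linU_conj_apply (C : ∀ n, Matrix (Fin n) (Fin n) Bit) (D : Op (Key N)) (x y : Key N) :
    ((linU N C).conjTranspose * D * linU N C : Op (Key N)) x y =
      D (linKey C x) (linKey C y) := by
  rw [Matrix.mul_apply, Finset.sum_eq_single (linKey C y)]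
  · rw [Matrix.mul_apply, Finset.sum_eq_single (linKey C x)]
    · simp [linU_apply]
    · intro b _ hb; simp [linU_apply, hb]
    · simp
  · intro b _ hb; simp [linU_apply, hb]
  · simp

lemma linKey_inj {C : ∀ n, Matrix (Fin n) (Fin n) Bit} {x y : Key N} (hC : IsUnit (C y.1.val))
    (h : linKey C x = linKey C y) : x = y := by
  obtain ⟨n, x⟩ := x
  obtain ⟨n', y⟩ := y
  obtain rfl : n = n' := congrArg Sigma.fst h
  have h1 : Matrix.vecMul x (C n.val) = Matrix.vecMul y (C n.val) :=
    eq_of_heq (Sigma.mk.inj h).2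
  rw [Matrix.vecMul_injective_of_isUnit hC h1]

lemma zFirst_apply {l : ℕ} (n : Fin (N + 1)) (s : Fin l → Bit) (x y : Key N) :
    zFirst n s x y = if x = y ∧ y.1 = n ∧ firstBits l y.2 = s then 1 else 0 := by
  unfold zFirst
  obtain ⟨m, y⟩ := y
  rw [Matrix.sum_apply]
  by_cases hm : m = n
  · subst hm
    rw [Finset.sum_eq_single y]
    · by_cases h1 : firstBits l y = s <;> simp [h1, ketBra]
    · intro b _ hb
      by_cases h1 : firstBits l b = s <;> simp [h1, ketBra, Ne.symm hb]
    · simp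
  · rw [Finset.sum_eq_zero]
    · simp [hm]
    · intro b _
      by_cases h1 : firstBits l b = s <;> simp [h1, ketBra, hm]

lemma firstBits_self {n : ℕ} (a : Fin n → Bit) : firstBits n a = a := by
  funext i; simp [firstBits]

lemma firstBits_vecMul {n l : ℕ} (hl : l ≤ n) (a : Fin n → Bit) (T : Matrix (Fin n) (Fin n) Bit)
    (C : Matrix (Fin n) (Fin l) Bit)
    (h : ∀ (i j : Fin n) (k : Fin l), j.val = k.val → T i j = C i k) :
    firstBits l (Matrix.vecMul a T) = Matrix.vecMul a C := by
  funext k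
  have hk : k.val < n := lt_of_lt_of_le k.2 hl
  simp only [firstBits, hk, dif_pos, Matrix.vecMul, dotProduct]
  exact Finset.sum_congr rfl fun i _ => by rw [h i ⟨k, hk⟩ k rfl]

lemma lastBits_vecMul {n m : ℕ} (hm : m ≤ n) (a : Fin n → Bit) (T : Matrix (Fin n) (Fin n) Bit)
    (C : Matrix (Fin n) (Fin m) Bit)
    (h : ∀ (i j : Fin n) (k : Fin m), j.val = n - m + k.val → T i j = C i k) :
    lastBits m (Matrix.vecMul a T) = Matrix.vecMul a C := by
  funext k
  have hk : n - m + k.val < n := by have := k.2; omega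
  simp only [lastBits, hk, dif_pos, Matrix.vecMul, dotProduct]
  exact Finset.sum_congr rfl fun i _ => by rw [h i ⟨_, hk⟩ k rfl]

lemma numPulses_le {L M : ℕ} (n : Fin (numPulses L M + 1)) : n.val ≤ numPulses L M :=
  Nat.lt_succ_iff.mp n.2

end LinU

/-! ### Sifting -/

section Sifting

variable {L M : ℕ} {P : Params L M} {ε : Type u}

lemma consistent_eraseSifted {d : Data L M} (h : Consistent d) (i : Fin (numPulses L M)) :
    recAt (eraseSifted d) i = if i ∈ siftSet d then (((recAt d i).1.1, some 0), (recAt d i).2)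
      else recAt d i := by
  unfold eraseSifted recAt
  rw [if_pos h]
  simp only [Prod.mk.eta, Equiv.apply_symm_apply]

lemma eraseSifted_fst {d : Data L M} (h : Consistent d) (i : Fin (numPulses L M)) :
    (eraseSifted d).1 i = if i ∈ siftSet d then ((d.1 i).1, (d.1 i).2.1, 0) else d.1 i := by
  unfold eraseSifted
  rw [if_pos h]

lemma mem_siftSet {d : Data L M} {i : Fin (numPulses L M)} : i ∈ siftSet d ↔
    (d.1 i).2.1 = Basis.Z ∧ (recAt d i).1.1 = Basis.Z ∧ (recAt d i).1.2 ≠ none := by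
  simp [siftSet]

lemma siftSet_eraseSifted (d : Data L M) : siftSet (eraseSifted d) = siftSet d := by
  by_cases h : Consistent d
  swap
  · unfold eraseSifted; rw [if_neg h]
  ext i
  rw [mem_siftSet, mem_siftSet, consistent_eraseSifted h, eraseSifted_fst h]
  by_cases hi : i ∈ siftSet d
  · have := mem_siftSet.mp hi
    simp [hi, this]
  · simp [hi]

lemma numSift_eraseSifted (d : Data L M) : numSift (eraseSifted d) = numSift d := by
  by_cases h : Consistent d
  swap
  · unfold eraseSifted; rw [if_neg h]
  funext ω
  unfold numSift
  rw [siftSet_eraseSifted]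
  congr 1
  refine Finset.filter_congr fun i _ => ?_
  rw [eraseSifted_fst h]
  split_ifs
  rfl

lemma numErrX_eraseSifted (d : Data L M) : numErrX (eraseSifted d) = numErrX d := by
  by_cases h : Consistent d
  swap
  · unfold eraseSifted; rw [if_neg h]
  funext ω
  unfold numErrX
  congr 1
  refine Finset.filter_congr fun i _ => ?_
  rw [eraseSifted_fst h, consistent_eraseSifted h]
  by_cases hi : i ∈ siftSet d
  · have := (mem_siftSet.mp hi).1
    simp [hi, this]
  · simp [hi]

lemma finalLength_eraseSifted (d : Data L M) : finalLength P (eraseSifted d) = finalLength P d := by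
  unfold finalLength
  simp only [numSift_eraseSifted, numErrX_eraseSifted, siftSet_eraseSifted]

/-- The announcements do not depend on the sifted bits. -/
lemma consistent_eraseSifted_iff (d : Data L M) : Consistent (eraseSifted d) ↔ Consistent d := by
  by_cases h : Consistent d
  swap
  · unfold eraseSifted; rw [if_neg h]
  refine iff_of_true (fun i => ?_) h
  rw [consistent_eraseSifted h, eraseSifted_fst h]
  by_cases hi : i ∈ siftSet d
  · obtain ⟨h1, h2, h3⟩ := mem_siftSet.mp hi
    rw [if_pos hi, if_pos hi]
    obtain ⟨h4, h5⟩ := h i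
    obtain ⟨b, hb⟩ := Option.ne_none_iff_exists'.mp h3
    have h6 : (recAt d i).1 = (Basis.Z, some b) := Prod.ext h2 hb
    rw [h6] at h4
    refine ⟨?_, ?_⟩
    · simp only [h4, h2]; rfl
    · simp only [h5, h4, aliceAnn, h1]
      simp
  · rw [if_neg hi, if_neg hi]; exact h i

lemma siftedKey_eq {d d' : Data L M} (hS : siftSet d = siftSet d')
    {f g : Fin (numPulses L M) → Bit} (h : siftedKey d f = siftedKey d' g) :
    ∀ i ∈ siftSet d, f i = g i := by
  unfold siftedKey at h
  have key : ∀ (S S' : Finset (Fin (numPulses L M))) (hS : S = S')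
      (h1 : S.card < numPulses L M + 1) (h2 : S'.card < numPulses L M + 1),
      (⟨⟨S.card, h1⟩, fun t => f (S.orderEmbOfFin rfl t)⟩ : Key (numPulses L M)) =
        ⟨⟨S'.card, h2⟩, fun t => g (S'.orderEmbOfFin rfl t)⟩ → ∀ i ∈ S, f i = g i := by
    rintro S S' rfl h1 h2 h i hi
    have h3 := eq_of_heq (Sigma.mk.inj h).2
    have h4 : i ∈ Set.range (S.orderEmbOfFin rfl) := by
      rw [Finset.range_orderEmbOfFin]; exact hi
    obtain ⟨t, rfl⟩ := h4
    exact congrFun h3 t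
  exact key _ _ hS _ _ h

lemma actsAs_sift : ActsAs (siftKraus P) (fun _ => True) eraseSifted (siftOut P) 1 where
  apply k z a _ := by
    unfold siftKraus
    exact ite_eq_ite_of_iff ⟨fun h => ⟨h.1.symm, h.2.symm⟩, fun h => ⟨h.1.symm, h.2.symm⟩⟩ _ _
  inj d d' _ _ h1 h2 := by
    have hc : Consistent d ↔ Consistent d' := by
      rw [← consistent_eraseSifted_iff d, h1, consistent_eraseSifted_iff]
    by_cases h : Consistent d
    swap
    · have h' : ¬ Consistent d' := fun hn => h (hc.mpr hn)
      unfold eraseSifted at h1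
      rwa [if_neg h, if_neg h'] at h1
    have h' := hc.mp h
    have hS : siftSet d = siftSet d' := by
      rw [← siftSet_eraseSifted d, h1, siftSet_eraseSifted]
    unfold siftOut at h2
    rw [if_pos h, if_pos h'] at h2
    simp only [Prod.mk.injEq] at h2
    have hA := siftedKey_eq hS h2.1
    have hB := siftedKey_eq hS h2.2.1
    have e1 : ∀ i, d.1 i = d'.1 i := by
      intro i
      have := congrFun (congrArg Prod.fst h1) i
      rw [eraseSifted_fst h, eraseSifted_fst h', ← hS] at this
      by_cases hi : i ∈ siftSet d
      · rw [if_pos hi, if_pos hi] at this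
        simp only [Prod.mk.injEq] at this
        exact Prod.ext this.1 (Prod.ext this.2.1 (hA i hi))
      · rwa [if_neg hi, if_neg hi] at this
    have e2 : ∀ i, recAt d i = recAt d' i := by
      intro i
      have : recAt (eraseSifted d) i = recAt (eraseSifted d') i := by rw [h1]
      rw [consistent_eraseSifted h, consistent_eraseSifted h', ← hS] at this
      by_cases hi : i ∈ siftSet d
      · rw [if_pos hi, if_pos hi] at this
        simp only [Prod.mk.injEq] at this
        obtain ⟨-, h3, h4⟩ := mem_siftSet.mp hi
        obtain ⟨-, -, h5⟩ := mem_siftSet.mp (hS ▸ hi)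
        obtain ⟨b, hb⟩ := Option.ne_none_iff_exists'.mp h4
        obtain ⟨b', hb'⟩ := Option.ne_none_iff_exists'.mp h5
        have h6 := hB i hi
        rw [hb, hb'] at h6
        simp only [Option.getD_some] at h6
        exact Prod.ext (Prod.ext this.1.1 (by rw [hb, hb', h6])) this.2
      · rwa [if_neg hi, if_neg hi] at this
    refine Prod.ext (funext e1) (funext fun j => funext fun m => ?_)
    have := e2 (finProdFinEquiv (j, m))
    simpa [recAt] using this

variable {τ : Op (ε × Rest L M Unit (L + 1))}

lemma sift_dephase :
    sift P (dephase (fun x => restLab x.2) τ) = dephase (fun x => x.1) (sift P τ) := by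
  have hg : ∀ ρ : Op (Data L M × (Unit × ε)), ∀ x y, ρ x y ≠ 0 → True ∧ True :=
    fun _ _ _ _ => ⟨trivial, trivial⟩
  funext x y
  obtain ⟨x, s⟩ := x
  obtain ⟨y, t⟩ := y
  by_cases hxy : x = y
  · subst hxy
    simp only [dephase, if_true]
    have h1 := (actsAs_sift (P := P)).act_diag (hg ((dephase (fun x => restLab x.2) τ).submatrix
      (fun p => (p.2.2, (p.1.1, p.2.1, p.1.2))) (fun p => (p.2.2, (p.1.1, p.2.1, p.1.2))))) x s t
    have h2 := (actsAs_sift (P := P)).act_diag (hg (τ.submatrix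
      (fun p => (p.2.2, (p.1.1, p.2.1, p.1.2))) (fun p => (p.2.2, (p.1.1, p.2.1, p.1.2))))) x s t
    refine h1.trans (Eq.trans ?_ h2.symm)
    refine Finset.sum_congr rfl fun a _ => ?_
    simp only [Matrix.submatrix_apply, dephase, restLab, if_true]
    exact ite_eq_ite_of_iff Iff.rfl _ _
  · have h0 : dephase (fun x : (Key (numPulses L M) × Key (numPulses L M) ×
        Fin (numPulses L M + 1) × Bool) × (Unit × ε) => x.1) (sift P τ) (x, s) (y, t) = 0 := by
      simp [dephase, hxy]
    rw [h0]
    by_contra hn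
    obtain ⟨a, b, -, -, -, ha, hb, h1⟩ := actsAs_sift.exists_of_ne_zero (hg _) hn
    simp only [Matrix.submatrix_apply, dephase, restLab] at h1
    have h2 := (ite_ne_right_iff.mp h1).1
    have h3 : a = b := Prod.ext (Prod.ext_iff.mp h2).1 (Prod.ext_iff.mp h2).2
    exact hxy (ha.symm.trans ((congrArg _ h3).trans hb))

/-- What sifting guarantees about its output. -/
def SiftGood (P : Params L M)
    (x : Key (numPulses L M) × Key (numPulses L M) × Fin (numPulses L M + 1) × Bool) : Prop :=
  x.1.1 = x.2.1.1 ∧ (x.2.2.2 = true → P.NEC x.1.1.val + P.Nverify + x.2.2.1.val ≤ x.1.1.val)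

lemma siftGood_siftOut (d : Data L M) : SiftGood P (siftOut P d) := by
  unfold siftOut SiftGood
  split_ifs
  · refine ⟨rfl, fun h => ?_⟩
    have := of_decide_eq_true h
    simp only [finalLength, siftedKey] at this ⊢
    omega
  · exact ⟨rfl, fun h => by simp at h⟩

/-- The environment of sifting keeps the erased records, which determine the key lengths. -/
lemma sift_support {x y : (Key (numPulses L M) × Key (numPulses L M) × Fin (numPulses L M + 1) ×
      Bool) × (Unit × ε)} (h : sift P τ x y ≠ 0) :
    SiftGood P x.1 ∧ SiftGood P y.1 ∧ x.1.1.1 = y.1.1.1 ∧ x.1.2.2 = y.1.2.2 := by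
  obtain ⟨a, b, -, -, h1, ha, hb, -⟩ := actsAs_sift.exists_of_ne_zero
    (fun _ _ _ => ⟨trivial, trivial⟩) h
  change siftOut P a = x.1 at ha
  change siftOut P b = y.1 at hb
  rw [← ha, ← hb]
  refine ⟨siftGood_siftOut a, siftGood_siftOut b, ?_⟩
  have hc : Consistent a ↔ Consistent b := by
    rw [← consistent_eraseSifted_iff a, h1, consistent_eraseSifted_iff]
  have hS : siftSet a = siftSet b := by
    rw [← siftSet_eraseSifted a, h1, siftSet_eraseSifted]
  have hl : finalLength P a = finalLength P b := by
    rw [← finalLength_eraseSifted a, h1, finalLength_eraseSifted]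
  unfold siftOut
  by_cases h : Consistent a
  · rw [if_pos h, if_pos (hc.mp h)]
    refine ⟨?_, by simp only [hl]⟩
    simp only [siftedKey, hS]
  · rw [if_neg h, if_neg fun hn => h (hc.mpr hn)]
    exact ⟨rfl, rfl⟩

end Sifting

/-! ### Error correction -/

section EC

variable {L M : ℕ} {P : Params L M} {ε : Type u} (V : VirParams P)

/-- The syndrome of a key. -/
def syndOf (P : Params L M) (k : Key (numPulses L M)) :
    Σ n : Fin (numPulses L M + 1), (Fin (P.NEC n.val) → Bit) :=
  ⟨k.1, Matrix.vecMul k.2 (P.Csynd k.1.val)⟩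

/-- The key corrected by means of a syndrome; meant for a key of the length of the syndrome. -/
def corrected (P : Params L M)
    (s : Σ n : Fin (numPulses L M + 1), (Fin (P.NEC n.val) → Bit)) (k : Key (numPulses L M)) :
    Key (numPulses L M) :=
  ⟨s.1, firstBits s.1.val k.2 + P.fEC s.1.val s.2⟩

lemma zFirst_synd_apply {x y : Key (numPulses L M)} (hy : P.NEC y.1.val ≤ y.1.val)
    (s : Σ n : Fin (numPulses L M + 1), (Fin (P.NEC n.val) → Bit)) :
    ((linU _ V.tCsynd).conjTranspose * zFirst s.1 s.2 * linU _ V.tCsynd :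
      Op (Key (numPulses L M))) x y = if x = y ∧ syndOf P y = s then 1 else 0 := by
  rw [linU_conj_apply, zFirst_apply]
  have hU := V.tCsynd_unit y.1.val hy (numPulses_le y.1)
  refine ite_eq_ite_of_iff ?_ _ _
  have hf : firstBits (P.NEC y.1.val) (Matrix.vecMul y.2 (V.tCsynd y.1.val)) =
      Matrix.vecMul y.2 (P.Csynd y.1.val) :=
    firstBits_vecMul hy _ _ _ (V.tCsynd_cols y.1.val hy (numPulses_le y.1))
  constructor
  · rintro ⟨h1, h2, h3⟩
    refine ⟨linKey_inj hU h1, ?_⟩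
    obtain ⟨n, s⟩ := s
    obtain ⟨n', y⟩ := y
    change n' = n at h2
    subst h2
    unfold syndOf
    simp only at h3 hf ⊢
    rw [← h3, ← hf]
    rfl
  · rintro ⟨rfl, rfl⟩
    exact ⟨rfl, rfl, hf⟩

lemma actsAs_ecA : ActsAs (ecAVirKraus V)
    (fun a => a.2 = true → P.NEC a.1.1.val ≤ a.1.1.val)
    (fun a => if a.2 = true then Sum.inl (syndOf P a.1) else Sum.inr a.1)
    (fun a => if a.2 = true then (a.1, true, some (syndOf P a.1)) else (nullKey _, false, none))
    1 where
  apply k z a ha := by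
    obtain ⟨a, f⟩ := a
    obtain ⟨z, f', c⟩ := z
    cases k with
    | inl s =>
      cases f with
      | true =>
        simp only [ecAVirKraus, if_true, zFirst_synd_apply V (ha rfl), Sum.inl.injEq, Prod.mk.injEq]
        by_cases h1 : syndOf P a = s
        · subst h1
          by_cases h2 : z = a
          · subst h2
            simp [eq_comm]
          · simp [h2, Ne.symm h2]
        · simp [h1]
      | false => simp [ecAVirKraus]
    | inr k =>
      cases f with
      | true => simp [ecAVirKraus, ketBra]
      | false =>
        simp only [ecAVirKraus, ketBra, Bool.false_eq_true, if_false, Sum.inr.injEq,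
          Prod.mk.injEq, and_true]
        exact ite_eq_ite_of_iff
          ⟨fun ⟨⟨h1, h2, h3⟩, h4⟩ => ⟨h4, h1.symm, h2.symm, h3.symm⟩,
            fun ⟨h4, h1, h2, h3⟩ => ⟨⟨h1.symm, h2.symm, h3.symm⟩, h4⟩⟩ _ _
  inj a b ha hb h1 h2 := by
    obtain ⟨a, f⟩ := a
    obtain ⟨b, f'⟩ := b
    cases f <;> cases f' <;> simp_all

/-- The inputs of Bob's error correction: flag and syndrome match the key length. -/
def EcBGood (P : Params L M) (b : Key (numPulses L M) × Bool × CEC P) : Prop :=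
  match b.2.2 with
  | some s => b.2.1 = true ∧ s.1 = b.1.1
  | none => b.2.1 = false

lemma actsAs_ecB : ActsAs (ecBVirKraus P) (EcBGood P)
    (fun b => match b.2.2 with
      | some s => Sum.inl s
      | none => Sum.inr b.1)
    (fun b => match b.2.2 with
      | some s => (corrected P s b.1, true, some s)
      | none => (nullKey _, false, none)) 1 where
  apply k z b hb := by
    obtain ⟨b, f, c⟩ := b
    cases c with
    | none =>
      have hf : f = false := hb
      subst hf
      cases k with
      | inl s =>
        simp only [ecBVirKraus, Matrix.sum_apply, ketBra]
        simp
      | inr k =>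
        simp only [ecBVirKraus, ketBra, Sum.inr.injEq, Prod.mk.injEq, and_true]
        exact ite_eq_ite_of_iff ⟨fun h => ⟨h.2, h.1.symm⟩, fun h => ⟨h.2.symm, h.1⟩⟩ _ _
    | some s' =>
      obtain ⟨hf, hs⟩ : f = true ∧ s'.1 = b.1 := hb
      subst hf
      cases k with
      | inr k => simp [ecBVirKraus, ketBra]
      | inl s =>
        obtain ⟨n, b⟩ := b
        obtain ⟨n', s'⟩ := s'
        change n' = n at hs
        subst hs
        simp only [ecBVirKraus, Matrix.sum_apply, ketBra, Sum.inl.injEq, Prod.mk.injEq,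
          Option.some.injEq, true_and]
        by_cases h1 : (⟨n', s'⟩ : Σ n : Fin (numPulses L M + 1), (Fin (P.NEC n.val) → Bit)) = s
        · subst h1
          simp only [and_true, true_and]
          rw [Finset.sum_eq_single b]
          · simp only [and_true, corrected, firstBits_self]
            exact ite_eq_ite_of_iff eq_comm _ _
          · intro b' _ hb'
            rw [if_neg]
            rintro ⟨-, h⟩
            exact hb' (eq_of_heq (Sigma.mk.inj h).2).symm
          · simp
        · simp [h1]
  inj a b ha hb h1 h2 := by
    obtain ⟨a, f, c⟩ := a
    obtain ⟨b, f', c'⟩ := b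
    cases c with
    | none =>
      cases c' with
      | none =>
        have e1 : f = false := ha
        have e2 : f' = false := hb
        simp at h1
        simp [e1, e2, h1]
      | some s => simp at h1
    | some s =>
      cases c' with
      | none => simp at h1
      | some s' =>
        obtain ⟨e1, e2⟩ : f = true ∧ s.1 = a.1 := ha
        obtain ⟨e3, e4⟩ : f' = true ∧ s'.1 = b.1 := hb
        simp only [Sum.inl.injEq] at h1
        subst h1
        obtain ⟨n, a⟩ := a
        obtain ⟨n', b⟩ := b
        obtain ⟨n'', s⟩ := s
        change n'' = n at e2
        change n'' = n' at e4
        subst e2 e4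
        simp only [corrected, firstBits_self, Prod.mk.injEq, Sigma.mk.injEq, heq_eq_eq, true_and,
          and_true, add_left_inj] at h2
        simp [e1, e3, h2]

/-- Actual error correction as a map of labels. -/
def ecMap (P : Params L M) (a : Key (numPulses L M) × Key (numPulses L M) × Bool) :
    Key (numPulses L M) × Key (numPulses L M) × Bool × CEC P :=
  if a.2.2 = true then (a.1, corrected P (syndOf P a.1) a.2.1, true, some (syndOf P a.1))
  else (nullKey _, nullKey _, false, none)

/-- The two keys as one index of Kraus operators. -/
def keyPair {N : ℕ} (k l : Key N) : Σ n : Fin (N + 1), (Fin n.val → Bit) × (Fin n.val → Bit) :=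
  ⟨k.1, k.2, firstBits k.1.val l.2⟩

lemma ketBra_keyPair {N : ℕ} {A : Type*} {kA kB : Key N} (h : kA.1 = kB.1)
    (k : Σ n : Fin (N + 1), (Fin n.val → Bit) × (Fin n.val → Bit)) (a b : A) :
    ((kA, kB, a) = ((⟨k.1, k.2.1⟩ : Key N), (⟨k.1, k.2.2⟩ : Key N), b)) ↔
      keyPair kA kB = k ∧ a = b := by
  obtain ⟨n, u⟩ := kA
  obtain ⟨n', v⟩ := kB
  change n = n' at h
  subst h
  obtain ⟨m, u', v'⟩ := k
  constructor
  · intro h1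
    simp only [Prod.mk.injEq] at h1
    obtain ⟨h2, h3, h4⟩ := h1
    obtain rfl : n = m := congrArg Sigma.fst h2
    have e1 := eq_of_heq (Sigma.mk.inj h2).2
    have e2 := eq_of_heq (Sigma.mk.inj h3).2
    subst e1 e2
    exact ⟨by simp [keyPair, firstBits_self], h4⟩
  · rintro ⟨h1, rfl⟩
    obtain rfl : n = m := congrArg Sigma.fst h1
    have e1 := eq_of_heq (Sigma.mk.inj h1).2
    simp only [firstBits_self, Prod.mk.injEq] at e1
    obtain ⟨rfl, rfl⟩ := e1
    rfl

lemma keyPair_inj {N : ℕ} {kA kB lA lB : Key N} (h : kA.1 = kB.1) (h' : lA.1 = lB.1)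
    (he : keyPair kA kB = keyPair lA lB) : kA = lA ∧ kB = lB := by
  have h1 := (ketBra_keyPair (A := Unit) h (keyPair lA lB) () ()).mpr ⟨he, rfl⟩
  have h2 := (ketBra_keyPair (A := Unit) h' (keyPair lA lB) () ()).mpr ⟨rfl, rfl⟩
  have h3 := h1.trans h2.symm
  simp only [Prod.mk.injEq, and_true] at h3
  exact h3

lemma actsAs_ec : ActsAs (ecKraus P) (fun a => a.1.1 = a.2.1.1) (fun a => keyPair a.1 a.2.1)
    (ecMap P) 1 where
  apply k z a ha := by
    obtain ⟨kA, kB, f⟩ := a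
    change kA.1 = kB.1 at ha
    unfold ecKraus
    simp only [Matrix.add_apply, ketBra, ketBra_keyPair ha]
    by_cases hk : keyPair kA kB = k
    · subst hk
      cases f with
      | true =>
        simp only [ecMap, keyPair, if_true, and_true, true_and, Bool.true_eq_false, and_false,
          if_false, add_zero]
        refine ite_eq_ite_of_iff ⟨fun h => ?_, fun h => ?_⟩ _ _
        · rw [h]; rfl
        · rw [← h]; rfl
      | false =>
        simp only [ecMap, and_true, true_and, Bool.false_eq_true, and_false,
          if_false, zero_add]
        exact ite_eq_ite_of_iff eq_comm _ _
    · simp [hk]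
  inj a b ha hb h1 h2 := by
    obtain ⟨kA, kB, f⟩ := a
    obtain ⟨lA, lB, g⟩ := b
    obtain ⟨rfl, rfl⟩ := keyPair_inj ha hb h1
    cases f <;> cases g <;> simp_all [ecMap]

/-- Actual error correction. -/
def ecState (P : Params L M)
    (ρ : Op ((Key (numPulses L M) × Key (numPulses L M) × Fin (numPulses L M + 1) × Bool) ×
      (Unit × ε))) :
    Op ((Key (numPulses L M) × Key (numPulses L M) × Bool) ×
      (CEC P × Fin (numPulses L M + 1) × Unit × ε)) :=
  actOn (σ := Fin (numPulses L M + 1) × Unit × ε) (ecKraus P)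
      (fun p => ((p.1.1, p.1.2.1, p.2.1, p.1.2.2), p.2.2))
      (fun q => ((q.1.1, q.1.2.1, q.1.2.2, q.2.1), q.2.2)) ρ

/-- What error correction guarantees about its output. -/
def EcGood (X : (Key (numPulses L M) × Key (numPulses L M) × Bool) ×
      (CEC P × Fin (numPulses L M + 1) × Unit × ε)) : Prop :=
  X.1.1.1 = X.1.2.1.1 ∧ (X.1.2.2 = true → P.Nverify + X.2.2.1.val ≤ X.1.1.1.val) ∧
    (X.1.2.2 = false → X.1.1 = nullKey _ ∧ X.1.2.1 = nullKey _)

/-- What Alice's part of error correction guarantees about its output. -/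
def EcAGood (X : (Key (numPulses L M) × Bool × CEC P) ×
      (Key (numPulses L M) × Fin (numPulses L M + 1) × Unit × ε)) : Prop :=
  (X.1.2.1 = true ∧ X.1.2.2 = some (syndOf P X.1.1) ∧ X.1.1.1 = X.2.1.1 ∧
    P.NEC X.1.1.1.val + P.Nverify + X.2.2.1.val ≤ X.1.1.1.val) ∨
  (X.1.2.1 = false ∧ X.1.2.2 = none ∧ X.1.1 = nullKey _)

section State

lemma dephase_ne_zero {X C : Type*} {lab : X → C} {ρ : Op X} {x y : X}
    (h : dephase lab ρ x y ≠ 0) : lab x = lab y ∧ ρ x y ≠ 0 :=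
  ite_ne_right_iff.mp h

/-- Composition of two classical steps, by summation over the intermediate label. -/
lemma sum_two_step {A B F G A' Z W : Type*} [Fintype A] [Fintype B] [Fintype F] [Fintype G]
    {TA : A × F → A' × G} {TB : B × G → W} {T : A × B × F → Z} {z : Z} {k : A'} {w : W}
    (h : ∀ a b f, T (a, b, f) = z ↔ (TA (a, f)).1 = k ∧ TB (b, (TA (a, f)).2) = w)
    (D : A × B × F → ℂ) :
    (∑ a, if T a = z then D a else 0) =
      ∑ b : B × G, if TB b = w then ∑ a : A × F, if TA a = (k, b.2) then D (a.1, b.1, a.2) else 0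
        else 0 := by
  have h1 : ∀ b : B × G, (if TB b = w then ∑ a : A × F,
      if TA a = (k, b.2) then D (a.1, b.1, a.2) else 0 else 0) =
      ∑ a : A × F, if TB b = w ∧ TA a = (k, b.2) then D (a.1, b.1, a.2) else 0 := fun b => by
    split_ifs with hb <;> simp [hb]
  simp only [h1]
  rw [Finset.sum_comm, Fintype.sum_prod_type, Fintype.sum_prod_type]
  refine Finset.sum_congr rfl fun a _ => ?_
  rw [Fintype.sum_prod_type, Finset.sum_comm]
  refine Finset.sum_congr rfl fun f _ => ?_
  rw [Fintype.sum_prod_type]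
  refine Finset.sum_congr rfl fun b _ => ?_
  rw [Finset.sum_eq_single (TA (a, f)).2]
  · refine ite_eq_ite_of_iff ?_ _ _
    rw [h a b f, and_comm, Prod.ext_iff]
    simp
  · intro g _ hg
    rw [if_neg]
    rintro ⟨-, h2⟩
    exact hg (by rw [h2])
  · simp

/-- The support properties of a state after sifting. -/
def SiftSupp (P : Params L M) (ρ : Op ((Key (numPulses L M) × Key (numPulses L M) ×
    Fin (numPulses L M + 1) × Bool) × (Unit × ε))) : Prop :=
  ∀ x y, ρ x y ≠ 0 → SiftGood P x.1 ∧ SiftGood P y.1 ∧ x.1.1.1 = y.1.1.1 ∧ x.1.2.2 = y.1.2.2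

variable {ρ : Op ((Key (numPulses L M) × Key (numPulses L M) × Fin (numPulses L M + 1) × Bool) ×
      (Unit × ε))}

/-- Alice's part of virtual error correction. -/
abbrev ecAState (ρ : Op ((Key (numPulses L M) × Key (numPulses L M) ×
      Fin (numPulses L M + 1) × Bool) × (Unit × ε))) :
    Op ((Key (numPulses L M) × Bool × CEC P) ×
      (Key (numPulses L M) × Fin (numPulses L M + 1) × Unit × ε)) :=
  actOn (σ := Key (numPulses L M) × Fin (numPulses L M + 1) × Unit × ε) (ecAVirKraus V)
      (fun p => ((p.1.1, p.2.1, p.2.2.1, p.1.2), p.2.2.2)) id ρ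

lemma ecA_good (hρ : SiftSupp P ρ) (x y : (Key (numPulses L M) × Bool) ×
    (Key (numPulses L M) × Fin (numPulses L M + 1) × Unit × ε))
    (h : ρ.submatrix (fun p => ((p.1.1, p.2.1, p.2.2.1, p.1.2), p.2.2.2))
      (fun p => ((p.1.1, p.2.1, p.2.2.1, p.1.2), p.2.2.2)) x y ≠ 0) :
    (x.1.2 = true → P.NEC x.1.1.1.val ≤ x.1.1.1.val) ∧
      (y.1.2 = true → P.NEC y.1.1.1.val ≤ y.1.1.1.val) := by
  obtain ⟨h1, h2, -, -⟩ := hρ _ _ h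
  refine ⟨fun hx => ?_, fun hy => ?_⟩
  · have := h1.2 hx
    simp only at this
    omega
  · have := h2.2 hy
    simp only at this
    omega

lemma ecAState_support (hρ : SiftSupp P ρ) {X Y} (h : ecAState V ρ X Y ≠ 0) :
    EcAGood X ∧ EcAGood Y ∧ X.1.2 = Y.1.2 ∧ X.2.2.1 = Y.2.2.1 := by
  obtain ⟨a, b, -, -, h1, ha, hb, h2⟩ := (actsAs_ecA V).exists_of_ne_zero (ecA_good hρ) h
  obtain ⟨g1, g2, g3, g4⟩ := hρ _ _ h2
  obtain ⟨⟨kA, f, c⟩, ⟨kB, m, u, e⟩⟩ := X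
  obtain ⟨⟨kA', f', c'⟩, ⟨kB', m', u', e'⟩⟩ := Y
  obtain ⟨a, g⟩ := a
  obtain ⟨b, g'⟩ := b
  simp only [SiftGood, id, Prod.mk.injEq] at g1 g2 g3 g4
  obtain ⟨rfl, rfl⟩ := g4
  cases g with
  | true =>
    simp only [if_true, id, Prod.mk.injEq, Sum.inl.injEq] at h1 ha hb
    obtain ⟨rfl, rfl, rfl⟩ := ha
    obtain ⟨rfl, rfl, rfl⟩ := hb
    refine ⟨Or.inl ⟨rfl, rfl, g1.1, g1.2 rfl⟩, Or.inl ⟨rfl, rfl, g2.1, g2.2 rfl⟩, ?_, rfl⟩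
    simp [h1]
  | false =>
    simp only [Bool.false_eq_true, if_false, id, Prod.mk.injEq] at ha hb
    obtain ⟨rfl, rfl, rfl⟩ := ha
    obtain ⟨rfl, rfl, rfl⟩ := hb
    exact ⟨Or.inr ⟨rfl, rfl, rfl⟩, Or.inr ⟨rfl, rfl, rfl⟩, rfl, rfl⟩

lemma ecB_good (hρ : SiftSupp P ρ) (x y : (Key (numPulses L M) × Bool × CEC P) ×
    (Key (numPulses L M) × Fin (numPulses L M + 1) × Unit × ε))
    (h : (ecAState V ρ).submatrix (fun p => ((p.2.1, p.1.2.1, p.1.2.2), (p.1.1, p.2.2)))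
      (fun p => ((p.2.1, p.1.2.1, p.1.2.2), (p.1.1, p.2.2))) x y ≠ 0) :
    EcBGood P x.1 ∧ EcBGood P y.1 := by
  obtain ⟨h1, h2, -, -⟩ := ecAState_support V hρ h
  have key : ∀ x : (Key (numPulses L M) × Bool × CEC P) ×
      (Key (numPulses L M) × Fin (numPulses L M + 1) × Unit × ε),
      EcAGood ((x.2.1, x.1.2.1, x.1.2.2), (x.1.1, x.2.2)) → EcBGood P x.1 := by
    rintro ⟨⟨k, f, c⟩, s⟩ (⟨h1, h2, h3, -⟩ | ⟨h1, h2, -⟩)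
    · simp only at h1 h2 h3
      subst h1 h2
      exact ⟨rfl, h3⟩
    · simp only at h1 h2
      subst h1 h2
      rfl
  exact ⟨key x h1, key y h2⟩

lemma ecVirState_support (hρ : SiftSupp P ρ) {X Y} (h : ecVirState V ρ X Y ≠ 0) :
    EcGood X ∧ EcGood Y ∧ X.1.2.2 = Y.1.2.2 ∧ X.2.1 = Y.2.1 ∧ X.2.2.1 = Y.2.2.1 := by
  obtain ⟨a, b, -, -, h1, ha, hb, h2⟩ := actsAs_ecB.exists_of_ne_zero (ecB_good V hρ) h
  obtain ⟨g1, g2, g3, g4⟩ := ecAState_support V hρ h2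
  obtain ⟨⟨kA, kB, f⟩, ⟨c, m, u, e⟩⟩ := X
  obtain ⟨⟨kA', kB', f'⟩, ⟨c', m', u', e'⟩⟩ := Y
  obtain ⟨kB0, f0, c0⟩ := a
  obtain ⟨kB1, f1, c1⟩ := b
  simp only [EcAGood, Prod.mk.injEq] at g1 g2 g3 g4
  obtain ⟨rfl, rfl⟩ := g3
  subst g4
  rcases g1 with ⟨rfl, rfl, p1, p2⟩ | ⟨rfl, rfl, rfl⟩
  · rcases g2 with ⟨-, q0, q1, q2⟩ | ⟨q, -⟩
    swap
    · simp at q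
    simp only [Prod.mk.injEq] at ha hb
    obtain ⟨rfl, rfl, rfl⟩ := ha
    obtain ⟨rfl, rfl, rfl⟩ := hb
    simp only [Option.some.injEq] at q0
    refine ⟨⟨rfl, fun _ => ?_, by simp⟩, ⟨?_, fun _ => ?_, by simp⟩, rfl, rfl, rfl⟩
    · simp only; omega
    · rw [q0]; rfl
    · simp only; omega
  · rcases g2 with ⟨q, -⟩ | ⟨-, -, rfl⟩
    · simp at q
    simp only [Prod.mk.injEq] at ha hb
    obtain ⟨rfl, rfl, rfl⟩ := ha
    obtain ⟨rfl, rfl, rfl⟩ := hb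
    exact ⟨⟨rfl, by simp, fun _ => ⟨rfl, rfl⟩⟩, ⟨rfl, by simp, fun _ => ⟨rfl, rfl⟩⟩, rfl, rfl, rfl⟩

/-- Actual error correction yields the dephased output of virtual error correction. -/
lemma ecState_dephase (hρ : SiftSupp P ρ) : ecState P (dephase (fun x => x.1) ρ) =
    dephase (fun X => (X.1, X.2.1, X.2.2.1)) (ecVirState V ρ) := by
  have hg : ∀ x y : (Key (numPulses L M) × Key (numPulses L M) × Bool) ×
      (Fin (numPulses L M + 1) × Unit × ε), (dephase (fun x => x.1) ρ).submatrix
        (fun p => ((p.1.1, p.1.2.1, p.2.1, p.1.2.2), p.2.2))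
        (fun p => ((p.1.1, p.1.2.1, p.2.1, p.1.2.2), p.2.2)) x y ≠ 0 →
        x.1.1.1 = x.1.2.1.1 ∧ y.1.1.1 = y.1.2.1.1 := by
    intro x y h
    have h' := (dephase_ne_zero h).2
    obtain ⟨h1, h2, -, -⟩ := hρ _ _ h'
    exact ⟨h1.1, h2.1⟩
  funext X Y
  obtain ⟨⟨kA, kB, f⟩, ⟨c, m, u, e⟩⟩ := X
  obtain ⟨⟨kA', kB', f'⟩, ⟨c', m', u', e'⟩⟩ := Y
  by_cases hXY : ((kA, kB, f), c, m) = ((kA', kB', f'), c', m')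
  · simp only [dephase]
    rw [if_pos hXY]
    simp only [Prod.mk.injEq] at hXY
    obtain ⟨⟨rfl, rfl, rfl⟩, rfl, rfl⟩ := hXY
    have e1 := actsAs_ec.act_diag hg (kA, kB, f, c) (m, u, e) (m, u', e')
    have e2 := actsAs_ecB.act_diag (ecB_good V hρ) (kB, f, c) (kA, m, u, e) (kA, m, u', e')
    have e3 : ∀ b : Key (numPulses L M) × Bool × CEC P,
        ecAState V ρ ((kA, b.2.1, b.2.2), (b.1, m, u, e)) ((kA, b.2.1, b.2.2), (b.1, m, u', e')) =
          _ := fun b =>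
      (actsAs_ecA V).act_diag (ecA_good hρ) (kA, b.2.1, b.2.2) (b.1, m, u, e) (b.1, m, u', e')
    refine Eq.trans e1 (Eq.trans ?_ e2.symm)
    simp only [Matrix.submatrix_apply, e3, dephase, if_true, map_one, mul_one, one_mul]
    have key := sum_two_step
      (TA := fun a : Key (numPulses L M) × Bool => if a.2 = true then
        (a.1, (true, (some (syndOf P a.1) : CEC P))) else (nullKey _, (false, none)))
      (TB := fun b : Key (numPulses L M) × Bool × CEC P => match b.2.2 with
        | some s => (corrected P s b.1, true, some s)
        | none => (nullKey _, false, none))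
      (T := ecMap P) (z := (kA, kB, f, c)) (k := kA) (w := (kB, f, c)) (fun kA0 kB0 f0 => by
        cases f0 <;> simp [ecMap])
      (fun a => ρ ((a.1, a.2.1, m, a.2.2), u, e) ((a.1, a.2.1, m, a.2.2), u', e'))
    refine (Eq.trans ?_ key).trans ?_
    · exact Finset.sum_congr rfl fun a _ => ite_eq_ite_of_iff Iff.rfl _ _
    · refine Finset.sum_congr rfl fun b _ => ?_
      rw [ite_eq_ite_of_iff Iff.rfl]
      refine congrArg₂ _ ?_ rfl
      exact Finset.sum_congr rfl fun a _ => ite_eq_ite_of_iff Iff.rfl _ _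
  · simp only [dephase]
    rw [if_neg hXY]
    by_contra hn
    obtain ⟨a, b, -, -, -, ha, hb, h1⟩ := actsAs_ec.exists_of_ne_zero hg hn
    have h2 := (dephase_ne_zero h1).1
    simp only [Prod.mk.injEq] at h2
    have h3 : a = b := Prod.ext h2.1 (Prod.ext h2.2.1 h2.2.2.2)
    subst h3
    have h4 := ha.symm.trans hb
    simp only [Prod.mk.injEq] at h4
    obtain ⟨rfl, rfl, rfl, rfl⟩ := h4
    exact hXY (by rw [h2.2.2.1])

end State

end EC

/-! ### Error verification -/

section Seed

variable {Ω B κ ι σ : Type*} {K : Ω × B → Matrix κ ι ℂ}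

/-- A Kraus family with a classical seed is the sum over the seeds. -/
lemma act_seed [Fintype Ω] [Finite B] [Finite ι] (ρ : Op (ι × σ)) (x y : κ × σ) :
    act K ρ x y = ∑ r, act (fun k => K (r, k)) ρ x y := by
  have := Fintype.ofFinite B
  have := Fintype.ofFinite ι
  simp only [act, tsum_fintype, Fintype.sum_prod_type]

end Seed

section Verify

variable {L M : ℕ} {P : Params L M} {ε : Type u} (V : VirParams P)

lemma tens_linU_conj_apply {N : ℕ} (C : ∀ n, Matrix (Fin n) (Fin n) Bit) (D : Op (Key N × Key N))
    (x y : Key N × Key N) :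
    ((tens (linU N C) (linU N C)).conjTranspose * D * tens (linU N C) (linU N C) :
      Op (Key N × Key N)) x y =
      D (linKey C x.1, linKey C x.2) (linKey C y.1, linKey C y.2) := by
  have h : ∀ a b : Key N × Key N, tens (linU N C) (linU N C) a b =
      if a = (linKey C b.1, linKey C b.2) then 1 else 0 := by
    intro a b
    simp only [tens, linU_apply, ← ite_and, mul_ite, mul_one, mul_zero]
    exact ite_eq_ite_of_iff (by rw [Prod.ext_iff, and_comm]) _ _
  rw [Matrix.mul_apply, Finset.sum_eq_single (linKey C y.1, linKey C y.2)]
  · rw [Matrix.mul_apply, Finset.sum_eq_single (linKey C x.1, linKey C x.2)]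
    · simp only [Matrix.conjTranspose_apply, h, if_true, star_one, one_mul, mul_one]
    · intro b _ hb; simp only [Matrix.conjTranspose_apply, h, hb, if_false, star_zero, zero_mul]
    · simp
  · intro b _ hb; simp only [h, hb, if_false, mul_zero]
  · simp

/-- The hash value of a key in error verification. -/
def hashOf (P : Params L M) (r : Fin P.hVerify → Bit) (k : Key (numPulses L M)) :
    Fin P.Nverify → Bit :=
  Matrix.vecMul k.2 (P.Cverify k.1.val r)

/-- The linear map of labels behind `verifyU`. -/
abbrev verifyKey (r : Fin P.hVerify → Bit) : Key (numPulses L M) → Key (numPulses L M) :=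
  linKey fun n => V.tCverify n r

/-- The bits of `verifyKey`. -/
def verifyBits (r : Fin P.hVerify → Bit) (k : Key (numPulses L M)) : Fin k.1.val → Bit :=
  Matrix.vecMul k.2 (V.tCverify k.1.val r)

lemma verifyKey_eq (r : Fin P.hVerify → Bit) {k : Key (numPulses L M)}
    {n : Fin (numPulses L M + 1)} (h : n = k.1) :
    verifyKey V r k = ⟨n, firstBits n.val (verifyBits V r k)⟩ := by
  subst h
  rw [firstBits_self]
  rfl

lemma firstBits_verifyBits (r : Fin P.hVerify → Bit) {k : Key (numPulses L M)}
    (hk : P.Nverify ≤ k.1.val) : firstBits P.Nverify (verifyBits V r k) = hashOf P r k :=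
  firstBits_vecMul hk _ _ _ (V.tCverify_cols k.1.val r hk (numPulses_le k.1))

lemma firstBits_firstBits_verifyBits (r : Fin P.hVerify → Bit) {k : Key (numPulses L M)}
    (hk : P.Nverify ≤ k.1.val) {n : Fin (numPulses L M + 1)} (h : n = k.1) :
    firstBits P.Nverify (firstBits n.val (verifyBits V r k)) = hashOf P r k := by
  subst h
  rw [firstBits_self, firstBits_verifyBits V r hk]

lemma linKey_eq_nullKey {N : ℕ} (C : ∀ n, Matrix (Fin n) (Fin n) Bit) (k : Key N) :
    nullKey N = linKey C k ↔ nullKey N = k := by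
  constructor
  · intro h
    obtain ⟨n, k⟩ := k
    obtain rfl : (0 : Fin (N + 1)) = n := congrArg Sigma.fst h
    exact congrArg _ (funext fun i => i.elim0)
  · rintro rfl
    exact congrArg _ (funext fun i => i.elim0)

/-- What error verification needs of its input. -/
def VerifyIn (P : Params L M) (a : Key (numPulses L M) × Key (numPulses L M) × Bool) : Prop :=
  a.1.1 = a.2.1.1 ∧ (a.2.2 = true → P.Nverify ≤ a.1.1.val) ∧
    (a.2.2 = false → a.1 = nullKey _ ∧ a.2.1 = nullKey _)

/-- The branch of virtual error verification for given keys. -/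
def verifyBr (r : Fin P.hVerify → Bit) (a : Key (numPulses L M) × Key (numPulses L M) × Bool) :
    VerifyBranch P :=
  if a.2.2 = true then
    if hashOf P r a.1 = hashOf P r a.2.1 then VerifyBranch.pass a.1.1 (hashOf P r a.1)
    else VerifyBranch.fail a.1.1 (firstBits a.1.1.val (verifyBits V r a.1))
      (firstBits a.1.1.val (verifyBits V r a.2.1))
  else VerifyBranch.aborted

/-- Virtual error verification as a map of labels. -/
def verifyVirMap (r : Fin P.hVerify → Bit)
    (a : Key (numPulses L M) × Key (numPulses L M) × Bool) :
    Key (numPulses L M) × Key (numPulses L M) × Bool × CHash P × Option Bool :=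
  if a.2.2 = true then
    if hashOf P r a.1 = hashOf P r a.2.1 then
      (a.1, a.2.1, true, some (r, hashOf P r a.1), some true)
    else (nullKey _, nullKey _, false, some (r, hashOf P r a.1), some false)
  else (nullKey _, nullKey _, false, none, none)

/-- Actual error verification as a map of labels. -/
def verifyMap (P : Params L M) (r : Fin P.hVerify → Bit)
    (a : Key (numPulses L M) × Key (numPulses L M) × Bool) :
    Key (numPulses L M) × Key (numPulses L M) × Bool × CHash P × Option Bool :=
  if a.2.2 = true then
    (a.1, a.2.1, decide (hashOf P r a.1 = hashOf P r a.2.1), some (r, hashOf P r a.1),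
      some (decide (hashOf P r a.1 = hashOf P r a.2.1)))
  else (nullKey _, nullKey _, false, none, none)

/-- Discards the keys after a failure. -/
def discard {A : Type*} (z : Key (numPulses L M) × Key (numPulses L M) × Bool × A) :
    Key (numPulses L M) × Key (numPulses L M) × Bool × A :=
  if z.2.2.1 = true then z else (nullKey _, nullKey _, z.2.2)

/-- Virtual verification discards the keys at a mismatch, actual verification only at the end of
privacy amplification. -/
lemma verifyVirMap_eq (r : Fin P.hVerify → Bit)
    (a : Key (numPulses L M) × Key (numPulses L M) × Bool) :
    verifyVirMap r a = discard (verifyMap P r a) := by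
  unfold verifyVirMap verifyMap discard
  by_cases h : a.2.2 = true
  · by_cases h2 : hashOf P r a.1 = hashOf P r a.2.1 <;> simp [h, h2]
  · simp [h]

lemma verifyVirMap_reg (r : Fin P.hVerify → Bit)
    (a : Key (numPulses L M) × Key (numPulses L M) × Bool)
    (ha : VerifyIn P a) :
    (a.2.2, (verifyVirMap r a).2.2) = verifyVirReg r (verifyBr V r a) := by
  unfold verifyVirMap verifyBr
  by_cases h : a.2.2 = true
  · by_cases h2 : hashOf P r a.1 = hashOf P r a.2.1
    · simp [h, h2, verifyVirReg]
    · simp only [h, if_true, if_neg h2, verifyVirReg,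
        firstBits_firstBits_verifyBits V r (ha.2.1 h) rfl]
  · simp [h, verifyVirReg]

lemma verifyKey_inj (r : Fin P.hVerify → Bit) {k l : Key (numPulses L M)}
    (hl : P.Nverify ≤ l.1.val) (h : verifyKey V r k = verifyKey V r l) : k = l :=
  linKey_inj (V.tCverify_unit l.1.val r hl (numPulses_le l.1)) h

lemma zFirst_verifyKey (r : Fin P.hVerify → Bit) {z k : Key (numPulses L M)}
    (hk : P.Nverify ≤ k.1.val) (n : Fin (numPulses L M + 1)) (h : Fin P.Nverify → Bit) :
    zFirst n h (verifyKey V r z) (verifyKey V r k) =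
      if z = k ∧ k.1 = n ∧ hashOf P r k = h then 1 else 0 := by
  have e := firstBits_verifyBits V r hk
  rw [zFirst_apply]
  change (if verifyKey V r z = verifyKey V r k ∧ k.1 = n ∧
    firstBits P.Nverify (verifyBits V r k) = h then (1 : ℂ) else 0) = _
  rw [e]
  refine ite_eq_ite_of_iff (and_congr_left' ⟨fun h => verifyKey_inj V r hk h, ?_⟩) _ _
  rintro rfl; rfl

lemma ite_mul_ite_of_iff {p q s : Prop} {_ : Decidable p} {_ : Decidable q} {_ : Decidable s}
    (h : p ∧ q ↔ s) (c : ℂ) :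
    (if p then c * (if q then 1 else 0) else 0) = if s then c else 0 := by
  by_cases hs : s
  · rw [if_pos (h.mpr hs).1, if_pos (h.mpr hs).2, if_pos hs, mul_one]
  · rw [if_neg hs]
    by_cases hp : p
    · rw [if_pos hp, if_neg fun hq => hs (h.mp ⟨hp, hq⟩), mul_zero]
    · rw [if_neg hp]

lemma ite_mul_ite_one {p q : Prop} {_ : Decidable p} {_ : Decidable q} :
    ((if p then (1 : ℂ) else 0) * if q then 1 else 0) = if p ∧ q then 1 else 0 := by
  by_cases hp : p <;> by_cases hq : q <;> simp [hp, hq]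

lemma actsAs_verifyVir (r : Fin P.hVerify → Bit) :
    ActsAs (fun k => verifyVirKraus V (r, k)) (VerifyIn P) (verifyBr V r) (verifyVirMap r)
      (Real.sqrt (1 / 2 ^ P.hVerify) : ℂ) where
  apply k z a ha := by
    obtain ⟨kA, kB, f⟩ := a
    obtain ⟨zA, zB, g⟩ := z
    simp only [verifyVirKraus, verifyU, tens_linU_conj_apply]
    have hreg := verifyVirMap_reg V r _ ha
    obtain ⟨h1, h2, h3⟩ := ha
    simp only at h1 h2 h3 hreg
    by_cases hk : verifyBr V r (kA, kB, f) = k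
    · subst hk
      rw [← hreg]
      simp only [Prod.mk.injEq, true_and]
      cases f with
      | false =>
        obtain ⟨rfl, rfl⟩ := h3 rfl
        simp only [verifyVirMap, verifyBr, Bool.false_eq_true, if_false, verifyVirMid, ketBra,
          Prod.mk.injEq, eq_comm (b := nullKey (numPulses L M)), linKey_eq_nullKey, and_true]
        exact ite_mul_ite_of_iff ⟨fun h => ⟨h.2.1, h.2.2, h.1.symm⟩,
          fun h => ⟨h.2.2.symm, h.1, h.2.1⟩⟩ _
      | true =>
        have hB : P.Nverify ≤ kB.1.val := h1 ▸ h2 rfl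
        by_cases he : hashOf P r kA = hashOf P r kB
        · simp only [verifyVirMap, verifyBr, if_true, he, verifyVirMid, tens,
            zFirst_verifyKey V r (h2 rfl), zFirst_verifyKey V r hB, h1, and_true, Prod.mk.injEq]
          rw [ite_mul_ite_one]
          exact ite_mul_ite_of_iff ⟨fun h => ⟨h.2.1.symm, h.2.2.symm, h.1.symm⟩,
            fun h => ⟨h.2.2.symm, h.1.symm, h.2.1.symm⟩⟩ _
        · have p1 := firstBits_firstBits_verifyBits V r (h2 rfl) rfl
          have p2 := firstBits_firstBits_verifyBits V r hB h1
          simp only [verifyVirMap, verifyBr, if_true, if_neg he, verifyVirMid, p1, p2, ne_eq]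
          rw [if_pos he]
          simp only [ketBra, Prod.mk.injEq, ← verifyKey_eq V r h1,
            ← verifyKey_eq V r (k := kA) rfl, and_true,
            eq_comm (b := nullKey (numPulses L M)), linKey_eq_nullKey]
          exact ite_mul_ite_of_iff ⟨fun h => ⟨h.2.1, h.2.2, h.1.symm⟩,
            fun h => ⟨h.2.2.symm, h.1, h.2.1⟩⟩ _
    · rw [if_neg (c := verifyBr V r (kA, kB, f) = k ∧ _) fun h => hk h.1]
      split_ifs with hr
      swap
      · rfl
      rw [mul_eq_zero]
      right
      cases k with
      | pass n h =>
        simp only [verifyVirReg, Prod.mk.injEq] at hr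
        obtain ⟨rfl, -⟩ := hr
        have hB : P.Nverify ≤ kB.1.val := h1 ▸ h2 rfl
        simp only [verifyVirMid, tens, zFirst_verifyKey V r (h2 rfl), zFirst_verifyKey V r hB]
        rw [mul_eq_zero]
        by_contra hn
        push Not at hn
        obtain ⟨hn1, hn2⟩ := hn
        obtain ⟨-, p1, p2⟩ := (ite_ne_right_iff.mp hn1).1
        obtain ⟨-, q1, q2⟩ := (ite_ne_right_iff.mp hn2).1
        refine hk ?_
        simp [verifyBr, p2, q2, p1]
      | fail n a b =>
        simp only [verifyVirReg, Prod.mk.injEq] at hr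
        obtain ⟨rfl, -⟩ := hr
        simp only [verifyVirMid]
        split_ifs with hab
        swap
        · rfl
        unfold ketBra
        rw [if_neg]
        rintro ⟨-, hn⟩
        simp only [Prod.mk.injEq] at hn
        have p1 : kA.1 = n := congrArg Sigma.fst hn.1
        subst p1
        have p2 := verifyKey_eq V r (k := kA) rfl
        have p3 := verifyKey_eq V r h1
        have q2 := eq_of_heq (Sigma.mk.inj (p2.symm.trans hn.1)).2
        have q3 := eq_of_heq (Sigma.mk.inj (p3.symm.trans hn.2)).2
        rw [← q2, ← q3, firstBits_firstBits_verifyBits V r (h2 rfl) rfl,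
          firstBits_firstBits_verifyBits V r (h1 ▸ h2 rfl) h1] at hab
        refine hk ?_
        simp only [verifyBr, if_true, if_neg hab, q2, q3]
      | aborted =>
        simp only [verifyVirReg, Prod.mk.injEq] at hr
        obtain ⟨rfl, -⟩ := hr
        exact absurd rfl hk
  inj a b ha hb h1 h2 := by
    have ra := verifyVirMap_reg V r a ha
    have rb := verifyVirMap_reg V r b hb
    rw [← h1] at rb
    have hf : a.2.2 = b.2.2 := congrArg Prod.fst (ra.trans rb.symm)
    obtain ⟨kA, kB, f⟩ := a
    obtain ⟨lA, lB, f'⟩ := b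
    simp only at hf
    subst hf
    obtain ⟨a1, a2, a3⟩ := ha
    obtain ⟨b1, b2, b3⟩ := hb
    simp only at a1 a2 a3 b1 b2 b3
    cases f with
    | false =>
      obtain ⟨rfl, rfl⟩ := a3 rfl
      obtain ⟨rfl, rfl⟩ := b3 rfl
      rfl
    | true =>
      by_cases he : hashOf P r kA = hashOf P r kB
      · by_cases he' : hashOf P r lA = hashOf P r lB
        · simp only [verifyVirMap, if_true, if_pos he, if_pos he', Prod.mk.injEq] at h2
          rw [h2.1, h2.2.1]
        · simp [verifyBr, he, he'] at h1
      · by_cases he' : hashOf P r lA = hashOf P r lB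
        · simp [verifyBr, he, he'] at h1
        · simp only [verifyBr, if_true, if_neg he, if_neg he'] at h1
          injection h1 with e1 e2 e3
          have hA : verifyKey V r kA = verifyKey V r lA := by
            rw [verifyKey_eq V r (k := kA) rfl, verifyKey_eq V r (k := lA) rfl]
            exact Sigma.ext e1 e2
          have hA' := verifyKey_inj V r (b2 rfl) hA
          subst hA'
          have hB : verifyKey V r kB = verifyKey V r lB := by
            rw [verifyKey_eq V r a1, verifyKey_eq V r b1]
            exact Sigma.ext rfl e3
          rw [verifyKey_inj V r (b1 ▸ b2 rfl) hB]

lemma actsAs_verify (r : Fin P.hVerify → Bit) :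
    ActsAs (fun k => verifyKraus P (r, k)) (fun a => a.1.1 = a.2.1.1)
      (fun a => keyPair a.1 a.2.1) (verifyMap P r) (Real.sqrt (1 / 2 ^ P.hVerify) : ℂ) where
  apply k z a ha := by
    obtain ⟨kA, kB, f⟩ := a
    change kA.1 = kB.1 at ha
    unfold verifyKraus
    simp only [Matrix.smul_apply, Matrix.add_apply, ketBra, ketBra_keyPair ha]
    by_cases hk : keyPair kA kB = k
    · have e1 : (kA, kB, ()) = ((⟨k.1, k.2.1⟩ : Key (numPulses L M)), (⟨k.1, k.2.2⟩ : Key _), ()) :=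
        (ketBra_keyPair ha k () ()).mpr ⟨hk, rfl⟩
      simp only [Prod.mk.injEq, and_true] at e1
      obtain ⟨rfl, rfl⟩ := e1
      cases f with
      | true =>
        simp only [verifyMap, if_true, and_true, hk, Bool.true_eq_false, and_false,
          if_false, add_zero, hashOf, true_and, smul_eq_mul, mul_ite, mul_one, mul_zero]
        exact ite_eq_ite_of_iff eq_comm _ _
      | false =>
        simp only [verifyMap, and_true, hk, Bool.false_eq_true, and_false,
          if_false, zero_add, true_and, smul_eq_mul, mul_ite, mul_one, mul_zero]
        exact ite_eq_ite_of_iff eq_comm _ _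
    · simp [hk]
  inj a b ha hb h1 h2 := by
    obtain ⟨kA, kB, f⟩ := a
    obtain ⟨lA, lB, g⟩ := b
    obtain ⟨rfl, rfl⟩ := keyPair_inj ha hb h1
    cases f <;> cases g <;> simp_all [verifyMap]

end Verify

section VerifyState

variable {L M : ℕ} {P : Params L M} {ε : Type u} (V : VirParams P)

/-- Actual error verification. -/
def verifyState (P : Params L M)
    (ρ : Op ((Key (numPulses L M) × Key (numPulses L M) × Bool) ×
      (CEC P × Fin (numPulses L M + 1) × Unit × ε))) :
    Op ((Key (numPulses L M) × Key (numPulses L M) × Fin (numPulses L M + 1) × Bool) ×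
      (CEC P × CHash P × Option Bool × Unit × ε)) :=
  actOn (σ := CEC P × Fin (numPulses L M + 1) × Unit × ε) (verifyKraus P) id
    (fun q => ((q.1.1, q.1.2.1, q.1.2.2.2, q.2.2.1, q.2.2.2.1),
      (q.2.1, q.1.2.2.1, q.2.2.2.2))) ρ

/-- The support properties of a state after error correction. -/
def EcSupp (ρ : Op ((Key (numPulses L M) × Key (numPulses L M) × Bool) ×
      (CEC P × Fin (numPulses L M + 1) × Unit × ε))) : Prop :=
  ∀ X Y, ρ X Y ≠ 0 → EcGood X ∧ EcGood Y ∧ X.1.2.2 = Y.1.2.2 ∧ X.2.1 = Y.2.1 ∧ X.2.2.1 = Y.2.2.1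

/-- What error verification guarantees about its output. -/
def VerifyGood (X : (Key (numPulses L M) × Key (numPulses L M) × Fin (numPulses L M + 1) × Bool) ×
      (CEC P × CHash P × Option Bool × Unit × ε)) : Prop :=
  X.1.1.1 = X.1.2.1.1 ∧ (X.1.2.2.2 = true → X.1.2.2.1.val ≤ X.1.1.1.val)

/-- The public registers after error verification. -/
def verifyPub (X : (Key (numPulses L M) × Key (numPulses L M) × Fin (numPulses L M + 1) × Bool) ×
      (CEC P × CHash P × Option Bool × Unit × ε)) :
    (Fin (numPulses L M + 1) × Bool) × CEC P × CHash P × Option Bool :=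
  (X.1.2.2, X.2.1, X.2.2.1, X.2.2.2.1)

variable {ρ : Op ((Key (numPulses L M) × Key (numPulses L M) × Bool) ×
      (CEC P × Fin (numPulses L M + 1) × Unit × ε))}

lemma EcSupp.verifyIn (hρ : EcSupp ρ) (x y) (h : ρ x y ≠ 0) :
    VerifyIn P x.1 ∧ VerifyIn P y.1 := by
  obtain ⟨h1, h2, -⟩ := hρ x y h
  refine ⟨⟨h1.1, fun h => ?_, h1.2.2⟩, ⟨h2.1, fun h => ?_, h2.2.2⟩⟩
  · have := h1.2.1 h; omega
  · have := h2.2.1 h; omega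

lemma verifyVirState_support (hρ : EcSupp ρ) {X Y} (h : verifyVirState V ρ X Y ≠ 0) :
    VerifyGood X ∧ VerifyGood Y ∧ verifyPub X = verifyPub Y := by
  change act (verifyVirKraus V) ρ _ _ ≠ 0 at h
  rw [act_seed] at h
  obtain ⟨r, -, h⟩ := Finset.exists_ne_zero_of_sum_ne_zero h
  obtain ⟨a, b, ga, gb, h1, ha, hb, h2⟩ :=
    (actsAs_verifyVir V r).exists_of_ne_zero hρ.verifyIn h
  obtain ⟨g1, g2, g3, g4, g5⟩ := hρ _ _ h2
  have ra := verifyVirMap_reg V r a ga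
  have rb := verifyVirMap_reg V r b gb
  rw [h1, ← rb] at ra
  have hT := (Prod.ext_iff.mp ra).2
  simp only at hT
  rw [ha, hb] at hT
  obtain ⟨⟨kA, kB, m, f⟩, ⟨c, hh, o, u, e⟩⟩ := X
  obtain ⟨⟨kA', kB', m', f'⟩, ⟨c', hh', o', u', e'⟩⟩ := Y
  simp only [Prod.mk.injEq] at hT ha hb g1 g2 g3 g4 g5
  obtain ⟨rfl, rfl, rfl⟩ := hT
  subst g4 g5
  have key : ∀ (a : Key (numPulses L M) × Key (numPulses L M) × Bool)
      (kA kB : Key (numPulses L M)), a.1.1 = a.2.1.1 →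
      (a.2.2 = true → P.Nverify + m.val ≤ a.1.1.val) →
      verifyVirMap r a = (kA, kB, f, hh, o) →
      kA.1 = kB.1 ∧ (f = true → m.val ≤ kA.1.val) := by
    intro a kA kB e1 e2 e3
    unfold verifyVirMap at e3
    split_ifs at e3 with hf hh'
    · simp only [Prod.mk.injEq] at e3
      obtain ⟨rfl, rfl, rfl, -⟩ := e3
      have := e2 hf
      exact ⟨e1, fun _ => by omega⟩
    · simp only [Prod.mk.injEq] at e3
      obtain ⟨rfl, rfl, rfl, -⟩ := e3
      exact ⟨rfl, by simp⟩
    · simp only [Prod.mk.injEq] at e3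
      obtain ⟨rfl, rfl, rfl, -⟩ := e3
      exact ⟨rfl, by simp⟩
  exact ⟨key a kA kB g1.1 g1.2.1 ha, key b kA' kB' g2.1 g2.2.1 hb, rfl⟩

/-- The classical registers after error correction. -/
abbrev ecLab (X : (Key (numPulses L M) × Key (numPulses L M) × Bool) ×
      (CEC P × Fin (numPulses L M + 1) × Unit × ε)) :=
  (X.1, X.2.1, X.2.2.1)

lemma EcSupp.keyLength (hρ : EcSupp ρ) (x y) (h : dephase ecLab ρ x y ≠ 0) :
    x.1.1.1 = x.1.2.1.1 ∧ y.1.1.1 = y.1.2.1.1 := by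
  obtain ⟨h1, h2, -⟩ := hρ _ _ (dephase_ne_zero h).2
  exact ⟨h1.1, h2.1⟩

lemma verifyState_support (hρ : EcSupp ρ) {X Y}
    (h : verifyState P (dephase ecLab ρ) X Y ≠ 0) :
    VerifyGood X ∧ X.1 = Y.1 ∧ verifyPub X = verifyPub Y := by
  change act (verifyKraus P) _ _ _ ≠ 0 at h
  rw [act_seed] at h
  obtain ⟨r, -, h⟩ := Finset.exists_ne_zero_of_sum_ne_zero h
  obtain ⟨a, b, -, -, -, ha, hb, h2⟩ :=
    (actsAs_verify (P := P) r).exists_of_ne_zero hρ.keyLength h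
  obtain ⟨hl, h2⟩ := dephase_ne_zero h2
  obtain ⟨g1, -⟩ := hρ _ _ h2
  simp only [ecLab, Prod.mk.injEq] at hl
  obtain ⟨hab, h3, h4⟩ := hl
  subst hab
  rw [ha] at hb
  obtain ⟨⟨kA, kB, m, f⟩, ⟨c, hh, o, u, e⟩⟩ := X
  obtain ⟨⟨kA', kB', m', f'⟩, ⟨c', hh', o', u', e'⟩⟩ := Y
  simp only [Prod.mk.injEq] at hb ha g1 h3 h4
  obtain ⟨rfl, rfl, rfl, rfl, rfl⟩ := hb
  subst h3 h4
  refine ⟨?_, rfl, rfl⟩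
  unfold verifyMap at ha
  split_ifs at ha with hf
  · simp only [Prod.mk.injEq] at ha
    obtain ⟨rfl, rfl, rfl, -⟩ := ha
    have := g1.2.1 hf
    simp only at this
    exact ⟨g1.1, fun _ => by simp only; omega⟩
  · simp only [Prod.mk.injEq] at ha
    obtain ⟨rfl, rfl, rfl, -⟩ := ha
    exact ⟨rfl, by simp⟩

/-- Virtual error verification discards the keys after a failure, and otherwise agrees with actual
error verification. -/
lemma verifyVirState_diag (hρ : EcSupp ρ) (kA kB : Key (numPulses L M))
    (m : Fin (numPulses L M + 1)) (f : Bool) (c : CEC P) (h : CHash P) (o : Option Bool)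
    (e e' : Unit × ε) :
    verifyVirState V ρ ((kA, kB, m, f), (c, h, o, e)) ((kA, kB, m, f), (c, h, o, e')) =
      ∑ k : Key (numPulses L M) × Key (numPulses L M),
        if (if f = true then k else (nullKey _, nullKey _)) = (kA, kB) then
          verifyState P (dephase ecLab ρ) ((k.1, k.2, m, f), (c, h, o, e))
            ((k.1, k.2, m, f), (c, h, o, e')) else 0 := by
  have e1 := act_seed (K := verifyVirKraus V) ρ ((kA, kB, f, h, o), (c, m, e))
    ((kA, kB, f, h, o), (c, m, e'))
  have e2 : ∀ k : Key (numPulses L M) × Key (numPulses L M), _ := fun k =>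
    act_seed (K := verifyKraus P) (dephase ecLab ρ) ((k.1, k.2, f, h, o), (c, m, e))
      ((k.1, k.2, f, h, o), (c, m, e'))
  simp only [(actsAs_verifyVir V _).act_diag hρ.verifyIn] at e1
  simp only [(actsAs_verify _).act_diag hρ.keyLength] at e2
  have e3 : ∀ k : Key (numPulses L M) × Key (numPulses L M),
      verifyState P (dephase ecLab ρ) ((k.1, k.2, m, f), (c, h, o, e))
        ((k.1, k.2, m, f), (c, h, o, e')) = _ := e2
  simp only [e3]
  refine e1.trans ?_
  have h4 : ∀ (p : Prop) (_ : Decidable p) (F : (Fin P.hVerify → Bit) →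
      (Key (numPulses L M) × Key (numPulses L M) × Bool) → ℂ),
      (if p then ∑ r, ∑ a, F r a else 0) = ∑ r, ∑ a, if p then F r a else 0 := fun p _ F => by
    split_ifs <;> simp
  simp only [h4]
  symm
  rw [Finset.sum_comm]
  refine Finset.sum_congr rfl fun r _ => ?_
  rw [Finset.sum_comm]
  refine Finset.sum_congr rfl fun a _ => ?_
  rw [Finset.sum_eq_single ((verifyMap P r a).1, (verifyMap P r a).2.1)]
  · rw [← ite_and, verifyVirMap_eq]
    simp only [dephase, if_true]
    refine ite_eq_ite_of_iff ?_ _ _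
    generalize verifyMap P r a = z
    obtain ⟨zA, zB, g, h', o'⟩ := z
    cases g <;> cases f <;> simp only [discard, if_true, Bool.false_eq_true, if_false,
      Prod.mk.injEq, true_and, reduceCtorEq, false_and, and_false] <;> tauto
  · intro k _ hk
    rw [← ite_and, if_neg]
    rintro ⟨-, h2⟩
    exact hk (by rw [h2])
  · simp

end VerifyState

/-! ### The `X` basis of the key qubits -/

section Signs

lemma neg_one_pow_val_add (s t : Bit) :
    (-1 : ℂ) ^ (s + t).val = (-1) ^ s.val * (-1) ^ t.val := by
  have h11 : (1 + 1 : Bit) = 0 := rfl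
  rcases bit_cases s with rfl | rfl <;> rcases bit_cases t with rfl | rfl <;>
    simp [bit_val_one, h11]

lemma neg_one_pow_val_sum {α : Type*} (s : Finset α) (f : α → Bit) :
    (-1 : ℂ) ^ (∑ i ∈ s, f i).val = ∏ i ∈ s, (-1) ^ (f i).val := by
  induction s using Finset.induction_on with
  | empty => simp
  | insert a s ha ih => rw [Finset.sum_insert ha, Finset.prod_insert ha, neg_one_pow_val_add, ih]

lemma signOf_eq_prod {n : ℕ} (z x : Fin n → Bit) :
    signOf z x = ∏ i, (-1 : ℂ) ^ (z i * x i).val :=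
  neg_one_pow_val_sum _ _

lemma signOf_add {n : ℕ} (z z' x : Fin n → Bit) :
    signOf (z + z') x = signOf z x * signOf z' x := by
  unfold signOf
  rw [add_dotProduct, neg_one_pow_val_add]

lemma conj_signOf {n : ℕ} (z x : Fin n → Bit) : conj (signOf z x) = signOf z x := by
  simp [signOf]

lemma signOf_mul_self {n : ℕ} (z x : Fin n → Bit) : signOf z x * signOf z x = 1 := by
  unfold signOf
  rw [← mul_pow]; simp

lemma sum_signOf {n : ℕ} (d : Fin n → Bit) :
    ∑ x, signOf d x = if d = 0 then (2 : ℂ) ^ n else 0 := by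
  simp only [signOf_eq_prod]
  have h := Finset.prod_univ_sum (fun _ : Fin n => (Finset.univ : Finset Bit))
    fun i b => (-1 : ℂ) ^ (d i * b).val
  rw [Fintype.piFinset_univ] at h
  rw [← h]
  split_ifs with hd
  · subst hd
    simp
  · obtain ⟨i, hi⟩ := Function.ne_iff.mp hd
    refine Finset.prod_eq_zero (Finset.mem_univ i) ?_
    have h1 : d i = 1 := (bit_cases (d i)).resolve_left hi
    rw [sum_bit, h1]
    simp [bit_val_one]

lemma bit_add_self_eq_zero {n : ℕ} {a b : Fin n → Bit} : a + b = 0 ↔ a = b := by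
  constructor
  · intro h
    funext i
    have h1 : a i + b i = 0 := congrFun h i
    rcases bit_cases (a i) with h2 | h2 <;> rcases bit_cases (b i) with h3 | h3 <;>
      simp_all
  · rintro rfl
    funext i
    have h11 : (1 + 1 : Bit) = 0 := rfl
    rcases bit_cases (a i) with h2 | h2 <;> simp [h2, h11]

/-- Splits a bit string into its first `n - m` and last `m` bits. -/
def splitBits {n m : ℕ} (h : m ≤ n) :
    (Fin n → Bit) ≃ (Fin (n - m) → Bit) × (Fin m → Bit) where
  toFun a := (firstBits (n - m) a, lastBits m a)
  invFun p i := if hi : i.val < n - m then p.1 ⟨i.val, hi⟩ else p.2 ⟨i.val - (n - m), by omega⟩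
  left_inv a := by
    funext i
    by_cases hi : i.val < n - m
    · simp [hi, firstBits]
    · have h1 : n - m + (i.val - (n - m)) = i.val := by omega
      simp [hi, lastBits, h1]
  right_inv p := by
    refine Prod.ext (funext fun i => ?_) (funext fun i => ?_)
    · have h1 : i.val < n := by omega
      simp [firstBits, h1]
    · have h1 : n - m + i.val < n := by omega
      simp [lastBits, h1]

lemma sum_fin_split {A : Type*} [AddCommMonoid A] {n m : ℕ} (h : m ≤ n) (f : Fin n → A) :
    ∑ i, f i = ∑ i : Fin (n - m), f ⟨i.val, by omega⟩ +
      ∑ j : Fin m, f ⟨n - m + j.val, by omega⟩ := by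
  have e := Fintype.sum_equiv (finSumFinEquiv.trans (finCongr (by omega : n - m + m = n)))
    (fun x => f ((finSumFinEquiv.trans (finCongr (by omega : n - m + m = n))) x)) f fun _ => rfl
  rw [← e, Fintype.sum_sum_type]
  rfl

lemma signOf_split {n m : ℕ} (h : m ≤ n) (z x : Fin n → Bit) :
    signOf z x = signOf (firstBits (n - m) z) (firstBits (n - m) x) *
      signOf (lastBits m z) (lastBits m x) := by
  unfold signOf
  rw [← neg_one_pow_val_add]
  congr 2
  unfold dotProduct
  rw [sum_fin_split h]
  congr 1
  · refine Finset.sum_congr rfl fun i _ => ?_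
    have h1 : i.val < n := by omega
    simp [firstBits, h1]
  · refine Finset.sum_congr rfl fun i _ => ?_
    have h1 : n - m + i.val < n := by omega
    simp [lastBits, h1]

lemma firstBits_add {n l : ℕ} (a b : Fin n → Bit) :
    firstBits l (a + b) = firstBits l a + firstBits l b := by
  funext i
  unfold firstBits
  by_cases h : i.val < n <;> simp [h]

lemma lastBits_add {n l : ℕ} (a b : Fin n → Bit) :
    lastBits l (a + b) = lastBits l a + lastBits l b := by
  funext i
  unfold lastBits
  by_cases h : n - l + i.val < n <;> simp [h]

lemma sum_firstBits_signOf {n m : ℕ} (h : m ≤ n) (d : Fin n → Bit) (x : Fin (n - m) → Bit) :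
    (∑ a : Fin n → Bit, if firstBits (n - m) a = x then signOf d a else 0) =
      if lastBits m d = 0 then (2 : ℂ) ^ m * signOf (firstBits (n - m) d) x else 0 := by
  have e := Fintype.sum_equiv (splitBits h)
    (fun a => if firstBits (n - m) a = x then signOf d a else 0)
    (fun p => if p.1 = x then signOf (firstBits (n - m) d) p.1 * signOf (lastBits m d) p.2 else 0)
    fun a => by
      rw [signOf_split h]; rfl
  rw [e, Fintype.sum_prod_type, Finset.sum_eq_single x]
  · simp only [if_true]
    rw [← Finset.mul_sum, sum_signOf]
    split_ifs <;> ring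
  · intro b _ hb; simp [hb]
  · simp

variable {N : ℕ}

lemma xKet_apply (n : Fin (N + 1)) (x z : Fin n.val → Bit) :
    xKet n x ⟨n, z⟩ = signOf z x / (Real.sqrt (2 ^ n.val) : ℂ) := by
  unfold xKet
  rw [Finset.sum_eq_single z]
  · simp
  · intro b _ hb
    rw [if_neg]
    intro h
    exact hb (eq_of_heq (Sigma.mk.inj h).2).symm
  · simp

lemma xKet_of_ne {n : Fin (N + 1)} (x : Fin n.val → Bit) {k : Key N} (h : k.1 ≠ n) :
    xKet n x k = 0 := by
  refine Finset.sum_eq_zero fun z _ => ?_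
  rw [if_neg]
  rintro rfl
  exact h rfl

lemma sqrt_two_pow_mul_self (n : ℕ) :
    (Real.sqrt (2 ^ n) : ℂ) * (Real.sqrt (2 ^ n) : ℂ) = 2 ^ n := by
  rw [← Complex.ofReal_mul, Real.mul_self_sqrt (by positivity)]
  push_cast; ring

lemma xKet_mul_conj (n : Fin (N + 1)) (x z z' : Fin n.val → Bit) :
    xKet n x ⟨n, z⟩ * conj (xKet n x ⟨n, z'⟩) = signOf (z + z') x / 2 ^ n.val := by
  rw [xKet_apply, xKet_apply, map_div₀, conj_signOf, Complex.conj_ofReal, div_mul_div_comm,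
    sqrt_two_pow_mul_self, signOf_add]

lemma sum_key {A : Type*} [AddCommMonoid A] {n : Fin (N + 1)} {f : Key N → A}
    (h : ∀ k : Key N, k.1 ≠ n → f k = 0) : ∑ k, f k = ∑ z : Fin n.val → Bit, f ⟨n, z⟩ := by
  rw [Fintype.sum_sigma, Finset.sum_eq_single n]
  · intro m _ hm
    exact Finset.sum_eq_zero fun z _ => h _ hm
  · simp

lemma sum_xKet_sq (n : Fin (N + 1)) (x : Fin n.val → Bit) :
    ∑ k, xKet n x k * conj (xKet n x k) = 1 := by
  rw [sum_key (n := n) fun k hk => by rw [xKet_of_ne x hk, zero_mul]]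
  simp only [xKet_mul_conj]
  have h : ∀ z : Fin n.val → Bit, signOf (z + z) x = 1 := fun z => by
    rw [signOf_add, signOf_mul_self]
  simp only [h]
  simp [ZMod.card]

/-- Completeness of the `X` basis. -/
lemma sum_xKet_mul_conj (n : Fin (N + 1)) (z z' : Fin n.val → Bit) :
    ∑ x, xKet n x ⟨n, z⟩ * conj (xKet n x ⟨n, z'⟩) = if z = z' then 1 else 0 := by
  simp only [xKet_mul_conj]
  rw [← Finset.sum_div, sum_signOf]
  by_cases h : z = z'
  · rw [if_pos h, if_pos (bit_add_self_eq_zero.mpr h)]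
    exact div_self (by positivity)
  · rw [if_neg h, if_neg fun hn => h (bit_add_self_eq_zero.mp hn), zero_div]

/-- The `X` measurement of the first qubits, with the outcome `x`, and of the last qubits with
an unknown outcome. -/
lemma sum_xProj_firstBits {n m : Fin (N + 1)} (h : m.val ≤ n.val) (x : Fin (n.val - m.val) → Bit)
    (a u : Fin n.val → Bit) :
    (∑ y : Fin n.val → Bit, if firstBits (n.val - m.val) y = x then xProj n y ⟨n, a⟩ ⟨n, u⟩ else 0)
      = if lastBits m.val a = lastBits m.val u then
          signOf (firstBits (n.val - m.val) a) x * signOf (firstBits (n.val - m.val) u) x /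
            2 ^ (n.val - m.val) else 0 := by
  have h1 : ∀ y : Fin n.val → Bit,
      (if firstBits (n.val - m.val) y = x then xProj n y ⟨n, a⟩ ⟨n, u⟩ else 0) =
      (if firstBits (n.val - m.val) y = x then signOf (a + u) y else 0) / 2 ^ n.val := fun y => by
    unfold xProj
    rw [xKet_mul_conj]
    split_ifs <;> simp
  simp only [h1]
  rw [← Finset.sum_div, sum_firstBits_signOf h, lastBits_add, firstBits_add]
  by_cases h2 : lastBits m.val a = lastBits m.val u
  · rw [if_pos h2, if_pos (bit_add_self_eq_zero.mpr h2), signOf_add]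
    have h3 : (2 : ℂ) ^ n.val = 2 ^ m.val * 2 ^ (n.val - m.val) := by
      rw [← pow_add]; congr 1; omega
    rw [h3, mul_div_mul_left _ _ (by positivity)]
  · rw [if_neg h2, if_neg fun hn => h2 (bit_add_self_eq_zero.mp hn), zero_div]

end Signs

/-! ### Privacy amplification -/

section PA

variable {L M : ℕ} {P : Params L M} {ε : Type u} (V : VirParams P)

/-- The linear map of labels of virtual privacy amplification. -/
abbrev paKey (m : Fin (numPulses L M + 1)) (r : Fin P.hPA → Bit) :
    Key (numPulses L M) → Key (numPulses L M) :=
  linKey fun n => V.tCPA n m.val r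

lemma paVir1_apply (r : Fin P.hPA → Bit) (p y : PASys L M) :
    paVir1 V r p y = if p = (paKey V y.2.2 r y.1, paKey V y.2.2 r y.2.1, y.2.2) then 1 else 0 := by
  unfold paVir1
  by_cases h : p.2.2 = y.2.2
  · rw [if_pos h, h, linU_apply, linU_apply, ite_mul_ite_one]
    refine ite_eq_ite_of_iff ?_ _ _
    constructor
    · rintro ⟨h1, h2⟩
      exact Prod.ext h1 (Prod.ext h2 h)
    · rintro rfl
      exact ⟨rfl, rfl⟩
  · rw [if_neg h, if_neg]
    rintro rfl
    exact h rfl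

lemma paVir3_mul_apply (n m : Fin (numPulses L M + 1)) (r : Fin P.hPA → Bit)
    (xA : Fin (n.val - m.val) → Bit) (xB : Fin n.val → Bit) (Q : Op (PASys L M))
    (a : Fin n.val → Bit) (s : Key (numPulses L M) × Fin (numPulses L M + 1)) (y : PASys L M) :
    (paVir3 V n m r xA xB * Q : Op (PASys L M)) (⟨n, a⟩, s) y =
      signOf (V.zString n.val m.val r xA xB) a * Q (⟨n, a⟩, s) y := by
  rw [Matrix.mul_apply, Finset.sum_eq_single ((⟨n, a⟩, s) : PASys L M)]
  · congr 1
    simp only [paVir3, if_true]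
    rw [Finset.sum_eq_single a]
    · simp [ketBra]
    · intro b _ hb; simp [ketBra, Ne.symm hb]
    · simp
  · intro q _ hq
    rw [mul_eq_zero]
    left
    simp only [paVir3]
    split_ifs with h
    swap
    · rfl
    refine Finset.sum_eq_zero fun b _ => ?_
    rw [mul_eq_zero]
    right
    unfold ketBra
    rw [if_neg]
    rintro ⟨h1, h2⟩
    exact hq (Prod.ext (h2.trans h1.symm) h.symm)
  · simp

/-- A branch of virtual privacy amplification, by matrix elements. -/
lemma paVir_apply (n m : Fin (numPulses L M + 1)) (r : Fin P.hPA → Bit)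
    (xA c : Fin (n.val - m.val) → Bit) (xB : Fin n.val → Bit) (b : Key (numPulses L M))
    (x : Key (numPulses L M) × Fin (numPulses L M + 1)) (y : PASys L M) :
    (paVir4 n m c b * paVir3 V n m r xA xB * paVir2 n m xA xB * paVir1 V r) x y =
      ∑ a : Fin n.val → Bit, if firstBits (n.val - m.val) a = c ∧ x = (⟨m, lastBits m.val a⟩, m) ∧
          y.2.2 = m then
        signOf (V.zString n.val m.val r xA xB) a *
          ((∑ z : Fin n.val → Bit, if firstBits (n.val - m.val) z = xA then
            xProj n z ⟨n, a⟩ (paKey V m r y.1) else 0) * xProj n xB b (paKey V m r y.2.1))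
        else 0 := by
  rw [Matrix.mul_assoc, Matrix.mul_assoc]
  unfold paVir4
  rw [Matrix.sum_mul, Matrix.sum_apply]
  refine Finset.sum_congr rfl fun a _ => ?_
  by_cases h1 : firstBits (n.val - m.val) a = c
  swap
  · simp [h1]
  rw [if_pos h1, Matrix.mul_apply, Finset.sum_eq_single ((⟨n, a⟩, b, m) : PASys L M)]
  · rw [paVir3_mul_apply, Matrix.mul_apply,
      Finset.sum_eq_single ((paKey V y.2.2 r y.1, paKey V y.2.2 r y.2.1, y.2.2) : PASys L M)]
    · rw [paVir1_apply, if_pos rfl, mul_one]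
      by_cases hx : x = (⟨m, lastBits m.val a⟩, m)
      · by_cases hy : y.2.2 = m
        · simp [ketBra, hx, h1, hy, paVir2]
        · simp [hy, paVir2]
      · simp [ketBra, hx]
    · intro p _ hp
      rw [paVir1_apply, if_neg hp, mul_zero]
    · simp
  · intro q _ hq
    simp [ketBra, hq]
  · simp

/-- What privacy amplification needs of its input. -/
def PAIn (a : Key (numPulses L M) × Key (numPulses L M) × Fin (numPulses L M + 1) × Bool) : Prop :=
  a.1.1 = a.2.1.1 ∧ (a.2.2.2 = true → a.2.2.1.val ≤ a.1.1.val)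

/-- The amplified key. -/
def paHash (P : Params L M) (r : Fin P.hPA → Bit) (m : Fin (numPulses L M + 1))
    (k : Key (numPulses L M)) : Key (numPulses L M) :=
  ⟨m, Matrix.vecMul k.2 (P.CPA k.1.val m.val r)⟩

/-- The bits of `paKey`. -/
def paBits (r : Fin P.hPA → Bit) {n : Fin (numPulses L M + 1)} (m : Fin (numPulses L M + 1))
    (k : Fin n.val → Bit) : Fin n.val → Bit :=
  Matrix.vecMul k (V.tCPA n.val m.val r)

lemma paKey_mk (r : Fin P.hPA → Bit) {n : Fin (numPulses L M + 1)} (m : Fin (numPulses L M + 1))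
    (k : Fin n.val → Bit) : paKey V m r ⟨n, k⟩ = ⟨n, paBits V r m k⟩ := rfl

lemma lastBits_paBits (r : Fin P.hPA → Bit) {n m : Fin (numPulses L M + 1)} (h : m.val ≤ n.val)
    (k : Fin n.val → Bit) :
    (⟨m, lastBits m.val (paBits V r m k)⟩ : Key (numPulses L M)) = paHash P r m ⟨n, k⟩ :=
  congrArg (Sigma.mk m) (lastBits_vecMul h _ _ _ (V.tCPA_cols n.val m.val r h (numPulses_le n)))

lemma paBits_inj (r : Fin P.hPA → Bit) {n m : Fin (numPulses L M + 1)} (h : m.val ≤ n.val)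
    {k l : Fin n.val → Bit} : paBits V r m k = paBits V r m l ↔ k = l :=
  ⟨fun he => Matrix.vecMul_injective_of_isUnit (V.tCPA_unit n.val m.val r h (numPulses_le n)) he,
    fun he => by rw [he]⟩

/-- A branch of virtual privacy amplification for a given output key. -/
lemma paVir_apply_key {n m : Fin (numPulses L M + 1)} (h : m.val ≤ n.val) (r : Fin P.hPA → Bit)
    (xA c : Fin (n.val - m.val) → Bit) (xB : Fin n.val → Bit) (b : Key (numPulses L M))
    (v : Fin m.val → Bit) (k l : Fin n.val → Bit) :
    (paVir4 n m c b * paVir3 V n m r xA xB * paVir2 n m xA xB * paVir1 V r)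
        (⟨m, v⟩, m) (⟨n, k⟩, ⟨n, l⟩, m) =
      if v = lastBits m.val (paBits V r m k) then
        signOf (V.zString n.val m.val r xA xB) ((splitBits h).symm (c, v)) *
          (signOf c xA * signOf (firstBits (n.val - m.val) (paBits V r m k)) xA /
            2 ^ (n.val - m.val)) * xProj n xB b ⟨n, paBits V r m l⟩
      else 0 := by
  rw [paVir_apply, Finset.sum_eq_single ((splitBits h).symm (c, v))]
  · have e := (splitBits h).apply_symm_apply (c, v)
    have e1 : firstBits (n.val - m.val) ((splitBits h).symm (c, v)) = c := (Prod.ext_iff.mp e).1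
    have e2 : lastBits m.val ((splitBits h).symm (c, v)) = v := (Prod.ext_iff.mp e).2
    rw [if_pos ⟨e1, by rw [e2], rfl⟩]
    have e3 := sum_xProj_firstBits h xA ((splitBits h).symm (c, v)) (paBits V r m k)
    rw [e1, e2] at e3
    simp only [paKey_mk, e3]
    by_cases hv : v = lastBits m.val (paBits V r m k)
    · rw [if_pos hv, if_pos hv, mul_assoc]
    · rw [if_neg hv, if_neg hv, zero_mul, mul_zero]
  · intro a _ ha
    rw [if_neg]
    rintro ⟨h1, h2, -⟩
    have h3 := eq_of_heq (Sigma.mk.inj (Prod.ext_iff.mp h2).1).2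
    exact ha ((splitBits h).eq_symm_apply.mpr (Prod.ext h1 h3.symm))
  · simp

/-- The sum over the `X` outcomes and the traced-out indices in virtual privacy amplification:
phases and signs cancel. -/
lemma sum_paVir_signs {n m : Fin (numPulses L M + 1)} (h : m.val ≤ n.val)
    (t : (Fin (n.val - m.val) → Bit) → (Fin n.val → Bit) → (Fin n.val → Bit))
    (v : Fin m.val → Bit) {u u' : Fin n.val → Bit} (w w' : Fin n.val → Bit)
    (h1 : v = lastBits m.val u) (h2 : v = lastBits m.val u') :
    ∑ p : (Fin (n.val - m.val) → Bit) × (Fin n.val → Bit) × (Fin (n.val - m.val) → Bit) ×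
        Key (numPulses L M),
      signOf (t p.1 p.2.1) ((splitBits h).symm (p.2.2.1, v)) *
          (signOf p.2.2.1 p.1 * signOf (firstBits (n.val - m.val) u) p.1 /
            2 ^ (n.val - m.val)) * xProj n p.2.1 p.2.2.2 ⟨n, w⟩ *
        conj (signOf (t p.1 p.2.1) ((splitBits h).symm (p.2.2.1, v)) *
          (signOf p.2.2.1 p.1 * signOf (firstBits (n.val - m.val) u') p.1 /
            2 ^ (n.val - m.val)) * xProj n p.2.1 p.2.2.2 ⟨n, w'⟩) =
      if u = u' ∧ w' = w then 1 else 0 := by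
  have e1 : ∀ p : (Fin (n.val - m.val) → Bit) × (Fin n.val → Bit) × (Fin (n.val - m.val) → Bit) ×
        Key (numPulses L M),
      signOf (t p.1 p.2.1) ((splitBits h).symm (p.2.2.1, v)) *
          (signOf p.2.2.1 p.1 * signOf (firstBits (n.val - m.val) u) p.1 /
            2 ^ (n.val - m.val)) * xProj n p.2.1 p.2.2.2 ⟨n, w⟩ *
        conj (signOf (t p.1 p.2.1) ((splitBits h).symm (p.2.2.1, v)) *
          (signOf p.2.2.1 p.1 * signOf (firstBits (n.val - m.val) u') p.1 /
            2 ^ (n.val - m.val)) * xProj n p.2.1 p.2.2.2 ⟨n, w'⟩) =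
      (signOf (firstBits (n.val - m.val) (u + u')) p.1 /
          (2 ^ (n.val - m.val) * 2 ^ (n.val - m.val))) *
          ((xKet n p.2.1 ⟨n, w'⟩ * conj (xKet n p.2.1 ⟨n, w⟩)) *
          (xKet n p.2.1 p.2.2.2 * conj (xKet n p.2.1 p.2.2.2))) := by
    intro p
    have s1 := signOf_mul_self (t p.1 p.2.1)
      ((splitBits h).symm (p.2.2.1, v))
    have s2 := signOf_mul_self p.2.2.1 p.1
    simp only [map_mul, map_div₀, conj_signOf, map_pow, Complex.conj_ofNat, xProj,
      Complex.conj_conj, firstBits_add, signOf_add]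
    generalize signOf (t p.1 p.2.1) ((splitBits h).symm (p.2.2.1, v)) = s at *
    generalize signOf p.2.2.1 p.1 = t' at *
    generalize signOf (firstBits (n.val - m.val) u) p.1 = g
    generalize signOf (firstBits (n.val - m.val) u') p.1 = g'
    linear_combination (g * g' / (2 ^ (n.val - m.val) * 2 ^ (n.val - m.val)) *
      ((xKet n p.2.1 ⟨n, w'⟩ * conj (xKet n p.2.1 ⟨n, w⟩)) *
          (xKet n p.2.1 p.2.2.2 * conj (xKet n p.2.1 p.2.2.2)))) * (t' * t' * s1 + s2)
  simp only [e1]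
  simp only [Fintype.sum_prod_type, ← Finset.mul_sum, sum_xKet_sq]
  simp only [Finset.sum_const, Finset.card_univ, ← Finset.sum_mul,
    sum_xKet_mul_conj, ← Finset.sum_div, sum_signOf]
  have h3 : firstBits (n.val - m.val) (u + u') = 0 ↔ u = u' := by
    rw [firstBits_add, bit_add_self_eq_zero]
    refine ⟨fun he => (splitBits h).injective (Prod.ext he (h1.symm.trans h2)), fun he => ?_⟩
    rw [he]
  by_cases hu : u = u'
  · by_cases hw : w' = w
    · rw [if_pos (h3.mpr hu), if_pos hw, if_pos ⟨hu, hw⟩]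
      simp [ZMod.card]
    · simp [hw]
  · have h4 : ¬ firstBits (n.val - m.val) (u + u') = 0 := fun hn => hu (h3.mp hn)
    simp [hu, h4]

/-- The Gram matrix of the branches of virtual privacy amplification. -/
lemma sum_paVir {n m : Fin (numPulses L M + 1)} (h : m.val ≤ n.val) (r : Fin P.hPA → Bit)
    (v : Fin m.val → Bit) (k k' l l' : Fin n.val → Bit) :
    ∑ p : (Fin (n.val - m.val) → Bit) × (Fin n.val → Bit) × (Fin (n.val - m.val) → Bit) ×
        Key (numPulses L M),
      (paVir4 n m p.2.2.1 p.2.2.2 * paVir3 V n m r p.1 p.2.1 * paVir2 n m p.1 p.2.1 * paVir1 V r)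
        (⟨m, v⟩, m) (⟨n, k⟩, ⟨n, l⟩, m) *
      conj ((paVir4 n m p.2.2.1 p.2.2.2 * paVir3 V n m r p.1 p.2.1 * paVir2 n m p.1 p.2.1 *
        paVir1 V r) (⟨m, v⟩, m) (⟨n, k'⟩, ⟨n, l'⟩, m)) =
      if (k = k' ∧ l = l') ∧ (⟨m, v⟩ : Key (numPulses L M)) = paHash P r m ⟨n, k⟩ then 1
        else 0 := by
  rw [← lastBits_paBits V r h k]
  simp only [paVir_apply_key V h]
  by_cases h1 : v = lastBits m.val (paBits V r m k)
  swap
  · rw [if_neg]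
    · simp [h1]
    · rintro ⟨-, h2⟩
      exact h1 (eq_of_heq (Sigma.mk.inj h2).2)
  by_cases h2 : v = lastBits m.val (paBits V r m k')
  swap
  · rw [if_neg]
    · simp [h2]
    · rintro ⟨⟨rfl, rfl⟩, -⟩
      exact h2 h1
  have e := sum_paVir_signs h (V.zString n.val m.val r) v (paBits V r m l) (paBits V r m l') h1 h2
  simp only [if_pos h1, if_pos h2]
  refine e.trans (ite_eq_ite_of_iff ?_ _ _)
  rw [paBits_inj V r h, paBits_inj V r h, eq_comm (a := l'), ← h1]
  simp

end PA

section PAState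

variable {L M : ℕ} {P : Params L M} {ε : Type u} (V : VirParams P)

/-- Input labels of privacy amplification: the two keys, the final length and the flag. -/
abbrev PALab (L M : ℕ) :=
  Key (numPulses L M) × Key (numPulses L M) × Fin (numPulses L M + 1) × Bool

/-- Virtual privacy amplification as a map of labels, when only diagonal entries matter. -/
def paVirOut (P : Params L M) (r : Fin P.hPA → Bit) (a : PALab L M) :
    Key (numPulses L M) × Fin (numPulses L M + 1) × Bool × CPASeed P :=
  if a.2.2.2 = true then (paHash P r a.2.2.1 a.1, a.2.2.1, true, r)
  else (a.1, a.2.2.1, false, r)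

/-- Actual privacy amplification as a map of labels. -/
def paOut (P : Params L M) (r : Fin P.hPA → Bit) (a : PALab L M) :
    Key (numPulses L M) × Key (numPulses L M) × Fin (numPulses L M + 1) × Bool × CPASeed P :=
  if a.2.2.2 = true then
    (paHash P r a.2.2.1 a.1, paHash P r a.2.2.1 a.2.1, a.2.2.1, true, r)
  else (nullKey _, nullKey _, a.2.2.1, false, r)

lemma paVir_ne_zero {n m : Fin (numPulses L M + 1)} {r : Fin P.hPA → Bit}
    {xA c : Fin (n.val - m.val) → Bit} {xB : Fin n.val → Bit} {b : Key (numPulses L M)}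
    {x : Key (numPulses L M) × Fin (numPulses L M + 1)} {y : PASys L M}
    (h : (paVir4 n m c b * paVir3 V n m r xA xB * paVir2 n m xA xB * paVir1 V r) x y ≠ 0) :
    x.1.1 = m ∧ x.2 = m ∧ y.1.1 = n ∧ y.2.2 = m := by
  rw [paVir_apply] at h
  obtain ⟨a, -, h⟩ := Finset.exists_ne_zero_of_sum_ne_zero h
  obtain ⟨⟨-, rfl, h3⟩, h4⟩ := ite_ne_right_iff.mp h
  refine ⟨rfl, rfl, ?_, h3⟩
  have h5 := left_ne_zero_of_mul (right_ne_zero_of_mul h4)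
  obtain ⟨z, -, h6⟩ := Finset.exists_ne_zero_of_sum_ne_zero h5
  have h7 := (ite_ne_right_iff.mp h6).2
  by_contra hn
  refine h7 ?_
  unfold xProj
  rw [xKet_of_ne z (k := paKey V m r y.1) hn, map_zero, mul_zero]

lemma paVirKraus_positive (r : Fin P.hPA → Bit) {n m : Fin (numPulses L M + 1)} (le : m ≤ n)
    (xA : Fin (n.val - m.val) → Bit) (xB : Fin n.val → Bit) (c : Fin (n.val - m.val) → Bit)
    (b : Key (numPulses L M))
    (z : Key (numPulses L M) × Fin (numPulses L M + 1) × Bool × CPASeed P) (a : PALab L M) :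
    paVirKraus V (r, PABranch.positive n m le xA xB c b) z a =
      if z.2.2.2 = r ∧ z.2.2.1 = true ∧ a.2.2.2 = true then (Real.sqrt (1 / 2 ^ P.hPA) : ℂ) *
        (paVir4 n m c b * paVir3 V n m r xA xB * paVir2 n m xA xB * paVir1 V r)
          (z.1, z.2.1) (a.1, a.2.1, a.2.2.1) else 0 := by
  simp only [paVirKraus]
  by_cases h1 : z.2.2.2 = r
  · by_cases h2 : z.2.2.1 = true ∧ a.2.2.2 = true
    · rw [if_pos h1, if_pos h2, if_pos ⟨h1, h2⟩]
    · rw [if_pos h1, if_neg h2, if_neg fun h => h2 h.2, mul_zero]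
  · rw [if_neg h1, if_neg fun h => h1 h.1]

lemma paVirKraus_aborted (r : Fin P.hPA → Bit) (b : Key (numPulses L M))
    (z : Key (numPulses L M) × Fin (numPulses L M + 1) × Bool × CPASeed P) (a : PALab L M) :
    paVirKraus V (r, PABranch.aborted b) z a =
      if a.2.2.2 = false ∧ a.2.1 = b ∧ (a.1, a.2.2.1, false, r) = z then
        (Real.sqrt (1 / 2 ^ P.hPA) : ℂ) else 0 := by
  obtain ⟨z1, z2, z3, z4⟩ := z
  simp only [paVirKraus, Prod.mk.injEq]
  by_cases h1 : z4 = r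
  · rw [if_pos h1, mul_ite, mul_one, mul_zero]
    refine ite_eq_ite_of_iff ⟨?_, ?_⟩ _ _
    · rintro ⟨rfl, h3, rfl, rfl, h6⟩
      exact ⟨h6, h3, rfl, rfl, rfl, h1.symm⟩
    · rintro ⟨h2, h3, rfl, rfl, rfl, rfl⟩
      exact ⟨rfl, h3, rfl, rfl, h2⟩
  · rw [if_neg h1, if_neg]
    rintro ⟨-, -, -, -, -, h⟩
    exact h1 h.symm

/-- The Gram matrix of virtual privacy amplification for a given seed. -/
lemma tsum_paVirKraus (r : Fin P.hPA → Bit) {a b : PALab L M} (ha : PAIn a) (hb : PAIn b)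
    (hab : a.2.2 = b.2.2)
    (z : Key (numPulses L M) × Fin (numPulses L M + 1) × Bool × CPASeed P) :
    ∑' k : PABranch L M, paVirKraus V (r, k) z a * conj (paVirKraus V (r, k) z b) =
      if a = b ∧ paVirOut P r a = z then
        (Real.sqrt (1 / 2 ^ P.hPA) : ℂ) * conj (Real.sqrt (1 / 2 ^ P.hPA) : ℂ) else 0 := by
  set w : ℂ := (Real.sqrt (1 / 2 ^ P.hPA) : ℂ) with hw
  obtain ⟨kA, kB, m, f⟩ := a
  obtain ⟨lA, lB, m', f'⟩ := b
  simp only [Prod.mk.injEq] at hab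
  obtain ⟨rfl, rfl⟩ := hab
  cases f with
  | false =>
    have hinj : Function.Injective (PABranch.aborted (L := L) (M := M)) := fun b b' h => by
      simpa using h
    rw [← hinj.tsum_eq]
    · simp only [paVirKraus_aborted, paVirOut, true_and, ← hw]
      rw [tsum_eq_single kB]
      · simp only [true_and, Bool.false_eq_true, if_false]
        by_cases h1 : (kA, m, false, r) = z
        · subst h1
          by_cases h2 : (kA, kB) = (lA, lB)
          · simp only [Prod.mk.injEq] at h2
            obtain ⟨rfl, rfl⟩ := h2
            simp
          · have h4 : ¬ (lB = kB ∧ (lA, m, false, r) = (kA, m, false, r)) := by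
              rintro ⟨rfl, h3⟩
              simp only [Prod.mk.injEq] at h3
              exact h2 (by rw [h3.1])
            rw [if_neg h4, map_zero, mul_zero, if_neg]
            rintro ⟨h3, -⟩
            simp only [Prod.mk.injEq] at h3
            exact h2 (by rw [h3.1, h3.2.1])
        · rw [if_neg h1, zero_mul, if_neg fun h => h1 h.2]
      · intro b hb
        rw [if_neg fun h => hb h.1.symm, zero_mul]
    · intro k hk
      cases k with
      | aborted b => exact ⟨b, rfl⟩
      | positive n m' le xA xB c b =>
        refine absurd ?_ hk
        beta_reduce
        rw [paVirKraus_positive, if_neg (by simp), zero_mul]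
  | true =>
    obtain ⟨n, k⟩ := kA
    obtain ⟨n1, l⟩ := kB
    obtain ⟨ha1, ha2⟩ := ha
    change n = n1 at ha1
    subst ha1
    have hle : m.val ≤ n.val := ha2 rfl
    obtain ⟨n', k'⟩ := lA
    obtain ⟨n1', l'⟩ := lB
    have hb1 : n' = n1' := hb.1
    subst hb1
    have hinj : Function.Injective fun p : (Fin (n.val - m.val) → Bit) × (Fin n.val → Bit) ×
        (Fin (n.val - m.val) → Bit) × Key (numPulses L M) =>
        PABranch.positive n m hle p.1 p.2.1 p.2.2.1 p.2.2.2 := fun p q h => by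
      simp only [PABranch.positive.injEq, heq_eq_eq, true_and] at h
      exact Prod.ext h.1 (Prod.ext h.2.1 (Prod.ext h.2.2.1 h.2.2.2))
    rw [← hinj.tsum_eq]
    swap
    · intro q hq
      cases q with
      | aborted b =>
        refine absurd ?_ hq
        beta_reduce
        rw [paVirKraus_aborted, if_neg (by simp), zero_mul]
      | positive n2 m2 le xA xB c b =>
        have h1 := left_ne_zero_of_mul hq
        rw [paVirKraus_positive] at h1
        have h2 := right_ne_zero_of_mul (ite_ne_right_iff.mp h1).2
        obtain ⟨-, -, h3, h4⟩ := paVir_ne_zero V h2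
        simp only at h3 h4
        subst h3 h4
        exact ⟨(xA, xB, c, b), rfl⟩
    simp only [paVirKraus_positive, and_true, ← hw]
    by_cases hn : n = n'
    swap
    · rw [if_neg]
      · refine (tsum_congr fun p => ?_).trans tsum_zero
        by_contra h1
        obtain ⟨h2, h3⟩ := mul_ne_zero_iff.mp h1
        rw [map_ne_zero] at h3
        have h4 := paVir_ne_zero V (right_ne_zero_of_mul (ite_ne_right_iff.mp h3).2)
        exact hn h4.2.2.1.symm
      · rintro ⟨h1, -⟩
        exact hn (congrArg (fun x : PALab L M => x.1.1) h1)
    subst hn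
    obtain ⟨⟨m0, v⟩, m1, f1, r1⟩ := z
    by_cases hz : m0 = m ∧ m1 = m ∧ f1 = true ∧ r1 = r
    · obtain ⟨rfl, rfl, rfl, rfl⟩ := hz
      simp only [and_self, if_true, paVirOut]
      have e := sum_paVir V hle r1 v k k' l l'
      rw [tsum_fintype]
      simp only [map_mul]
      have e2 : ∀ x y : ℂ, w * x * (conj w * y) = w * conj w * (x * y) := fun x y => by ring
      simp only [e2]
      rw [← Finset.mul_sum, e, mul_ite, mul_one, mul_zero]
      refine ite_eq_ite_of_iff ?_ _ _
      simp only [Prod.mk.injEq, and_true, Sigma.mk.injEq, heq_eq_eq, true_and]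
      exact and_congr_right' eq_comm
    · rw [if_neg]
      · refine (tsum_congr fun p => ?_).trans tsum_zero
        by_contra h1
        obtain ⟨h2, h3⟩ := mul_ne_zero_iff.mp h1
        obtain ⟨h4, h5⟩ := ite_ne_right_iff.mp h2
        have h6 := paVir_ne_zero V (right_ne_zero_of_mul h5)
        exact hz ⟨h6.1, h6.2.1, h4.2, h4.1⟩
      · rintro ⟨-, h1⟩
        simp only [paVirOut, if_true, Prod.mk.injEq] at h1
        exact hz ⟨(congrArg Sigma.fst h1.1).symm, h1.2.1.symm, h1.2.2.1.symm, h1.2.2.2.symm⟩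

lemma actsAs_pa (r : Fin P.hPA → Bit) :
    ActsAs (fun k => paKraus P (r, k)) (fun a : PALab L M => a.1.1 = a.2.1.1)
      (fun a => (keyPair a.1 a.2.1, a.2.2.1)) (paOut P r) (Real.sqrt (1 / 2 ^ P.hPA) : ℂ) where
  apply k z a ha := by
    obtain ⟨kA, kB, m, f⟩ := a
    obtain ⟨k, m'⟩ := k
    change kA.1 = kB.1 at ha
    unfold paKraus
    simp only [Matrix.smul_apply, Matrix.add_apply, ketBra, ketBra_keyPair ha]
    by_cases hk : keyPair kA kB = k
    · have e1 : (kA, kB, ()) = ((⟨k.1, k.2.1⟩ : Key (numPulses L M)), (⟨k.1, k.2.2⟩ : Key _), ()) :=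
        (ketBra_keyPair ha k () ()).mpr ⟨hk, rfl⟩
      simp only [Prod.mk.injEq, and_true] at e1
      obtain ⟨rfl, rfl⟩ := e1
      by_cases hm : m = m'
      · subst hm
        cases f with
        | true =>
          simp only [paOut, if_true, and_true, hk, Bool.true_eq_false, and_false, Prod.mk.injEq,
            if_false, add_zero, true_and, smul_eq_mul, mul_ite, mul_one, mul_zero, paHash]
          refine ite_eq_ite_of_iff eq_comm _ _
        | false =>
          simp only [paOut, and_true, hk, Bool.false_eq_true, and_false, Prod.mk.injEq,
            if_false, zero_add, true_and, smul_eq_mul, mul_ite, mul_one, mul_zero]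
          exact ite_eq_ite_of_iff eq_comm _ _
      · simp [hm]
    · simp [hk]
  inj a b ha hb h1 h2 := by
    obtain ⟨kA, kB, m, f⟩ := a
    obtain ⟨lA, lB, m', g⟩ := b
    simp only [Prod.mk.injEq] at h1
    obtain ⟨h1, rfl⟩ := h1
    obtain ⟨rfl, rfl⟩ := keyPair_inj ha hb h1
    cases f <;> cases g <;> simp_all [paOut]

end PAState

/-! ### The final states -/

section FinalState

variable {L M : ℕ} {P : Params L M} {ε : Type u} (V : VirParams P)

/-- Labels of the systems untouched by privacy amplification. -/
abbrev PASpec (P : Params L M) (ε : Type u) := CEC P × CHash P × Option Bool × Unit × ε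

/-- The public registers among the systems untouched by privacy amplification. -/
def specPub (s : PASpec P ε) : CEC P × CHash P × Option Bool := (s.1, s.2.1, s.2.2.1)

/-- Replaces the keys by null keys if the protocol is aborted. -/
def collapse (a : PALab L M) : PALab L M :=
  if a.2.2.2 = true then a else (nullKey _, nullKey _, a.2.2)

lemma collapse_reg (a : PALab L M) : (collapse a).2.2 = a.2.2 := by
  unfold collapse
  split_ifs <;> rfl

/-- Actual privacy amplification agrees with the virtual one once the keys of an aborted run are
replaced by null keys. -/
lemma paOut_eq (r : Fin P.hPA → Bit) (a : PALab L M) :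
    ((paOut P r a).1, (paOut P r a).2.2) = paVirOut P r (collapse a) := by
  obtain ⟨kA, kB, m, f⟩ := a
  cases f <;> simp [paOut, paVirOut, collapse]

lemma paVirKraus_reg {r : Fin P.hPA → Bit} {k : PABranch L M}
    {z : Key (numPulses L M) × Fin (numPulses L M + 1) × Bool × CPASeed P} {a : PALab L M}
    (h : paVirKraus V (r, k) z a ≠ 0) : z.2 = (a.2.2.1, a.2.2.2, r) := by
  cases k with
  | aborted b =>
    rw [paVirKraus_aborted] at h
    obtain ⟨h1, -, h2⟩ := (ite_ne_right_iff.mp h).1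
    rw [← h2, h1]
  | positive n m le xA xB c b =>
    rw [paVirKraus_positive] at h
    obtain ⟨⟨h1, h2, h3⟩, h4⟩ := ite_ne_right_iff.mp h
    have h5 := paVir_ne_zero V (right_ne_zero_of_mul h4)
    exact Prod.ext (h5.2.1.trans h5.2.2.2.symm) (Prod.ext (h2.trans h3.symm) h1)

variable {ρ : Op ((Key (numPulses L M) × Key (numPulses L M) × Bool) ×
      (CEC P × Fin (numPulses L M + 1) × Unit × ε))}

lemma verifyVirState_paIn (hρ : EcSupp ρ) {a b : PALab L M} {s t : PASpec P ε}
    (h : verifyVirState V ρ (a, s) (b, t) ≠ 0) :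
    PAIn a ∧ PAIn b ∧ a.2.2 = b.2.2 ∧ specPub s = specPub t := by
  obtain ⟨h1, h2, h3⟩ := verifyVirState_support V hρ h
  exact ⟨h1, h2, (Prod.ext_iff.mp h3).1, (Prod.ext_iff.mp h3).2⟩

lemma paVirState_support (hρ : EcSupp ρ) {X Y}
    (h : act (paVirKraus V) (verifyVirState V ρ) X Y ≠ 0) :
    X.1.2 = Y.1.2 ∧ specPub X.2 = specPub Y.2 := by
  rw [act_seed] at h
  obtain ⟨r, -, h⟩ := Finset.exists_ne_zero_of_sum_ne_zero h
  obtain ⟨k, a, b, h1, h2, h3⟩ := exists_of_act_ne_zero h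
  obtain ⟨-, -, h4, h5⟩ := verifyVirState_paIn V hρ h3
  rw [paVirKraus_reg V h1, paVirKraus_reg V h2, h4]
  exact ⟨rfl, h5⟩

lemma verifyState_length (hρ : EcSupp ρ) (x y)
    (h : verifyState P (dephase ecLab ρ) x y ≠ 0) : x.1.1.1 = x.1.2.1.1 ∧ y.1.1.1 = y.1.2.1.1 := by
  obtain ⟨h1, h2, -⟩ := verifyState_support hρ h
  exact ⟨h1.1, h2 ▸ h1.1⟩

lemma paState_support (hρ : EcSupp ρ) {X Y}
    (h : act (paKraus P) (verifyState P (dephase ecLab ρ)) X Y ≠ 0) :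
    X.1 = Y.1 ∧ specPub X.2 = specPub Y.2 := by
  rw [act_seed] at h
  obtain ⟨r, -, h⟩ := Finset.exists_ne_zero_of_sum_ne_zero h
  obtain ⟨a, b, -, -, -, ha, hb, h2⟩ :=
    (actsAs_pa (P := P) r).exists_of_ne_zero (verifyState_length hρ) h
  obtain ⟨-, h3, h4⟩ := verifyState_support hρ h2
  simp only at h3
  subst h3
  exact ⟨ha.symm.trans hb, (Prod.ext_iff.mp h4).2⟩

lemma sum_collapse {A Z : Type*} [Fintype A] (F : A → Z) (G : A → A) (D : A → ℂ) (z : Z) (c : ℂ)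
    {d₁ : ∀ a, Decidable (F a = z)} {d₂ : ∀ a b, Decidable (G b = a)}
    {d₃ : ∀ b, Decidable (F (G b) = z)} :
    (∑ a, if F a = z then c * ∑ b, (if G b = a then D b else 0) else 0) =
      ∑ b, if F (G b) = z then c * D b else 0 := by
  have h : ∀ a, (if F a = z then c * ∑ b, (if G b = a then D b else 0) else 0) =
      ∑ b, if G b = a then (if F a = z then c * D b else 0) else 0 := fun a => by
    split_ifs with h
    · rw [Finset.mul_sum]
      exact Finset.sum_congr rfl fun b _ => by rw [mul_ite, mul_zero]
    · simp
  simp only [h]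
  rw [Finset.sum_comm]
  refine Finset.sum_congr rfl fun b _ => ?_
  rw [Finset.sum_eq_single (G b)]
  · rw [if_pos rfl]
    exact ite_eq_ite_of_iff Iff.rfl _ _
  · intro a _ ha
    rw [if_neg (Ne.symm ha)]
  · simp

/-- Virtual error verification is the actual one followed by discarding the keys after an
abort. -/
lemma verifyVirState_collapse (hρ : EcSupp ρ) (a : PALab L M) {s t : PASpec P ε}
    (hst : specPub s = specPub t) : verifyVirState V ρ (a, s) (a, t) =
      ∑ b : PALab L M, if collapse b = a then
        verifyState P (dephase ecLab ρ) (b, s) (b, t) else 0 := by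
  obtain ⟨c, h, o, e⟩ := s
  obtain ⟨c', h', o', e'⟩ := t
  simp only [specPub, Prod.mk.injEq] at hst
  obtain ⟨rfl, rfl, rfl⟩ := hst
  obtain ⟨kA, kB, m, f⟩ := a
  rw [verifyVirState_diag V hρ]
  refine Finset.sum_of_injOn (fun k : Key (numPulses L M) × Key (numPulses L M) =>
    ((k.1, k.2, m, f) : PALab L M)) ?_ (fun _ _ => Finset.mem_univ _) ?_ ?_
  · intro k _ l _ hkl
    simp only [Prod.mk.injEq] at hkl
    exact Prod.ext hkl.1 hkl.2.1
  · intro b _ hb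
    rw [if_neg]
    intro hc
    refine hb ⟨(b.1, b.2.1), Finset.mem_coe.mpr (Finset.mem_univ _), ?_⟩
    have h1 := collapse_reg b
    rw [hc] at h1
    simp only at h1
    rw [h1]
  · intro k _
    refine ite_eq_ite_of_iff ?_ _ _
    cases f <;> simp [collapse, Prod.ext_iff]

/-- Actual privacy amplification with a fixed seed, with Bob's key traced out. -/
lemma sum_paState (hρ : EcSupp ρ) (r : Fin P.hPA → Bit)
    (z : Key (numPulses L M) × Fin (numPulses L M + 1) × Bool × CPASeed P) (s t : PASpec P ε) :
    ∑ kB, act (fun k => paKraus P (r, k)) (verifyState P (dephase ecLab ρ)) ((z.1, kB, z.2), s)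
        ((z.1, kB, z.2), t) =
      ∑ a, if paVirOut P r (collapse a) = z then
        ((Real.sqrt (1 / 2 ^ P.hPA) : ℂ) * conj (Real.sqrt (1 / 2 ^ P.hPA) : ℂ)) *
          verifyState P (dephase ecLab ρ) (a, s) (a, t) else 0 := by
  simp only [(actsAs_pa (P := P) r).act_diag (verifyState_length hρ)]
  rw [Finset.sum_comm]
  refine Finset.sum_congr rfl fun a _ => ?_
  rw [Finset.sum_eq_single (paOut P r a).2.1]
  · rw [← paOut_eq]
    refine ite_eq_ite_of_iff ⟨fun h1 => ?_, fun h1 => ?_⟩ _ _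
    · rw [h1]
    · rw [← h1]
  · intro b _ hb
    rw [if_neg]
    intro h1
    exact hb (by rw [h1])
  · simp

/-- Diagonal entries after virtual privacy amplification with a fixed seed. -/
lemma paVirState_seed (hρ : EcSupp ρ) (r : Fin P.hPA → Bit)
    (z : Key (numPulses L M) × Fin (numPulses L M + 1) × Bool × CPASeed P) (s t : PASpec P ε) :
    act (fun k => paVirKraus V (r, k)) (verifyVirState V ρ) (z, s) (z, t) =
      ∑ a, if paVirOut P r a = z then
        ((Real.sqrt (1 / 2 ^ P.hPA) : ℂ) * conj (Real.sqrt (1 / 2 ^ P.hPA) : ℂ)) *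
          verifyVirState V ρ (a, s) (a, t) else 0 := by
  rw [act_eq_sum]
  refine Finset.sum_congr rfl fun a _ => ?_
  rw [Finset.sum_eq_single a]
  · by_cases h0 : verifyVirState V ρ (a, s) (a, t) = 0
    · simp [h0]
    · obtain ⟨h1, h2, h3, -⟩ := verifyVirState_paIn V hρ h0
      rw [tsum_paVirKraus V r h1 h2 h3, ite_mul, zero_mul]
      exact ite_eq_ite_of_iff (by simp) _ _
  · intro b _ hb
    by_cases h0 : verifyVirState V ρ (a, s) (b, t) = 0
    · simp [h0]
    · obtain ⟨h1, h2, h3, -⟩ := verifyVirState_paIn V hρ h0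
      rw [tsum_paVirKraus V r h1 h2 h3, if_neg fun h => hb h.1.symm, zero_mul]
  · simp

/-- Tracing out Bob's key after actual privacy amplification gives the diagonal entries of the
output of virtual privacy amplification. -/
lemma paVirState_diag (hρ : EcSupp ρ)
    (z : Key (numPulses L M) × Fin (numPulses L M + 1) × Bool × CPASeed P) (s t : PASpec P ε) :
    act (paVirKraus V) (verifyVirState V ρ) (z, s) (z, t) =
      ∑ kB, act (paKraus P) (verifyState P (dephase ecLab ρ)) ((z.1, kB, z.2), s)
        ((z.1, kB, z.2), t) := by
  by_cases hst : specPub s = specPub t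
  swap
  · have h1 : act (paVirKraus V) (verifyVirState V ρ) (z, s) (z, t) = 0 := by
      by_contra h
      exact hst (paVirState_support V hρ h).2
    rw [h1]
    symm
    refine Finset.sum_eq_zero fun kB _ => ?_
    by_contra h
    exact hst (paState_support hρ h).2
  have e1 : ∀ kB : Key (numPulses L M), act (paKraus P) (verifyState P (dephase ecLab ρ))
      ((z.1, kB, z.2), s) ((z.1, kB, z.2), t) = _ := fun kB => act_seed _ _ _
  simp only [e1]
  rw [Finset.sum_comm, act_seed]
  refine Finset.sum_congr rfl fun r _ => ?_
  rw [sum_paState hρ, paVirState_seed V hρ]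
  simp only [verifyVirState_collapse V hρ _ hst]
  exact sum_collapse (paVirOut P r) collapse _ z _

/-- Eve's final operation in the actual protocol. -/
def finalState (C : Channel.{u} (ε × Pub P) ε)
    (ρ : Op ((Key (numPulses L M) × Key (numPulses L M) × Fin (numPulses L M + 1) × Bool ×
      CPASeed P) × PASpec P ε)) : Op (Key (numPulses L M) × Key (numPulses L M) × ε) :=
  actOn (σ := Key (numPulses L M) × Key (numPulses L M)) C.K
    (fun p => ((p.2.1, p.2.2, p.1.2.2.1, p.1.2.2.2.1, p.1.2.2.2.2.2.2),
      (p.1.2.1, p.1.2.2.2.2.1, p.1.2.2.2.2.2.1, (), p.1.1)))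
    (fun q => (q.2.2, (q.1, q.2.1))) ρ

/-- Eve's final map does not act on the key. -/
lemma finalVirState_dephase (C : Channel.{u} (ε × Pub P) ε)
    (ρ : Op ((Key (numPulses L M) × Fin (numPulses L M + 1) × Bool × CPASeed P) ×
      PASpec P ε)) :
    finalVirState C (dephase (fun X => X.1.1) ρ) = dephase (fun X => X.1) (finalVirState C ρ) := by
  have e := act_dephase (K := C.K) (fun s : Key (numPulses L M) × Unit => s.1)
    (ρ.submatrix
      (fun p : (ε × Pub P) × (Key (numPulses L M) × Unit) =>
        ((p.2.1, p.1.2.2.1, p.1.2.2.2.1, p.1.2.2.2.2.2.2),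
        ((p.1.2.1, p.1.2.2.2.2.1, p.1.2.2.2.2.2.1, p.2.2, p.1.1) : PASpec P ε)))
      (fun p : (ε × Pub P) × (Key (numPulses L M) × Unit) =>
        ((p.2.1, p.1.2.2.1, p.1.2.2.2.1, p.1.2.2.2.2.2.2),
        ((p.1.2.1, p.1.2.2.2.2.1, p.1.2.2.2.2.2.1, p.2.2, p.1.1) : PASpec P ε))))
  funext x y
  exact congrFun (congrFun e (x.2.1, (x.1, x.2.2))) (y.2.1, (y.1, y.2.2))

lemma trRel_finalState (C : Channel.{u} (ε × Pub P) ε)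
    {ρ : Op ((Key (numPulses L M) × Key (numPulses L M) × Fin (numPulses L M + 1) × Bool ×
      CPASeed P) × PASpec P ε)}
    {ρ' : Op ((Key (numPulses L M) × Fin (numPulses L M + 1) × Bool × CPASeed P) ×
      PASpec P ε)} (hρ : TraceClass.{u} ρ)
    (h : TrRel (fun X (k : Key (numPulses L M)) => ((X.1.1, k, X.1.2), X.2)) ρ ρ') :
    TrRel (fun x (k : Key (numPulses L M)) => (x.1, k, x.2.1)) (finalState C ρ)
      (finalVirState C ρ') := by
  have e := TrRel.actOn (O := Key (numPulses L M) × Key (numPulses L M) × ε)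
    (O' := Key (numPulses L M) × ε × Unit)
    (K := C.K)
    (g := fun (x : Key (numPulses L M) × Unit) (k : Key (numPulses L M)) => (x.1, k))
    (by rintro ⟨⟨a, _⟩, b⟩ ⟨⟨a', _⟩, b'⟩ h; simpa using h)
    (inp := fun p => ((p.2.1, p.2.2, p.1.2.2.1, p.1.2.2.2.1, p.1.2.2.2.2.2.2),
      (p.1.2.1, p.1.2.2.2.2.1, p.1.2.2.2.2.2.1, (), p.1.1)))
    (out := fun q => (q.2.2, (q.1, q.2.1)))
    (inp' := fun p => ((p.2.1, p.1.2.2.1, p.1.2.2.2.1, p.1.2.2.2.2.2.2),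
      (p.1.2.1, p.1.2.2.2.2.1, p.1.2.2.2.2.2.1, p.2.2, p.1.1)))
    (out' := fun q => (q.2.1, (q.1, q.2.2)))
    (fO := fun x k => (x.1, k, x.2.1)) hρ C.bdd h
    (Function.LeftInverse.injective (g := fun q =>
      ((q.2.2.2.2.2, (q.2.1, q.1.2.2.1, q.1.2.2.2.1, q.2.2.1, q.2.2.2.1, q.1.2.2.2.2)),
        (q.1.1, q.1.2.1))) fun _ => rfl) (fun _ _ _ => rfl) (fun _ _ => rfl)
  exact e

variable {𝒦 : Type u} (E : Eve P 𝒦 ε) {S : Channel.{u} (BSig 𝒦) (Option Bit)}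

/-- Tracing out Bob's key, the actual final state is the virtual one with Alice's key dephased. -/
theorem sum_rhoPA (hS : IsSquashing P S) (x y : Key (numPulses L M) × ε) :
    ∑ b, rhoPA E (x.1, b, x.2) (y.1, b, y.2) =
      if x.1 = y.1 then rhoPAVir V E S x y else 0 := by
  have hs : SiftSupp P (sift P (rhoQCTr E S)) := fun _ _ h => sift_support h
  have hec : EcSupp (ecVirState V (sift P (rhoQCTr E S))) := fun _ _ h =>
    ecVirState_support V hs h
  have e0 : rhoPA E = finalState E.final (act (paKraus P) (verifyState P
      (ecState P (sift P (rhoQC E))))) := rfl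
  rw [rhoQC_eq_dephase E hS, sift_dephase, ecState_dephase V hs] at e0
  have t0 := traceClass_rhoQCTr E (S := S)
  have t1 := traceClass_sift (P := P) t0
  have t2 := TraceClass.dephase.{u, 0} (traceClass_ecVirState V t1) ecLab
  have t3 : TraceClass.{u} (verifyState P (dephase ecLab (ecVirState V (sift P (rhoQCTr E S))))) :=
    TraceClass.actOn.{u, 0} t2 (bdd_of_finite (verifyKraus P)) Function.injective_id
    (Function.LeftInverse.injective
      (g := fun q => ((q.1.1, q.1.2.1, q.2.2.1, q.1.2.2.1),
        (q.2.1, q.1.2.2.2.1, q.1.2.2.2.2, q.2.2.2))) fun _ => rfl)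
  have t4 := TraceClass.act.{u, 0} t3 (bdd_of_finite (paKraus P))
  have h4 : TrRel (fun X (k : Key (numPulses L M)) => ((X.1.1, k, X.1.2), X.2))
      (act (paKraus P) (verifyState P (dephase ecLab (ecVirState V (sift P (rhoQCTr E S))))))
      (dephase (fun X => X.1.1) (act (paVirKraus V) (verifyVirState V
        (ecVirState V (sift P (rhoQCTr E S)))))) := by
    rintro ⟨⟨k, x⟩, s⟩ ⟨⟨l, y⟩, t⟩
    rw [tsum_fintype]
    by_cases hxy : (k, x) = (l, y)
    · simp only [Prod.mk.injEq] at hxy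
      obtain ⟨rfl, rfl⟩ := hxy
      simp only [dephase, if_true]
      exact paVirState_diag V hec (k, x) s t
    · have h5 : ∑ b, act (paKraus P) (verifyState P (dephase ecLab (ecVirState V
          (sift P (rhoQCTr E S))))) ((k, b, x), s) ((l, b, y), t) = 0 := by
        refine Finset.sum_eq_zero fun b _ => ?_
        by_contra hn
        have h6 := (paState_support hec hn).1
        simp only [Prod.mk.injEq] at h6
        exact hxy (by rw [h6.1, h6.2.2])
      rw [h5]
      by_contra hn
      obtain ⟨h6, h7⟩ := dephase_ne_zero hn
      have h8 := (paVirState_support V hec h7).1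
      simp only at h6 h8
      exact hxy (by rw [h6, h8])
  have h5 := trRel_finalState E.final t4 h4 (x.1, x.2, ()) (y.1, y.2, ())
  rw [finalVirState_dephase, ← e0, tsum_fintype] at h5
  rw [← h5]
  simp only [dephase, rhoPAVir_eq]
  exact ite_eq_ite_of_iff Iff.rfl _ _

end FinalState

/-! ### Conditional states and the final `Z` measurement -/

section Conditional

variable {N : ℕ} {ε : Type u}

lemma measureZ_apply (ρ : Op (Key N × ε)) (x y : Key N × ε) :
    measureZ ρ x y = if x.1 = y.1 then ρ x y else 0 := by
  unfold measureZ
  rw [act_eq_sum, Finset.sum_eq_single x.1, Finset.sum_eq_single y.1, tsum_eq_single x.1]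
  · by_cases h : x.1 = y.1
    · have h1 : (y.1, x.2) = x := Prod.ext h.symm rfl
      simp [ketBra, h, h1]
    · simp [ketBra, h, Ne.symm h]
  · intro k hk; simp [ketBra, Ne.symm hk]
  · intro b _ hb
    rw [mul_eq_zero]
    left
    refine (tsum_congr fun k => ?_).trans tsum_zero
    by_cases h : y.1 = k
    · subst h; simp [ketBra, hb]
    · simp [ketBra, h]
  · simp
  · intro a _ ha
    refine Finset.sum_eq_zero fun b _ => ?_
    rw [mul_eq_zero]
    left
    refine (tsum_congr fun k => ?_).trans tsum_zero
    by_cases h : x.1 = k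
    · subst h; simp [ketBra, ha]
    · simp [ketBra, h]
  · simp

lemma plusKet_apply (n : Fin (N + 1)) (k : Key N) :
    plusKet n k = if k.1 = n then 1 / (Real.sqrt (2 ^ n.val) : ℂ) else 0 := by
  unfold plusKet
  obtain ⟨m, k⟩ := k
  by_cases h : m = n
  · subst h
    rw [Finset.sum_eq_single k]
    · simp
    · intro b _ hb
      rw [if_neg]
      intro he
      exact hb (eq_of_heq (Sigma.mk.inj he).2).symm
    · simp
  · rw [Finset.sum_eq_zero, mul_zero, if_neg h]
    intro a _
    rw [if_neg]
    intro he
    exact h (congrArg Sigma.fst he)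

lemma sum_ketBra_mul_ketBra (n : Fin (N + 1)) (k l b : Key N) :
    ∑ a : Fin n.val → Bit, ketBra (⟨n, a⟩ : Key N) (⟨n, a⟩ : Key N) k l *
      ketBra (⟨n, a⟩ : Key N) (⟨n, a⟩ : Key N) b b = if k = l ∧ b = k ∧ k.1 = n then 1 else 0 := by
  obtain ⟨m, k⟩ := k
  by_cases h : m = n
  · subst h
    rw [Finset.sum_eq_single k]
    · unfold ketBra
      rw [ite_mul_ite_one]
      refine ite_eq_ite_of_iff ?_ _ _
      simp only [true_and, and_self, and_true]
      rw [eq_comm]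
    · intro a _ ha
      unfold ketBra
      rw [if_neg, zero_mul]
      rintro ⟨he, -⟩
      exact ha (eq_of_heq (Sigma.mk.inj he).2).symm
    · simp
  · rw [if_neg fun hn => h hn.2.2]
    refine Finset.sum_eq_zero fun a _ => ?_
    unfold ketBra
    rw [if_neg, zero_mul]
    rintro ⟨he, -⟩
    exact h (congrArg Sigma.fst he)

/-- The ideal states agree: measuring a uniform superposition of the keys of length `n` gives a
uniform key. -/
theorem measureZ_idealVir (ρ : Op (Key N × Key N × ε)) (n : Fin (N + 1)) (p : ℂ) :
    measureZ (idealVir (condAE ρ n p) n) = condAE (idealize ρ) n p := by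
  funext x y
  rw [measureZ_apply]
  simp only [idealVir, condAE, idealize, plusKet_apply, sum_ketBra_mul_ketBra]
  by_cases hx : x.1.1 = n
  swap
  · simp [hx]
  by_cases hxy : x.1 = y.1
  swap
  · simp [hxy]
  have hy : y.1.1 = n := hxy ▸ hx
  simp only [if_pos hxy, if_pos hx, if_pos hy]
  have h1 : ∀ b : Key N, (∑ n' : Fin (N + 1),
      (∑ a : Key N, ∑ b : Key N, if a.1 = n' then ρ (a, b, x.2) (a, b, y.2) else 0) *
      ((1 / 2 ^ n'.val : ℂ) * if x.1 = y.1 ∧ b = x.1 ∧ x.1.1 = n' then 1 else 0)) =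
      if b = x.1 then (∑ a : Key N, ∑ b : Key N, if a.1 = n then ρ (a, b, x.2) (a, b, y.2) else 0) *
        (1 / 2 ^ n.val : ℂ) else 0 := fun b => by
    rw [Finset.sum_eq_single n]
    · by_cases hb : b = x.1
      · rw [if_pos hb, if_pos ⟨hxy, hb, hx⟩, mul_one]
      · rw [if_neg hb, if_neg fun h => hb h.2.1, mul_zero, mul_zero]
    · intro m _ hm
      rw [if_neg fun h => hm (h.2.2.symm.trans hx), mul_zero, mul_zero]
    · simp
  have h2 : (∑ b : Key N, if b = x.1 then (∑ a : Key N, ∑ b : Key N,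
      if a.1 = n then ρ (a, b, x.2) (a, b, y.2) else 0) * (1 / 2 ^ n.val : ℂ) else 0) =
      (∑ a : Key N, ∑ b : Key N, if a.1 = n then ρ (a, b, x.2) (a, b, y.2) else 0) *
        (1 / 2 ^ n.val : ℂ) := by
    rw [Finset.sum_eq_single x.1 (fun b _ hb => if_neg hb) (by simp), if_pos rfl]
  refine Eq.trans ?_ (congrArg (· / p) ((Finset.sum_congr rfl fun b _ => h1 b).trans h2).symm)
  have h3 : (1 / (Real.sqrt (2 ^ n.val) : ℂ)) * conj (1 / (Real.sqrt (2 ^ n.val) : ℂ)) =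
      1 / 2 ^ n.val := by
    rw [map_div₀, map_one, Complex.conj_ofReal, div_mul_div_comm, one_mul, sqrt_two_pow_mul_self]
  rw [h3, ← Finset.sum_div, mul_comm (1 / 2 ^ n.val : ℂ), div_mul_eq_mul_div]
  refine congrArg (· / p) (congrArg (· * _) (Finset.sum_congr rfl fun a _ => ?_))
  split_ifs <;> simp

variable {L M : ℕ} {P : Params L M} {𝒦 : Type u} (V : VirParams P) (E : Eve P 𝒦 ε)
  {S : Channel.{u} (BSig 𝒦) (Option Bit)}

/-- Alice's final `Z` measurement turns the virtual into the actual conditional state. -/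
theorem measureZ_condA (hS : IsSquashing P S) (n : Fin (numPulses L M + 1)) (p : ℂ) :
    measureZ (condA (rhoPAVir V E S) n p) = condAE (rhoPA E) n p := by
  funext x y
  rw [measureZ_apply]
  simp only [condA, condAE, sum_rhoPA V E hS]
  by_cases hxy : x.1 = y.1
  · by_cases hx : x.1.1 = n
    · rw [if_pos hxy, if_pos hxy, if_pos hx, if_pos ⟨hx, hxy ▸ hx⟩]
    · rw [if_pos hxy, if_neg hx, if_neg fun h => hx h.1]
  · simp [hxy]

end Conditional

/-! ### Second quantization of two-mode transformations -/

section Antidiagonal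

variable {σ A : Type*} [CommSemiring A]

lemma finsupp_prod_eq {m : σ →₀ ℕ} {s : Finset σ} (h : m.support ⊆ s) {f : σ → ℕ → A}
    (hf : ∀ k, f k 0 = 1) : m.prod f = ∏ k ∈ s, f k (m k) :=
  Finsupp.prod_of_support_subset m h f fun k _ => hf k

/-- A product over modes of sums over the splittings of the photons of each mode is a sum over the
splittings of the occupation numbers. -/
lemma prod_sum_antidiagonal (m : σ →₀ ℕ) (F : σ → ℕ → ℕ → A) :
    ∏ k ∈ m.support, ∑ p ∈ Finset.HasAntidiagonal.antidiagonal (m k), F k p.1 p.2 =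
      ∑ p ∈ Finset.HasAntidiagonal.antidiagonal m, ∏ k ∈ m.support, F k (p.1 k) (p.2 k) := by
  rw [Finset.prod_sum]
  refine Finset.sum_bij' (i := fun f _ =>
      (Finsupp.onFinset m.support (fun k => if h : k ∈ m.support then (f k h).1 else 0)
        (fun k hk => by
          by_contra h
          simp [h] at hk),
       Finsupp.onFinset m.support (fun k => if h : k ∈ m.support then (f k h).2 else 0)
        (fun k hk => by
          by_contra h
          simp [h] at hk)))
    (j := fun p _ k _ => (p.1 k, p.2 k)) ?_ ?_ ?_ ?_ ?_
  · intro f hf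
    rw [Finset.HasAntidiagonal.mem_antidiagonal]
    ext k
    rw [Finsupp.add_apply, Finsupp.onFinset_apply, Finsupp.onFinset_apply]
    by_cases h : k ∈ m.support
    · rw [dif_pos h, dif_pos h]
      exact Finset.HasAntidiagonal.mem_antidiagonal.mp (Finset.mem_pi.mp hf k h)
    · rw [dif_neg h, dif_neg h, Finsupp.notMem_support_iff.mp h, add_zero]
  · intro p hp
    rw [Finset.mem_pi]
    intro k _
    rw [Finset.HasAntidiagonal.mem_antidiagonal] at hp ⊢
    rw [← hp]; rfl
  · intro f _
    funext k hk
    simp only [Finsupp.onFinset_apply, dif_pos hk]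
  · intro p hp
    rw [Finset.HasAntidiagonal.mem_antidiagonal] at hp
    have h0 : ∀ k, k ∉ m.support → p.1 k = 0 ∧ p.2 k = 0 := fun k hk => by
      have h1 := Finsupp.notMem_support_iff.mp hk
      rw [← hp, Finsupp.add_apply] at h1
      omega
    refine Prod.ext (Finsupp.ext fun k => ?_) (Finsupp.ext fun k => ?_)
    · simp only [Finsupp.onFinset_apply]
      split_ifs with h
      · rfl
      · exact (h0 k h).1.symm
    · simp only [Finsupp.onFinset_apply]
      split_ifs with h
      · rfl
      · exact (h0 k h).2.symm
  · intro f _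
    rw [← Finset.prod_attach m.support]
    refine Finset.prod_congr rfl fun k _ => ?_
    simp only [Finsupp.onFinset_apply, dif_pos k.2]

/-- `m! = ∏ₖ mₖ!` -/
def modeFact (m : σ →₀ ℕ) : ℕ := m.prod fun _ n => n.factorial

lemma modeFact_pos (m : σ →₀ ℕ) : 0 < modeFact m :=
  Finset.prod_pos fun _ _ => Nat.factorial_pos _

lemma modeFact_eq {m : σ →₀ ℕ} {s : Finset σ} (h : m.support ⊆ s) :
    modeFact m = ∏ k ∈ s, (m k).factorial :=
  finsupp_prod_eq h fun _ => rfl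

end Antidiagonal

section SecondQuant

variable {𝒦 : Type u}

/-- The occupation numbers of both systems as one function of the mode. -/
abbrev occ (x : BSig 𝒦) : (𝒦 ⊕ 𝒦) →₀ ℕ := Finsupp.sumElim x.1 x.2

lemma occ_injective : Function.Injective (occ (𝒦 := 𝒦)) := fun x y h => by
  refine Prod.ext (Finsupp.ext fun k => ?_) (Finsupp.ext fun k => ?_)
  · exact DFunLike.congr_fun h (Sum.inl k)
  · exact DFunLike.congr_fun h (Sum.inr k)

lemma occ_surjective : Function.Surjective (occ (𝒦 := 𝒦)) := fun z =>
  ⟨(Finsupp.comapDomain Sum.inl z Sum.inl_injective.injOn,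
    Finsupp.comapDomain Sum.inr z Sum.inr_injective.injOn),
    Finsupp.comapDomain_sumElim_comapDomain z⟩

lemma occ_add (x y : BSig 𝒦) : occ (x + y) = occ x + occ y :=
  Finsupp.sumElim_add _ _ _ _

/-- `x₁! x₂!` -/
def sigFact (x : BSig 𝒦) : ℕ := modeFact x.1 * modeFact x.2

lemma sigFact_pos (x : BSig 𝒦) : 0 < sigFact x := Nat.mul_pos (modeFact_pos _) (modeFact_pos _)

lemma sigFact_eq (x : BSig 𝒦) : sigFact x = modeFact (occ x) :=
  (Finsupp.prod_sumElim x.1 x.2 fun _ n => n.factorial).symm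

/-- `√(x₁! x₂!)` -/
def sqrtFact (x : BSig 𝒦) : ℂ := (Real.sqrt (sigFact x) : ℂ)

lemma sqrtFact_ne_zero (x : BSig 𝒦) : sqrtFact x ≠ 0 := by
  have := sigFact_pos x
  unfold sqrtFact
  rw [Complex.ofReal_ne_zero]
  positivity

lemma sqrtFact_mul_self (x : BSig 𝒦) : sqrtFact x * sqrtFact x = sigFact x := by
  unfold sqrtFact
  rw [← Complex.ofReal_mul, Real.mul_self_sqrt (by positivity)]
  norm_cast

/-- The substitution of the creation operators by a linear transformation of the two systems that
acts in the same way on all optical modes. -/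
def modeSubst (g : Matrix (Fin 2) (Fin 2) ℂ) :
    MvPolynomial (𝒦 ⊕ 𝒦) ℂ →ₐ[ℂ] MvPolynomial (𝒦 ⊕ 𝒦) ℂ :=
  MvPolynomial.aeval (Sum.elim
    (fun k => g 0 0 • MvPolynomial.X (Sum.inl k) + g 1 0 • MvPolynomial.X (Sum.inr k))
    (fun k => g 0 1 • MvPolynomial.X (Sum.inl k) + g 1 1 • MvPolynomial.X (Sum.inr k)))

lemma modeSubst_mul (g h : Matrix (Fin 2) (Fin 2) ℂ) (p : MvPolynomial (𝒦 ⊕ 𝒦) ℂ) :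
    modeSubst (g * h) p = modeSubst g (modeSubst h p) := by
  have : modeSubst (𝒦 := 𝒦) (g * h) = (modeSubst g).comp (modeSubst h) := by
    refine MvPolynomial.algHom_ext fun k => ?_
    rcases k with k | k <;>
    · simp only [modeSubst, MvPolynomial.aeval_X, Sum.elim_inl, Sum.elim_inr, AlgHom.comp_apply,
        map_add, map_smul, Matrix.mul_apply, Fin.sum_univ_two, smul_add, smul_smul, add_smul]
      simp only [mul_comm]
      abel
  rw [this]; rfl

/-- The second quantization of a linear transformation of the two systems (the same for all
optical modes), in the basis of occupation numbers.  The vector `|y⟩` is the monomial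
`X ^ y / √(y!)` in the creation operators. -/
def secondQuant (g : Matrix (Fin 2) (Fin 2) ℂ) : Op (BSig 𝒦) := fun x y =>
  sqrtFact x / sqrtFact y *
    MvPolynomial.coeff (occ x) (modeSubst g (MvPolynomial.monomial (occ y) 1))

/-- Second quantization is a functor, since substitutions compose. -/
lemma mulOp_secondQuant (g h : Matrix (Fin 2) (Fin 2) ℂ) :
    mulOp (secondQuant g) (secondQuant h) = secondQuant (𝒦 := 𝒦) (g * h) := by
  funext x y
  have h1 := sqrtFact_ne_zero (𝒦 := 𝒦)
  have e1 : ∀ c, secondQuant g x c * secondQuant h c y = sqrtFact x / sqrtFact y *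
      (MvPolynomial.coeff (occ c) (modeSubst h (MvPolynomial.monomial (occ y) 1)) *
        MvPolynomial.coeff (occ x) (modeSubst g (MvPolynomial.monomial (occ c) 1))) := fun c => by
    unfold secondQuant
    have := h1 c
    field_simp
  unfold mulOp
  simp only [e1]
  rw [tsum_mul_left]
  unfold secondQuant
  congr 1
  rw [modeSubst_mul]
  set p := modeSubst h (MvPolynomial.monomial (occ y) 1) with hp
  have e2 := (Equiv.ofBijective occ ⟨occ_injective, occ_surjective⟩).tsum_eq (fun c =>
    MvPolynomial.coeff c p * MvPolynomial.coeff (occ x) (modeSubst g (MvPolynomial.monomial c 1)))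
  refine e2.trans ?_
  rw [tsum_eq_sum (s := p.support) fun c hc => by
    rw [MvPolynomial.notMem_support_iff.mp hc, zero_mul]]
  conv_rhs => rw [p.as_sum, map_sum, MvPolynomial.coeff_sum]
  refine Finset.sum_congr rfl fun c _ => ?_
  have : MvPolynomial.monomial c (MvPolynomial.coeff c p) =
      MvPolynomial.coeff c p • MvPolynomial.monomial c (1 : ℂ) := by
    rw [MvPolynomial.smul_monomial, smul_eq_mul, mul_one]
  rw [this, map_smul, MvPolynomial.coeff_smul, smul_eq_mul]

lemma eval_modeSubst (g : Matrix (Fin 2) (Fin 2) ℂ) (y : BSig 𝒦) (a b : 𝒦 → ℂ) :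
    MvPolynomial.eval (Sum.elim a b) (modeSubst g (MvPolynomial.monomial (occ y) 1)) =
      (y.1.prod fun k n => (g 0 0 * a k + g 1 0 * b k) ^ n) *
        y.2.prod fun k n => (g 0 1 * a k + g 1 1 * b k) ^ n := by
  rw [MvPolynomial.monomial_eq, map_one, one_mul, Finsupp.prod_sumElim]
  simp only [map_mul, Finsupp.prod, map_prod, map_pow, Function.comp_apply, modeSubst,
    MvPolynomial.aeval_X, Sum.elim_inl, Sum.elim_inr, map_add, MvPolynomial.smul_eval,
    MvPolynomial.eval_X]

/-- A polynomial is determined by its values. -/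
lemma coeff_eq_of_eval {p : MvPolynomial (𝒦 ⊕ 𝒦) ℂ} {S : Finset (BSig 𝒦)} {f : BSig 𝒦 → ℂ}
    (h : ∀ a b : 𝒦 → ℂ, MvPolynomial.eval (Sum.elim a b) p =
      ∑ x ∈ S, f x * ((x.1.prod fun k n => a k ^ n) * x.2.prod fun k n => b k ^ n))
    (x : BSig 𝒦) : MvPolynomial.coeff (occ x) p = if x ∈ S then f x else 0 := by
  have h1 : p = ∑ x ∈ S, MvPolynomial.monomial (occ x) (f x) := by
    refine MvPolynomial.funext fun t => ?_
    have h2 := h (fun k => t (Sum.inl k)) (fun k => t (Sum.inr k))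
    have h3 : Sum.elim (fun k => t (Sum.inl k)) (fun k => t (Sum.inr k)) = t := by
      funext k; rcases k with k | k <;> rfl
    rw [h3] at h2
    rw [h2, map_sum]
    refine Finset.sum_congr rfl fun x _ => ?_
    rw [MvPolynomial.eval_monomial, Finsupp.prod_sumElim]
    rfl
  rw [h1, MvPolynomial.coeff_sum]
  simp only [MvPolynomial.coeff_monomial, occ_injective.eq_iff]
  simp

/-- The matrix elements of a second quantization from the expansion in each optical mode. -/
lemma secondQuant_apply {g : Matrix (Fin 2) (Fin 2) ℂ} {y : BSig 𝒦} (F : 𝒦 → ℕ → ℕ → ℂ)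
    (hF : ∀ k (a b : ℂ), (g 0 0 * a + g 1 0 * b) ^ y.1 k * (g 0 1 * a + g 1 1 * b) ^ y.2 k =
      ∑ p ∈ Finset.HasAntidiagonal.antidiagonal ((y.1 + y.2) k),
        F k p.1 p.2 * (a ^ p.1 * b ^ p.2)) (x : BSig 𝒦) :
    secondQuant g x y = if x.1 + x.2 = y.1 + y.2 then
      sqrtFact x / sqrtFact y * ∏ k ∈ (y.1 + y.2).support, F k (x.1 k) (x.2 k) else 0 := by
  unfold secondQuant
  have hsub : ∀ x : BSig 𝒦, x.1.support ⊆ (x.1 + x.2).support ∧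
      x.2.support ⊆ (x.1 + x.2).support := fun x => by
    constructor <;> intro k hk <;> simp at hk ⊢ <;> omega
  rw [coeff_eq_of_eval (S := Finset.HasAntidiagonal.antidiagonal (y.1 + y.2))
    (f := fun x => ∏ k ∈ (y.1 + y.2).support, F k (x.1 k) (x.2 k)),
    mul_ite, mul_zero]
  · exact ite_eq_ite_of_iff Finset.HasAntidiagonal.mem_antidiagonal _ _
  intro a b
  rw [eval_modeSubst, finsupp_prod_eq (hsub y).1 fun _ => pow_zero _,
    finsupp_prod_eq (hsub y).2 fun _ => pow_zero _, ← Finset.prod_mul_distrib]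
  simp only [hF]
  refine (prod_sum_antidiagonal _ fun k i j => F k i j * (a k ^ i * b k ^ j)).trans ?_
  refine Finset.sum_congr rfl fun p hp => ?_
  rw [Finset.HasAntidiagonal.mem_antidiagonal] at hp
  rw [finsupp_prod_eq (hp ▸ (hsub p).1) fun _ => pow_zero _,
    finsupp_prod_eq (hp ▸ (hsub p).2) fun _ => pow_zero _, ← Finset.prod_mul_distrib,
    ← Finset.prod_mul_distrib]

end SecondQuant

/-! ### Beam splitters -/

section BeamSplitter

lemma div_sqrt_factorial (j r : ℕ) :
    ((j + 1 : ℕ) : ℝ) / Real.sqrt (((j + 1).factorial * r.factorial : ℕ)) =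
      Real.sqrt (((j + 1 : ℕ) : ℝ) * ((r + 1 : ℕ) : ℝ)) /
        Real.sqrt ((j.factorial * (r + 1).factorial : ℕ)) := by
  have h1 := Nat.factorial_pos j
  have h2 := Nat.factorial_pos r
  have h3 := Nat.factorial_pos (j + 1)
  have h4 := Nat.factorial_pos (r + 1)
  rw [div_eq_div_iff (by positivity) (by positivity), ← Real.sqrt_mul (by positivity)]
  have h5 : ((j + 1 : ℕ) : ℝ) = Real.sqrt (((j + 1 : ℕ) : ℝ) ^ 2) :=
    (Real.sqrt_sq (by positivity)).symm
  conv_lhs => rw [h5]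
  rw [← Real.sqrt_mul (by positivity)]
  congr 1
  rw [Nat.factorial_succ, Nat.factorial_succ]
  push_cast
  ring

/-- The amplitude of `|j⟩|n - j⟩` in the state generated from the vacuum by two transformed
creation operators. -/
def twoModeAmp (n : ℕ) (a b : ℂ) (j : ℕ) : ℂ :=
  a ^ j * b ^ (n - j) / (Real.sqrt ((j.factorial * (n - j).factorial : ℕ)) : ℂ)

/-- The generator of the beam splitter acts on the amplitudes as a derivation. -/
lemma hasDerivAt_twoModeAmp {a b : ℝ → ℂ} {t : ℝ}
    (ha : HasDerivAt a (Complex.I * b t) t) (hb : HasDerivAt b (Complex.I * a t) t) (n : ℕ)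
    (j : Fin (n + 1)) : HasDerivAt (fun t => twoModeAmp n (a t) (b t) j)
      (∑ k : Fin (n + 1), twoModeAmp n (a t) (b t) k * (Complex.I * hop n k j)) t := by
  obtain ⟨j, hj⟩ := j
  have hd := ((ha.pow j).mul (hb.pow (n - j))).div_const
    (Real.sqrt ((j.factorial * (n - j).factorial : ℕ)) : ℂ)
  refine hd.congr_deriv ?_
  symm
  -- the two neighbours of `j`
  have e1 : ∀ k : Fin (n + 1), twoModeAmp n (a t) (b t) k * (Complex.I * hop n k ⟨j, hj⟩) =
      (if k.val = j + 1 then twoModeAmp n (a t) (b t) (j + 1) *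
        (Complex.I * (Real.sqrt ((j + 1 : ℝ) * (n - j : ℝ)) : ℂ)) else 0) +
      (if j = k.val + 1 then twoModeAmp n (a t) (b t) (j - 1) *
        (Complex.I * (Real.sqrt ((j : ℝ) * (n - j + 1 : ℝ)) : ℂ)) else 0) := by
    intro k
    unfold hop
    by_cases h1 : k.val = j + 1
    · have h2 : ¬ j = k.val + 1 := by omega
      rw [if_pos h1, if_pos h1, if_neg h2, add_zero, h1]
    · by_cases h2 : j = k.val + 1
      · have h3 : j - 1 = k.val := by omega
        rw [if_neg h1, if_neg h1, if_pos h2, if_pos h2, h3, zero_add]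
      · simp [h1, h2]
  rw [Finset.sum_congr rfl fun k _ => e1 k, Finset.sum_add_distrib]
  have e2 : (∑ k : Fin (n + 1), if k.val = j + 1 then twoModeAmp n (a t) (b t) (j + 1) *
        (Complex.I * (Real.sqrt ((j + 1 : ℝ) * (n - j : ℝ)) : ℂ)) else 0) =
      a t ^ j * ((n - j : ℕ) * b t ^ (n - j - 1) * (Complex.I * a t)) /
        (Real.sqrt ((j.factorial * (n - j).factorial : ℕ)) : ℂ) := by
    rcases Nat.lt_or_ge j n with h | h
    · obtain ⟨r, rfl⟩ : ∃ r, n = j + 1 + r := ⟨n - (j + 1), by omega⟩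
      rw [Finset.sum_eq_single (⟨j + 1, by omega⟩ : Fin (j + 1 + r + 1))]
      · have h1 : j + 1 + r - (j + 1) = r := by omega
        have h2 : j + 1 + r - j = r + 1 := by omega
        have h3 : ((j + 1 + r : ℕ) - j : ℝ) = ((r + 1 : ℕ) : ℝ) := by push_cast; ring
        have h4 := congrArg (fun x : ℝ => (x : ℂ)) (div_sqrt_factorial r j)
        rw [if_pos rfl, twoModeAmp, h1, h2, h3, Nat.add_sub_cancel, mul_comm j.factorial,
          mul_comm (j + 1).factorial, mul_comm (j + 1 : ℝ)]
        push_cast at h4 ⊢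
        rw [pow_succ]
        linear_combination (-(a t) ^ j * a t * b t ^ r * Complex.I) * h4
      · intro k _ hk
        rw [if_neg]
        intro h1
        exact hk (Fin.ext h1)
      · simp
    · have h1 : j = n := by omega
      subst h1
      rw [Finset.sum_eq_zero]
      · simp
      · intro k _
        rw [if_neg]
        have := k.isLt
        omega
  have e3 : (∑ k : Fin (n + 1), if j = k.val + 1 then twoModeAmp n (a t) (b t) (j - 1) *
        (Complex.I * (Real.sqrt ((j : ℝ) * (n - j + 1 : ℝ)) : ℂ)) else 0) =
      (j * a t ^ (j - 1) * (Complex.I * b t)) * b t ^ (n - j) /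
        (Real.sqrt ((j.factorial * (n - j).factorial : ℕ)) : ℂ) := by
    rcases j with _ | j
    · rw [Finset.sum_eq_zero]
      · simp
      · intro k _
        rw [if_neg]
        omega
    · obtain ⟨r, rfl⟩ : ∃ r, n = j + 1 + r := ⟨n - (j + 1), by omega⟩
      rw [Finset.sum_eq_single (⟨j, by omega⟩ : Fin (j + 1 + r + 1))]
      · have h1 : j + 1 + r - (j + 1) = r := by omega
        have h2 : j + 1 + r - j = r + 1 := by omega
        have h3 : ((j + 1 + r : ℕ) - (j + 1 : ℕ) + 1 : ℝ) = ((r + 1 : ℕ) : ℝ) := by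
          push_cast; ring
        have h4 := congrArg (fun x : ℝ => (x : ℂ)) (div_sqrt_factorial j r)
        rw [if_pos rfl, twoModeAmp, Nat.add_sub_cancel, h1, h2, h3]
        push_cast at h4 ⊢
        rw [pow_succ]
        linear_combination (-(a t) ^ j * b t * b t ^ r * Complex.I) * h4
      · intro k _ hk
        rw [if_neg]
        intro h1
        exact hk (Fin.ext (by simp only; omega))
      · simp
  rw [e2, e3]
  simp only [Pi.pow_apply]
  ring

section ODE

attribute [local instance] Matrix.linftyOpNormedRing Matrix.linftyOpNormedAlgebra

lemma hasDerivAt_beamSplitter1 (θ t : ℝ) (n : ℕ) (i j : Fin (n + 1)) :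
    HasDerivAt (fun t : ℝ => beamSplitter1 (θ - t) n i j)
      (-∑ k, (Complex.I * hop n i k) * beamSplitter1 (θ - t) n k j) t := by
  have h1 : ∀ s : ℝ, beamSplitter1 s n = NormedSpace.exp (s • (Complex.I • hop n)) := fun s => by
    unfold beamSplitter1
    congr 1
    ext a b
    simp only [Matrix.smul_apply, smul_eq_mul, Complex.real_smul]
    ring
  have h2 := hasDerivAt_exp_smul_const' (𝕂 := ℝ) (Complex.I • hop n) (θ - t)
  have h3 : HasDerivAt (fun t : ℝ => θ - t) (-1) t := by
    simpa using (hasDerivAt_id t).const_sub θ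
  have h4 := h2.scomp t h3
  have h5 := hasDerivAt_pi.mp (hasDerivAt_pi.mp h4 i) j
  have h6 : (fun s : ℝ => beamSplitter1 (θ - s) n i j) = fun s : ℝ =>
      NormedSpace.exp ((θ - s) • (Complex.I • hop n)) i j := by
    funext s; rw [h1]
  rw [h6]
  refine h5.congr_deriv ?_
  simp [h1, Matrix.mul_apply, mul_assoc, Finset.mul_sum]
  rfl

end ODE

/-- The beam splitter transforms the two creation operators linearly. -/
lemma beamSplitter1_expand (θ : ℝ) (n : ℕ) (j : Fin (n + 1)) (a b : ℂ) :
    twoModeAmp n (Real.cos θ * a + Complex.I * Real.sin θ * b)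
      (Complex.I * Real.sin θ * a + Real.cos θ * b) j =
      ∑ i : Fin (n + 1), twoModeAmp n a b i * beamSplitter1 θ n i j := by
  set U : ℝ → ℂ := fun t => Real.cos t * a + Complex.I * Real.sin t * b with hU
  set W : ℝ → ℂ := fun t => Complex.I * Real.sin t * a + Real.cos t * b with hW
  have hI := Complex.I_mul_I
  have dU : ∀ t, HasDerivAt U (Complex.I * W t) t := fun t => by
    have h1 := (((Real.hasDerivAt_cos t).ofReal_comp).mul_const a).add
      ((((Real.hasDerivAt_sin t).ofReal_comp).const_mul Complex.I).mul_const b)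
    refine h1.congr_deriv ?_
    simp only [hW]
    push_cast
    linear_combination (-(Complex.sin t * a)) * hI
  have dW : ∀ t, HasDerivAt W (Complex.I * U t) t := fun t => by
    have h1 := ((((Real.hasDerivAt_sin t).ofReal_comp).const_mul Complex.I).mul_const a).add
      (((Real.hasDerivAt_cos t).ofReal_comp).mul_const b)
    refine h1.congr_deriv ?_
    simp only [hU]
    push_cast
    linear_combination (-(Complex.sin t * b)) * hI
  -- interpolates between the two sides, with the derivatives of the two factors cancelling
  set H : ℝ → ℂ := fun t => ∑ i : Fin (n + 1), twoModeAmp n (U t) (W t) i *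
    beamSplitter1 (θ - t) n i j with hH
  have dH : ∀ t, HasDerivAt H 0 t := fun t => by
    have h1 := HasDerivAt.fun_sum (u := Finset.univ) fun (i : Fin (n + 1)) _ =>
      (hasDerivAt_twoModeAmp (dU t) (dW t) n i).mul (hasDerivAt_beamSplitter1 θ t n i j)
    refine h1.congr_deriv ?_
    simp only [Finset.sum_add_distrib, mul_neg, Finset.sum_neg_distrib, Finset.sum_mul,
      Finset.mul_sum]
    rw [Finset.sum_comm, ← sub_eq_add_neg, sub_eq_zero]
    exact Finset.sum_congr rfl fun i _ => Finset.sum_congr rfl fun k _ => by ring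
  have hc := is_const_of_deriv_eq_zero (fun t => (dH t).differentiableAt) (fun t => (dH t).deriv)
    θ 0
  have h1 : beamSplitter1 0 n = 1 := by
    simp [beamSplitter1]
  simp only [hH, sub_self, sub_zero, h1, Matrix.one_apply, mul_ite, mul_one, mul_zero,
    Finset.sum_ite_eq', Finset.mem_univ, if_true] at hc
  rw [hc]
  simp [hU, hW]

lemma hop_conjTranspose (n : ℕ) : (hop n).conjTranspose = hop n := by
  ext i j
  simp only [Matrix.conjTranspose_apply, hop]
  by_cases h1 : j.val = i.val + 1
  · have h2 : ¬ i.val = j.val + 1 := by omega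
    rw [if_pos h1, if_neg h2, if_pos h1]
    simp only [Complex.star_def, Complex.conj_ofReal]
    rw [h1]
    push_cast
    ring_nf
  · by_cases h2 : i.val = j.val + 1
    · rw [if_neg h1, if_pos h2, if_pos h2]
      simp only [Complex.star_def, Complex.conj_ofReal]
      rw [h2]
      push_cast
      ring_nf
    · simp [h1, h2]

lemma beamSplitter1_conj (θ : ℝ) (n : ℕ) (i j : Fin (n + 1)) :
    conj (beamSplitter1 θ n i j) = beamSplitter1 (-θ) n j i := by
  have h : (beamSplitter1 θ n).conjTranspose = beamSplitter1 (-θ) n := by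
    unfold beamSplitter1
    rw [← Matrix.exp_conjTranspose, Matrix.conjTranspose_smul, hop_conjTranspose]
    simp
  rw [← h]; rfl

variable {𝒦 : Type u}

lemma beamSplitter_conj (θ : ℝ) (x y : BSig 𝒦) :
    conj (beamSplitter θ x y) = beamSplitter (-θ) y x := by
  unfold beamSplitter
  by_cases h : x.1 + x.2 = y.1 + y.2
  · have e : ∀ m, conj (∏ k ∈ m.support, beamSplitter1 θ (m k) (Fin.ofNat _ (x.1 k))
        (Fin.ofNat _ (y.1 k))) = ∏ k ∈ Finsupp.support m, beamSplitter1 (-θ) (m k)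
        (Fin.ofNat _ (y.1 k)) (Fin.ofNat _ (x.1 k)) := fun m => by
      rw [map_prod]
      exact Finset.prod_congr rfl fun k _ => beamSplitter1_conj _ _ _ _
    have e' : ∀ m m' : Fock 𝒦, m = m' →
        ∏ k ∈ m'.support, beamSplitter1 (-θ) (m' k) (Fin.ofNat _ (y.1 k))
          (Fin.ofNat _ (x.1 k)) = ∏ k ∈ m.support, beamSplitter1 (-θ) (m k)
          (Fin.ofNat _ (y.1 k)) (Fin.ofNat _ (x.1 k)) := by
      rintro m _ rfl; rfl
    rw [if_pos h, if_pos h.symm, e]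
    exact e' _ _ h
  · rw [if_neg h, if_neg (Ne.symm h), map_zero]

lemma sqrtFact_eq_prod {x : BSig 𝒦} {m : Fock 𝒦} (h : x.1 + x.2 = m) : sqrtFact x =
    ∏ k ∈ m.support, (Real.sqrt (((x.1 k).factorial * (x.2 k).factorial : ℕ)) : ℂ) := by
  have h1 : x.1.support ⊆ m.support := by
    intro k hk; rw [← h]; simp at hk ⊢; omega
  have h2 : x.2.support ⊆ m.support := by
    intro k hk; rw [← h]; simp at hk ⊢; omega
  unfold sqrtFact sigFact
  rw [modeFact_eq h1, modeFact_eq h2, ← Finset.prod_mul_distrib, Nat.cast_prod,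
    Real.sqrt_prod _ fun _ _ => by positivity, Complex.ofReal_prod]

/-- The action of a beam splitter on the two creation operators of one mode. -/
def bsMatrix (θ : ℝ) : Matrix (Fin 2) (Fin 2) ℂ :=
  !![(Real.cos θ : ℂ), Complex.I * Real.sin θ; Complex.I * Real.sin θ, (Real.cos θ : ℂ)]

/-- Beam splitters are second quantizations. -/
lemma beamSplitter_eq (θ : ℝ) : beamSplitter (𝒦 := 𝒦) θ = secondQuant (bsMatrix θ) := by
  funext x y
  have e := secondQuant_apply (𝒦 := 𝒦) (g := bsMatrix θ) (y := y) (fun k i j =>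
    (Real.sqrt (((y.1 k).factorial * (y.2 k).factorial : ℕ)) : ℂ) /
      (Real.sqrt ((i.factorial * j.factorial : ℕ)) : ℂ) *
      beamSplitter1 θ ((y.1 + y.2) k) (Fin.ofNat _ i) (Fin.ofNat _ (y.1 k))) ?_ x
  · rw [e]
    unfold beamSplitter
    by_cases h : x.1 + x.2 = y.1 + y.2
    · rw [if_pos h, if_pos h, Finset.prod_mul_distrib, Finset.prod_div_distrib,
        ← sqrtFact_eq_prod h, ← sqrtFact_eq_prod (rfl : y.1 + y.2 = _), ← mul_assoc,
        div_mul_div_cancel₀ (sqrtFact_ne_zero y), div_self (sqrtFact_ne_zero x), one_mul]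
    · rw [if_neg h, if_neg h]
  · intro k a b
    have hle : y.1 k < (y.1 + y.2) k + 1 := by
      rw [Finsupp.add_apply]; omega
    have h1 := beamSplitter1_expand θ ((y.1 + y.2) k) ⟨y.1 k, hle⟩ a b
    have h2 : (Fin.ofNat ((y.1 + y.2) k + 1) (y.1 k)) = ⟨y.1 k, hle⟩ :=
      Fin.ext (Nat.mod_eq_of_lt hle)
    have h3 : (y.1 + y.2) k - y.1 k = y.2 k := by rw [Finsupp.add_apply]; omega
    have h4 : (Real.sqrt (((y.1 k).factorial * (y.2 k).factorial : ℕ)) : ℂ) ≠ 0 := by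
      have := Nat.factorial_pos (y.1 k)
      have := Nat.factorial_pos (y.2 k)
      rw [Complex.ofReal_ne_zero]
      positivity
    simp only [twoModeAmp, h3] at h1
    rw [div_eq_iff h4, Finset.sum_mul] at h1
    rw [h2, Finset.Nat.sum_antidiagonal_eq_sum_range_succ_mk, ← Fin.sum_univ_eq_sum_range
      (fun i => (Real.sqrt (((y.1 k).factorial * (y.2 k).factorial : ℕ)) : ℂ) /
        (Real.sqrt ((i.factorial * ((y.1 + y.2) k - i).factorial : ℕ)) : ℂ) *
        beamSplitter1 θ ((y.1 + y.2) k) (Fin.ofNat _ i) ⟨y.1 k, hle⟩ *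
        (a ^ i * b ^ ((y.1 + y.2) k - i)))]
    refine Eq.trans ?_ (h1.trans (Finset.sum_congr rfl fun i _ => ?_))
    · simp [bsMatrix]
    · have h5 : Fin.ofNat ((y.1 + y.2) k + 1) i.val = i := Fin.ext (Nat.mod_eq_of_lt i.isLt)
      rw [h5]
      ring

end BeamSplitter

/-! ### Photon loss -/

section Loss

variable {σ : Type*}

/-- `√(m!)` -/
def sqrtMode (m : σ →₀ ℕ) : ℂ := (Real.sqrt (modeFact m) : ℂ)

lemma sqrtMode_ne_zero (m : σ →₀ ℕ) : sqrtMode m ≠ 0 := by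
  have := modeFact_pos m
  unfold sqrtMode
  rw [Complex.ofReal_ne_zero]
  positivity

lemma sqrtMode_mul_self (m : σ →₀ ℕ) : sqrtMode m * sqrtMode m = modeFact m := by
  unfold sqrtMode
  rw [← Complex.ofReal_mul, Real.mul_self_sqrt (by positivity)]
  norm_cast

lemma sqrtMode_zero : sqrtMode (0 : σ →₀ ℕ) = 1 := by simp [sqrtMode, modeFact]

/-- The second quantization of the substitution `Xₛ ↦ ℓ s` of the creation operators. -/
def fockQuant (l : σ → MvPolynomial σ ℂ) : Op (σ →₀ ℕ) := fun a b =>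
  sqrtMode a / sqrtMode b *
    MvPolynomial.coeff a (MvPolynomial.aeval l (MvPolynomial.monomial b (1 : ℂ)))

lemma fockQuant_diag (c : σ → ℂ) (a b : σ →₀ ℕ) :
    fockQuant (fun s => MvPolynomial.C (c s) * MvPolynomial.X s) a b =
      if a = b then b.prod fun s n => c s ^ n else 0 := by
  have h : MvPolynomial.aeval
      (fun s => MvPolynomial.C (c s) * (MvPolynomial.X s : MvPolynomial σ ℂ))
      (MvPolynomial.monomial b (1 : ℂ)) = MvPolynomial.monomial b (b.prod fun s n => c s ^ n) := by
    rw [MvPolynomial.aeval_monomial, map_one, one_mul, MvPolynomial.monomial_eq]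
    simp only [Finsupp.prod, mul_pow, ← map_pow]
    rw [Finset.prod_mul_distrib, ← map_prod]
  unfold fockQuant
  rw [h, MvPolynomial.coeff_monomial]
  by_cases hab : a = b
  · subst hab
    rw [if_pos rfl, div_self (sqrtMode_ne_zero a), one_mul]
  · rw [if_neg hab, if_neg (Ne.symm hab), mul_zero]

lemma modeFact_add (x r : σ →₀ ℕ) : modeFact (x + r) =
    (∏ s ∈ (x + r).support, ((x + r) s).choose (x s)) * (modeFact x * modeFact r) := by
  have h1 : x.support ⊆ (x + r).support := by intro k hk; simp at hk ⊢; omega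
  have h2 : r.support ⊆ (x + r).support := by intro k hk; simp at hk ⊢; omega
  rw [modeFact_eq h1, modeFact_eq h2, modeFact_eq (subset_refl _), ← Finset.prod_mul_distrib,
    ← Finset.prod_mul_distrib]
  refine Finset.prod_congr rfl fun s _ => ?_
  have := Nat.choose_mul_factorial_mul_factorial (n := (x + r) s) (k := x s) (by simp)
  rw [← this, Finsupp.add_apply, Nat.add_sub_cancel_left, mul_assoc]

lemma prod_pow_degree {m : σ →₀ ℕ} {s : Finset σ} (h : m.support ⊆ s) (c : ℂ) :
    ∏ k ∈ s, c ^ m k = c ^ m.degree := by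
  rw [← finsupp_prod_eq h (f := fun _ n => c ^ n) fun _ => pow_zero _, Finsupp.prod,
    Finset.prod_pow_eq_pow_sum]
  rfl

/-- The amplitude for the loss of `r` out of `x + r` photons. -/
def lossAmp (κ : ℝ) (r x : σ →₀ ℕ) : ℂ :=
  sqrtMode (x + r) / (sqrtMode x * sqrtMode r) *
    ((Real.sqrt κ : ℂ) ^ x.degree * (Complex.I * Real.sqrt (1 - κ)) ^ r.degree)

/-- Kraus operator for the loss of `r` photons. -/
def lossOp (κ : ℝ) (r : σ →₀ ℕ) : Op (σ →₀ ℕ) := fun x a =>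
  if x + r = a then lossAmp κ r x else 0

/-- The pullback under Kraus operators that remove `r` particles. -/
lemma heis_shift {X : Type*} [AddCommMonoid X] [PartialOrder X] [CanonicallyOrderedAdd X] [Sub X]
    [OrderedSub X] [AddLeftReflectLE X] [DecidableEq X] [DecidableLE X] {K : X → Op X}
    {A : X → X → ℂ}
    (hK : ∀ r x a, K r x a = if x + r = a then A r x else 0) (E : Op X) (a b : X) :
    heis K E a b =
      ∑' r, if r ≤ a ∧ r ≤ b then conj (A r (a - r)) * E (a - r) (b - r) * A r (b - r)
        else 0 := by
  unfold heis
  simp only [hK]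
  refine tsum_congr fun r => ?_
  by_cases h : r ≤ a ∧ r ≤ b
  · rw [if_pos h, tsum_eq_single (a - r), tsum_eq_single (b - r)]
    · rw [if_pos (tsub_add_cancel_of_le h.1), if_pos (tsub_add_cancel_of_le h.2)]
    · intro y hy
      rw [if_neg (c := y + r = b), mul_zero]
      rintro rfl
      exact hy (add_tsub_cancel_right _ _).symm
    · intro x hx
      rw [if_neg (c := x + r = a)]
      · simp
      · rintro rfl
        exact hx (add_tsub_cancel_right _ _).symm
  · rw [if_neg h]
    refine (tsum_congr fun x => (tsum_congr fun y => ?_).trans tsum_zero).trans tsum_zero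
    by_cases h1 : x + r = a
    · rw [if_neg (c := y + r = b), mul_zero]
      rintro rfl
      exact h ⟨h1 ▸ le_add_self, le_add_self⟩
    · rw [if_neg h1, map_zero, zero_mul, zero_mul]

/-- The phases of the lost photons cancel between states with the same number of photons. -/
lemma conj_lossAmp_mul {κ : ℝ} (h0 : 0 ≤ κ) (h1 : κ ≤ 1) (r x y : σ →₀ ℕ)
    {d : ℂ} (hd : d ≠ 0 → x.degree = y.degree) :
    conj (lossAmp κ r x) * d * lossAmp κ r y =
      sqrtMode (x + r) * sqrtMode (y + r) / (sqrtMode x * sqrtMode y * modeFact r) *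
        ((κ : ℂ) ^ y.degree * ((1 - κ : ℝ) : ℂ) ^ r.degree) * d := by
  by_cases h : d = 0
  · simp [h]
  have hxy := hd h
  have e1 : ((Real.sqrt κ : ℝ) : ℂ) * (Real.sqrt κ : ℝ) = κ := by
    rw [← Complex.ofReal_mul, Real.mul_self_sqrt h0]
  have e2 : (-Complex.I * (Real.sqrt (1 - κ) : ℝ)) * (Complex.I * (Real.sqrt (1 - κ) : ℝ)) =
      ((1 - κ : ℝ) : ℂ) := by
    have : ((Real.sqrt (1 - κ) : ℝ) : ℂ) * (Real.sqrt (1 - κ) : ℝ) = ((1 - κ : ℝ) : ℂ) := by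
      rw [← Complex.ofReal_mul, Real.mul_self_sqrt (by linarith)]
    linear_combination (-(Real.sqrt (1 - κ) : ℂ) ^ 2) * Complex.I_mul_I + this
  have e3 : ∀ m : σ →₀ ℕ, conj (sqrtMode m) = sqrtMode m := fun m => Complex.conj_ofReal _
  unfold lossAmp
  rw [← e1, ← e2, ← sqrtMode_mul_self r]
  simp only [map_mul, map_div₀, map_pow, e3, Complex.conj_ofReal, Complex.conj_I, hxy]
  have n1 := sqrtMode_ne_zero r
  have n2 := sqrtMode_ne_zero x
  have n3 := sqrtMode_ne_zero y
  simp only [mul_pow]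
  field_simp

lemma sum_antidiagonal_eq_tsum (m : σ →₀ ℕ) (F : (σ →₀ ℕ) → (σ →₀ ℕ) → ℂ) :
    ∑ p ∈ Finset.HasAntidiagonal.antidiagonal m, F p.1 p.2 =
      ∑' r, if r ≤ m then F (m - r) r else 0 := by
  rw [tsum_eq_sum (s := (Finset.HasAntidiagonal.antidiagonal m).image Prod.snd), Finset.sum_image]
  · refine Finset.sum_congr rfl fun p hp => ?_
    rw [Finset.HasAntidiagonal.mem_antidiagonal] at hp
    subst hp
    rw [if_pos le_add_self, add_tsub_cancel_right]
  · rintro ⟨a, b⟩ hp ⟨a', b'⟩ hq h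
    simp only [Finset.mem_coe, Finset.HasAntidiagonal.mem_antidiagonal] at hp hq h
    subst h
    rw [← hq] at hp
    rw [add_right_cancel hp]
  · intro r hr
    rw [if_neg]
    intro h
    refine hr (Finset.mem_image.mpr ⟨(m - r, r), ?_, rfl⟩)
    rw [Finset.HasAntidiagonal.mem_antidiagonal]
    exact tsub_add_cancel_of_le h

lemma aeval_monomial_add_X (l : σ → MvPolynomial σ ℂ) (κ q : ℂ) (b : σ →₀ ℕ) :
    MvPolynomial.aeval (fun s => MvPolynomial.C κ * l s + MvPolynomial.C q * MvPolynomial.X s)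
        (MvPolynomial.monomial b (1 : ℂ)) =
      ∑ p ∈ Finset.HasAntidiagonal.antidiagonal b,
        ((modeFact b : ℂ) / (modeFact p.1 * modeFact p.2) * (κ ^ p.1.degree * q ^ p.2.degree)) •
          (MvPolynomial.aeval l (MvPolynomial.monomial p.1 (1 : ℂ)) *
            MvPolynomial.monomial p.2 (1 : ℂ)) := by
  rw [MvPolynomial.aeval_monomial, map_one, one_mul, Finsupp.prod]
  simp only [fun (x y : MvPolynomial σ ℂ) n => (Commute.all x y).add_pow' n]
  refine (prod_sum_antidiagonal b fun s i j => (b s).choose i •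
    ((MvPolynomial.C κ * l s) ^ i * (MvPolynomial.C q * MvPolynomial.X s) ^ j)).trans ?_
  refine Finset.sum_congr rfl fun p hp => ?_
  rw [Finset.HasAntidiagonal.mem_antidiagonal] at hp
  subst hp
  have h1 : p.1.support ⊆ (p.1 + p.2).support := by intro k hk; simp at hk ⊢; omega
  have h2 : p.2.support ⊆ (p.1 + p.2).support := by intro k hk; simp at hk ⊢; omega
  have e1 : ((modeFact (p.1 + p.2) : ℂ) / (modeFact p.1 * modeFact p.2)) =
      ∏ s ∈ (p.1 + p.2).support, (((p.1 + p.2) s).choose (p.1 s) : ℂ) := by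
    have n1 : (modeFact p.1 : ℂ) ≠ 0 := by exact_mod_cast (modeFact_pos p.1).ne'
    have n2 : (modeFact p.2 : ℂ) ≠ 0 := by exact_mod_cast (modeFact_pos p.2).ne'
    rw [div_eq_iff (mul_ne_zero n1 n2)]
    exact_mod_cast modeFact_add p.1 p.2
  rw [e1, MvPolynomial.aeval_monomial, map_one, one_mul, MvPolynomial.monomial_eq, map_one, one_mul,
    finsupp_prod_eq h1 fun _ => pow_zero _, finsupp_prod_eq h2 fun _ => pow_zero _,
    ← prod_pow_degree h1, ← prod_pow_degree h2, MvPolynomial.smul_eq_C_mul,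
    ← Finset.prod_mul_distrib, ← Finset.prod_mul_distrib, ← Finset.prod_mul_distrib, map_prod,
    ← Finset.prod_mul_distrib]
  refine Finset.prod_congr rfl fun s _ => ?_
  simp only [nsmul_eq_mul, map_mul, map_pow, map_natCast]
  ring

/-- Loss of photons turns a second quantized substitution into the second quantization of a convex
combination with the identity. -/
lemma heis_lossOp_fockQuant {κ : ℝ} (h0 : 0 ≤ κ) (h1 : κ ≤ 1) (l : σ → MvPolynomial σ ℂ)
    (hl : ∀ a b, fockQuant l a b ≠ 0 → a.degree = b.degree) :
    heis (lossOp κ) (fockQuant l) =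
      fockQuant fun s => MvPolynomial.C (κ : ℂ) * l s +
        MvPolynomial.C ((1 - κ : ℝ) : ℂ) * MvPolynomial.X s := by
  funext a b
  refine (heis_shift (K := lossOp κ) (A := lossAmp κ) (fun _ _ _ => rfl) _ a b).trans ?_
  conv_rhs => rw [fockQuant, aeval_monomial_add_X, MvPolynomial.coeff_sum]
  rw [Finset.mul_sum]
  rw [sum_antidiagonal_eq_tsum b fun c r => sqrtMode a / sqrtMode b * MvPolynomial.coeff a
    (((modeFact b : ℂ) / (modeFact c * modeFact r) *
      ((κ : ℂ) ^ c.degree * ((1 - κ : ℝ) : ℂ) ^ r.degree)) •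
      (MvPolynomial.aeval l (MvPolynomial.monomial c (1 : ℂ)) * MvPolynomial.monomial r (1 : ℂ)))]
  refine tsum_congr fun r => ?_
  simp only [MvPolynomial.coeff_smul, smul_eq_mul, MvPolynomial.coeff_mul_monomial', mul_one]
  by_cases hb : r ≤ b
  · by_cases ha : r ≤ a
    · rw [if_pos ⟨ha, hb⟩, if_pos hb, if_pos ha,
        conj_lossAmp_mul h0 h1 r _ _ (hl _ _), tsub_add_cancel_of_le ha, tsub_add_cancel_of_le hb,
        ← sqrtMode_mul_self b, ← sqrtMode_mul_self (b - r), fockQuant]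
      have n1 := sqrtMode_ne_zero b
      have n2 := sqrtMode_ne_zero (b - r)
      have n3 := sqrtMode_ne_zero (a - r)
      have n4 : (modeFact r : ℂ) ≠ 0 := by exact_mod_cast (modeFact_pos r).ne'
      field_simp
    · rw [if_neg fun h => ha h.1, if_pos hb, if_neg ha, mul_zero, mul_zero]
  · rw [if_neg fun h => hb h.2, if_neg hb]

lemma summable_lossOp (A : (σ →₀ ℕ) → ℂ) (a b : σ →₀ ℕ) :
    Summable fun r => if r ≤ a ∧ r ≤ b then A r else 0 := by
  refine summable_of_hasFiniteSupport ((Set.finite_Iic a).subset fun r hr => ?_)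
  by_contra h
  exact hr (if_neg fun h1 => h h1.1)

lemma heis_lossOp_sub (κ : ℝ) (E F : Op (σ →₀ ℕ)) (c : ℂ) :
    heis (lossOp κ) (E - c • F) = heis (lossOp κ) E - c • heis (lossOp κ) F := by
  funext a b
  have h := fun E => heis_shift (K := lossOp κ) (A := lossAmp κ) (fun _ _ _ => rfl) E a b
  rw [Matrix.sub_apply, Matrix.smul_apply, smul_eq_mul]
  rw [h, h, h, ← tsum_mul_left, ← (summable_lossOp _ a b).tsum_sub]
  · refine tsum_congr fun r => ?_
    split_ifs
    · simp only [Matrix.sub_apply, Matrix.smul_apply, smul_eq_mul]; ring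
    · simp
  · simp only [mul_ite, mul_zero]
    exact summable_lossOp _ a b

end Loss

/-! ### The optical elements of Bob's measurement -/

section Elements

variable {𝒦 : Type u}

/-- The linear forms substituted for the creation operators by `modeSubst g`. -/
def linForms (g : Matrix (Fin 2) (Fin 2) ℂ) : 𝒦 ⊕ 𝒦 → MvPolynomial (𝒦 ⊕ 𝒦) ℂ :=
  Sum.elim
    (fun k => g 0 0 • MvPolynomial.X (Sum.inl k) + g 1 0 • MvPolynomial.X (Sum.inr k))
    (fun k => g 0 1 • MvPolynomial.X (Sum.inl k) + g 1 1 • MvPolynomial.X (Sum.inr k))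

lemma sqrtFact_eq (x : BSig 𝒦) : sqrtFact x = sqrtMode (occ x) := by
  unfold sqrtFact sqrtMode
  rw [sigFact_eq]

lemma secondQuant_eq (g : Matrix (Fin 2) (Fin 2) ℂ) (x y : BSig 𝒦) :
    secondQuant g x y = fockQuant (linForms g) (occ x) (occ y) := by
  unfold secondQuant fockQuant
  rw [sqrtFact_eq, sqrtFact_eq]
  rfl

lemma linForms_smul_add (κ q : ℂ) (g : Matrix (Fin 2) (Fin 2) ℂ) :
    linForms (𝒦 := 𝒦) (κ • g + q • 1) =
      fun s => MvPolynomial.C κ * linForms g s + MvPolynomial.C q * MvPolynomial.X s := by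
  funext s
  rcases s with k | k <;>
  · simp only [linForms, Sum.elim_inl, Sum.elim_inr, Matrix.add_apply, Matrix.smul_apply,
      MvPolynomial.smul_eq_C_mul, smul_eq_mul, map_add, map_mul, Matrix.one_apply_eq,
      Matrix.one_apply_ne (show (0 : Fin 2) ≠ 1 by decide),
      Matrix.one_apply_ne (show (1 : Fin 2) ≠ 0 by decide), map_zero, map_one]
    ring

lemma degree_occ (x : BSig 𝒦) : (occ x).degree = x.1.degree + x.2.degree :=
  Finsupp.sum_sumElim x.1 x.2 fun _ n => n

lemma fockQuant_linForms_degree (g : Matrix (Fin 2) (Fin 2) ℂ) {a b : (𝒦 ⊕ 𝒦) →₀ ℕ}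
    (h : fockQuant (linForms g) a b ≠ 0) : a.degree = b.degree := by
  have h1 : (MvPolynomial.aeval (linForms (𝒦 := 𝒦) g)
      (MvPolynomial.monomial b (1 : ℂ))).IsHomogeneous (1 * b.degree) := by
    refine MvPolynomial.IsHomogeneous.aeval (MvPolynomial.isHomogeneous_monomial 1 rfl) _
      fun s => ?_
    rcases s with k | k <;>
    · simp only [linForms, Sum.elim_inl, Sum.elim_inr, MvPolynomial.smul_eq_C_mul]
      exact ((MvPolynomial.isHomogeneous_X ℂ _).C_mul _).add
        ((MvPolynomial.isHomogeneous_X ℂ _).C_mul _)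
  have h2 := h1 (d := a) (right_ne_zero_of_mul h)
  rw [one_mul] at h2
  rw [← h2, Finsupp.degree_eq_weight_one]
  rfl

lemma secondQuant_diag (α β : ℂ) (x y : BSig 𝒦) : secondQuant !![α, 0; 0, β] x y =
    if x = y then α ^ y.1.degree * β ^ y.2.degree else 0 := by
  have h : linForms (𝒦 := 𝒦) !![α, 0; 0, β] = fun s =>
      MvPolynomial.C (Sum.elim (fun _ => α) (fun _ => β) s) * MvPolynomial.X s := by
    funext s
    rcases s with k | k <;> simp [linForms, MvPolynomial.smul_eq_C_mul]
  rw [secondQuant_eq, h, fockQuant_diag, Finsupp.prod_sumElim]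
  rw [Finsupp.prod, Finsupp.prod]
  simp only [Function.comp_apply, Sum.elim_inl, Sum.elim_inr]
  rw [Finset.prod_pow_eq_pow_sum, Finset.prod_pow_eq_pow_sum]
  exact ite_eq_ite_of_iff occ_injective.eq_iff _ _

lemma secondQuant_smul_one (α : ℂ) (x y : BSig 𝒦) : secondQuant (α • 1) x y =
    if x = y then α ^ (occ y).degree else 0 := by
  have h : (α • 1 : Matrix (Fin 2) (Fin 2) ℂ) = !![α, 0; 0, α] := by
    ext i j; fin_cases i <;> fin_cases j <;> simp
  rw [h, secondQuant_diag, degree_occ, pow_add]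

lemma secondQuant_one : secondQuant (𝒦 := 𝒦) 1 = 1 := by
  funext x y
  have h := secondQuant_smul_one (𝒦 := 𝒦) 1 x y
  rw [one_smul] at h
  rw [h, one_pow, Matrix.one_apply]

lemma secondQuant_finite_support (g : Matrix (Fin 2) (Fin 2) ℂ) (y : BSig 𝒦) :
    (Function.support fun x => secondQuant g x y).Finite := by
  refine ((Finset.finite_toSet (MvPolynomial.support (modeSubst g
    (MvPolynomial.monomial (occ y) 1)))).preimage occ_injective.injOn).subset fun x hx => ?_
  exact MvPolynomial.mem_support_iff.mpr (right_ne_zero_of_mul hx)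

lemma summable_mul_secondQuant (f : BSig 𝒦 → ℂ) (g : Matrix (Fin 2) (Fin 2) ℂ) (y : BSig 𝒦) :
    Summable fun c => f c * secondQuant g c y :=
  summable_of_hasFiniteSupport ((secondQuant_finite_support g y).subset
    fun _ hx => right_ne_zero_of_mul hx)

lemma mulOp_add_secondQuant (α β γ δ : ℂ) (g h g' h' : Matrix (Fin 2) (Fin 2) ℂ) :
    mulOp (α • secondQuant (𝒦 := 𝒦) g + β • secondQuant h)
        (γ • secondQuant g' + δ • secondQuant h') =
      (α * γ) • secondQuant (g * g') + (α * δ) • secondQuant (g * h') +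
        (β * γ) • secondQuant (h * g') + (β * δ) • secondQuant (h * h') := by
  have e : ∀ x y, (mulOp (α • secondQuant (𝒦 := 𝒦) g + β • secondQuant h)
      (γ • secondQuant g' + δ • secondQuant h')) x y =
      ∑' c, (((α * γ) * (secondQuant g x c * secondQuant g' c y) +
        (α * δ) * (secondQuant g x c * secondQuant h' c y)) +
        (β * γ) * (secondQuant h x c * secondQuant g' c y) +
        (β * δ) * (secondQuant h x c * secondQuant h' c y)) := fun x y => by
    refine tsum_congr fun c => ?_
    simp only [Matrix.add_apply, Matrix.smul_apply, smul_eq_mul]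
    ring
  funext x y
  have s1 : ∀ (t : ℂ) (a b : Matrix (Fin 2) (Fin 2) ℂ),
      Summable fun c => t * (secondQuant (𝒦 := 𝒦) a x c * secondQuant b c y) := fun t a b =>
    (summable_mul_secondQuant _ b y).mul_left t
  rw [e, (((s1 _ _ _).add (s1 _ _ _)).add (s1 _ _ _)).tsum_add (s1 _ _ _),
    ((s1 _ _ _).add (s1 _ _ _)).tsum_add (s1 _ _ _), (s1 _ _ _).tsum_add (s1 _ _ _)]
  simp only [tsum_mul_left, ← mulOp_secondQuant]
  rfl

lemma lossKraus_eq {η : ℝ} (h0 : 0 ≤ η) (h1 : η ≤ 1) (r : Fock 𝒦) : lossKraus η r = lossOp η r := by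
  funext x y
  have hc : Real.cos (Real.arccos (Real.sqrt η)) = Real.sqrt η :=
    Real.cos_arccos (by linarith [Real.sqrt_nonneg η]) (Real.sqrt_le_one.mpr h1)
  have hs : Real.sin (Real.arccos (Real.sqrt η)) = Real.sqrt (1 - η) := by
    rw [Real.sin_arccos, Real.sq_sqrt h0]
  unfold lossKraus lossOp
  rw [beamSplitter_eq]
  have e := secondQuant_apply (𝒦 := 𝒦) (g := bsMatrix (Real.arccos (Real.sqrt η))) (y := (y, 0))
    (fun k i j => ((y k).choose i : ℂ) *
      ((Real.sqrt η : ℂ) ^ i * (Complex.I * Real.sqrt (1 - η)) ^ j)) ?_ (x, r)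
  · rw [e]
    simp only [add_zero]
    by_cases h : x + r = y
    · subst h
      have e1 : x.support ⊆ (x + r).support := by intro k hk; simp at hk ⊢; omega
      have e2 : r.support ⊆ (x + r).support := by intro k hk; simp at hk ⊢; omega
      rw [if_pos rfl, if_pos rfl, Finset.prod_mul_distrib, Finset.prod_mul_distrib,
        prod_pow_degree e1, prod_pow_degree e2]
      unfold lossAmp
      rw [← mul_assoc]
      congr 1
      have e3 : ∀ a b : Fock 𝒦, sqrtFact (a, b) = sqrtMode a * sqrtMode b := fun a b => by
        unfold sqrtFact sqrtMode sigFact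
        rw [← Complex.ofReal_mul, ← Real.sqrt_mul (by positivity), Nat.cast_mul]
      have e4 : ((modeFact (x + r) : ℕ) : ℂ) = _ := congrArg Nat.cast (modeFact_add x r)
      push_cast at e4
      rw [← sqrtMode_mul_self, ← sqrtMode_mul_self, ← sqrtMode_mul_self] at e4
      rw [e3, e3, sqrtMode_zero, mul_one]
      have n1 := sqrtMode_ne_zero x
      have n2 := sqrtMode_ne_zero r
      have n3 := sqrtMode_ne_zero (x + r)
      field_simp
      simp only [Finsupp.add_apply] at e4 ⊢
      linear_combination -e4
    · rw [if_neg h, if_neg h]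
  · intro k a b
    simp only [bsMatrix, hc, hs, Matrix.of_apply, Matrix.cons_val', Matrix.cons_val_zero,
      Matrix.cons_val_one, Matrix.cons_val_fin_one, Finsupp.coe_zero, Pi.zero_apply, pow_zero,
      mul_one, add_zero]
    rw [(Commute.all _ _).add_pow']
    refine Finset.sum_congr rfl fun p _ => ?_
    rw [nsmul_eq_mul]
    ring

/-- The Kraus operator for the loss of the photons `r` from both systems. -/
def sigLoss (κ : ℝ) (r : BSig 𝒦) : Op (BSig 𝒦) := fun x a => lossOp κ (occ r) (occ x) (occ a)

lemma lossAmp_occ (κ : ℝ) (r x : BSig 𝒦) :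
    lossAmp κ (occ r) (occ x) = lossAmp κ r.1 x.1 * lossAmp κ r.2 x.2 := by
  have e3 : ∀ a : BSig 𝒦, sqrtMode (occ a) = sqrtMode a.1 * sqrtMode a.2 := fun a => by
    rw [← sqrtFact_eq]
    unfold sqrtFact sqrtMode sigFact
    rw [← Complex.ofReal_mul, ← Real.sqrt_mul (by positivity), Nat.cast_mul]
  unfold lossAmp
  rw [← occ_add, e3, e3, e3, degree_occ, degree_occ]
  simp only [Prod.fst_add, Prod.snd_add, pow_add]
  ring

lemma tens_lossOp (κ : ℝ) (r : BSig 𝒦) : tens (lossOp κ r.1) (lossOp κ r.2) = sigLoss κ r := by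
  funext x a
  unfold tens sigLoss lossOp
  rw [← occ_add, lossAmp_occ]
  by_cases h : x + r = a
  · subst h
    rw [if_pos rfl, Prod.fst_add, Prod.snd_add, if_pos rfl, if_pos rfl]
  · rw [if_neg fun h1 => h (occ_injective h1)]
    by_cases h1 : x.1 + r.1 = a.1
    · rw [if_neg (c := x.2 + r.2 = a.2) fun h2 => h (Prod.ext h1 h2), mul_zero]
    · rw [if_neg h1, zero_mul]

/-- The bijection between pairs of occupation numbers and occupation numbers of all modes. -/
def occEquiv : BSig 𝒦 ≃ ((𝒦 ⊕ 𝒦) →₀ ℕ) := Equiv.ofBijective occ ⟨occ_injective, occ_surjective⟩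

lemma heis_sigLoss (κ : ℝ) (E : Op ((𝒦 ⊕ 𝒦) →₀ ℕ)) (a b : BSig 𝒦) :
    heis (sigLoss κ) (fun x y => E (occ x) (occ y)) a b = heis (lossOp κ) E (occ a) (occ b) := by
  unfold heis sigLoss
  refine ((tsum_congr fun r => ?_).trans (occEquiv.tsum_eq fun r => ∑' x, ∑' y,
    conj (lossOp κ r x (occ a)) * E x y * lossOp κ r y (occ b)))
  refine ((tsum_congr fun x => ?_).trans (occEquiv.tsum_eq fun x => ∑' y,
    conj (lossOp κ (occ r) x (occ a)) * E x y * lossOp κ (occ r) y (occ b)))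
  exact occEquiv.tsum_eq fun y =>
    conj (lossOp κ (occ r) (occ x) (occ a)) * E (occ x) y * lossOp κ (occ r) y (occ b)

lemma heis_sigLoss_of_eq (κ : ℝ) {F : Op (BSig 𝒦)} {E : Op ((𝒦 ⊕ 𝒦) →₀ ℕ)}
    (h : ∀ x y, F x y = E (occ x) (occ y)) (a b : BSig 𝒦) :
    heis (sigLoss κ) F a b = heis (lossOp κ) E (occ a) (occ b) := by
  have h1 : F = fun x y => E (occ x) (occ y) := by funext x y; exact h x y
  rw [h1, heis_sigLoss]

lemma exists_eq_occ (F : Op (BSig 𝒦)) :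
    ∃ E : Op ((𝒦 ⊕ 𝒦) →₀ ℕ), ∀ x y, F x y = E (occ x) (occ y) := by
  refine ⟨fun a b => F (occEquiv.symm a) (occEquiv.symm b), fun x y => ?_⟩
  have h : ∀ x : BSig 𝒦, occEquiv.symm (occ x) = x := occEquiv.symm_apply_apply
  beta_reduce
  rw [h, h]

lemma heis_sigLoss_sub (κ : ℝ) (E F : Op (BSig 𝒦)) (c : ℂ) :
    heis (sigLoss κ) (E - c • F) = heis (sigLoss κ) E - c • heis (sigLoss κ) F := by
  obtain ⟨E', hE⟩ := exists_eq_occ E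
  obtain ⟨F', hF⟩ := exists_eq_occ F
  have h : ∀ x y, (E - c • F) x y = (E' - c • F') (occ x) (occ y) := fun x y => by
    rw [Matrix.sub_apply, Matrix.smul_apply, Matrix.sub_apply, Matrix.smul_apply, hE, hF]
  funext a b
  rw [heis_sigLoss_of_eq κ h, heis_lossOp_sub, Matrix.sub_apply, Matrix.smul_apply,
    Matrix.sub_apply, Matrix.smul_apply, heis_sigLoss_of_eq κ hE, heis_sigLoss_of_eq κ hF]

/-- The pullback of a second quantization under a loss, equal for both systems: each photon is
either kept and transformed, or lost. -/
lemma heis_sigLoss_secondQuant {κ : ℝ} (h0 : 0 ≤ κ) (h1 : κ ≤ 1) (g : Matrix (Fin 2) (Fin 2) ℂ) :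
    heis (sigLoss (𝒦 := 𝒦) κ) (secondQuant g) =
      secondQuant ((κ : ℂ) • g + ((1 - κ : ℝ) : ℂ) • 1) := by
  have e : ∀ g, secondQuant (𝒦 := 𝒦) g = fun x y => fockQuant (linForms g) (occ x) (occ y) :=
    fun g => by funext x y; exact secondQuant_eq g x y
  funext a b
  rw [e, e, heis_sigLoss, heis_lossOp_fockQuant h0 h1 _ fun _ _ => fockQuant_linForms_degree g,
    linForms_smul_add]

/-- The click effect of a threshold detector is a function of the number of photons. -/
lemma detectorClick_eq {p η : ℝ} (h0 : 0 ≤ η) (h1 : η ≤ 1) (x y : Fock 𝒦) :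
    detectorClick p η x y =
      if x = y then 1 - ((1 - p : ℝ) : ℂ) * ((1 - η : ℝ) : ℂ) ^ y.degree else 0 := by
  have d1 : ∀ a b : Fock 𝒦, fockQuant (fun s => MvPolynomial.C 1 * MvPolynomial.X s) a b =
      (1 : Op (Fock 𝒦)) a b := fun a b => by
    rw [fockQuant_diag, Matrix.one_apply]; simp
  have d0 : ∀ (c : ℂ) (a b : Fock 𝒦), fockQuant (fun s => MvPolynomial.C c * MvPolynomial.X s) a b =
      if a = b then c ^ b.degree else 0 := fun c a b => by
    rw [fockQuant_diag, Finsupp.prod, Finset.prod_pow_eq_pow_sum]; rfl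
  have e : detector1Click (𝒦 := 𝒦) p = fockQuant (fun s => MvPolynomial.C 1 * MvPolynomial.X s) -
      ((1 - p : ℝ) : ℂ) • fockQuant (fun s => MvPolynomial.C 0 * MvPolynomial.X s) := by
    unfold detector1Click
    congr 1
    · funext a b; exact (d1 a b).symm
    · congr 1
      funext a b
      rw [d0, ketBra]
      by_cases hb : b = 0
      · subst hb
        simp
      · have : b.degree ≠ 0 := fun h => hb ((Finsupp.degree_eq_zero_iff b).mp h)
        rw [zero_pow this, ite_self, if_neg fun h => hb h.2]
  have hd : ∀ (c : ℂ) (a b : Fock 𝒦),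
      fockQuant (fun s => MvPolynomial.C c * MvPolynomial.X s) a b ≠ 0 → a.degree = b.degree :=
    fun c a b h => by
      rw [d0] at h
      by_contra h2
      exact h (if_neg fun h3 => h2 (by rw [h3]))
  have hk : (lossKraus η : Fock 𝒦 → Op (Fock 𝒦)) = lossOp η := funext (lossKraus_eq h0 h1)
  have hl : ∀ c : ℂ, (fun s : 𝒦 => MvPolynomial.C (η : ℂ) *
      (MvPolynomial.C c * MvPolynomial.X s : MvPolynomial 𝒦 ℂ) +
      MvPolynomial.C ((1 - η : ℝ) : ℂ) * MvPolynomial.X s) =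
      fun s => MvPolynomial.C ((η : ℂ) * c + ((1 - η : ℝ) : ℂ)) * MvPolynomial.X s := fun c => by
    funext s; rw [map_add, map_mul]; ring
  unfold detectorClick
  rw [hk, e, heis_lossOp_sub, heis_lossOp_fockQuant h0 h1 _ (hd 1),
    heis_lossOp_fockQuant h0 h1 _ (hd 0), hl, hl, Matrix.sub_apply, Matrix.smul_apply, d0, d0]
  split_ifs
  · rw [mul_one, mul_zero, zero_add, smul_eq_mul]
    push_cast
    rw [add_sub_cancel, one_pow]
  · simp

end Elements

section ClickOperators

variable {𝒦 : Type u}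

lemma heis_secondQuant {u : Matrix (Fin 2) (Fin 2) ℂ} {U : Op (BSig 𝒦)}
    (hU : U = secondQuant u)
    (hconj : ∀ x a, conj (U x a) = secondQuant u.conjTranspose a x)
    (g h : Matrix (Fin 2) (Fin 2) ℂ) (c : ℂ) :
    heis (fun _ : Unit => U) (secondQuant g - c • secondQuant h) =
      secondQuant (u.conjTranspose * (g * u)) - c • secondQuant (u.conjTranspose * (h * u)) := by
  have e1 : heis (fun _ : Unit => U) (secondQuant g - c • secondQuant h) =
      mulOp (secondQuant u.conjTranspose) (mulOp (secondQuant g - c • secondQuant h)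
        (secondQuant u)) := by
    funext a b
    unfold heis mulOp
    rw [tsum_eq_single () fun b hb => absurd rfl hb]
    refine tsum_congr fun x => ?_
    rw [← tsum_mul_left]
    refine tsum_congr fun y => ?_
    rw [hconj, hU, mul_assoc]
  have e2 := mulOp_add_secondQuant (𝒦 := 𝒦) 1 (-c) 1 0 g h u 0
  have e3 := mulOp_add_secondQuant (𝒦 := 𝒦) 1 0 1 (-c) u.conjTranspose 0 (g * u) (h * u)
  simp only [one_smul, zero_smul, add_zero, mul_one, mul_zero, zero_mul, one_mul, neg_smul,
    ← sub_eq_add_neg] at e2 e3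
  rw [e1, e2, e3]

/-- Single photon modes: the bases `Z` and `X` of the qubit in which a photon is measured. -/
def modeVec : Basis → Bit → Fin 2 → ℂ
  | Basis.Z, b => if b = 0 then ![1 / (Real.sqrt 2 : ℂ), 1 / (Real.sqrt 2 : ℂ)]
      else ![-Complex.I / (Real.sqrt 2 : ℂ), Complex.I / (Real.sqrt 2 : ℂ)]
  | Basis.X, b => if b = 0 then ![(1 - Complex.I) / 2, (1 + Complex.I) / 2]
      else ![(1 + Complex.I) / 2, (1 - Complex.I) / 2]

/-- The projection to the mode that reaches the detector `d`. -/
def modeProj (β : Basis) (d : Bit) : Matrix (Fin 2) (Fin 2) ℂ :=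
  Matrix.vecMulVec (modeVec β d) (star (modeVec β d))

lemma sqrt_two_mul_self : (Real.sqrt 2 : ℂ) * (Real.sqrt 2 : ℂ) = 2 := by
  rw [← Complex.ofReal_mul, Real.mul_self_sqrt (by norm_num)]; norm_num

lemma sqrt_two_ne_zero : (Real.sqrt 2 : ℂ) ≠ 0 := by
  intro h
  have := sqrt_two_mul_self
  rw [h] at this
  norm_num at this

/-- `½ [[1, z], [z̄, 1]]` -/
def offDiag (z : ℂ) : Matrix (Fin 2) (Fin 2) ℂ := !![1 / 2, z / 2; conj z / 2, 1 / 2]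

/-- The relative phase of the mode that reaches the detector `d`. -/
def modePhase (β : Basis) (d : Bit) : ℂ :=
  (-1) ^ d.val * (match β with | Basis.Z => 1 | Basis.X => -Complex.I)

lemma modePhase_mul_conj (β : Basis) (d : Bit) : modePhase β d * conj (modePhase β d) = 1 := by
  rcases bit_cases d with rfl | rfl <;> cases β <;> simp [modePhase, bit_val_one]

lemma modePhase_add_one (β : Basis) (d : Bit) : modePhase β (d + 1) = -modePhase β d := by
  rcases bit_cases d with rfl | rfl
  · simp [modePhase, bit_val_one]
  · rw [show (1 + 1 : Bit) = 0 from rfl]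
    simp [modePhase, bit_val_one]

lemma modeProj_eq (β : Basis) (d : Bit) : modeProj β d = offDiag (modePhase β d) := by
  have h2 := sqrt_two_mul_self
  have n2 := sqrt_two_ne_zero
  have hI := Complex.I_mul_I
  have h3 : ∀ a b : ℂ, a / (Real.sqrt 2 : ℂ) * (b / (Real.sqrt 2 : ℂ)) = a * b / 2 := fun a b => by
    rw [div_mul_div_comm, h2]
  rcases bit_cases d with rfl | rfl <;> cases β <;> ext i j <;> fin_cases i <;> fin_cases j <;>
    simp only [modeProj, modeVec, offDiag, modePhase, Matrix.vecMulVec_apply, bit_val_one,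
      Pi.star_apply, if_true, Fin.mk_zero, Fin.mk_one, Matrix.cons_val_zero,
      Matrix.cons_val_one, Matrix.of_apply, Complex.star_def, map_div₀, Complex.conj_ofReal,
      map_one, map_mul, map_neg, Complex.conj_I, ZMod.val_zero, pow_zero, pow_one, h3,
      map_sub, map_add, map_ofNat, one_ne_zero, if_false, Matrix.cons_val',
      Matrix.cons_val_fin_one] <;>
    first
      | ring1
      | linear_combination (1 / 4 : ℂ) * hI
      | linear_combination (-1 / 4 : ℂ) * hI
      | linear_combination (1 / 2 : ℂ) * hI
      | linear_combination (-1 / 2 : ℂ) * hI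

lemma modeProj_add (β : Basis) (d : Bit) : modeProj β d + modeProj β (d + 1) = 1 := by
  rw [modeProj_eq, modeProj_eq, modePhase_add_one]
  ext i j
  fin_cases i <;> fin_cases j <;> simp [offDiag] <;> ring

lemma modeProj_mul (β : Basis) (d : Bit) : modeProj β d * modeProj β (d + 1) = 0 := by
  have h := modePhase_mul_conj β d
  rw [modeProj_eq, modeProj_eq, modePhase_add_one]
  ext i j
  fin_cases i <;> fin_cases j <;> simp [offDiag, Matrix.mul_apply, Fin.sum_univ_two] <;>
    first
      | ring1
      | linear_combination (1 / 4 : ℂ) * h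
      | linear_combination (-1 / 4 : ℂ) * h

lemma modeProj_mul_self (β : Basis) (d : Bit) : modeProj β d * modeProj β d = modeProj β d := by
  have h := congrArg (modeProj β d * ·) (modeProj_add β d)
  simpa [mul_add, modeProj_mul] using h

variable {L M : ℕ} (P : Params L M)

/-- The transformation of the creation operators by the losses on the way to the detector `d`. -/
def detMatrix (β : Basis) (d : Bit) : Matrix (Fin 2) (Fin 2) ℂ :=
  1 - ((P.etaDet / 2 : ℝ) : ℂ) • modeProj β d

/-- The detectors, seen from the beam splitter. -/
lemma tens_detectorClick (d : Bit) :
    (if d = 0 then tens (detectorClick P.pDark P.etaDet) 1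
      else tens 1 (detectorClick P.pDark P.etaDet) : Op (BSig 𝒦)) =
    secondQuant 1 - ((1 - P.pDark : ℝ) : ℂ) • secondQuant
      (if d = 0 then !![((1 - P.etaDet : ℝ) : ℂ), 0; 0, 1]
        else !![1, 0; 0, ((1 - P.etaDet : ℝ) : ℂ)]) := by
  have h := detectorClick_eq (𝒦 := 𝒦) (p := P.pDark) P.etaDet_mem.1 P.etaDet_mem.2
  have e1 : secondQuant (𝒦 := 𝒦) 1 = 1 := secondQuant_one
  rcases bit_cases d with rfl | rfl
  · rw [if_pos rfl, if_pos rfl, e1]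
    funext x y
    rw [tens, h, Matrix.sub_apply, Matrix.smul_apply, secondQuant_diag, one_pow, mul_one,
      Matrix.one_apply, Matrix.one_apply, smul_eq_mul]
    by_cases hx : x = y
    · subst hx; simp
    · rw [if_neg (c := x = y) hx, if_neg (c := x = y) hx]
      by_cases h1 : x.1 = y.1
      · rw [if_neg (c := x.2 = y.2) fun h2 => hx (Prod.ext h1 h2)]; simp
      · rw [if_neg h1]; simp
  · rw [if_neg one_ne_zero, if_neg one_ne_zero, e1]
    funext x y
    rw [tens, h, Matrix.sub_apply, Matrix.smul_apply, secondQuant_diag, one_pow, one_mul,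
      Matrix.one_apply, Matrix.one_apply, smul_eq_mul]
    by_cases hx : x = y
    · subst hx; simp
    · rw [if_neg (c := x = y) hx, if_neg (c := x = y) hx]
      by_cases h1 : x.1 = y.1
      · rw [if_neg (c := x.2 = y.2) fun h2 => hx (Prod.ext h1 h2)]; simp
      · rw [if_neg h1]; simp

lemma tens_phaseShifter (θ : ℝ) : (tens (phaseShifter θ) 1 : Op (BSig 𝒦)) =
    secondQuant !![Complex.exp (Complex.I * θ), 0; 0, 1] := by
  funext x y
  rw [secondQuant_diag, one_pow, mul_one, tens, phaseShifter, Matrix.one_apply,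
    ← Complex.exp_nat_mul]
  by_cases hx : x = y
  · subst hx
    rw [if_pos rfl, if_pos rfl, if_pos rfl, mul_one]
    congr 1
    rw [mul_comm]
    rfl
  · rw [if_neg (c := x = y) hx]
    by_cases h1 : x.1 = y.1
    · rw [if_neg (c := x.2 = y.2) fun h2 => hx (Prod.ext h1 h2), mul_zero]
    · rw [if_neg h1, zero_mul]

lemma conj_secondQuant_phase (θ : ℝ) (x a : BSig 𝒦) :
    conj (secondQuant !![Complex.exp (Complex.I * θ), 0; 0, 1] x a) =
      secondQuant (Matrix.conjTranspose !![Complex.exp (Complex.I * θ), 0; 0, 1]) a x := by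
  have h : Matrix.conjTranspose !![Complex.exp (Complex.I * θ), 0; 0, 1] =
      !![conj (Complex.exp (Complex.I * θ)), 0; 0, 1] := by
    ext i j; fin_cases i <;> fin_cases j <;> simp
  rw [h, secondQuant_diag, secondQuant_diag]
  by_cases hx : x = a
  · subst hx
    simp
  · rw [if_neg hx, if_neg (Ne.symm hx), map_zero]

lemma conj_beamSplitter_eq (θ : ℝ) (x a : BSig 𝒦) :
    conj (beamSplitter θ x a) = secondQuant (bsMatrix θ).conjTranspose a x := by
  have h : (bsMatrix θ).conjTranspose = bsMatrix (-θ) := by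
    ext i j
    fin_cases i <;> fin_cases j <;> simp [bsMatrix, Matrix.conjTranspose_apply] <;>
      simp [← Complex.ofReal_cos, ← Complex.ofReal_sin, Complex.conj_ofReal]
  rw [h, beamSplitter_conj, beamSplitter_eq]

lemma phase_conj_beamSplitter (e : ℝ) (β : Basis) (d : Bit) :
    Matrix.conjTranspose !![Complex.exp (Complex.I * thetaBob β), 0; 0, 1] *
      ((bsMatrix (Real.pi / 4)).conjTranspose *
        ((if d = 0 then !![((1 - e : ℝ) : ℂ), 0; 0, 1]
          else !![1, 0; 0, ((1 - e : ℝ) : ℂ)]) * bsMatrix (Real.pi / 4)) *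
        !![Complex.exp (Complex.I * thetaBob β), 0; 0, 1]) =
    1 - (e : ℂ) • modeProj β d := by
  have hu : bsMatrix (Real.pi / 4) = !![(Real.sqrt 2 : ℂ) / 2, Complex.I * ((Real.sqrt 2 : ℂ) / 2);
      Complex.I * ((Real.sqrt 2 : ℂ) / 2), (Real.sqrt 2 : ℂ) / 2] := by
    unfold bsMatrix
    rw [Real.cos_pi_div_four, Real.sin_pi_div_four]
    push_cast
    rfl
  have he : Complex.exp (Complex.I * thetaBob β) =
      (match β with | Basis.Z => Complex.I | Basis.X => -1) := by
    cases β
    · change Complex.exp (Complex.I * (Real.pi / 2 : ℝ)) = Complex.I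
      rw [mul_comm]
      push_cast
      exact Complex.exp_pi_div_two_mul_I
    · change Complex.exp (Complex.I * (Real.pi : ℝ)) = -1
      rw [mul_comm, Complex.exp_pi_mul_I]
  have h2 := sqrt_two_mul_self
  have hI := Complex.I_mul_I
  rw [hu, he, modeProj_eq]
  have hs : conj (Real.sqrt 2 : ℂ) = (Real.sqrt 2 : ℂ) := Complex.conj_ofReal _
  have hc : conj (2 : ℂ) = 2 := map_ofNat _ 2
  generalize (Real.sqrt 2 : ℂ) = s at h2 hs
  rcases bit_cases d with rfl | rfl <;> cases β <;> ext i j <;> fin_cases i <;> fin_cases j <;>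
    simp [Matrix.mul_apply, Fin.sum_univ_two, Matrix.conjTranspose_apply, hs, hc, offDiag,
      modePhase, bit_val_one] <;> ring_nf <;>
    simp only [Complex.I_sq, Complex.I_pow_four, show s ^ 2 = 2 by rw [sq]; exact h2] <;> ring

/-- The click effect of one detector, seen from the input of the interferometer. -/
lemma clickOp_eq (β : Basis) (d : Bit) : clickOp (𝒦 := 𝒦) P β d =
    secondQuant 1 - ((1 - P.pDark : ℝ) : ℂ) • secondQuant (detMatrix P β d) := by
  have hone : ∀ β, Matrix.conjTranspose !![Complex.exp (Complex.I * thetaBob β), 0; 0, 1] *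
      ((bsMatrix (Real.pi / 4)).conjTranspose * (1 * bsMatrix (Real.pi / 4)) *
        !![Complex.exp (Complex.I * thetaBob β), 0; 0, 1]) = 1 := fun β => by
    have h := phase_conj_beamSplitter 0 β 0
    have h1 : !![((1 - 0 : ℝ) : ℂ), 0; 0, 1] = (1 : Matrix (Fin 2) (Fin 2) ℂ) := by
      ext i j; fin_cases i <;> fin_cases j <;> simp
    rw [if_pos rfl, h1, Complex.ofReal_zero, zero_smul, sub_zero] at h
    exact h
  have hl : (fun r : Fock 𝒦 × Fock 𝒦 => tens (lossKraus (1 / 2) r.1) (lossKraus (1 / 2) r.2)) =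
      sigLoss (1 / 2) := by
    funext r
    rw [lossKraus_eq (by norm_num) (by norm_num), lossKraus_eq (by norm_num) (by norm_num),
      tens_lossOp]
  have hm : ((1 / 2 : ℝ) : ℂ) • (1 - (P.etaDet : ℂ) • modeProj β d) +
      ((1 - 1 / 2 : ℝ) : ℂ) • 1 = detMatrix P β d := by
    unfold detMatrix
    rw [smul_sub, smul_smul, sub_add_eq_add_sub, ← add_smul]
    congr 1
    · rw [← Complex.ofReal_add]; norm_num
    · congr 1
      push_cast; ring
  have h1 : ((1 / 2 : ℝ) : ℂ) • (1 : Matrix (Fin 2) (Fin 2) ℂ) + ((1 - 1 / 2 : ℝ) : ℂ) • 1 = 1 := by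
    rw [← add_smul, ← Complex.ofReal_add]; norm_num
  unfold clickOp
  rw [tens_detectorClick, heis_secondQuant (beamSplitter_eq _) (conj_beamSplitter_eq _),
    heis_secondQuant (tens_phaseShifter _)
      (fun x a => by rw [tens_phaseShifter]; exact conj_secondQuant_phase _ x a),
    phase_conj_beamSplitter, hone, hl, heis_sigLoss_sub,
    heis_sigLoss_secondQuant (by norm_num) (by norm_num),
    heis_sigLoss_secondQuant (by norm_num) (by norm_num), hm, h1]

lemma noclickOp_eq (β : Basis) (d : Bit) : noclickOp (𝒦 := 𝒦) P β d =
    ((1 - P.pDark : ℝ) : ℂ) • secondQuant (detMatrix P β d) := by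
  unfold noclickOp
  rw [clickOp_eq, secondQuant_one, sub_sub_cancel]

lemma detMatrix_mul (β : Basis) (d : Bit) : detMatrix P β d * detMatrix P β (d + 1) =
    ((1 - P.etaDet / 2 : ℝ) : ℂ) • 1 := by
  have h : modeProj β (d + 1) = 1 - modeProj β d := by
    rw [← modeProj_add β d]; abel
  have h2 := modeProj_mul_self β d
  unfold detMatrix
  rw [h]
  simp only [mul_sub, sub_mul, smul_sub, mul_one, one_mul, Matrix.smul_mul, Matrix.mul_smul, h2]
  push_cast
  rw [sub_smul, one_smul]
  abel

lemma detMatrix_eq (β : Basis) (d : Bit) : detMatrix P β (d + 1) =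
    ((P.etaDet / 2 : ℝ) : ℂ) • modeProj β d + ((1 - P.etaDet / 2 : ℝ) : ℂ) • 1 := by
  have h : modeProj β (d + 1) = 1 - modeProj β d := by
    rw [← modeProj_add β d]; abel
  unfold detMatrix
  rw [h, smul_sub]
  push_cast
  rw [sub_smul, one_smul]
  abel

/-- The effect of `No click` depends on the number of photons only. -/
lemma measPOVM_none (β : Basis) : measPOVM (𝒦 := 𝒦) P β none =
    (((1 - P.pDark) ^ 2 : ℝ) : ℂ) • secondQuant (((1 - P.etaDet / 2 : ℝ) : ℂ) • 1) := by
  have e := mulOp_add_secondQuant (𝒦 := 𝒦) ((1 - P.pDark : ℝ) : ℂ) 0 ((1 - P.pDark : ℝ) : ℂ) 0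
    (detMatrix P β 0) 0 (detMatrix P β 1) 0
  simp only [zero_smul, add_zero, mul_zero, zero_mul] at e
  change mulOp (noclickOp P β 0) (noclickOp P β 1) = _
  rw [noclickOp_eq, noclickOp_eq, e]
  have h := detMatrix_mul P β 0
  rw [zero_add] at h
  rw [h]
  push_cast
  rw [sq]

/-- The effect of the outcome `b` on at least one photon, in the absence of losses and dark counts:
all photons in the mode of `b`, or photons in both modes and a random bit. -/
def clickEffect (β : Basis) (b : Bit) : Op (BSig 𝒦) :=
  (1 / 2 : ℂ) • (secondQuant 1 - secondQuant 0 + secondQuant (modeProj β b) -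
    secondQuant (modeProj β (b + 1)))

/-- The effect of a bit: a dark count with a random bit, or a click of lossless detectors after the
losses, the transmittance of which is half of the detection efficiency. -/
lemma measPOVM_some (β : Basis) (b : Bit) : measPOVM (𝒦 := 𝒦) P β (some b) =
    ((P.pDark / 2 : ℝ) : ℂ) • secondQuant 1 +
      ((P.pDark * (1 - P.pDark) / 2 : ℝ) : ℂ) •
        secondQuant (((1 - P.etaDet / 2 : ℝ) : ℂ) • 1) +
      ((1 - P.pDark : ℝ) : ℂ) • heis (sigLoss (P.etaDet / 2)) (clickEffect β b) := by
  have hη := P.etaDet_mem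
  have h0 : 0 ≤ P.etaDet / 2 := by linarith [hη.1]
  have h1 : P.etaDet / 2 ≤ 1 := by linarith [hη.2]
  have e0 : clickEffect (𝒦 := 𝒦) β b = 0 - (-(1 / 2) : ℂ) • (secondQuant 1 -
      (1 : ℂ) • secondQuant 0 - (-1 : ℂ) • secondQuant (modeProj β b) -
      (1 : ℂ) • secondQuant (modeProj β (b + 1))) := by
    unfold clickEffect
    simp only [neg_smul, one_smul, sub_neg_eq_add]
    rw [zero_add]
  have hz : heis (sigLoss (𝒦 := 𝒦) (P.etaDet / 2)) 0 = 0 := by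
    funext a b
    simp [heis]
  have hb2 : b + 1 + 1 = b := by rw [add_assoc, show (1 + 1 : Bit) = 0 from rfl, add_zero]
  have m1 : ((P.etaDet / 2 : ℝ) : ℂ) • (1 : Matrix (Fin 2) (Fin 2) ℂ) +
      ((1 - P.etaDet / 2 : ℝ) : ℂ) • 1 = 1 := by
    rw [← add_smul, ← Complex.ofReal_add, add_sub_cancel, Complex.ofReal_one, one_smul]
  have d1 := detMatrix_eq P β b
  have d2 := detMatrix_eq P β (b + 1)
  rw [hb2] at d2
  rw [e0, heis_sigLoss_sub, heis_sigLoss_sub, heis_sigLoss_sub, heis_sigLoss_sub, hz,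
    heis_sigLoss_secondQuant h0 h1, heis_sigLoss_secondQuant h0 h1, heis_sigLoss_secondQuant h0 h1,
    heis_sigLoss_secondQuant h0 h1, smul_zero, zero_add, m1, ← d1, ← d2]
  have t1 := mulOp_add_secondQuant (𝒦 := 𝒦) 1 (-((1 - P.pDark : ℝ) : ℂ)) ((1 - P.pDark : ℝ) : ℂ) 0
    1 (detMatrix P β b) (detMatrix P β (b + 1)) 0
  have t2 := mulOp_add_secondQuant (𝒦 := 𝒦) 1 (-((1 - P.pDark : ℝ) : ℂ)) 1
    (-((1 - P.pDark : ℝ) : ℂ)) 1 (detMatrix P β 0) 1 (detMatrix P β 1)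
  simp only [zero_smul, add_zero, mul_zero, one_smul, one_mul, neg_smul, ← sub_eq_add_neg,
    detMatrix_mul] at t1
  have h01 := detMatrix_mul P β 0
  rw [zero_add] at h01
  simp only [one_smul, one_mul, mul_one, neg_smul, ← sub_eq_add_neg, h01] at t2
  change mulOp (clickOp P β b) (noclickOp P β (b + 1)) +
      (1 / 2 : ℂ) • mulOp (clickOp P β 0) (clickOp P β 1) = _
  rw [clickOp_eq, clickOp_eq, clickOp_eq, noclickOp_eq, t1, t2]
  have hsum : secondQuant (𝒦 := 𝒦) (detMatrix P β 0) + secondQuant (detMatrix P β 1) =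
      secondQuant (detMatrix P β b) + secondQuant (detMatrix P β (b + 1)) := by
    rcases bit_cases b with rfl | rfl
    · rfl
    · rw [show (1 + 1 : Bit) = 0 from rfl, add_comm]
  have hsum' : secondQuant (𝒦 := 𝒦) (detMatrix P β 0) = secondQuant (detMatrix P β b) +
      secondQuant (detMatrix P β (b + 1)) - secondQuant (detMatrix P β 1) :=
    eq_sub_of_add_eq hsum
  rw [hsum']
  ext x y
  simp only [Matrix.add_apply, Matrix.sub_apply, Matrix.smul_apply, smul_eq_mul,
    Matrix.zero_apply]
  push_cast
  ring

end ClickOperators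

/-! ### A positivity problem for two pairs of orthogonal states -/

section Positivity

variable {H : Type*} [NormedAddCommGroup H] [InnerProductSpace ℂ H]

open scoped ComplexInnerProductSpace

/-- Removal of the component along `f`. -/
lemma exists_residual (f a : H) : ∃ a' : H, ‖f‖ ^ 2 * ‖a'‖ ^ 2 = ‖f‖ ^ 2 * ‖a‖ ^ 2 - ‖⟪f, a⟫‖ ^ 2 ∧
    ∀ w : H, ⟪w, f⟫ = 0 → ⟪w, a'⟫ = ⟪w, a⟫ := by
  by_cases hf : f = 0
  · subst hf
    exact ⟨a, by simp, fun _ _ => rfl⟩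
  have hn : ‖f‖ ≠ 0 := norm_ne_zero_iff.mpr hf
  have hn' : (‖f‖ : ℂ) ≠ 0 := Complex.ofReal_ne_zero.mpr hn
  refine ⟨a - (⟪f, a⟫ / (‖f‖ : ℂ) ^ 2) • f, ?_, fun w hw => ?_⟩
  · have h1 : ((‖a - (⟪f, a⟫ / (‖f‖ : ℂ) ^ 2) • f‖ ^ 2 : ℝ) : ℂ) =
        (‖a‖ : ℂ) ^ 2 - ⟪f, a⟫ * conj ⟪f, a⟫ / (‖f‖ : ℂ) ^ 2 := by
      have hk : ∀ z : H, ((‖z‖ : ℝ) : ℂ) ^ 2 = ⟪z, z⟫ := fun z =>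
        (inner_self_eq_norm_sq_to_K z).symm
      push_cast
      rw [hk (a - _), inner_sub_left, inner_sub_right, inner_sub_right,
        inner_smul_left, inner_smul_left, inner_smul_right, inner_smul_right,
        ← hk a, ← hk f, ← inner_conj_symm a f, map_div₀, map_pow, Complex.conj_ofReal]
      field_simp
      ring
    rw [Complex.mul_conj, Complex.normSq_eq_norm_sq] at h1
    have h2 : ‖a - (⟪f, a⟫ / (‖f‖ : ℂ) ^ 2) • f‖ ^ 2 = ‖a‖ ^ 2 - ‖⟪f, a⟫‖ ^ 2 / ‖f‖ ^ 2 := by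
      exact_mod_cast h1
    rw [h2]
    field_simp
  · rw [inner_sub_right, inner_smul_right, hw, mul_zero, sub_zero]

lemma exists_residual_unit {f : H} (hf : ‖f‖ = 1) (a : H) :
    ∃ a' : H, ‖a'‖ ^ 2 = ‖a‖ ^ 2 - ‖⟪f, a⟫‖ ^ 2 ∧ ∀ w : H, ⟪w, f⟫ = 0 → ⟪w, a'⟫ = ⟪w, a⟫ := by
  obtain ⟨a', h1, h2⟩ := exists_residual f a
  refine ⟨a', ?_, h2⟩
  rwa [hf, one_pow, one_mul, one_mul] at h1

lemma re_conj_mul (u v : ℂ) : (conj u * v).re = u.re * v.re + u.im * v.im := by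
  simp [Complex.mul_re]

lemma norm_sq_eq (u : ℂ) : ‖u‖ ^ 2 = u.re * u.re + u.im * u.im := by
  rw [← Complex.normSq_eq_norm_sq, Complex.normSq_apply]

/-- The sum of squares for an even number of photons, with the square in `u` completed. -/
lemma nonneg_form_even {c F B : ℝ} (hF : F = 1 - 2 * c ^ 2) (hF0 : 0 ≤ F) (u v w : ℂ)
    (hw : ‖w‖ ^ 2 ≤ F * B) (hB : 0 ≤ B) :
    0 ≤ ‖u‖ ^ 2 + 2 * ‖v‖ ^ 2 + B + 2 * (conj u * (2 * c * v + w)).re := by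
  rw [norm_sq_eq] at hw
  rw [norm_sq_eq, norm_sq_eq, re_conj_mul]
  have e1 : (2 * c * v + w).re = 2 * c * v.re + w.re := by simp
  have e2 : (2 * c * v + w).im = 2 * c * v.im + w.im := by simp
  rw [e1, e2]
  have key : (2 * c * v.re + w.re) ^ 2 + (2 * c * v.im + w.im) ^ 2 ≤
      2 * (v.re * v.re + v.im * v.im) + B := by
    rcases hF0.eq_or_lt with h | h
    · have hw0 : w.re * w.re + w.im * w.im ≤ 0 := by rw [← h, zero_mul] at hw; exact hw
      have h1 : w.re = 0 := by nlinarith [mul_self_nonneg w.re, mul_self_nonneg w.im]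
      have h2 : w.im = 0 := by nlinarith [mul_self_nonneg w.re, mul_self_nonneg w.im]
      have h3 : c ^ 2 = 1 / 2 := by linarith
      rw [h1, h2]
      have : (2 * c * v.re + 0) ^ 2 + (2 * c * v.im + 0) ^ 2 =
          4 * c ^ 2 * (v.re * v.re + v.im * v.im) := by ring
      rw [this, h3]
      linarith
    · refine le_of_mul_le_mul_left ?_ h
      have : F * (2 * (v.re * v.re + v.im * v.im) + B) -
          F * ((2 * c * v.re + w.re) ^ 2 + (2 * c * v.im + w.im) ^ 2) =
          2 * ((F * v.re - c * w.re) ^ 2 + (F * v.im - c * w.im) ^ 2) +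
            (F * B - (w.re * w.re + w.im * w.im)) := by
        rw [hF]; ring
      nlinarith [sq_nonneg (F * v.re - c * w.re), sq_nonneg (F * v.im - c * w.im)]
  nlinarith [sq_nonneg (u.re + (2 * c * v.re + w.re)), sq_nonneg (u.im + (2 * c * v.im + w.im))]

/-- The sum of squares for an odd number of photons. -/
lemma nonneg_form_odd {c s : ℝ} (h : c ^ 2 + s ^ 2 = 1) (a b x y : ℝ) :
    0 ≤ 2 * a ^ 2 + 2 * b ^ 2 + x ^ 2 + y ^ 2 +
      2 * (2 * c ^ 2 * (a * b) + 2 * c * s * (a * y) + 2 * c * s * (x * b) +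
        (1 - 2 * c ^ 2) * (x * y)) := by
  refine nonneg_of_mul_nonneg_right (a := 1 + c ^ 2) ?_ (by positivity)
  have e : (1 + c ^ 2) * (2 * a ^ 2 + 2 * b ^ 2 + x ^ 2 + y ^ 2 +
      2 * (2 * c ^ 2 * (a * b) + 2 * c * s * (a * y) + 2 * c * s * (x * b) +
        (1 - 2 * c ^ 2) * (x * y))) =
      (2 * c * (a + b) + s * (x + y)) ^ 2 +
        2 * (s ^ 2 * ((s * a - c * x) ^ 2 + (s * b - c * y) ^ 2) +
          c ^ 2 * ((s * a - c * x) - (s * b - c * y)) ^ 2) := by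
    linear_combination (-(2 * s ^ 2 + 2) * (a ^ 2 + b ^ 2) - (2 * c ^ 2 + 1) * (x ^ 2 + y ^ 2) -
      2 * (x * y) + 4 * c ^ 2 * (a * b) + 4 * c * s * (a * x + b * y)) * h
  rw [e]
  positivity

/-- `|u⟩⟨v|` -/
def rankOne (u v : H) : H →L[ℂ] H := (innerSL ℂ v).smulRight u

lemma inner_rankOne (a u v b : H) : ⟪a, rankOne u v b⟫ = ⟪v, b⟫ * ⟪a, u⟫ := by
  simp [rankOne]

/-- The quadratic form of the operator `½ [[1 + Z, G], [G†, 1 - Z]]`, with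
`Z = |z₀⟩⟨z₀| - |z₁⟩⟨z₁|`. -/
def clickForm (z0 z1 : H) (G : H →L[ℂ] H) (a b : H) : ℝ :=
  ‖a‖ ^ 2 + ‖⟪z0, a⟫‖ ^ 2 - ‖⟪z1, a⟫‖ ^ 2 + ‖b‖ ^ 2 - ‖⟪z0, b⟫‖ ^ 2 + ‖⟪z1, b⟫‖ ^ 2 +
    2 * (⟪a, G b⟫).re

/-- An even number of photons: with `e = (x₀ + x₁) / √2` and `o = (x₀ - x₁) / √2`, the overlaps make
`o` orthogonal to `z₀` and `z₁`, and `e = c (z₀ + z₁) + f`. -/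
lemma clickForm_even_nonneg {z0 z1 o f : H} {c : ℝ} (h0 : ‖z0‖ = 1) (h1 : ‖z1‖ = 1)
    (ho : ‖o‖ = 1) (h01 : ⟪z0, z1⟫ = 0) (h0o : ⟪z0, o⟫ = 0) (h1o : ⟪z1, o⟫ = 0)
    (hf0 : ⟪f, z0⟫ = 0) (hf1 : ⟪f, z1⟫ = 0) (hfo : ⟪f, o⟫ = 0) (hf : ‖f‖ ^ 2 = 1 - 2 * c ^ 2)
    (a b : H) :
    0 ≤ clickForm z0 z1 (rankOne o ((2 * c : ℂ) • z1 + f) + rankOne ((2 * c : ℂ) • z0 + f) o)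
      a b := by
  have h10 : ⟪z1, z0⟫ = 0 := inner_eq_zero_symm.mp h01
  have ho0 : ⟪o, z0⟫ = 0 := inner_eq_zero_symm.mp h0o
  have ho1 : ⟪o, z1⟫ = 0 := inner_eq_zero_symm.mp h1o
  have hB : ∀ a : H, ∃ B : ℝ, 0 ≤ B ∧ ‖⟪f, a⟫‖ ^ 2 ≤ ‖f‖ ^ 2 * B ∧
      ‖a‖ ^ 2 = ‖⟪z0, a⟫‖ ^ 2 + ‖⟪z1, a⟫‖ ^ 2 + ‖⟪o, a⟫‖ ^ 2 + B := fun a => by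
    obtain ⟨a1, e1, p1⟩ := exists_residual_unit h0 a
    obtain ⟨a2, e2, p2⟩ := exists_residual_unit h1 a1
    obtain ⟨a3, e3, p3⟩ := exists_residual_unit ho a2
    obtain ⟨a4, e4, p4⟩ := exists_residual f a3
    refine ⟨‖a3‖ ^ 2, by positivity, ?_, ?_⟩
    · rw [p3 f hfo, p2 f hf1, p1 f hf0] at e4
      have : 0 ≤ ‖f‖ ^ 2 * ‖a4‖ ^ 2 := by positivity
      linarith
    · rw [e3, e2, e1, p2 o ho1, p1 o ho0, p1 z1 h10]
      ring
  obtain ⟨Ba, pa, fa, ea⟩ := hB a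
  obtain ⟨Bb, pb, fb, eb⟩ := hB b
  have hF0 : 0 ≤ ‖f‖ ^ 2 := by positivity
  have i1 := nonneg_form_even hf hF0 ⟪o, a⟫ ⟪z1, b⟫ ⟪f, b⟫ fb pb
  have i2 := nonneg_form_even hf hF0 ⟪o, b⟫ ⟪z0, a⟫ ⟪f, a⟫ fa pa
  have i3 : (⟪a, (rankOne o ((2 * c : ℂ) • z1 + f) + rankOne ((2 * c : ℂ) • z0 + f) o) b⟫).re =
      (conj ⟪o, a⟫ * (2 * c * ⟪z1, b⟫ + ⟪f, b⟫)).re +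
        (conj ⟪o, b⟫ * (2 * c * ⟪z0, a⟫ + ⟪f, a⟫)).re := by
    rw [← Complex.conj_re (conj ⟪o, b⟫ * _), ← Complex.add_re]
    congr 1
    simp only [add_apply, inner_add_right, inner_rankOne, inner_add_left,
      inner_smul_left, inner_smul_right, map_mul, map_add, inner_conj_symm,
      map_ofNat, Complex.conj_ofReal]
    ring
  unfold clickForm
  rw [ea, eb, i3]
  linarith

/-- An odd number of photons: with `e = (x₀ + x₁) / √2` and `o = (x₀ - x₁) / √2`, the overlaps give
`e = c z₀ + f` and `o = c z₁ + g` with `f` and `g` orthogonal to `z₀` and `z₁`. -/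
lemma clickForm_odd_nonneg {z0 z1 f g : H} {c : ℝ} (h0 : ‖z0‖ = 1) (h1 : ‖z1‖ = 1)
    (h01 : ⟪z0, z1⟫ = 0) (hf0 : ⟪f, z0⟫ = 0) (hf1 : ⟪f, z1⟫ = 0) (hg0 : ⟪g, z0⟫ = 0)
    (hg1 : ⟪g, z1⟫ = 0) (hfg : ⟪f, g⟫ = 0) (hf : ‖f‖ ^ 2 = 1 - c ^ 2) (hg : ‖g‖ ^ 2 = 1 - c ^ 2)
    (a b : H) :
    0 ≤ clickForm z0 z1 ((2 * c ^ 2 : ℂ) • rankOne z0 z1 + (2 * c : ℂ) • rankOne z0 g +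
      (2 * c : ℂ) • rankOne f z1 + (1 - c ^ 2 / (1 - c ^ 2) : ℂ) • rankOne f g +
      (1 + c ^ 2 / (1 - c ^ 2) : ℂ) • rankOne g f) a b := by
  have h10 : ⟪z1, z0⟫ = 0 := inner_eq_zero_symm.mp h01
  have hgf : ⟪g, f⟫ = 0 := inner_eq_zero_symm.mp hfg
  have hB : ∀ a : H, ∃ B : ℝ, 0 ≤ B ∧ ‖⟪f, a⟫‖ ^ 2 + ‖⟪g, a⟫‖ ^ 2 ≤ (1 - c ^ 2) * B ∧
      ‖a‖ ^ 2 = ‖⟪z0, a⟫‖ ^ 2 + ‖⟪z1, a⟫‖ ^ 2 + B := fun a => by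
    obtain ⟨a1, e1, p1⟩ := exists_residual_unit h0 a
    obtain ⟨a2, e2, p2⟩ := exists_residual_unit h1 a1
    obtain ⟨a3, e3, p3⟩ := exists_residual f a2
    obtain ⟨a4, e4, p4⟩ := exists_residual g a3
    refine ⟨‖a2‖ ^ 2, by positivity, ?_, ?_⟩
    · rw [p3 g hgf, p2 g hg1, p1 g hg0, hg] at e4
      rw [p2 f hf1, p1 f hf0, hf] at e3
      have : 0 ≤ ‖g‖ ^ 2 * ‖a4‖ ^ 2 := by positivity
      rw [hg] at this
      linarith
    · rw [e2, e1, p1 z1 h10]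
      ring
  obtain ⟨Ba, pa, fa, ea⟩ := hB a
  obtain ⟨Bb, pb, fb, eb⟩ := hB b
  have hs0 : 0 ≤ 1 - c ^ 2 := hf ▸ (by positivity)
  have i3 : (⟪a, ((2 * c ^ 2 : ℂ) • rankOne z0 z1 + (2 * c : ℂ) • rankOne z0 g +
      (2 * c : ℂ) • rankOne f z1 + (1 - c ^ 2 / (1 - c ^ 2) : ℂ) • rankOne f g +
      (1 + c ^ 2 / (1 - c ^ 2) : ℂ) • rankOne g f) b⟫).re =
      2 * c ^ 2 * (conj ⟪z0, a⟫ * ⟪z1, b⟫).re + 2 * c * (conj ⟪z0, a⟫ * ⟪g, b⟫).re +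
        2 * c * (conj ⟪f, a⟫ * ⟪z1, b⟫).re +
        (1 - c ^ 2 / (1 - c ^ 2)) * (conj ⟪f, a⟫ * ⟪g, b⟫).re +
        (1 + c ^ 2 / (1 - c ^ 2)) * (conj ⟪g, a⟫ * ⟪f, b⟫).re := by
    simp only [← Complex.re_ofReal_mul, ← Complex.add_re]
    congr 1
    simp only [add_apply, smul_apply, inner_add_right,
      inner_smul_right, inner_rankOne, inner_conj_symm]
    push_cast
    ring
  unfold clickForm
  rw [ea, eb, i3]
  simp only [re_conj_mul, norm_sq_eq] at fa fb ⊢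
  generalize ⟪z0, a⟫ = u at *
  generalize ⟪z1, b⟫ = v at *
  generalize ⟪f, a⟫ = x at *
  generalize ⟪g, b⟫ = y at *
  generalize ⟪g, a⟫ = x' at *
  generalize ⟪f, b⟫ = y' at *
  rcases hs0.eq_or_lt with hs | hs
  · -- `f = g = 0`, so that the value `c ^ 2 / 0 = 0` of the coefficient is immaterial
    have hc : c ^ 2 = 1 := by linarith
    rw [← hs, zero_mul] at fa fb
    have z1 : ∀ {p q r s : ℝ}, p * p + q * q + (r * r + s * s) ≤ 0 → p = 0 := by
      intro p q r s h
      nlinarith [mul_self_nonneg p, mul_self_nonneg q, mul_self_nonneg r, mul_self_nonneg s]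
    have z : ∀ {p q r s : ℝ}, p * p + q * q + (r * r + s * s) ≤ 0 →
        p = 0 ∧ q = 0 ∧ r = 0 ∧ s = 0 := by
      intro p q r s h
      refine ⟨z1 h, z1 (q := p) (r := r) (s := s) (by linarith),
        z1 (q := s) (r := p) (s := q) (by linarith), z1 (q := r) (r := p) (s := q) (by linarith)⟩
    obtain ⟨x1, x2, x3, x4⟩ := z fa
    obtain ⟨y1, y2, y3, y4⟩ := z fb
    rw [x1, x2, x3, x4, y1, y2, y3, y4, hc]
    refine (add_nonneg (add_nonneg (mul_nonneg zero_le_two (add_nonneg (sq_nonneg (u.re + v.re))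
      (sq_nonneg (u.im + v.im)))) pa) pb).trans (le_of_eq ?_)
    ring
  · set t := 1 - c ^ 2 with ht
    set s := Real.sqrt t with hsdef
    have hst : s ^ 2 = t := Real.sq_sqrt hs.le
    have hs1 : 0 < s := Real.sqrt_pos.mpr hs
    have hcs : c ^ 2 + s ^ 2 = 1 := by rw [hst, ht]; ring
    have q1 := nonneg_form_odd hcs u.re v.re (x.re / s) (y.re / s)
    have q2 := nonneg_form_odd hcs u.im v.im (x.im / s) (y.im / s)
    have q3 : 0 ≤ ((x'.re + y'.re) ^ 2 + (x'.im + y'.im) ^ 2) / t := by positivity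
    have hBa : ((x.re * x.re + x.im * x.im) + (x'.re * x'.re + x'.im * x'.im)) / t ≤ Ba := by
      rw [div_le_iff₀ hs]; linarith
    have hBb : ((y'.re * y'.re + y'.im * y'.im) + (y.re * y.re + y.im * y.im)) / t ≤ Bb := by
      rw [div_le_iff₀ hs]; linarith
    have hy1 : 1 - c ^ 2 / t = (1 - 2 * c ^ 2) / t := by
      field_simp; rw [ht]; ring
    have hy2 : 1 + c ^ 2 / t = 1 / t := by
      field_simp; rw [ht]; ring
    rw [hy1, hy2]
    have r1 : 2 * u.re ^ 2 + 2 * v.re ^ 2 + (x.re / s) ^ 2 + (y.re / s) ^ 2 +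
        2 * (2 * c ^ 2 * (u.re * v.re) + 2 * c * s * (u.re * (y.re / s)) +
          2 * c * s * (x.re / s * v.re) + (1 - 2 * c ^ 2) * (x.re / s * (y.re / s))) =
        2 * u.re ^ 2 + 2 * v.re ^ 2 + (x.re * x.re + y.re * y.re) / t +
        2 * (2 * c ^ 2 * (u.re * v.re) + 2 * c * (u.re * y.re) +
          2 * c * (x.re * v.re) + (1 - 2 * c ^ 2) / t * (x.re * y.re)) := by
      rw [← hst]; field_simp; ring
    have r2 : 2 * u.im ^ 2 + 2 * v.im ^ 2 + (x.im / s) ^ 2 + (y.im / s) ^ 2 +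
        2 * (2 * c ^ 2 * (u.im * v.im) + 2 * c * s * (u.im * (y.im / s)) +
          2 * c * s * (x.im / s * v.im) + (1 - 2 * c ^ 2) * (x.im / s * (y.im / s))) =
        2 * u.im ^ 2 + 2 * v.im ^ 2 + (x.im * x.im + y.im * y.im) / t +
        2 * (2 * c ^ 2 * (u.im * v.im) + 2 * c * (u.im * y.im) +
          2 * c * (x.im * v.im) + (1 - 2 * c ^ 2) / t * (x.im * y.im)) := by
      rw [← hst]; field_simp; ring
    rw [r1] at q1
    rw [r2] at q2
    refine (add_nonneg (add_nonneg (add_nonneg q1 q2) q3)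
      (add_nonneg (sub_nonneg.mpr hBa) (sub_nonneg.mpr hBb))).trans (le_of_eq ?_)
    ring

/-- For two orthonormal pairs with the mutual overlaps of the `n`-photon states of the four BB84
modes, some `G` with `(G + G†) / 2 = |x₀⟩⟨x₀| - |x₁⟩⟨x₁|` makes the click form positive. -/
lemma exists_clickForm_nonneg {z0 z1 x0 x1 : H} {t ε : ℝ} (hε : ε = 1 ∨ ε = -1)
    (hz0 : ‖z0‖ = 1) (hz1 : ‖z1‖ = 1) (hx0 : ‖x0‖ = 1) (hx1 : ‖x1‖ = 1)
    (hz : ⟪z0, z1⟫ = 0) (hx : ⟪x0, x1⟫ = 0) (h00 : ⟪z0, x0⟫ = t) (h01 : ⟪z0, x1⟫ = t)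
    (h10 : ⟪z1, x0⟫ = t) (h11 : ⟪z1, x1⟫ = ε * t) :
    ∃ G : H →L[ℂ] H,
      (∀ a b, ⟪a, G b⟫ + conj ⟪b, G a⟫ = 2 * (⟪x0, b⟫ * ⟪a, x0⟫ - ⟪x1, b⟫ * ⟪a, x1⟫)) ∧
      ∀ a b, 0 ≤ clickForm z0 z1 G a b := by
  have hk : ∀ z : H, ⟪z, z⟫ = ((‖z‖ : ℝ) : ℂ) ^ 2 := fun z => inner_self_eq_norm_sq_to_K z
  have q2 := sqrt_two_mul_self
  have n2 := sqrt_two_ne_zero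
  have w0 : ⟪z0, z0⟫ = 1 := by rw [hk, hz0]; simp
  have w1 : ⟪z1, z1⟫ = 1 := by rw [hk, hz1]; simp
  have y0 : ⟪x0, x0⟫ = 1 := by rw [hk, hx0]; simp
  have y1 : ⟪x1, x1⟫ = 1 := by rw [hk, hx1]; simp
  have hz' : ⟪z1, z0⟫ = 0 := inner_eq_zero_symm.mp hz
  have hx' : ⟪x1, x0⟫ = 0 := inner_eq_zero_symm.mp hx
  have g00 : ⟪x0, z0⟫ = t := by rw [← inner_conj_symm, h00, Complex.conj_ofReal]
  have g01 : ⟪x1, z0⟫ = t := by rw [← inner_conj_symm, h01, Complex.conj_ofReal]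
  have g10 : ⟪x0, z1⟫ = t := by rw [← inner_conj_symm, h10, Complex.conj_ofReal]
  have g11 : ⟪x1, z1⟫ = ε * t := by
    rw [← inner_conj_symm, h11, map_mul, Complex.conj_ofReal, Complex.conj_ofReal]
  -- in terms of `e, o = (x₀ ± x₁) / √2` the operator `X` is `|e⟩⟨o| + |o⟩⟨e|`
  set r : ℂ := (Real.sqrt 2 : ℂ) / 2 with hr
  have hrr : r * r = 1 / 2 := by rw [hr, div_mul_div_comm, q2]; norm_num
  have hrc : conj r = r := by rw [hr, map_div₀, Complex.conj_ofReal, map_ofNat]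
  have hc : (((Real.sqrt 2 * t : ℝ)) : ℂ) = 2 * r * t := by rw [hr]; push_cast; ring
  set c : ℝ := Real.sqrt 2 * t with hcdef
  set e : H := r • x0 + r • x1 with he
  set o : H := r • x0 - r • x1 with ho
  have x0e : x0 = r • e + r • o := by
    rw [he, ho, smul_add, smul_sub, smul_smul, smul_smul, hrr]
    module
  have x1e : x1 = r • e - r • o := by
    rw [he, ho, smul_add, smul_sub, smul_smul, smul_smul, hrr]
    module
  have ee : ⟪e, e⟫ = 1 := by
    simp only [he, inner_add_left, inner_add_right, inner_smul_left, inner_smul_right, hrc, y0, y1,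
      hx, hx']
    linear_combination 2 * hrr
  have oo : ⟪o, o⟫ = 1 := by
    simp only [ho, inner_sub_left, inner_sub_right, inner_smul_left, inner_smul_right, hrc, y0, y1,
      hx, hx']
    linear_combination 2 * hrr
  have eo : ⟪e, o⟫ = 0 := by
    simp only [he, ho, inner_sub_right, inner_add_left, inner_smul_left, inner_smul_right, hrc, y0,
      y1, hx, hx']
    ring
  have oe : ⟪o, e⟫ = 0 := inner_eq_zero_symm.mp eo
  have on : ‖o‖ = 1 := by
    have h := hk o
    rw [oo] at h
    have h2 : ‖o‖ ^ 2 = 1 := by exact_mod_cast h.symm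
    exact (pow_eq_one_iff_of_nonneg (norm_nonneg _) two_ne_zero).mp h2
  have z0e : ⟪z0, e⟫ = c := by
    simp only [he, inner_add_right, inner_smul_right, h00, h01]
    rw [hc]; ring
  have z0o : ⟪z0, o⟫ = 0 := by
    simp only [ho, inner_sub_right, inner_smul_right, h00, h01, sub_self]
  have ez0 : ⟪e, z0⟫ = c := by rw [← inner_conj_symm, z0e, Complex.conj_ofReal]
  have oz0 : ⟪o, z0⟫ = 0 := inner_eq_zero_symm.mp z0o
  have hX : ∀ a b, 2 * (⟪x0, b⟫ * ⟪a, x0⟫ - ⟪x1, b⟫ * ⟪a, x1⟫) =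
      2 * (⟪e, b⟫ * ⟪a, o⟫ + ⟪o, b⟫ * ⟪a, e⟫) := fun a b => by
    rw [x0e, x1e]
    simp only [inner_add_left, inner_add_right, inner_sub_left, inner_sub_right, inner_smul_left,
      inner_smul_right, hrc]
    linear_combination (4 * (⟪e, b⟫ * ⟪a, o⟫ + ⟪o, b⟫ * ⟪a, e⟫)) * hrr
  rcases hε with rfl | rfl
  · -- `o` is orthogonal to both `z₀` and `z₁`
    have z1e : ⟪z1, e⟫ = c := by
      simp only [he, inner_add_right, inner_smul_right, h10, h11]
      rw [hc]; push_cast; ring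
    have z1o : ⟪z1, o⟫ = 0 := by
      simp only [ho, inner_sub_right, inner_smul_right, h10, h11]
      push_cast; ring
    have ez1 : ⟪e, z1⟫ = c := by rw [← inner_conj_symm, z1e, Complex.conj_ofReal]
    have oz1 : ⟪o, z1⟫ = 0 := inner_eq_zero_symm.mp z1o
    set f : H := e - (c : ℂ) • z0 - (c : ℂ) • z1 with hf
    have hef : e = (c : ℂ) • z0 + (c : ℂ) • z1 + f := by rw [hf]; abel
    have hfn : ‖f‖ ^ 2 = 1 - 2 * c ^ 2 := by
      have h : (((‖f‖ ^ 2 : ℝ)) : ℂ) = 1 - 2 * (c : ℂ) ^ 2 := by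
        push_cast
        rw [← hk, hf]
        simp only [inner_sub_left, inner_sub_right, inner_smul_left, inner_smul_right, ee, z0e, z1e,
          ez0, ez1, w0, w1, hz, hz', Complex.conj_ofReal]
        ring
      exact_mod_cast h
    refine ⟨_, fun a b => ?_, clickForm_even_nonneg (f := f) hz0 hz1 on hz z0o z1o ?_ ?_ ?_ hfn⟩
    · rw [hX, hef]
      simp only [add_apply, inner_add_right, inner_rankOne, inner_add_left, inner_smul_left,
        inner_smul_right, map_mul, map_add, inner_conj_symm, map_ofNat, Complex.conj_ofReal]
      ring
    · simp only [hf, inner_sub_left, inner_smul_left, ez0, w0, hz', Complex.conj_ofReal]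
      ring
    · simp only [hf, inner_sub_left, inner_smul_left, ez1, w1, hz, Complex.conj_ofReal]
      ring
    · simp only [hf, inner_sub_left, inner_smul_left, eo, z0o, z1o]
      ring
  · -- `e` is orthogonal to `z₁`, and `o` to `z₀`
    have z1e : ⟪z1, e⟫ = 0 := by
      simp only [he, inner_add_right, inner_smul_right, h10, h11]
      push_cast; ring
    have z1o : ⟪z1, o⟫ = c := by
      simp only [ho, inner_sub_right, inner_smul_right, h10, h11]
      rw [hc]; push_cast; ring
    have ez1 : ⟪e, z1⟫ = 0 := inner_eq_zero_symm.mp z1e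
    have oz1 : ⟪o, z1⟫ = c := by rw [← inner_conj_symm, z1o, Complex.conj_ofReal]
    set f : H := e - (c : ℂ) • z0 with hf
    set g : H := o - (c : ℂ) • z1 with hg
    have hef : e = (c : ℂ) • z0 + f := by rw [hf]; abel
    have hog : o = (c : ℂ) • z1 + g := by rw [hg]; abel
    have hfn : ‖f‖ ^ 2 = 1 - c ^ 2 := by
      have h : (((‖f‖ ^ 2 : ℝ)) : ℂ) = 1 - (c : ℂ) ^ 2 := by
        push_cast
        rw [← hk, hf]
        simp only [inner_sub_left, inner_sub_right, inner_smul_left, inner_smul_right, ee, z0e,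
          ez0, w0, Complex.conj_ofReal]
        ring
      exact_mod_cast h
    have hgn : ‖g‖ ^ 2 = 1 - c ^ 2 := by
      have h : (((‖g‖ ^ 2 : ℝ)) : ℂ) = 1 - (c : ℂ) ^ 2 := by
        push_cast
        rw [← hk, hg]
        simp only [inner_sub_left, inner_sub_right, inner_smul_left, inner_smul_right, oo, z1o,
          oz1, w1, Complex.conj_ofReal]
        ring
      exact_mod_cast h
    refine ⟨_, fun a b => ?_, clickForm_odd_nonneg (f := f) (g := g) (c := c) hz0 hz1 hz
      ?_ ?_ ?_ ?_ ?_ hfn hgn⟩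
    · rw [hX, hef, hog]
      have hconj : conj ((c : ℂ) ^ 2 / (1 - (c : ℂ) ^ 2)) = (c : ℂ) ^ 2 / (1 - (c : ℂ) ^ 2) := by
        simp only [map_div₀, map_pow, map_sub, map_one, Complex.conj_ofReal]
      simp only [add_apply, smul_apply, inner_add_right, inner_rankOne, inner_add_left,
        inner_smul_left, inner_smul_right, map_mul, map_add, map_sub, map_one, map_pow,
        inner_conj_symm, map_ofNat, Complex.conj_ofReal, hconj]
      ring
    · simp only [hf, inner_sub_left, inner_smul_left, ez0, w0, Complex.conj_ofReal]
      ring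
    · simp only [hf, inner_sub_left, inner_smul_left, ez1, hz]
      ring
    · simp only [hg, inner_sub_left, inner_smul_left, oz0, hz']
      ring
    · simp only [hg, inner_sub_left, inner_smul_left, oz1, w1, Complex.conj_ofReal]
      ring
    · simp only [hf, hg, inner_sub_left, inner_sub_right, inner_smul_left, inner_smul_right, eo,
        z0o, ez1, hz]
      ring

end Positivity

/-! ### Photons in one common two-system mode -/

section Sector

variable {𝒦 : Type u}

/-- The state in which all photons are in the superposition `φ` of the two systems, with `mₖ`
photons in the optical mode `k`; the amplitude of `|x⟩`, for `x₁ + x₂ = m`. -/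
def condensate (φ : Fin 2 → ℂ) (x : BSig 𝒦) : ℂ :=
  sqrtMode (x.1 + x.2) / sqrtFact x * (φ 0 ^ x.1.degree * φ 1 ^ x.2.degree)

lemma sigFact_mul_prod_choose (x : BSig 𝒦) : (sigFact x : ℂ) *
    ∏ k ∈ (x.1 + x.2).support, (((x.1 + x.2) k).choose (x.1 k) : ℂ) = modeFact (x.1 + x.2) := by
  have h := congrArg (Nat.cast (R := ℂ)) (modeFact_add x.1 x.2)
  push_cast at h
  rw [h]
  unfold sigFact
  push_cast
  ring

/-- On each sector the second quantization of a rank-one matrix has rank one. -/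
lemma secondQuant_vecMulVec (φ : Fin 2 → ℂ) (x y : BSig 𝒦) :
    secondQuant (Matrix.vecMulVec φ (star φ)) x y =
      if x.1 + x.2 = y.1 + y.2 then condensate φ x * conj (condensate φ y) else 0 := by
  have e := secondQuant_apply (𝒦 := 𝒦) (g := Matrix.vecMulVec φ (star φ)) (y := y)
    (fun k i j => (conj (φ 0) ^ y.1 k * conj (φ 1) ^ y.2 k) *
      ((((y.1 + y.2) k).choose i : ℂ) * (φ 0 ^ i * φ 1 ^ j))) ?_ x
  · rw [e]
    by_cases h : x.1 + x.2 = y.1 + y.2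
    · have h1 : ∀ x : BSig 𝒦, x.1.support ⊆ (x.1 + x.2).support := fun x => by
        intro k hk; simp at hk ⊢; omega
      have h2 : ∀ x : BSig 𝒦, x.2.support ⊆ (x.1 + x.2).support := fun x => by
        intro k hk; simp at hk ⊢; omega
      have hx := sigFact_mul_prod_choose x
      rw [if_pos h, if_pos h]
      simp only [Finset.prod_mul_distrib]
      rw [prod_pow_degree (h1 y), prod_pow_degree (h2 y), ← h, prod_pow_degree (h1 x),
        prod_pow_degree (h2 x)]
      unfold condensate
      rw [← h]
      have hc : ∀ x : BSig 𝒦, conj (sqrtFact x) = sqrtFact x := fun x => Complex.conj_ofReal _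
      have hc' : ∀ m : Fock 𝒦, conj (sqrtMode m) = sqrtMode m := fun m => Complex.conj_ofReal _
      simp only [map_mul, map_div₀, map_pow, hc, hc']
      rw [← sqrtFact_mul_self, ← sqrtMode_mul_self] at hx
      have n1 := sqrtFact_ne_zero x
      have n2 := sqrtFact_ne_zero y
      field_simp
      linear_combination (conj (φ 0) ^ y.1.degree * conj (φ 1) ^ y.2.degree *
        φ 0 ^ x.1.degree * φ 1 ^ x.2.degree) * hx
    · rw [if_neg h, if_neg h]
  · intro k a b
    have e1 : (Matrix.vecMulVec φ (star φ) 0 0 * a + Matrix.vecMulVec φ (star φ) 1 0 * b) =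
        conj (φ 0) * (φ 0 * a + φ 1 * b) := by
      simp only [Matrix.vecMulVec_apply, Pi.star_apply, Complex.star_def]; ring
    have e2 : (Matrix.vecMulVec φ (star φ) 0 1 * a + Matrix.vecMulVec φ (star φ) 1 1 * b) =
        conj (φ 1) * (φ 0 * a + φ 1 * b) := by
      simp only [Matrix.vecMulVec_apply, Pi.star_apply, Complex.star_def]; ring
    rw [e1, e2, mul_pow, mul_pow, mul_mul_mul_comm, ← pow_add, ← Finsupp.add_apply,
      (Commute.all _ _).add_pow', Finset.mul_sum]
    refine Finset.sum_congr rfl fun p _ => ?_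
    rw [nsmul_eq_mul, mul_pow, mul_pow]
    ring

/-- The overlap of two condensates is a power of the overlap of the modes. -/
lemma sum_condensate (m : Fock 𝒦) (φ ψ : Fin 2 → ℂ) :
    ∑ x ∈ Finset.HasAntidiagonal.antidiagonal m, conj (condensate φ x) * condensate ψ x =
      (conj (φ 0) * ψ 0 + conj (φ 1) * ψ 1) ^ m.degree := by
  rw [← prod_pow_degree (subset_refl m.support)]
  simp only [fun (x y : ℂ) n => (Commute.all x y).add_pow' n]
  refine Eq.trans ?_ (prod_sum_antidiagonal m fun k i j => (m k).choose i •
    ((conj (φ 0) * ψ 0) ^ i * (conj (φ 1) * ψ 1) ^ j)).symm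
  refine Finset.sum_congr rfl fun x hx => ?_
  rw [Finset.HasAntidiagonal.mem_antidiagonal] at hx
  subst hx
  have h1 : x.1.support ⊆ (x.1 + x.2).support := by intro k hk; simp at hk ⊢; omega
  have h2 : x.2.support ⊆ (x.1 + x.2).support := by intro k hk; simp at hk ⊢; omega
  have h3 := sigFact_mul_prod_choose x
  simp only [nsmul_eq_mul, Finset.prod_mul_distrib]
  rw [prod_pow_degree h1, prod_pow_degree h2]
  unfold condensate
  have hc : ∀ x : BSig 𝒦, conj (sqrtFact x) = sqrtFact x := fun x => Complex.conj_ofReal _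
  have hc' : ∀ m : Fock 𝒦, conj (sqrtMode m) = sqrtMode m := fun m => Complex.conj_ofReal _
  simp only [map_mul, map_div₀, map_pow, hc, hc']
  rw [← sqrtFact_mul_self, ← sqrtMode_mul_self] at h3
  have n1 := sqrtFact_ne_zero x
  rw [mul_pow, mul_pow]
  field_simp
  linear_combination (-(conj (φ 0) ^ x.1.degree * ψ 0 ^ x.1.degree * conj (φ 1) ^ x.2.degree *
    ψ 1 ^ x.2.degree)) * h3

end Sector

section Gram

variable {ι : Type*} [Fintype ι] [DecidableEq ι]

open scoped ComplexInnerProductSpace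

/-- A positive click form is the Gram form of a family of operators to the qubit. -/
lemma exists_gram_of_clickForm {z0 z1 : EuclideanSpace ℂ ι}
    {G : EuclideanSpace ℂ ι →L[ℂ] EuclideanSpace ℂ ι} (h : ∀ a b, 0 ≤ clickForm z0 z1 G a b) :
    ∃ (n : ℕ) (B : Fin n → ι ⊕ ι → ℂ),
      (∀ i j, ∑ k, conj (B k (Sum.inl i)) * B k (Sum.inl j) =
        (1 / 2) * ((if i = j then 1 else 0) + z0 i * conj (z0 j) - z1 i * conj (z1 j))) ∧
      (∀ i j, ∑ k, conj (B k (Sum.inr i)) * B k (Sum.inr j) =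
        (1 / 2) * ((if i = j then 1 else 0) - z0 i * conj (z0 j) + z1 i * conj (z1 j))) ∧
      (∀ i j, ∑ k, conj (B k (Sum.inl i)) * B k (Sum.inr j) =
        (1 / 2) * ⟪EuclideanSpace.single i 1, G (EuclideanSpace.single j 1)⟫) ∧
      (∀ i j, ∑ k, conj (B k (Sum.inr i)) * B k (Sum.inl j) =
        (1 / 2) * conj ⟪EuclideanSpace.single j 1, G (EuclideanSpace.single i 1)⟫) := by
  set A : Matrix ι ι ℂ := (1 / 2 : ℂ) • (1 + Matrix.vecMulVec z0.ofLp (star z0.ofLp) -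
    Matrix.vecMulVec z1.ofLp (star z1.ofLp)) with hA
  set D : Matrix ι ι ℂ := (1 / 2 : ℂ) • (1 - Matrix.vecMulVec z0.ofLp (star z0.ofLp) +
    Matrix.vecMulVec z1.ofLp (star z1.ofLp)) with hD
  set C : Matrix ι ι ℂ := fun i j =>
    (1 / 2) * ⟪EuclideanSpace.single i 1, G (EuclideanSpace.single j 1)⟫ with hC
  have h2 : star (1 / 2 : ℂ) = 1 / 2 := by simp
  have hv : ∀ z : ι → ℂ, (Matrix.vecMulVec z (star z)).conjTranspose =
      Matrix.vecMulVec z (star z) := fun z => by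
    rw [Matrix.conjTranspose_vecMulVec, star_star]
  have hA1 : A.IsHermitian := by
    rw [Matrix.IsHermitian, hA, Matrix.conjTranspose_smul, h2, Matrix.conjTranspose_sub,
      Matrix.conjTranspose_add, hv, hv, Matrix.conjTranspose_one]
  have hD1 : D.IsHermitian := by
    rw [Matrix.IsHermitian, hD, Matrix.conjTranspose_smul, h2, Matrix.conjTranspose_add,
      Matrix.conjTranspose_sub, hv, hv, Matrix.conjTranspose_one]
  have hCv : ∀ a b : ι → ℂ, star a ⬝ᵥ C.mulVec b =
      (1 / 2) * ⟪WithLp.toLp 2 a, G (WithLp.toLp 2 b)⟫ := fun a b => by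
    have hb : WithLp.toLp 2 b = ∑ j, b j • EuclideanSpace.single j (1 : ℂ) := by
      ext i
      simp [Pi.single_apply]
    have ha : WithLp.toLp 2 a = ∑ j, a j • EuclideanSpace.single j (1 : ℂ) := by
      ext i
      simp [Pi.single_apply]
    rw [ha, hb, map_sum, sum_inner, dotProduct, Finset.mul_sum]
    refine Finset.sum_congr rfl fun i _ => ?_
    rw [inner_sum, Matrix.mulVec, dotProduct, Finset.mul_sum, Finset.mul_sum]
    refine Finset.sum_congr rfl fun j _ => ?_
    rw [map_smul, inner_smul_left, inner_smul_right, Pi.star_apply, hC, Complex.star_def]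
    ring
  have hz : ∀ z a : ι → ℂ, star a ⬝ᵥ (Matrix.vecMulVec z (star z)).mulVec a =
      ((‖⟪WithLp.toLp 2 z, WithLp.toLp 2 a⟫‖ : ℝ) : ℂ) ^ 2 := fun z a => by
    rw [← Complex.ofReal_pow, ← Complex.normSq_eq_norm_sq, ← Complex.mul_conj,
      Matrix.vecMulVec_mulVec, EuclideanSpace.inner_toLp_toLp]
    rw [dotProduct_smul, MulOpposite.smul_eq_mul_unop, MulOpposite.unop_op, dotProduct_comm a,
      Matrix.star_dotProduct a z, Complex.star_def, mul_comm]
  have h1 : ∀ a : ι → ℂ, star a ⬝ᵥ a = ((‖WithLp.toLp 2 a‖ : ℝ) : ℂ) ^ 2 := fun a => by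
    have := inner_self_eq_norm_sq_to_K (𝕜 := ℂ) (WithLp.toLp 2 a : EuclideanSpace ℂ ι)
    rw [EuclideanSpace.inner_toLp_toLp, dotProduct_comm] at this
    exact this
  have hpsd : (Matrix.fromBlocks A C C.conjTranspose D).PosSemidef := by
    refine Matrix.PosSemidef.of_dotProduct_mulVec_nonneg (hA1.fromBlocks rfl hD1) fun x => ?_
    set a := x ∘ Sum.inl with ha
    set b := x ∘ Sum.inr with hb
    have hx : star x = Sum.elim (star a) (star b) := by
      funext i; rcases i with i | i <;> rfl
    have hC2 : star b ⬝ᵥ C.conjTranspose.mulVec a = conj (star a ⬝ᵥ C.mulVec b) := by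
      rw [Matrix.dotProduct_mulVec, ← Matrix.star_mulVec, Matrix.star_dotProduct]
      rfl
    rw [Matrix.fromBlocks_mulVec, hx, sumElim_dotProduct_sumElim, dotProduct_add, dotProduct_add,
      hC2, hCv, hA, hD, Matrix.smul_mulVec, Matrix.smul_mulVec, Matrix.sub_mulVec,
      Matrix.add_mulVec, Matrix.add_mulVec, Matrix.sub_mulVec, Matrix.one_mulVec, Matrix.one_mulVec,
      dotProduct_smul, dotProduct_smul, dotProduct_sub, dotProduct_add, dotProduct_add,
      dotProduct_sub, hz, hz, hz, hz, h1, h1]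
    have hf := h (WithLp.toLp 2 a) (WithLp.toLp 2 b)
    have hre := Complex.add_conj ⟪WithLp.toLp 2 a, G (WithLp.toLp 2 b)⟫
    have e : ((1 / 2 * clickForm z0 z1 G (WithLp.toLp 2 a) (WithLp.toLp 2 b) : ℝ) : ℂ) =
        (1 / 2 : ℂ) * ((((‖WithLp.toLp 2 a‖ : ℝ) : ℂ) ^ 2 +
          ((‖⟪z0, WithLp.toLp 2 a⟫‖ : ℝ) : ℂ) ^ 2 - ((‖⟪z1, WithLp.toLp 2 a⟫‖ : ℝ) : ℂ) ^ 2)) +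
        1 / 2 * ⟪WithLp.toLp 2 a, G (WithLp.toLp 2 b)⟫ +
        (conj (1 / 2 * ⟪WithLp.toLp 2 a, G (WithLp.toLp 2 b)⟫) +
        (1 / 2 : ℂ) * ((((‖WithLp.toLp 2 b‖ : ℝ) : ℂ) ^ 2 -
          ((‖⟪z0, WithLp.toLp 2 b⟫‖ : ℝ) : ℂ) ^ 2 + ((‖⟪z1, WithLp.toLp 2 b⟫‖ : ℝ) : ℂ) ^ 2))) := by
      unfold clickForm
      rw [map_mul, map_div₀, map_one, map_ofNat]
      push_cast
      push_cast at hre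
      linear_combination (-1 / 2 : ℂ) * hre
    refine le_of_le_of_eq ?_ e
    rw [Complex.zero_le_real]
    positivity
  obtain ⟨n, v, hv⟩ := Matrix.posSemidef_iff_eq_sum_vecMulVec.mp hpsd
  have hB' : ∀ i j, ∑ k, conj (conj (v k i)) * conj (v k j) =
      Matrix.fromBlocks A C C.conjTranspose D i j := fun i j => by
    rw [hv, Matrix.sum_apply]
    refine Finset.sum_congr rfl fun k _ => ?_
    rw [Complex.conj_conj]; rfl
  refine ⟨n, fun k i => conj (v k i), fun i j => (hB' _ _).trans ?_, fun i j => (hB' _ _).trans ?_,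
    fun i j => (hB' _ _).trans ?_, fun i j => (hB' _ _).trans ?_⟩
  · rw [← Matrix.one_apply]; rfl
  · rw [← Matrix.one_apply]; rfl
  · rfl
  · change conj (C j i) = _
    rw [hC, map_mul, map_div₀, map_one, map_ofNat]

end Gram

section SectorGram

variable {𝒦 : Type u}

open scoped ComplexInnerProductSpace

lemma clickEffect_apply (β : Basis) (b : Bit) {x y : BSig 𝒦} (h : x.1 + x.2 = y.1 + y.2) :
    clickEffect β b x y = (1 / 2) * ((if x = y then 1 else 0) -
      (if x = y then 0 ^ (y.1 + y.2).degree else 0) +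
      condensate (modeVec β b) x * conj (condensate (modeVec β b) y) -
      condensate (modeVec β (b + 1)) x * conj (condensate (modeVec β (b + 1)) y)) := by
  have h0 := secondQuant_smul_one (𝒦 := 𝒦) 0 x y
  rw [zero_smul] at h0
  unfold clickEffect modeProj
  rw [Matrix.smul_apply, Matrix.sub_apply, Matrix.add_apply, Matrix.sub_apply, smul_eq_mul,
    secondQuant_one, Matrix.one_apply, h0, secondQuant_vecMulVec, secondQuant_vecMulVec, if_pos h,
    if_pos h, degree_occ, map_add]

lemma modeVec_self (β : Basis) (b : Bit) : conj (modeVec β b 0) * modeVec β b 0 +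
    conj (modeVec β b 1) * modeVec β b 1 = 1 := by
  have h := congrArg Matrix.trace (modeProj_eq β b)
  simp only [modeProj, offDiag, Matrix.trace_fin_two, Matrix.vecMulVec_apply, Pi.star_apply,
    Complex.star_def, Matrix.of_apply, Matrix.cons_val', Matrix.cons_val_zero, Matrix.cons_val_one,
    Matrix.cons_val_fin_one] at h
  linear_combination h

lemma modeVec_zero_one (β : Basis) : conj (modeVec β 0 0) * modeVec β 1 0 +
    conj (modeVec β 0 1) * modeVec β 1 1 = 0 := by
  cases β
  · simp [modeVec, Complex.conj_ofReal]
    ring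
  · simp [modeVec, map_ofNat]
    linear_combination (1 / 2 : ℂ) * Complex.I_sq

lemma modeVec_Z_X (a b : Bit) : conj (modeVec Basis.Z a 0) * modeVec Basis.X b 0 +
    conj (modeVec Basis.Z a 1) * modeVec Basis.X b 1 =
      (((if a = 1 ∧ b = 1 then -1 else 1) * (1 / Real.sqrt 2) : ℝ) : ℂ) := by
  have n2 := sqrt_two_ne_zero
  have hI := Complex.I_mul_I
  have h01 : (0 : Bit) ≠ 1 := zero_ne_one
  rcases bit_cases a with rfl | rfl <;> rcases bit_cases b with rfl | rfl <;>
    simp [modeVec, Complex.conj_ofReal] <;> field_simp <;> ring_nf <;> simp [Complex.I_sq]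

/-- Photons in one sector can be mapped to the qubit such that the Pauli measurements have the
effects `clickEffect`. -/
lemma exists_squash_sector (m : Fock 𝒦) : ∃ (n : ℕ) (B : Fin n → Bit → BSig 𝒦 → ℂ),
    ∀ x y : BSig 𝒦, x.1 + x.2 = m → y.1 + y.2 = m →
      (∑ k, conj (B k 0 x) * B k 0 y = clickEffect Basis.Z 0 x y) ∧
      (∑ k, conj (B k 1 x) * B k 1 y = clickEffect Basis.Z 1 x y) ∧
      (∑ k, conj (B k 0 x) * B k 1 y + ∑ k, conj (B k 1 x) * B k 0 y =
        clickEffect Basis.X 0 x y - clickEffect Basis.X 1 x y) := by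
  have h11 : (1 + 1 : Bit) = 0 := rfl
  -- on the vacuum all condensates coincide and no detector clicks
  by_cases hm : m = 0
  · refine ⟨0, fun _ _ _ => 0, fun x y hx hy => ?_⟩
    have hc : ∀ β b, clickEffect β b x y = 0 := fun β b => by
      have e : ∀ z : BSig 𝒦, z.1 + z.2 = m → z = 0 := fun z hz => by
        rw [hm] at hz
        obtain ⟨h1, h2⟩ := add_eq_zero.mp hz
        exact Prod.ext h1 h2
      have ex := e x hx
      have ey := e y hy
      subst ex ey
      rw [clickEffect_apply β b rfl]
      simp [condensate, sqrtMode_zero, sqrtFact, sigFact, modeFact]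
    simp [hc]
  have hn : m.degree ≠ 0 := fun h => hm ((Finsupp.degree_eq_zero_iff m).mp h)
  set ι := ↥(Finset.HasAntidiagonal.antidiagonal m) with hι
  set vec : Basis → Bit → EuclideanSpace ℂ ι := fun β b =>
    WithLp.toLp 2 fun i => condensate (modeVec β b) i.1 with hvec
  have hin : ∀ β b β' b', ⟪vec β b, vec β' b'⟫ = (conj (modeVec β b 0) * modeVec β' b' 0 +
      conj (modeVec β b 1) * modeVec β' b' 1) ^ m.degree := fun β b β' b' => by
    rw [← sum_condensate, ← Finset.sum_coe_sort, hvec, EuclideanSpace.inner_toLp_toLp, dotProduct]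
    exact Finset.sum_congr rfl fun i _ => mul_comm _ _
  have hnorm : ∀ β b, ‖vec β b‖ = 1 := fun β b => by
    have h1 : ⟪vec β b, vec β b⟫ = ((‖vec β b‖ : ℝ) : ℂ) ^ 2 := inner_self_eq_norm_sq_to_K _
    rw [hin, modeVec_self, one_pow] at h1
    have h2 : ‖vec β b‖ ^ 2 = 1 := by exact_mod_cast h1.symm
    exact (pow_eq_one_iff_of_nonneg (norm_nonneg _) two_ne_zero).mp h2
  have h01 : ∀ β, ⟪vec β 0, vec β 1⟫ = 0 := fun β => by
    rw [hin, modeVec_zero_one, zero_pow hn]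
  have b01 : ¬ ((0 : Bit) = 1) := zero_ne_one
  obtain ⟨G, hG, hpos⟩ := exists_clickForm_nonneg (t := (1 / Real.sqrt 2) ^ m.degree)
    (ε := (-1) ^ m.degree) (neg_one_pow_eq_or ℝ m.degree) (hnorm Basis.Z 0) (hnorm Basis.Z 1)
    (hnorm Basis.X 0) (hnorm Basis.X 1) (h01 Basis.Z) (h01 Basis.X)
    (by rw [hin, modeVec_Z_X, if_neg fun h => b01 h.1, one_mul, Complex.ofReal_pow])
    (by rw [hin, modeVec_Z_X, if_neg fun h => b01 h.1, one_mul, Complex.ofReal_pow])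
    (by rw [hin, modeVec_Z_X, if_neg fun h => b01 h.2, one_mul, Complex.ofReal_pow])
    (by rw [hin, modeVec_Z_X, if_pos ⟨rfl, rfl⟩, ← Complex.ofReal_pow, mul_pow,
      Complex.ofReal_mul])
  obtain ⟨n, B, h00, h11', h01', h10'⟩ := exists_gram_of_clickForm hpos
  refine ⟨n, fun k c x => if h : x ∈ Finset.HasAntidiagonal.antidiagonal m then
    B k (if c = 0 then Sum.inl ⟨x, h⟩ else Sum.inr ⟨x, h⟩) else 0, fun x y hx hy => ?_⟩
  have hx' : x ∈ Finset.HasAntidiagonal.antidiagonal m :=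
    Finset.HasAntidiagonal.mem_antidiagonal.mpr hx
  have hy' : y ∈ Finset.HasAntidiagonal.antidiagonal m :=
    Finset.HasAntidiagonal.mem_antidiagonal.mpr hy
  have hxy : x.1 + x.2 = y.1 + y.2 := hx.trans hy.symm
  have hzero : (if x = y then (0 : ℂ) ^ (y.1 + y.2).degree else 0) = 0 := by
    rw [hy, zero_pow hn, ite_self]
  simp only [dif_pos hx', dif_pos hy', if_true, if_neg (one_ne_zero (α := Bit))]
  rw [h00, h11', h01', h10']
  simp only [clickEffect_apply _ _ hxy, hzero, zero_add, h11]
  refine ⟨?_, ?_, ?_⟩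
  · by_cases e : x = y
    · subst e; rw [if_pos rfl, if_pos rfl]; simp only [hvec]; ring
    · rw [if_neg fun h => e (Subtype.mk.inj h), if_neg e]; simp only [hvec]; ring
  · by_cases e : x = y
    · subst e; rw [if_pos rfl, if_pos rfl]; simp only [hvec]; ring
    · rw [if_neg fun h => e (Subtype.mk.inj h), if_neg e]; simp only [hvec]; ring
  · have hg := hG (EuclideanSpace.single ⟨x, hx'⟩ 1) (EuclideanSpace.single ⟨y, hy'⟩ 1)
    have e1 : ∀ (v : EuclideanSpace ℂ ι) i, ⟪EuclideanSpace.single i (1 : ℂ), v⟫ = v i :=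
      fun v i => by simp [EuclideanSpace.inner_single_left]
    have e2 : ∀ (v : EuclideanSpace ℂ ι) i, ⟪v, EuclideanSpace.single i (1 : ℂ)⟫ = conj (v i) :=
      fun v i => by simp [EuclideanSpace.inner_single_right]
    simp only [e2 (vec _ _), e1 (vec _ _)] at hg
    rw [← mul_add, hg]
    simp only [hvec]
    ring

end SectorGram

/-! ### A squashing map -/

section SquashCriterion

variable {𝒦 : Type u} {L M : ℕ} {P : Params L M} {S : Channel.{u} (BSig 𝒦) (Option Bit)}

lemma bdd_outcomeRow (x : BCR) : Bdd fun e (_ : Unit) => outcomeRow P S x e := by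
  obtain ⟨C, hC, h⟩ := bdd_of_complete (K := bobVirKraus P S) fun a b => by
    convert bobVirKraus_complete (P := P) (S := S) a b
  refine ⟨C, hC, fun F s v => ?_⟩
  have hinj : Function.Injective fun p : S.Env × Unit => ((branchOf x, p.1), x) := fun p q hpq => by
    simp only [Prod.mk.injEq, true_and, and_true] at hpq
    exact Prod.ext hpq rfl
  have := h (F.map ⟨_, hinj⟩) s v
  rw [Finset.sum_map] at this
  simpa only [Function.Embedding.coeFn_mk, bobVirKraus_apply, if_true] using this

/-- The probability of an outcome in the virtual protocol, in the Heisenberg picture. -/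
lemma trace_outcomeProj_krausMap {ρ : Op (BSig 𝒦)} (hρ : IsState ρ) (x : BCR) :
    (P.pB x.1 : ℂ) * Matrix.trace (outcomeProj x * krausMap S.K ρ) =
      ∑' a, ∑' b, outcomeEffect P S x a b * ρ b a := by
  obtain ⟨J, v, hv⟩ := TraceClass.submatrix (f := fun p : BSig 𝒦 × Unit => p.1) hρ.traceClass
    fun p q h => Prod.ext h rfl
  have hR := bdd_outcomeRow (P := P) (S := S) x
  have h1 := act_diag_eq (hρ.traceClass.submatrix (f := fun p : BSig 𝒦 × Unit => p.1)
    fun p q h => Prod.ext h rfl) hR () (fun a b => ((hasSum_outcomeRow x a b).tsum_eq).symm) () ()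
  refine Eq.trans ?_ h1
  have g1 := hv.act S.bdd
  have g2 := hv.act hR
  have hs : ∀ o o', Summable fun p : S.Env × J => (∑' a, S.K p.1 o a * v p.2 (a, ())) *
      conj (∑' a, S.K p.1 o' a * v p.2 (a, ())) := fun o o' =>
    summable_mul_of_sq (g1.summable_entry (o, ())) (summable_conj_sq (g1.summable_entry (o', ())))
  have hk : ∀ o o', krausMap S.K ρ o o' = ∑' p : S.Env × J,
      (∑' a, S.K p.1 o a * v p.2 (a, ())) * conj (∑' a, S.K p.1 o' a * v p.2 (a, ())) :=
    fun o o' => g1.2 (o, ()) (o', ())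
  have hrow : ∀ p : S.Env × J, ∑' a, outcomeRow P S x p.1 a * v p.2 (a, ()) =
      ∑ o, virBranchKraus P (branchOf x) x o * ∑' a, S.K p.1 o a * v p.2 (a, ()) := fun p => by
    have hw : Summable fun a => ‖v p.2 (a, ())‖ ^ 2 :=
      (hv.summable_vec p.2).comp_injective (i := fun a => (a, ())) fun _ _ h =>
        (Prod.ext_iff.mp h).1
    unfold outcomeRow
    simp only [Finset.sum_mul, mul_assoc]
    rw [Summable.tsum_finsetSum fun o _ => (S.bdd.summable_mul hw p.1 o).mul_left _]
    exact Finset.sum_congr rfl fun o _ => tsum_mul_left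
  have e := g2.2 ((), ()) ((), ())
  refine Eq.trans ?_ e.symm
  simp only [hrow]
  have e2 : ∀ p : S.Env × J,
      (∑ o, virBranchKraus P (branchOf x) x o * ∑' a, S.K p.1 o a * v p.2 (a, ())) *
        conj (∑ o, virBranchKraus P (branchOf x) x o * ∑' a, S.K p.1 o a * v p.2 (a, ())) =
      ∑ o, ∑ o', (P.pB x.1 : ℂ) * outcomeProj x o o' * ((∑' a, S.K p.1 o' a * v p.2 (a, ())) *
        conj (∑' a, S.K p.1 o a * v p.2 (a, ()))) := fun p => by
    simp only [map_sum, Finset.sum_mul_sum]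
    rw [Finset.sum_comm]
    refine Finset.sum_congr rfl fun o _ => Finset.sum_congr rfl fun o' _ => ?_
    rw [outcomeProj_eq, map_mul]; ring
  simp only [e2]
  rw [Summable.tsum_finsetSum fun o _ => summable_sum fun o' _ => (hs o' o).mul_left _,
    Matrix.trace, Finset.mul_sum]
  refine Finset.sum_congr rfl fun o _ => ?_
  rw [Summable.tsum_finsetSum fun o' _ => (hs o' o).mul_left _, Matrix.diag_apply, Matrix.mul_apply,
    Finset.mul_sum]
  refine Finset.sum_congr rfl fun o' _ => ?_
  rw [hk, tsum_mul_left, mul_assoc]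

/-- A channel is a squashing map if its Kraus operators do not mix the qubit with `Noclick` and
Bob's effects are the pullbacks of the Pauli effects. -/
lemma isSquashing_of_effects (hcoh : ∀ e b a a', S.K e (some b) a = 0 ∨ S.K e none a' = 0)
    (heff : ∀ x a b, outcomeEffect P S x a b = (P.pB x.1 : ℂ) * measPOVM P x.1 x.2 a b) :
    IsSquashing P S := by
  refine fun ρ hρ => ⟨fun b => ⟨?_, ?_⟩, ?_⟩
  · refine (tsum_congr fun e => (tsum_congr fun a => (tsum_congr fun a' => ?_).trans
      tsum_zero).trans tsum_zero).trans tsum_zero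
    rcases hcoh e b a a' with h | h <;> simp [h]
  · refine (tsum_congr fun e => (tsum_congr fun a => (tsum_congr fun a' => ?_).trans
      tsum_zero).trans tsum_zero).trans tsum_zero
    rcases hcoh e b a' a with h | h <;> simp [h]
  · rw [squash_sum_eq]
    have h : ∀ x : BCR, (P.pB x.1 : ℂ) * Matrix.trace (outcomeProj x * krausMap S.K ρ) =
        (P.pB x.1 : ℂ) * trMul (measPOVM P x.1 x.2) ρ := fun x => by
      rw [trace_outcomeProj_krausMap hρ]
      unfold trMul
      rw [← tsum_mul_left]
      refine tsum_congr fun a => ?_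
      rw [← tsum_mul_left]
      exact tsum_congr fun b => by rw [heff, mul_assoc]
    simp only [h]
    rw [Fintype.sum_prod_type]
    rfl

end SquashCriterion

section SquashMap

variable {𝒦 : Type u}

/-- The number of Kraus operators of `exists_squash_sector`. -/
def sectorNum (m : Fock 𝒦) : ℕ := (exists_squash_sector m).choose

/-- The Kraus operators of `exists_squash_sector`; the arguments are the label of the operator, the
output bit and the input. -/
def sectorKraus (m : Fock 𝒦) : Fin (sectorNum m) → Bit → BSig 𝒦 → ℂ :=
  (exists_squash_sector m).choose_spec.choose

/-- `∑ₖ Bₖ(c)† Bₖ(c')` on the direct sum of all sectors. -/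
def sectorGram (c c' : Bit) : Op (BSig 𝒦) := fun x y =>
  if x.1 + x.2 = y.1 + y.2 then
    ∑ k, conj (sectorKraus (x.1 + x.2) k c x) * sectorKraus (x.1 + x.2) k c' y else 0

lemma clickEffect_eq_zero (β : Basis) (b : Bit) {x y : BSig 𝒦} (h : x.1 + x.2 ≠ y.1 + y.2) :
    clickEffect β b x y = 0 := by
  have hxy : x ≠ y := fun e => h (by rw [e])
  have h0 := secondQuant_smul_one (𝒦 := 𝒦) 0 x y
  rw [zero_smul, if_neg hxy] at h0
  unfold clickEffect modeProj
  rw [Matrix.smul_apply, Matrix.sub_apply, Matrix.add_apply, Matrix.sub_apply, smul_eq_mul,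
    secondQuant_one, Matrix.one_apply_ne hxy, h0, secondQuant_vecMulVec, secondQuant_vecMulVec,
    if_neg h, if_neg h]
  simp

lemma sectorGram_Z (b : Bit) : sectorGram (𝒦 := 𝒦) b b = clickEffect Basis.Z b := by
  funext x y
  unfold sectorGram
  split_ifs with h
  · have hs := (exists_squash_sector (x.1 + x.2)).choose_spec.choose_spec x y rfl h.symm
    rcases bit_cases b with rfl | rfl
    · exact hs.1
    · exact hs.2.1
  · exact (clickEffect_eq_zero _ _ h).symm

lemma sectorGram_X : sectorGram (𝒦 := 𝒦) 0 1 - (-1 : ℂ) • sectorGram 1 0 =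
    clickEffect Basis.X 0 - (1 : ℂ) • clickEffect Basis.X 1 := by
  funext x y
  rw [neg_one_smul, sub_neg_eq_add, one_smul, Matrix.add_apply, Matrix.sub_apply]
  unfold sectorGram
  split_ifs with h
  · exact ((exists_squash_sector (x.1 + x.2)).choose_spec.choose_spec x y rfl h.symm).2.2
  · rw [clickEffect_eq_zero _ _ h, clickEffect_eq_zero _ _ h]; simp

lemma heis_sigLoss_apply (κ : ℝ) (E : Op (BSig 𝒦)) (a b : BSig 𝒦) :
    heis (sigLoss κ) E a b = ∑' r, if r ≤ a ∧ r ≤ b then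
      conj (lossAmp κ (occ r) (occ (a - r))) * E (a - r) (b - r) *
        lossAmp κ (occ r) (occ (b - r)) else 0 := by
  refine heis_shift (K := sigLoss κ) (A := fun r x => lossAmp κ (occ r) (occ x))
    (fun r x a => ?_) E a b
  unfold sigLoss lossOp
  rw [← occ_add]
  exact ite_eq_ite_of_iff occ_injective.eq_iff _ _

variable {L M : ℕ} (P : Params L M)

/-- The probability that the outcome `o` is due to dark counts alone: both detectors are silent, or
a click for which the bit is uniformly random. -/
def darkWeight (o : Option Bit) (y : BSig 𝒦) : ℝ :=
  o.elim ((1 - P.pDark) ^ 2 * (1 - P.etaDet / 2) ^ (occ y).degree) fun _ =>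
    P.pDark / 2 + P.pDark * (1 - P.pDark) / 2 * (1 - P.etaDet / 2) ^ (occ y).degree

/-- Labels of the Kraus operators of the squashing map: dark counts, and the pattern `r` of lost
photons together with a Kraus operator on a sector of the remaining photons. -/
abbrev SquashEnv (𝒦 : Type u) : Type u :=
  (Option Bit × BSig 𝒦) ⊕ (BSig 𝒦 × Σ m : Fock 𝒦, Fin (sectorNum m))

/-- The Kraus operators of the squashing map. -/
def squashKraus : SquashEnv 𝒦 → Matrix (Option Bit) (BSig 𝒦) ℂ
  | Sum.inl (o, y) => fun o' a => if o' = o ∧ a = y then (Real.sqrt (darkWeight P o a) : ℂ) else 0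
  | Sum.inr (r, ⟨m, k⟩) => fun o' a => o'.elim 0 fun c =>
      if r ≤ a ∧ (a - r).1 + (a - r).2 = m then (Real.sqrt (1 - P.pDark) : ℂ) *
        (sectorKraus m k c (a - r) * lossAmp (P.etaDet / 2) (occ r) (occ (a - r))) else 0

/-- `∑ₖ Kₖ(o)† Kₖ(o')` for the Kraus operators of the squashing map. -/
def squashGram (o o' : Option Bit) : Op (BSig 𝒦) := fun a b =>
  (if o = o' ∧ a = b then (darkWeight P o a : ℂ) else 0) + o.elim 0 fun c => o'.elim 0 fun c' =>
    ((1 - P.pDark : ℝ) : ℂ) * heis (sigLoss (P.etaDet / 2)) (sectorGram c c') a b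

lemma darkWeight_nonneg (o : Option Bit) (y : BSig 𝒦) : 0 ≤ darkWeight P o y := by
  have h1 := P.pDark_mem
  have h2 := P.etaDet_mem
  have h3 : 0 ≤ 1 - P.pDark := by linarith [h1.2]
  have h4 : 0 ≤ 1 - P.etaDet / 2 := by linarith [h2.2]
  have h5 := h1.1
  cases o <;> simp only [darkWeight, Option.elim] <;> positivity

lemma hasSum_sumType {α β : Type*} {f : α ⊕ β → ℂ} {s t : ℂ}
    (h1 : HasSum (fun a => f (Sum.inl a)) s)
    (h2 : HasSum (fun b => f (Sum.inr b)) t) : HasSum f (s + t) :=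
  HasSum.add_isCompl Set.isCompl_range_inl_range_inr
    (Sum.inl_injective.hasSum_range_iff.mpr h1) (Sum.inr_injective.hasSum_range_iff.mpr h2)

lemma hasSum_squashKraus_dark (o o' : Option Bit) (a b : BSig 𝒦) :
    HasSum (fun e => conj (squashKraus P (Sum.inl e) o a) * squashKraus P (Sum.inl e) o' b)
      (if o = o' ∧ a = b then (darkWeight P o a : ℂ) else 0) := by
  have h0 : ∀ e, e ≠ (o, a) →
      conj (squashKraus P (Sum.inl e) o a) * squashKraus P (Sum.inl e) o' b = 0 := fun e he => by
    have hne : ¬(o = e.1 ∧ a = e.2) := fun h => he (Prod.ext h.1.symm h.2.symm)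
    simp only [squashKraus, if_neg hne, map_zero, zero_mul]
  have h := hasSum_single (o, a) h0
  convert h using 1
  simp only [squashKraus, and_self, if_true]
  by_cases hc : o = o' ∧ a = b
  · obtain ⟨rfl, rfl⟩ := hc
    rw [if_pos ⟨rfl, rfl⟩, if_pos ⟨rfl, rfl⟩, conj_sqrt_mul_sqrt (darkWeight_nonneg P o a)]
  · rw [if_neg hc, if_neg (c := o' = o ∧ b = a) fun h => hc ⟨h.1.symm, h.2.symm⟩, mul_zero]

/-- The clicks: for each pattern `r` of lost photons the operators of one sector contribute. -/
lemma hasSum_squashKraus_click (c c' : Bit) (a b : BSig 𝒦) :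
    HasSum (fun e => conj (squashKraus P (Sum.inr e) (some c) a) *
        squashKraus P (Sum.inr e) (some c') b)
      (((1 - P.pDark : ℝ) : ℂ) * heis (sigLoss (P.etaDet / 2)) (sectorGram c c') a b) := by
  have hp : 0 ≤ 1 - P.pDark := by linarith [P.pDark_mem.2]
  have hs : Summable fun e => conj (squashKraus P (Sum.inr e) (some c) a) *
      squashKraus P (Sum.inr e) (some c') b := by
    refine summable_of_hasFiniteSupport (((Set.finite_Iic a).biUnion fun r _ => Set.finite_range
      fun k : Fin (sectorNum ((a - r).1 + (a - r).2)) =>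
        (r, (⟨_, k⟩ : Σ m : Fock 𝒦, Fin (sectorNum m)))).subset ?_)
    rintro ⟨r, m, k⟩ he
    by_cases h : r ≤ a ∧ (a - r).1 + (a - r).2 = m
    · obtain ⟨h1, rfl⟩ := h
      exact Set.mem_biUnion (x := r) h1 ⟨k, rfl⟩
    · refine absurd ?_ he
      simp only [squashKraus, Option.elim, if_neg h, map_zero, zero_mul]
  have e : ∀ r, ∑' e : Σ m : Fock 𝒦, Fin (sectorNum m),
      conj (squashKraus P (Sum.inr (r, e)) (some c) a) *
        squashKraus P (Sum.inr (r, e)) (some c') b =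
      ((1 - P.pDark : ℝ) : ℂ) * if r ≤ a ∧ r ≤ b then
      conj (lossAmp (P.etaDet / 2) (occ r) (occ (a - r))) * sectorGram c c' (a - r) (b - r) *
        lossAmp (P.etaDet / 2) (occ r) (occ (b - r)) else 0 := fun r => by
    by_cases ha : r ≤ a
    · have hinj : Function.Injective fun k : Fin (sectorNum ((a - r).1 + (a - r).2)) =>
          (⟨_, k⟩ : Σ m : Fock 𝒦, Fin (sectorNum m)) := fun k k' h => by simpa using h
      rw [← hinj.tsum_eq, tsum_fintype]
      · simp only [squashKraus, Option.elim, and_true, if_pos ha]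
        unfold sectorGram
        by_cases hb : r ≤ b
        · by_cases hm : (a - r).1 + (a - r).2 = (b - r).1 + (b - r).2
          · rw [if_pos ⟨ha, hb⟩, if_pos hm, Finset.mul_sum, Finset.sum_mul, Finset.mul_sum]
            refine Finset.sum_congr rfl fun k _ => ?_
            rw [if_pos ⟨hb, hm.symm⟩, map_mul, map_mul, ← conj_sqrt_mul_sqrt hp]
            ring
          · rw [if_neg hm, mul_zero, zero_mul, ite_self, mul_zero]
            refine Finset.sum_eq_zero fun k _ => ?_
            rw [if_neg (c := r ≤ b ∧ _) fun h => hm h.2.symm, mul_zero]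
        · rw [if_neg (c := r ≤ a ∧ r ≤ b) fun h => hb h.2, mul_zero]
          refine Finset.sum_eq_zero fun k _ => ?_
          rw [if_neg (c := r ≤ b ∧ _) fun h => hb h.1, mul_zero]
      · rintro ⟨m, k⟩ he
        by_cases h : r ≤ a ∧ (a - r).1 + (a - r).2 = m
        · obtain ⟨-, rfl⟩ := h
          exact ⟨k, rfl⟩
        · refine absurd ?_ he
          simp only [squashKraus, Option.elim, if_neg h, map_zero, zero_mul]
    · rw [if_neg (c := r ≤ a ∧ r ≤ b) fun h => ha h.1, mul_zero]
      refine (tsum_congr fun e => ?_).trans tsum_zero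
      have hn : ¬(r ≤ a ∧ (a - r).1 + (a - r).2 = e.1) := fun h => ha h.1
      simp only [squashKraus, Option.elim, if_neg hn, map_zero, zero_mul]
  rw [heis_sigLoss_apply, ← tsum_mul_left]
  simp only [← e]
  rw [← hs.tsum_prod]
  exact hs.hasSum

lemma hasSum_squashKraus (o o' : Option Bit) (a b : BSig 𝒦) :
    HasSum (fun e => conj (squashKraus P e o a) * squashKraus P e o' b)
      (squashGram P o o' a b) := by
  refine hasSum_sumType (hasSum_squashKraus_dark P o o' a b) ?_
  rcases o with _ | c
  · simp [squashKraus, hasSum_zero]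
  · rcases o' with _ | c'
    · simp [squashKraus, hasSum_zero]
    · exact hasSum_squashKraus_click P c c' a b

/-- Lossless detectors click unless all photons are lost. -/
lemma heis_clickEffect_add (β : Basis) :
    heis (sigLoss (P.etaDet / 2)) (clickEffect (𝒦 := 𝒦) β 0) +
      heis (sigLoss (P.etaDet / 2)) (clickEffect β 1) =
    1 - secondQuant (((1 - P.etaDet / 2 : ℝ) : ℂ) • 1) := by
  have h11 : (1 + 1 : Bit) = 0 := rfl
  have h0 : 0 ≤ P.etaDet / 2 := by linarith [P.etaDet_mem.1]
  have h1 : P.etaDet / 2 ≤ 1 := by linarith [P.etaDet_mem.2]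
  have e : clickEffect (𝒦 := 𝒦) β 0 = (secondQuant 1 - (1 : ℂ) • secondQuant 0) -
      (1 : ℂ) • clickEffect β 1 := by
    unfold clickEffect
    rw [zero_add, h11]
    module
  have h := heis_sigLoss_secondQuant (𝒦 := 𝒦) h0 h1
  have hq : ((P.etaDet / 2 : ℝ) : ℂ) • (1 : Matrix (Fin 2) (Fin 2) ℂ) +
      ((1 - P.etaDet / 2 : ℝ) : ℂ) • 1 = 1 := by
    rw [← add_smul, ← Complex.ofReal_add, add_sub_cancel, Complex.ofReal_one, one_smul]
  rw [e, heis_sigLoss_sub, heis_sigLoss_sub, h, h, hq, secondQuant_one, smul_zero, zero_add]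
  module

lemma sum_measPOVM (β : Basis) : ∑ o, measPOVM (𝒦 := 𝒦) P β o = 1 := by
  have h := heis_clickEffect_add (𝒦 := 𝒦) P β
  rw [Fintype.sum_option, sum_bit, measPOVM_none, measPOVM_some, measPOVM_some, secondQuant_one]
  rw [← eq_sub_iff_add_eq'] at h
  rw [h]
  push_cast
  module

/-- Bob's effect of a dark count. -/
lemma darkWeight_eq (o : Option Bit) (a b : BSig 𝒦) :
    (if a = b then (darkWeight P o a : ℂ) else 0) = o.elim
      ((((1 - P.pDark) ^ 2 : ℝ) : ℂ) * secondQuant (((1 - P.etaDet / 2 : ℝ) : ℂ) • 1) a b)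
      fun _ => ((P.pDark / 2 : ℝ) : ℂ) * (1 : Op (BSig 𝒦)) a b +
        ((P.pDark * (1 - P.pDark) / 2 : ℝ) : ℂ) *
          secondQuant (((1 - P.etaDet / 2 : ℝ) : ℂ) • 1) a b := by
  rw [secondQuant_smul_one, Matrix.one_apply]
  by_cases h : a = b
  · subst h
    cases o <;> simp [darkWeight]
  · cases o <;> simp [h]

lemma squashGram_none_none (β : Basis) : squashGram (𝒦 := 𝒦) P none none = measPOVM P β none := by
  funext a b
  have h := darkWeight_eq P none a b
  rw [measPOVM_none, Matrix.smul_apply, smul_eq_mul]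
  simp only [squashGram, true_and, Option.elim, add_zero] at h ⊢
  exact h

lemma squashGram_Z (b : Bit) :
    squashGram (𝒦 := 𝒦) P (some b) (some b) = measPOVM P Basis.Z (some b) := by
  funext x y
  have h := darkWeight_eq P (some b) x y
  rw [measPOVM_some, secondQuant_one]
  simp only [squashGram, true_and, Option.elim, sectorGram_Z] at h ⊢
  rw [h]
  rfl

/-- The effects in the `X` basis differ by the click part only: dark counts give random bits. -/
lemma squashGram_X : squashGram (𝒦 := 𝒦) P (some 0) (some 1) + squashGram P (some 1) (some 0) =
    measPOVM P Basis.X (some 0) - measPOVM P Basis.X (some 1) := by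
  have h := congrArg (heis (sigLoss (P.etaDet / 2))) (sectorGram_X (𝒦 := 𝒦))
  rw [heis_sigLoss_sub, heis_sigLoss_sub] at h
  have h01 : ¬((some (0 : Bit)) = some 1) := fun h => zero_ne_one (Option.some.inj h)
  funext x y
  have h2 := congrFun (congrFun h x) y
  rw [measPOVM_some, measPOVM_some]
  simp only [squashGram, Option.elim, Matrix.add_apply, Matrix.sub_apply, Matrix.smul_apply,
    smul_eq_mul, h01, Ne.symm h01, false_and, if_false] at h2 ⊢
  linear_combination ((1 - P.pDark : ℝ) : ℂ) * h2

/-- The squashing map. -/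
def squashMap (𝒦 : Type u) : Channel.{u} (BSig 𝒦) (Option Bit) where
  Env := SquashEnv 𝒦
  K := squashKraus P
  complete a b := by
    have h := hasSum_prod_fintype (f := fun p : SquashEnv 𝒦 × Option Bit =>
      conj (squashKraus P p.1 p.2 a) * squashKraus P p.1 p.2 b)
      fun o => hasSum_squashKraus P o o a b
    convert h using 1
    have e : ∀ o : Option Bit, squashGram (𝒦 := 𝒦) P o o = measPOVM P Basis.Z o := fun o => by
      cases o
      · exact squashGram_none_none P _
      · exact squashGram_Z P _
    simp only [e]
    rw [← Matrix.sum_apply, sum_measPOVM, Matrix.one_apply]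
    exact ite_eq_ite_of_iff Iff.rfl _ _

lemma isSquashing_squashMap : IsSquashing P (squashMap P 𝒦) := by
  refine isSquashing_of_effects (fun e b a a' => ?_) fun x a b => ?_
  · rcases e with ⟨o, y⟩ | ⟨r, m, k⟩
    · rcases o with _ | c
      · left
        have hn : ¬(some b = none ∧ a = y) := fun h => Option.some_ne_none _ h.1
        simp only [squashMap, squashKraus, if_neg hn]
      · right
        have hn : ¬(none = some c ∧ a' = y) := fun h => Option.some_ne_none _ h.1.symm
        simp only [squashMap, squashKraus, if_neg hn]
    · right
      rfl
  · have hG : ∀ o o', ∑' e, (squashMap P 𝒦).K e o' b * conj ((squashMap P 𝒦).K e o a) =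
        squashGram P o o' a b := fun o o' =>
      (tsum_congr fun e => mul_comm _ _).trans (hasSum_squashKraus P o o' a b).tsum_eq
    unfold outcomeEffect
    simp only [hG]
    have h00 := congrFun (congrFun (squashGram_Z (𝒦 := 𝒦) P 0) a) b
    have h11 := congrFun (congrFun (squashGram_Z (𝒦 := 𝒦) P 1) a) b
    have hX := congrFun (congrFun (squashGram_X (𝒦 := 𝒦) P) a) b
    have hsum : ∀ β, measPOVM P β none a b + (measPOVM P β (some 0) a b +
        measPOVM P β (some 1) a b) = (1 : Op (BSig 𝒦)) a b := fun β => by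
      rw [← sum_measPOVM P β, Fintype.sum_option, sum_bit]; rfl
    have hZs := hsum Basis.Z
    have hXs := hsum Basis.X
    have hn : measPOVM P Basis.Z none a b = measPOVM P Basis.X none a b := by
      rw [measPOVM_none, measPOVM_none]
    rw [Matrix.add_apply, Matrix.sub_apply] at hX
    obtain ⟨β, o⟩ := x
    rcases o with _ | c
    · rw [← squashGram_none_none]
      simp [outcomeProj, ketBra, Fintype.sum_option]
    · have h2 : (2⁻¹ : ℂ) * (1 + 1) = 1 := by norm_num
      cases β <;> rcases bit_cases c with rfl | rfl <;>
        simp [outcomeProj, pauliProj, pauli, id2, ketBra, Fintype.sum_option, sum_bit, bit_val_one,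
          h00, h11, h2]
      · linear_combination (P.pB Basis.X : ℂ) * 2⁻¹ * (hX + hZs - hXs - hn)
      · linear_combination (P.pB Basis.X : ℂ) * 2⁻¹ * (hZs - hXs - hn - hX)

end SquashMap

end QKD

end

theorem mainTheorem5 {L M : ℕ} (P : QKD.Params L M) (V : QKD.VirParams P)
    {𝒦 ε : Type u} (E : QKD.Eve P 𝒦 ε) :
    (∃ S : QKD.Channel.{u} (QKD.BSig 𝒦) (Option QKD.Bit), QKD.IsSquashing P S) ∧
    ∀ S : QKD.Channel.{u} (QKD.BSig 𝒦) (Option QKD.Bit), QKD.IsSquashing P S →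
      ∀ n : Fin (QKD.numPulses L M + 1),
        QKD.measureZ (QKD.condA (QKD.rhoPAVir V E S) n (QKD.prPA (QKD.rhoPA E) n)) =
          QKD.condAE (QKD.rhoPA E) n (QKD.prPA (QKD.rhoPA E) n) ∧
        QKD.measureZ (QKD.idealVir
            (QKD.condAE (QKD.rhoPA E) n (QKD.prPA (QKD.rhoPA E) n)) n) =
          QKD.condAE (QKD.idealize (QKD.rhoPA E)) n (QKD.prPA (QKD.rhoPA E) n) := by
  exact ⟨⟨QKD.squashMap P 𝒦, QKD.isSquashing_squashMap P⟩,
    fun S hS n => ⟨QKD.measureZ_condA V E hS n _, QKD.measureZ_idealVir _ n _⟩⟩
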